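/- Let $N$ be a counting process on $[0,\infty)$ (values in $\{0,1,2,\dots\}$, increasing, right-continuous, $N(0)=0$, $N(\infty)=\lim_{s\to\infty}N(s)<\infty$) with $\operatorname{E}(N(\infty)^2)<\infty$, and let $C\in(0,\infty)$ be a censoring time independent of $N$. Put $\tilde N(s)=\int_0^s 1\{C\ge u\}\,N(du)$, $\mu(s)=\operatorname{E}N(s)$, $\nu(s)=\operatorname{E}\tilde N(s)$, $K(s)=P(C\ge s)$, $G(s)=P(C\le s)$, $\Lambda(s)=\int_0^s K(u)^{-1}\,G(du)$. Integrals $\int_0^s$ are over $(0,s]$ and integrals $\int_0^{s-}$ over $(0,s)$. Let $X_i=(\tilde N_i,C_i)$, $i\ge 1$, be independent replications of $X=(\tilde N,C)$, let $\hat\nu_n(s)=n^{-1}\sum_{i=1}^n\tilde N_i(s)$, $\hat K_n(s)=n^{-1}\sum_{i=1}^n 1\{C_i\ge s\}$, and let $$\hat\mu_n(s)=\int_0^s\frac{1}{\hat K_n(u)}\,\hat\nu_n(du)$$ be the Lawless--Nadeau estimator. Let $t>0$ satisfy $K(t)>0$ and let $p\in[1,2)$. For a real function $f$ on an interval $J$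 let $v_p(f)=\sup\sum_{j=1}^m|f(t_j)-f(t_{j-1})|^p$, the supremum being over $m$ and $t_0\le\dots\le t_m$ in $J$, let $\|f\|_{[p]}=v_p(f)^{1/p}+\sup_J|f|$, and let $\mathcal W_p^{\mathsf r}(J)$ be the space of right-continuous $f$ with $v_p(f)<\infty$, normed by $\|\cdot\|_{[p]}$. Give $\mathbb F=\mathcal W_p^{\mathsf r}([0,\infty))^2$ the maximum norm. For $f=(f_1,f_2)\in\mathbb F$ put $K(f;s)=f_2(\infty)-f_2(s-)$ and $\mu(f;s)=\int_0^s K(f;u)^{-1}f_1(du)$ (Young integral). Put $F=(\nu,G)$ and, for $x=(\tilde n,c)$, $\delta_x=(\tilde n,1\{c\le\cdot\})$ and $F_n=n^{-1}\sum_{i=1}^n\delta_{X_i}$. Then the following hold. 1. $\tilde N$ is a counting process, $\nu(s)=\int_0^s K(u)\,\mu(du)$ for all $s$, and $\mu(s)=\int_0^s K(u)^{-1}\,\nu(du)$ whenever $K(s)>0$. 2. At every $f\in\mathbb F$ for which $K(f;\cdot)$ is bounded away from $0$ on $[0,t]$, the functional $f\mapsto\mu(f;\cdot)$ from $\mathbb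 F$ to $\mathcal W_p^{\mathsf r}([0,t])$ is well defined and Fréchet differentiable of any order, with first derivative $$\mu_f'(g;s)=\int_0^s\frac{1}{K(f;u)}\,g_1(du)-\int_0^s\frac{K(g;u)}{K(f;u)^2}\,f_1(du),\qquad s\in[0,t].$$ 3. $F\in\mathbb F$, $K(F;\cdot)$ is bounded away from $0$ on $[0,t]$, $\mu(F;s)=\mu(s)$ and $\hat\mu_n(s)=\mu(F_n;s)$ for $s\in[0,t]$, and for $x=(\tilde n,c)$ with $\tilde n$ a path of a counting process and $c>0$ the influence function $\dot\mu(x)=\mu_F'(\delta_x-F)$ is $$\dot\mu(x;s)=\int_0^s\frac{1}{K(u)}\,\tilde n(du)-\int_0^s\frac{1\{c\ge u\}}{K(u)}\,\mu(du),\qquad s\in[0,t].$$ 4. If $p\in(4/3,2)$, then $\sqrt n(\hat\mu_n-\mu)=n^{-1/2}\sum_{i=1}^n\dot\mu(X_i)+o_P(1)$ in $\|\cdot\|_{[p]}$ on $[0,t]$. 5. For every $s\in[0,t]$, $$\dot\mu(X;s)=N(s)-\mu(s)-\int_0^{s-}\frac{N(s)-\mu(s)-(N(u)-\mu(u))}{K(u+)}\,M_C(du),$$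 where $M_C(s)=1\{C\le s\}-\int_0^s1\{C\ge u\}\,\Lambda(du)$; $\dot\mu(X;s)$ is square integrable with mean $0$ and variance $$\sigma^2(s)=\operatorname{Var}N(s)+\int_0^{s-}\operatorname{Var}(N(s)-N(u))\,\frac{1}{K(u+)}\,\Lambda(du)<\infty;$$ and $\sqrt n(\hat\mu_n(s)-\mu(s))$ converges in distribution to the normal distribution with mean $0$ and variance $\sigma^2(s)$. 6. If $p\in(4/3,2)$, then for every $s\in[0,t]$, $n^{-1}\sum_{i=1}^n\mu_{F_n}'(\delta_{X_i}-F_n;s)^2\to\sigma^2(s)$ in probability. -/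

import Mathlib

open MeasureTheory ProbabilityTheory Filter Topology Set
open scoped NNReal ENNReal

noncomputable section

namespace CensRec

/-! ### Functions of bounded `p`-variation -/

section PVariation

variable {α : Type*} [LinearOrder α]

/-- The `p`-variation `v_p(f)` of a real function on a linearly ordered set: the supremum over
`m` and `u 0 ≤ u 1 ≤ … ≤ u m` of `∑ |f (u (j+1)) - f (u j)| ^ p`. -/
def pVar (p : ℝ) (f : α → ℝ) : ℝ≥0∞ :=
  ⨆ q : ℕ × {u : ℕ → α // Monotone u},
    ∑ i ∈ Finset.range q.1, ‖f (q.2.1 (i + 1)) - f (q.2.1 i)‖ₑ ^ p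

/-- The supremum norm, with values in `[0, ∞]`. -/
def supENorm (f : α → ℝ) : ℝ≥0∞ := ⨆ s, ‖f s‖ₑ

/-- The `p`-variation norm `‖f‖_[p] = v_p(f)^(1/p) + ‖f‖_∞`, with values in `[0, ∞]`. -/
def pVarENorm (p : ℝ) (f : α → ℝ) : ℝ≥0∞ := pVar p f ^ (1 / p) + supENorm f

theorem pVar_add_le {p : ℝ} (hp : 1 ≤ p) (f g : α → ℝ) :
    pVar p (f + g) ^ (1 / p) ≤ pVar p f ^ (1 / p) + pVar p g ^ (1 / p) := by
  have hp0 : 0 < p := by linarith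
  have hp1 : 0 < 1 / p := by positivity
  rw [← ENNReal.le_rpow_inv_iff (by positivity), one_div, inv_inv]
  refine iSup_le fun q => ?_
  rw [← one_div, ← ENNReal.rpow_inv_le_iff hp0, ← one_div]
  calc (∑ i ∈ Finset.range q.1, ‖(f + g) (q.2.1 (i + 1)) - (f + g) (q.2.1 i)‖ₑ ^ p) ^ (1 / p)
      ≤ (∑ i ∈ Finset.range q.1, (‖f (q.2.1 (i + 1)) - f (q.2.1 i)‖ₑ
          + ‖g (q.2.1 (i + 1)) - g (q.2.1 i)‖ₑ) ^ p) ^ (1 / p) := by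
        gcongr with i _
        have : (f + g) (q.2.1 (i + 1)) - (f + g) (q.2.1 i)
          = (f (q.2.1 (i + 1)) - f (q.2.1 i)) + (g (q.2.1 (i + 1)) - g (q.2.1 i)) := by
          simp only [Pi.add_apply]; ring
        rw [this]
        exact enorm_add_le _ _
    _ ≤ _ := ENNReal.Lp_add_le _ _ _ hp
    _ ≤ _ := by
        gcongr
        · exact le_iSup (fun q : ℕ × {u : ℕ → α // Monotone u} =>
            ∑ i ∈ Finset.range q.1, ‖f (q.2.1 (i + 1)) - f (q.2.1 i)‖ₑ ^ p) q
        · exact le_iSup (fun q : ℕ × {u : ℕ → α // Monotone u} =>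
            ∑ i ∈ Finset.range q.1, ‖g (q.2.1 (i + 1)) - g (q.2.1 i)‖ₑ ^ p) q

theorem pVar_smul {p : ℝ} (hp : 1 ≤ p) (c : ℝ) (f : α → ℝ) :
    pVar p (c • f) = ‖c‖ₑ ^ p * pVar p f := by
  have hp0 : 0 ≤ p := by linarith
  simp only [pVar, ENNReal.mul_iSup, Finset.mul_sum, ← ENNReal.mul_rpow_of_nonneg _ _ hp0,
    ← enorm_mul, mul_sub, Pi.smul_apply, smul_eq_mul]

theorem supENorm_add_le {β : Type*} (f g : β → ℝ) : supENorm (f + g) ≤ supENorm f + supENorm g :=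
  iSup_le fun s => (enorm_add_le (f s) (g s)).trans
    (add_le_add (le_iSup (fun s => ‖f s‖ₑ) s) (le_iSup (fun s => ‖g s‖ₑ) s))

theorem supENorm_smul {β : Type*} (c : ℝ) (f : β → ℝ) : supENorm (c • f) = ‖c‖ₑ * supENorm f := by
  simp only [supENorm, ENNReal.mul_iSup, Pi.smul_apply, smul_eq_mul, enorm_mul]

theorem pVarENorm_add_le {p : ℝ} (hp : 1 ≤ p) (f g : α → ℝ) :
    pVarENorm p (f + g) ≤ pVarENorm p f + pVarENorm p g :=
  calc _ ≤ (pVar p f ^ (1 / p) + pVar p g ^ (1 / p)) + (supENorm f + supENorm g) :=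
        add_le_add (pVar_add_le hp f g) (supENorm_add_le f g)
    _ = _ := by unfold pVarENorm; ring

theorem pVarENorm_smul {p : ℝ} (hp : 1 ≤ p) (c : ℝ) (f : α → ℝ) :
    pVarENorm p (c • f) = ‖c‖ₑ * pVarENorm p f := by
  have hp0 : 0 < p := by linarith
  rw [pVarENorm, pVar_smul hp, supENorm_smul, ENNReal.mul_rpow_of_nonneg _ _ (by positivity),
    one_div, ENNReal.rpow_rpow_inv hp0.ne', pVarENorm, mul_add, one_div]

theorem enorm_sub_le_pVar {p : ℝ} (hp : 1 ≤ p) (f : α → ℝ) (a b : α) :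
    ‖f b - f a‖ₑ ≤ pVar p f ^ (1 / p) := by
  have hp0 : 0 < p := by linarith
  wlog hab : a ≤ b generalizing a b
  · rw [← enorm_neg, neg_sub]
    exact this b a (le_of_not_ge hab)
  rw [one_div, ENNReal.le_rpow_inv_iff hp0]
  let u : ℕ → α := fun i => if i = 0 then a else b
  have hu : Monotone u := by
    intro i j hij
    by_cases hi : i = 0
    · by_cases hj : j = 0 <;> simp [u, hi, hj, hab]
    · have hj : j ≠ 0 := by omega
      simp [u, hi, hj]
  have := le_iSup (fun q : ℕ × {u : ℕ → α // Monotone u} =>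
    ∑ i ∈ Finset.range q.1, ‖f (q.2.1 (i + 1)) - f (q.2.1 i)‖ₑ ^ p) (1, ⟨u, hu⟩)
  simp only [u, Finset.sum_range_one] at this
  simpa [pVar] using this

/-- A function of bounded `p`-variation is bounded. -/
theorem pVarENorm_ne_top {p : ℝ} (hp : 1 ≤ p) {f : α → ℝ} (hf : pVar p f ≠ ∞) :
    pVarENorm p f ≠ ∞ := by
  have hp0 : 0 < p := by linarith
  have h1 : pVar p f ^ (1 / p) ≠ ∞ := ENNReal.rpow_ne_top_of_nonneg (by positivity) hf
  refine ENNReal.add_ne_top.2 ⟨h1, ?_⟩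
  rcases isEmpty_or_nonempty α with h | ⟨⟨a⟩⟩
  · simp [supENorm]
  · refine ne_top_of_le_ne_top (ENNReal.add_ne_top.2 ⟨h1, enorm_ne_top (x := f a)⟩)
      (iSup_le fun s => ?_)
    calc ‖f s‖ₑ = ‖(f s - f a) + f a‖ₑ := by rw [sub_add_cancel]
      _ ≤ _ := (enorm_add_le _ _).trans (by gcongr; exact enorm_sub_le_pVar hp f a s)

variable [TopologicalSpace α]

/-- Membership in `W_p^r`: right-continuous with bounded `p`-variation. -/
structure MemWr (p : ℝ) (f : α → ℝ) : Prop where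
  pVar_ne_top : pVar p f ≠ ∞
  right_cont : ∀ s, ContinuousWithinAt f (Ici s) s

variable (p : ℝ) [hp : Fact (1 ≤ p)] (α)

/-- The right-continuous functions of bounded `p`-variation as a linear subspace. -/
def wrSubmodule : Submodule ℝ (α → ℝ) where
  carrier := {f | MemWr p f}
  zero_mem' := by
    have hp0 : 0 < p := by linarith [hp.out]
    exact ⟨by simp [pVar, hp0], fun s => continuousWithinAt_const⟩
  add_mem' := by
    intro f g hf hg
    have hp0 : 0 < p := by linarith [hp.out]
    refine ⟨fun h => ?_, fun s => (hf.2 s).add (hg.2 s)⟩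
    have h2 := pVar_add_le hp.out f g
    rw [h, ENNReal.top_rpow_of_pos (by positivity), top_le_iff] at h2
    exact ENNReal.add_ne_top.2 ⟨ENNReal.rpow_ne_top_of_nonneg (by positivity) hf.1,
      ENNReal.rpow_ne_top_of_nonneg (by positivity) hg.1⟩ h2
  smul_mem' := by
    intro c f hf
    have hp0 : 0 < p := by linarith [hp.out]
    refine ⟨?_, fun s => (hf.2 s).const_smul c⟩
    rw [pVar_smul hp.out]
    exact ENNReal.mul_ne_top (ENNReal.rpow_ne_top_of_nonneg hp0.le enorm_ne_top) hf.1

/-- The space `W_p^r(α)`. It is a type of its own, so that it carries the `p`-variation norm and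
not the topology of pointwise convergence. -/
def Wr : Type _ := ↥(wrSubmodule α p)

instance : AddCommGroup (Wr α p) := inferInstanceAs (AddCommGroup ↥(wrSubmodule α p))

instance : Module ℝ (Wr α p) := inferInstanceAs (Module ℝ ↥(wrSubmodule α p))

variable {α} {p}

instance : CoeFun (Wr α p) (fun _ => α → ℝ) := ⟨fun f => f.1⟩

/-- The `p`-variation norm. -/
instance : Norm (Wr α p) := ⟨fun f => (pVarENorm p f).toReal⟩

theorem wr_norm_def (f : Wr α p) : ‖f‖ = (pVarENorm p f).toReal := rfl

theorem wr_core : NormedSpace.Core ℝ (Wr α p) where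
  norm_nonneg f := ENNReal.toReal_nonneg
  norm_smul c f := by
    have h : ((c • f : Wr α p) : α → ℝ) = c • (f : α → ℝ) := rfl
    rw [wr_norm_def, wr_norm_def, h, pVarENorm_smul hp.out, ENNReal.toReal_mul]
    simp
  norm_triangle f g := by
    have h : ((f + g : Wr α p) : α → ℝ) = (f : α → ℝ) + (g : α → ℝ) := rfl
    have hf := pVarENorm_ne_top hp.out f.2.1
    have hg := pVarENorm_ne_top hp.out g.2.1
    rw [wr_norm_def, wr_norm_def, wr_norm_def, h, ← ENNReal.toReal_add hf hg]
    exact ENNReal.toReal_mono (ENNReal.add_ne_top.2 ⟨hf, hg⟩) (pVarENorm_add_le hp.out _ _)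
  norm_eq_zero_iff f := by
    have hp0 : 0 < p := by linarith [hp.out]
    constructor
    · intro h
      rw [wr_norm_def, ENNReal.toReal_eq_zero_iff, or_iff_left (pVarENorm_ne_top hp.out f.2.1),
        pVarENorm, add_eq_zero, supENorm] at h
      refine Subtype.ext (funext fun s => ?_)
      have h2 := h.2
      simp only [ENNReal.iSup_eq_zero, enorm_eq_zero] at h2
      exact h2 s
    · rintro rfl
      have h : ((0 : Wr α p) : α → ℝ) = (0 : ℝ) • (0 : α → ℝ) := by rw [zero_smul]; rfl
      rw [wr_norm_def, h, pVarENorm_smul hp.out]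
      simp

instance : NormedAddCommGroup (Wr α p) := NormedAddCommGroup.ofCore wr_core

instance : NormedSpace ℝ (Wr α p) := NormedSpace.ofCore wr_core

open Classical in
/-- A function as an element of `W_p^r`; the value `0` is only used for non-members. -/
def toWr (p : ℝ) [Fact (1 ≤ p)] (f : α → ℝ) : Wr α p := if h : MemWr p f then ⟨f, h⟩ else 0

end PVariation

/-! ### Integrals -/

/-- The sum for a Young integral of `g` with respect to a right-continuous `f`, for the partition
`u 0 < … < u m` and tags `v i ∈ (u i, u (i+1))`: the open interval `(u i, u (i+1))` has
`f`-increment `f (u (i+1) -) - f (u i)`, and the point `u (i+1)` has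
`f`-increment `f (u (i+1)) - f (u (i+1) -)`. -/
def youngSum (g f : ℝ≥0 → ℝ) (m : ℕ) (u v : ℕ → ℝ≥0) : ℝ :=
  ∑ i ∈ Finset.range m,
    (g (v i) * (Function.leftLim f (u (i + 1)) - f (u i))
      + g (u (i + 1)) * (f (u (i + 1)) - Function.leftLim f (u (i + 1))))

/-- `I` is the (refinement) Young integral `∫_0^s g(u) f(du)`, for right-continuous `f`: the limit
of the Young sums under refinement of partitions of `[0, s]`. -/
def HasYoungIntegral (g f : ℝ≥0 → ℝ) (s : ℝ≥0) (I : ℝ) : Prop :=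
  ∀ ε > 0, ∃ T : Finset ℝ≥0, (∀ x ∈ T, x ≤ s) ∧
    ∀ (m : ℕ) (u v : ℕ → ℝ≥0), u 0 = 0 → u m = s → (∀ i < m, v i ∈ Ioo (u i) (u (i + 1))) →
      (∀ x ∈ T, ∃ i ≤ m, u i = x) → |youngSum g f m u v - I| < ε

open Classical in
/-- The Young integral `∫_0^s g(u) f(du)`. -/
def youngInt (g f : ℝ≥0 → ℝ) (s : ℝ≥0) : ℝ :=
  if h : ∃ I, HasYoungIntegral g f s I then h.choose else 0

open Classical in
/-- The Lebesgue–Stieltjes measure on `(0, ∞)` of an increasing right-continuous function. -/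
def lsMeasure (f : ℝ≥0 → ℝ) : Measure ℝ≥0 :=
  if h : Monotone f then h.stieltjesFunction.measure else 0

/-- The Lebesgue–Stieltjes integral `∫_0^s g(u) f(du)` over `(0, s]`, for increasing
right-continuous `f`. -/
def lsInt (g f : ℝ≥0 → ℝ) (s : ℝ≥0) : ℝ := ∫ u in Ioc 0 s, g u ∂(lsMeasure f)

/-! ### Counting processes and censoring -/

/-- The value at infinity, `lim_{s → ∞} x(s)`. -/
def atInfty (x : ℝ≥0 → ℝ) : ℝ := limUnder atTop x

/-- Paths of counting processes: increasing, right-continuous, with values in `ℕ`, zero at time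
zero, and with a finite value at infinity. -/
structure IsCountingPath (x : ℝ≥0 → ℝ) : Prop where
  nat_valued : ∀ s, ∃ k : ℕ, x s = k
  mono : Monotone x
  right_cont : ∀ s, ContinuousWithinAt x (Ici s) s
  zero : x 0 = 0
  bdd : BddAbove (range x)

/-- The path `s ↦ ∫_0^s 1{c ≥ u} x(du)` of the events of `x` that are observed up to time `c`. -/
def censor (x : ℝ≥0 → ℝ) (c : ℝ≥0) : ℝ≥0 → ℝ := lsInt ((Iic c).indicator 1) x

/-- The simple counting path `N_c(s) = 1{c ≤ s}`. -/
def simplePath (c : ℝ≥0) : ℝ≥0 → ℝ := (Ici c).indicator 1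

section Model

variable {Ω : Type*} [MeasurableSpace Ω]

/-- The mean function `s ↦ E (N(s))`. -/
def meanFun (P : Measure Ω) (N : Ω → ℝ≥0 → ℝ) (s : ℝ≥0) : ℝ := ∫ ω, N ω s ∂P

/-- `K(s) = P(C ≥ s)`. -/
def survFun (P : Measure Ω) (C : Ω → ℝ≥0) (s : ℝ≥0) : ℝ := P.real {ω | s ≤ C ω}

/-- `G(s) = P(C ≤ s)`. -/
def distFun (P : Measure Ω) (C : Ω → ℝ≥0) (s : ℝ≥0) : ℝ := P.real {ω | C ω ≤ s}

/-- The cumulative hazard `Λ(du) = K(u)⁻¹ G(du)`, as a measure. -/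
def hazard (P : Measure Ω) (C : Ω → ℝ≥0) : Measure ℝ≥0 :=
  (lsMeasure (distFun P C)).withDensity fun u => ENNReal.ofReal (1 / survFun P C u)

/-- The integral `∫_0^{s-} h(u) M_c(du)` over `(0, s)`, where
`M_c(s) = N_c(s) - ∫_0^s 1{c ≥ u} Λ(du)`. -/
def martInt (Λ : Measure ℝ≥0) (c : ℝ≥0) (h : ℝ≥0 → ℝ) (s : ℝ≥0) : ℝ :=
  (∫ u in Ioo 0 s, h u ∂(lsMeasure (simplePath c)))
    - ∫ u in Ioo 0 s, (Iic c).indicator 1 u * h u ∂Λ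

/-- The asymptotic variance `Var N(s) + ∫_0^{s-} Var (N(s) - N(u)) K(u+)⁻¹ Λ(du)`. -/
def asympVar (P : Measure Ω) (N : Ω → ℝ≥0 → ℝ) (K : ℝ≥0 → ℝ) (Λ : Measure ℝ≥0) (s : ℝ≥0) : ℝ :=
  Var[fun ω => N ω s; P]
    + ∫ u in Ioo 0 s, Var[fun ω => N ω s - N ω u; P] * (1 / Function.rightLim K u) ∂Λ

end Model

section Sample

variable {Ω : Type*}

/-- `ν̂_n(s) = n⁻¹ ∑ Ñ_i(s)` for observations `X_i = (Ñ_i, C_i)`. -/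
def nuHat (X : ℕ → Ω → (ℝ≥0 → ℝ) × ℝ≥0) (n : ℕ) (ω : Ω) (s : ℝ≥0) : ℝ :=
  (n : ℝ)⁻¹ * ∑ i ∈ Finset.range n, (X i ω).1 s

/-- `K̂_n(s) = n⁻¹ ∑ 1{C_i ≥ s}`. -/
def survHat (X : ℕ → Ω → (ℝ≥0 → ℝ) × ℝ≥0) (n : ℕ) (ω : Ω) (s : ℝ≥0) : ℝ :=
  (n : ℝ)⁻¹ * ∑ i ∈ Finset.range n, (Iic (X i ω).2).indicator 1 s

/-- `Ĝ_n(s) = n⁻¹ ∑ 1{C_i ≤ s}`. -/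
def distHat (X : ℕ → Ω → (ℝ≥0 → ℝ) × ℝ≥0) (n : ℕ) (ω : Ω) (s : ℝ≥0) : ℝ :=
  (n : ℝ)⁻¹ * ∑ i ∈ Finset.range n, simplePath (X i ω).2 s

/-- The Lawless–Nadeau estimator `μ̂_n(s) = ∫_0^s K̂_n(u)⁻¹ ν̂_n(du)`. -/
def muHat (X : ℕ → Ω → (ℝ≥0 → ℝ) × ℝ≥0) (n : ℕ) (ω : Ω) : ℝ≥0 → ℝ :=
  lsInt (fun u => 1 / survHat X n ω u) (nuHat X n ω)

end Sample

/-- The explicit expression of the influence function,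
`μ̇(x; s) = ∫_0^s K(u)⁻¹ ñ(du) - ∫_0^s 1{c ≥ u} K(u)⁻¹ μ(du)` at `x = (ñ, c)`. -/
def influence (K μ : ℝ≥0 → ℝ) (x : (ℝ≥0 → ℝ) × ℝ≥0) (s : ℝ≥0) : ℝ :=
  lsInt (fun u => 1 / K u) x.1 s - lsInt (fun u => (Iic x.2).indicator 1 u / K u) μ s

/-! ### The estimating functional -/

section Functional

variable {p : ℝ} [Fact (1 ≤ p)]

/-- `K(f; s) = f₂(∞) - f₂(s-)`. -/
def kFun (f : Wr ℝ≥0 p × Wr ℝ≥0 p) (s : ℝ≥0) : ℝ := atInfty f.2 - Function.leftLim f.2 s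

/-- `s ↦ ∫_0^s K(f; u)⁻¹ f₁(du)` on `[0, t]`. -/
def muPath (t : ℝ≥0) (f : Wr ℝ≥0 p × Wr ℝ≥0 p) (s : Icc 0 t) : ℝ :=
  youngInt (fun u => 1 / kFun f u) f.1 s

/-- The estimating functional `f ↦ ∫_0^(·) K(f; u)⁻¹ f₁(du)` from `W_p^r([0, ∞))²` (with the
maximum norm) to `W_p^r([0, t])`. -/
def muFun (p : ℝ) [Fact (1 ≤ p)] (t : ℝ≥0) (f : Wr ℝ≥0 p × Wr ℝ≥0 p) : Wr (Icc 0 t) p :=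
  toWr p (muPath t f)

/-- `δ_x = (ñ, N_c)` for `x = (ñ, c)`. -/
def delta (p : ℝ) [Fact (1 ≤ p)] (x : (ℝ≥0 → ℝ) × ℝ≥0) : Wr ℝ≥0 p × Wr ℝ≥0 p :=
  (toWr p x.1, toWr p (simplePath x.2))

/-- The empirical mean `F_n = n⁻¹ ∑ δ_{X_i}`. -/
def empMean (p : ℝ) [Fact (1 ≤ p)] {Ω : Type*} (X : ℕ → Ω → (ℝ≥0 → ℝ) × ℝ≥0) (n : ℕ) (ω : Ω) :
    Wr ℝ≥0 p × Wr ℝ≥0 p :=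
  (n : ℝ)⁻¹ • ∑ i ∈ Finset.range n, delta p (X i ω)

/-- The derivative at `f` in direction `δ_x - f`, a function on `[0, t]`. At `f = F` this is the
influence function of the functional. -/
def derivDelta (p : ℝ) [Fact (1 ≤ p)] (t : ℝ≥0) (f : Wr ℝ≥0 p × Wr ℝ≥0 p)
    (x : (ℝ≥0 → ℝ) × ℝ≥0) : Wr (Icc 0 t) p :=
  fderiv ℝ (muFun p t) f (delta p x - f)

end Functional

end CensRec

end

noncomputable section

namespace CensRec

/-! ### Basic properties of the `p`-variation -/

section PVar

variable {α β : Type*} [LinearOrder α] [LinearOrder β] {p q : ℝ}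

/-! Two facts carry the theorem: the estimator is a smooth functional of the empirical distribution
in `p`-variation norm, and for `p > 4/3` the empirical distribution converges in that norm faster
than `n ^ (-1/4)`. A quadratic Taylor remainder, multiplied by `√n`, is then negligible, and what is
left is an average of independent influence functions.

Smoothness. For `p < 2` the Love–Young inequality (`love_young`, `youngSum_bound`) bounds Young sums
by the `p`-variations of integrand and integrator. Hence the Young integral exists and is a bounded
bilinear map (`youngMap`). The functions of bounded `p`-variation form a Banach algebra `Bv`, `f ↦
K(f; ·)` is a bounded linear map into it, and being bounded away from zero means being a unit. So `f
↦ μ(f; ·)` is a composition of a linear map, ring inversion and a bilinear map; it is smooth, and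
its derivative comes from the derivative of inversion (`muFun_eq`, `contDiffAt_muFun`,
`hasFDerivAt_muFun`). For increasing integrators the Young integral is a Lebesgue–Stieltjes integral
(`hasYoungIntegral_lsInt`), which identifies the functional and its derivative at `F` and at the
empirical mean.

Rate. The empirical mean minus its expectation is a centered difference of increasing functions
whose increments have variance of order `1/n` relative to one fixed increasing function `m`.
Chaining over the dyadic level sets of `m` down to width `1/n`, and monotonicity below that width,
give a bound of order `n ^ (1/p - 1)` for the mean of the `p`-variation seminorm
(`exists_pVar_majorant`). This is `o(n ^ (-1/4))` exactly when `p > 4/3`.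

Influence function. With `S(u) = P(C ≥ u)`, the identity `1 / S(u) = 1 + ∫_(0,u) γ(dv) / (S(v)
S(v+))`, where `γ` is the law of `C` (`integral_Ico_odds`, `inv_surv_eq`), turns integrals of `1 /
K` into integrals against the measure `odds`. Partial integration gives the martingale form path by
path (`influence_eq_martInt`). Fubini gives the second moment over `C` for a fixed path
(`integral_lsInt_mul_lsInt`), and integrating over `N` then gives the variance. The central limit
theorem with Slutsky's lemma yields asymptotic normality. The law of large numbers, with the local
Lipschitz bound for the derivative, yields the variance estimator. -/

theorem sum_le_pVar (p : ℝ) (f : α → ℝ) (m : ℕ) {u : ℕ → α} (hu : Monotone u) :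
    ∑ i ∈ Finset.range m, ‖f (u (i + 1)) - f (u i)‖ₑ ^ p ≤ pVar p f :=
  le_iSup (fun q : ℕ × {u : ℕ → α // Monotone u} =>
    ∑ i ∈ Finset.range q.1, ‖f (q.2.1 (i + 1)) - f (q.2.1 i)‖ₑ ^ p) (m, ⟨u, hu⟩)

theorem pVar_le {f : α → ℝ} {V : ℝ≥0∞} (h : ∀ (m : ℕ) (u : ℕ → α), Monotone u →
    ∑ i ∈ Finset.range m, ‖f (u (i + 1)) - f (u i)‖ₑ ^ p ≤ V) : pVar p f ≤ V :=
  iSup_le fun q => h q.1 q.2.1 q.2.2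

theorem pVar_comp_le {φ : α → β} (hφ : Monotone φ) (f : β → ℝ) :
    pVar p (fun x => f (φ x)) ≤ pVar p f :=
  pVar_le fun m _ hu => sum_le_pVar p f m (hφ.comp hu)

/-- Lower semicontinuity under pointwise limits: each variation sum involves only finitely many
points. -/
theorem pVar_le_of_tendsto {ι : Type*} {l : Filter ι} [l.NeBot] {F : ι → α → ℝ}
    {f : α → ℝ} (h : ∀ s, Tendsto (fun i => F i s) l (𝓝 (f s))) {V : ℝ≥0∞}
    (hV : ∀ᶠ i in l, pVar p (F i) ≤ V) : pVar p f ≤ V := by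
  refine pVar_le fun m u hu => ?_
  refine le_of_tendsto (f := fun i => ∑ j ∈ Finset.range m, ‖F i (u (j + 1)) - F i (u j)‖ₑ ^ p)
    (tendsto_finsetSum _ fun j _ => ?_) (hV.mono fun i hi => (sum_le_pVar p (F i) m hu).trans hi)
  exact (ENNReal.continuous_rpow_const.tendsto _).comp
    ((continuous_enorm.tendsto _).comp ((h _).sub (h _)))

/-- A control function `Ψ` makes the variation sums telescope. The hypothesis is additive because
`Ψ` takes values in `[0, ∞]`, where subtraction is truncated. -/
theorem pVar_le_of_control {f : α → ℝ} {Ψ : α → ℝ≥0∞} {V : ℝ≥0∞}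
    (h : ∀ x y, x ≤ y → ‖f y - f x‖ₑ ^ p + Ψ x ≤ Ψ y) (hV : ∀ x, Ψ x ≤ V) : pVar p f ≤ V := by
  refine pVar_le fun m u hu => le_trans ?_ (hV (u m))
  induction m with
  | zero => simp
  | succ m ih =>
    rw [Finset.sum_range_succ, add_comm]
    exact (add_le_add le_rfl ih).trans (h _ _ (hu m.le_succ))

/-- For `p ≥ 1` the power `x ^ p` is superadditive, so the increments of a monotone function may be
merged into a single one. -/
theorem pVar_monotone_le (hp : 1 ≤ p) {f : α → ℝ} (hf : Monotone f) {M : ℝ}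
    (hM : ∀ x y, f y - f x ≤ M) : pVar p f ≤ ENNReal.ofReal M ^ p := by
  have hp0 : 0 ≤ p := by linarith
  refine pVar_le fun m u hu => ?_
  have key : ∑ i ∈ Finset.range m, ‖f (u (i + 1)) - f (u i)‖ₑ ^ p
      ≤ ENNReal.ofReal (f (u m) - f (u 0)) ^ p := by
    induction m with
    | zero => simp
    | succ m ih =>
      rw [Finset.sum_range_succ]
      have h1 : 0 ≤ f (u (m + 1)) - f (u m) := sub_nonneg.2 (hf (hu m.le_succ))
      have h2 : 0 ≤ f (u m) - f (u 0) := sub_nonneg.2 (hf (hu m.zero_le))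
      refine (add_le_add ih le_rfl).trans ((ENNReal.add_rpow_le_rpow_add _ _ hp).trans ?_)
      rw [Real.enorm_eq_ofReal h1, ← ENNReal.ofReal_add h2 h1]
      gcongr
      linarith
  exact key.trans (by gcongr; exact hM _ _)

/-- Interpolation: `q - p` of the `q` factors are bounded by the oscillation `D`. This is how
uniform smallness becomes smallness in `q`-variation once an exponent slightly larger than `p` is
allowed. -/
theorem pVar_le_mul_of_le (hp : 0 < p) (hpq : p ≤ q) {f : α → ℝ} {D : ℝ≥0∞}
    (hD : ∀ x y, ‖f y - f x‖ₑ ≤ D) : pVar q f ≤ D ^ (q - p) * pVar p f := by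
  refine pVar_le fun m u hu => ?_
  calc _ ≤ ∑ i ∈ Finset.range m, D ^ (q - p) * ‖f (u (i + 1)) - f (u i)‖ₑ ^ p := by
        gcongr with i
        have : q = (q - p) + p := by ring
        conv_lhs => rw [this]
        rw [ENNReal.rpow_add_of_nonneg _ _ (by linarith) hp.le]
        gcongr
        exact hD _ _
    _ ≤ _ := by
        rw [← Finset.mul_sum]
        gcongr
        exact sum_le_pVar p f m hu

theorem enorm_sub_rpow_le_pVar (hp : 1 ≤ p) (f : α → ℝ) (a b : α) :
    ‖f b - f a‖ₑ ^ p ≤ pVar p f := by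
  have h := enorm_sub_le_pVar hp f a b
  rwa [one_div, ENNReal.le_rpow_inv_iff (by linarith)] at h

/-- The `ℓ^q`-norm is at most the `ℓ^p`-norm. -/
theorem pVar_rpow_le_pVar_rpow (hp : 1 ≤ p) (hpq : p ≤ q) (f : α → ℝ) :
    pVar q f ^ (1 / q) ≤ pVar p f ^ (1 / p) := by
  have hp0 : 0 < p := by linarith
  have hq0 : 0 < q := by linarith
  by_cases htop : pVar p f = ∞
  · rw [htop, ENNReal.top_rpow_of_pos (by positivity)]; exact le_top
  rw [one_div, ENNReal.rpow_inv_le_iff hq0]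
  refine (pVar_le_mul_of_le hp0 hpq fun x y => enorm_sub_le_pVar hp f x y).trans ?_
  by_cases h0 : pVar p f = 0
  · rw [h0]; simp
  conv_lhs => rw [← ENNReal.rpow_one (pVar p f)]
  rw [ENNReal.rpow_one, ← ENNReal.rpow_mul, ← ENNReal.rpow_mul]
  conv_lhs => rw [← ENNReal.rpow_one (pVar p f), ← ENNReal.rpow_mul, ← ENNReal.rpow_add _ _ h0 htop]
  refine le_of_eq ?_
  congr 1
  field_simp
  ring

theorem pVar_ne_top_of_le (hp : 1 ≤ p) (hpq : p ≤ q) {f : α → ℝ} (hf : pVar p f ≠ ∞) :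
    pVar q f ≠ ∞ := by
  intro h
  have := pVar_rpow_le_pVar_rpow hp hpq f
  rw [h, ENNReal.top_rpow_of_pos (by have : 0 < q := by linarith
                                     positivity), top_le_iff] at this
  exact ENNReal.rpow_ne_top_of_nonneg (by have : 0 < p := by linarith
                                          positivity) hf this

theorem pVar_const (hp : 0 < p) (c : ℝ) : pVar p (fun _ : α => c) = 0 := by
  simp [pVar, hp]

theorem pVar_congr_sub {f g : α → ℝ} (h : ∀ x y, ‖f y - f x‖ₑ = ‖g y - g x‖ₑ) :
    pVar p f = pVar p g := by
  simp only [pVar, h]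

theorem pVar_add_ne_top (hp : 1 ≤ p) {f g : α → ℝ} (hf : pVar p f ≠ ∞) (hg : pVar p g ≠ ∞) :
    pVar p (fun x => f x + g x) ≠ ∞ := by
  have hp0 : 0 < p := by linarith
  intro h
  have h2 := pVar_add_le hp f g
  have h' : pVar p (f + g) = ∞ := h
  rw [h', ENNReal.top_rpow_of_pos (by positivity), top_le_iff] at h2
  exact ENNReal.add_ne_top.2 ⟨ENNReal.rpow_ne_top_of_nonneg (by positivity) hf,
    ENNReal.rpow_ne_top_of_nonneg (by positivity) hg⟩ h2

theorem pVar_const_mul_ne_top (hp : 1 ≤ p) (c : ℝ) {f : α → ℝ} (hf : pVar p f ≠ ∞) :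
    pVar p (fun x => c * f x) ≠ ∞ := by
  have h := pVar_smul hp c f
  rw [show (fun x => c * f x) = c • f from rfl, h]
  exact ENNReal.mul_ne_top (ENNReal.rpow_ne_top_of_nonneg (by linarith) enorm_ne_top) hf

theorem pVar_neg (f : α → ℝ) : pVar p (fun x => -f x) = pVar p f :=
  pVar_congr_sub fun x y => by rw [← enorm_neg]; congr 1; ring

theorem pVar_sub_ne_top (hp : 1 ≤ p) {f g : α → ℝ} (hf : pVar p f ≠ ∞) (hg : pVar p g ≠ ∞) :
    pVar p (fun x => f x - g x) ≠ ∞ := by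
  simp only [sub_eq_add_neg]
  exact pVar_add_ne_top hp hf (by rwa [pVar_neg])

theorem pVar_sum_ne_top (hp : 1 ≤ p) {ι : Type*} (s : Finset ι) {f : ι → α → ℝ}
    (hf : ∀ i ∈ s, pVar p (f i) ≠ ∞) : pVar p (fun x => ∑ i ∈ s, f i x) ≠ ∞ := by
  classical
  induction s using Finset.induction_on with
  | empty => simp [pVar_const (show 0 < p by linarith)]
  | insert a s ha ih =>
    simp only [Finset.sum_insert ha]
    exact pVar_add_ne_top hp (hf a (Finset.mem_insert_self _ _))
      (ih fun i hi => hf i (Finset.mem_insert_of_mem hi))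

/-! ### Superadditivity over intervals -/

/-- The `p`-variation on a set. -/
def pVarOn (p : ℝ) (f : α → ℝ) (S : Set α) : ℝ≥0∞ := pVar p fun x : S => f x

theorem pVarOn_mono {S T : Set α} (h : S ⊆ T) (f : α → ℝ) :
    pVarOn p f S ≤ pVarOn p f T :=
  pVar_comp_le (φ := Set.inclusion h) (fun _ _ hxy => hxy) (fun x : T => f x)

theorem pVarOn_le_pVar (S : Set α) (f : α → ℝ) : pVarOn p f S ≤ pVar p f :=
  pVar_comp_le (φ := fun x : S => (x : α)) (fun _ _ hxy => hxy) f

/-- A chain in `S` followed by a chain in `T` is a chain in `U`; its variation sum has one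
additional term, the jump between the two chains. -/
theorem pVarOn_add_le {S T U : Set α} (hS : S ⊆ U) (hT : T ⊆ U)
    (hST : ∀ x ∈ S, ∀ y ∈ T, x ≤ y) (f : α → ℝ) :
    pVarOn p f S + pVarOn p f T ≤ pVarOn p f U := by
  have aux : ∀ S : Set α, S = ∅ → pVarOn p f S = 0 := by
    rintro S rfl
    rw [pVarOn, pVar, ENNReal.iSup_eq_zero]
    rintro ⟨m, u, hu⟩
    exact (u 0).2.elim
  rcases S.eq_empty_or_nonempty with h | ⟨s0, hs0⟩
  · rw [aux S h, zero_add]; exact pVarOn_mono hT f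
  rcases T.eq_empty_or_nonempty with h | ⟨t0, ht0⟩
  · rw [aux T h, add_zero]; exact pVarOn_mono hS f
  have : Nonempty (ℕ × {u : ℕ → S // Monotone u}) := ⟨(0, ⟨fun _ => ⟨s0, hs0⟩, monotone_const⟩)⟩
  have : Nonempty (ℕ × {u : ℕ → T // Monotone u}) := ⟨(0, ⟨fun _ => ⟨t0, ht0⟩, monotone_const⟩)⟩
  unfold pVarOn pVar
  refine ENNReal.iSup_add_iSup_le ?_
  rintro ⟨m, u, hu⟩ ⟨k, v, hv⟩
  -- The points `u 0, …, u m` occupy `m + 1` places, so `v` starts at index `m + 1` and the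
  -- increment with index `m` is the bridge that is thrown away below.
  let w : ℕ → U := fun i => if i ≤ m then ⟨u i, hS (u i).2⟩ else ⟨v (i - (m + 1)), hT (v _).2⟩
  have hw : Monotone w := by
    intro i j hij
    by_cases hi : i ≤ m
    · by_cases hj : j ≤ m
      · simp only [w, hi, hj, if_true]; exact hu hij
      · simp only [w, hi, hj, if_true, if_false]; exact hST _ (u i).2 _ (v _).2
    · have hj : ¬ j ≤ m := by omega
      simp only [w, hi, hj, if_false]; exact hv (by omega)
  refine le_trans ?_ (sum_le_pVar p (fun x : U => f x) (m + (1 + k)) hw)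
  rw [Finset.sum_range_add, Finset.sum_range_add]
  refine add_le_add (Finset.sum_le_sum fun i hi => ?_) (le_add_left (Finset.sum_le_sum fun i hi => ?_))
  · have hi := Finset.mem_range.1 hi
    have h1 : i ≤ m := by omega
    have h2 : i + 1 ≤ m := by omega
    simp only [w, h1, h2, if_true, le_refl]
  · have h1 : ¬ m + (1 + i) ≤ m := by omega
    have h2 : ¬ m + (1 + i) + 1 ≤ m := by omega
    have e1 : m + (1 + i) - (m + 1) = i := by omega
    have e2 : m + (1 + i) + 1 - (m + 1) = i + 1 := by omega
    simp only [w, h1, h2, if_false, e1, e2, le_refl]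

/-- The `p`-variation on `(-∞, x]` controls the increments. -/
theorem pVarOn_Icc_add_pVarOn_Iic_le (f : α → ℝ) {x y : α} (hxy : x ≤ y) :
    pVarOn p f (Icc x y) + pVarOn p f (Iic x) ≤ pVarOn p f (Iic y) := by
  rw [add_comm]
  exact pVarOn_add_le (Iic_subset_Iic.2 hxy) Icc_subset_Iic_self
    (fun a ha b hb => le_trans ha hb.1) f

theorem enorm_sub_rpow_add_le (hp : 1 ≤ p) (f : α → ℝ) {x y : α} (hxy : x ≤ y) :
    ‖f y - f x‖ₑ ^ p + pVarOn p f (Iic x) ≤ pVarOn p f (Iic y) := by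
  refine le_trans (add_le_add ?_ le_rfl) (pVarOn_Icc_add_pVarOn_Iic_le f hxy)
  exact enorm_sub_rpow_le_pVar hp (fun z : Icc x y => f z) ⟨x, le_rfl, hxy⟩ ⟨y, hxy, le_rfl⟩

end PVar

/-! ### The Love–Young inequality for finite sums -/

section LoveYoung

variable {q : ℝ}

theorem sum_abs_rpow_le {α : Type*} [LinearOrder α] (hq : 0 ≤ q) {f : α → ℝ} {A : ℝ} (hA : 0 ≤ A)
    (h : pVar q f ≤ ENNReal.ofReal A) (m : ℕ) {u : ℕ → α} (hu : Monotone u) :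
    ∑ i ∈ Finset.range m, |f (u (i + 1)) - f (u i)| ^ q ≤ A := by
  rw [← ENNReal.ofReal_le_ofReal_iff hA, ENNReal.ofReal_sum_of_nonneg fun i _ => by positivity]
  refine le_trans (le_of_eq ?_) ((sum_le_pVar q f m hu).trans h)
  refine Finset.sum_congr rfl fun i _ => ?_
  rw [Real.enorm_eq_ofReal_abs, ENNReal.ofReal_rpow_of_nonneg (abs_nonneg _) hq]

/-- The map `ℕ → ℕ` that leaves out `k + 1`. -/
def skip (k i : ℕ) : ℕ := if i ≤ k then i else i + 1

theorem skip_monotone (k : ℕ) : Monotone (skip k) := by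
  intro i j hij
  unfold skip
  split_ifs <;> omega

/-- Removing the partition point `k + 1` merges two cells. With values of `a` at left endpoints, the
sum changes by one product of neighbouring increments of `a` and `F`. -/
theorem sum_eq_sum_skip (a F : ℕ → ℝ) {k m : ℕ} (hk : k ≤ m) :
    ∑ i ∈ Finset.range (m + 2), a i * (F (i + 1) - F i)
      = ∑ i ∈ Finset.range (m + 1), a (skip k i) * (F (skip k (i + 1)) - F (skip k i))
        + (a (k + 1) - a k) * (F (k + 2) - F (k + 1)) := by
  induction m, hk using Nat.le_induction with
  | base =>
    rw [Finset.sum_range_succ, Finset.sum_range_succ, Finset.sum_range_succ (n := k)]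
    have : ∑ i ∈ Finset.range k, a (skip k i) * (F (skip k (i + 1)) - F (skip k i))
        = ∑ i ∈ Finset.range k, a i * (F (i + 1) - F i) := by
      refine Finset.sum_congr rfl fun i hi => ?_
      have hi := Finset.mem_range.1 hi
      have h1 : i ≤ k := by omega
      have h2 : i + 1 ≤ k := by omega
      simp [skip, h1, h2]
    rw [this]
    simp [skip]
    ring
  | succ m hm ih =>
    rw [Finset.sum_range_succ, ih, Finset.sum_range_succ (n := m + 1)]
    have h1 : ¬ m + 1 ≤ k := by omega
    have h2 : ¬ m + 1 + 1 ≤ k := by omega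
    simp only [skip, h1, h2, if_false]
    ring

/-- Otherwise every `√(|x k| ^ q) √(|y k| ^ q)` would exceed `√(A B) / (m + 1)`, and summing over
the `m + 1` indices would contradict the Cauchy–Schwarz inequality. -/
theorem exists_mul_le (hq : 0 < q) (x y : ℕ → ℝ) (m : ℕ) {A B : ℝ}
    (hA : ∑ i ∈ Finset.range (m + 1), |x i| ^ q ≤ A)
    (hB : ∑ i ∈ Finset.range (m + 1), |y i| ^ q ≤ B) :
    ∃ k ≤ m, |x k * y k| ≤ (A * B) ^ (1 / q) * (1 / ((m : ℝ) + 1)) ^ (2 / q) := by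
  have hA0 : 0 ≤ A := le_trans (Finset.sum_nonneg fun i _ => by positivity) hA
  have hB0 : 0 ≤ B := le_trans (Finset.sum_nonneg fun i _ => by positivity) hB
  by_contra! hcon
  have h1 : ∀ k ∈ Finset.range (m + 1),
      √(A * B) / (m + 1) < √(|x k| ^ q) * √(|y k| ^ q) := by
    intro k hk
    have h := hcon k (by have := Finset.mem_range.1 hk; omega)
    have h2 := Real.rpow_lt_rpow (by positivity) h (show 0 < q / 2 by positivity)
    rw [Real.mul_rpow (by positivity) (by positivity), ← Real.rpow_mul (by positivity),
      ← Real.rpow_mul (by positivity)] at h2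
    have e1 : 1 / q * (q / 2) = 1 / 2 := by field_simp
    have e2 : 2 / q * (q / 2) = 1 := by field_simp
    rw [e1, e2, Real.rpow_one, ← Real.sqrt_eq_rpow, mul_one_div] at h2
    refine h2.trans_eq ?_
    rw [abs_mul, Real.mul_rpow (abs_nonneg _) (abs_nonneg _), Real.sqrt_eq_rpow, Real.sqrt_eq_rpow,
      ← Real.rpow_mul (abs_nonneg _), ← Real.rpow_mul (abs_nonneg _), mul_one_div]
  have h2 := Finset.sum_lt_sum_of_nonempty (by simp) h1
  have h3 := Real.sum_sqrt_mul_sqrt_le (Finset.range (m + 1)) (f := fun k => |x k| ^ q)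
    (g := fun k => |y k| ^ q) (fun i => by positivity) (fun i => by positivity)
  rw [Finset.sum_const, Finset.card_range, nsmul_eq_mul] at h2
  push_cast at h2
  rw [mul_div_cancel₀ _ (by positivity)] at h2
  have h4 : √(∑ k ∈ Finset.range (m + 1), |x k| ^ q) * √(∑ k ∈ Finset.range (m + 1), |y k| ^ q)
      ≤ √(A * B) := by
    rw [Real.sqrt_mul hA0]
    gcongr
  linarith

/-- Young's argument: remove the cheapest interior point repeatedly. A removal costs at most the
bound of `exists_mul_le`, and passing to a subsequence does not increase the variations. Subtracting
`a 0` makes the sum over the last remaining cell vanish. -/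
theorem love_young_aux (hq : 0 < q) {A B : ℝ} (hA : 0 ≤ A) (hB : 0 ≤ B) (m : ℕ) :
    ∀ a F : ℕ → ℝ, pVar q a ≤ ENNReal.ofReal A → pVar q F ≤ ENNReal.ofReal B →
      |∑ i ∈ Finset.range (m + 1), (a i - a 0) * (F (i + 1) - F i)|
        ≤ (A * B) ^ (1 / q) * ∑ j ∈ Finset.range m, (1 / ((j : ℝ) + 1)) ^ (2 / q) := by
  induction m with
  | zero => intro a F _ _; simp
  | succ m ih =>
    intro a F ha hF
    obtain ⟨k, hk, hle⟩ := exists_mul_le hq (fun i => a (i + 1) - a i)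
      (fun i => F (i + 1 + 1) - F (i + 1)) m
      (sum_abs_rpow_le hq.le hA ha (m + 1) (u := id) monotone_id)
      (sum_abs_rpow_le hq.le hB hF (m + 1) (u := fun i => i + 1) (fun i j h => by simpa using h))
    have h1 := sum_eq_sum_skip (fun i => a i - a 0) F hk
    have h2 := ih (fun i => a (skip k i)) (fun i => F (skip k i))
      ((pVar_comp_le (skip_monotone k) a).trans ha) ((pVar_comp_le (skip_monotone k) F).trans hF)
    have h0 : skip k 0 = 0 := by simp [skip]
    rw [h0] at h2
    rw [h1, Finset.sum_range_succ (fun j : ℕ => (1 / ((j : ℝ) + 1)) ^ (2 / q)) m, mul_add]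
    refine (abs_add_le _ _).trans (add_le_add h2 ?_)
    refine le_trans (le_of_eq ?_) hle
    congr 1
    ring

/-- The constant in the Love–Young inequality. -/
def loveYoungConst (q : ℝ) : ℝ := ∑' j : ℕ, (1 / ((j : ℝ) + 1)) ^ (2 / q)

theorem loveYoungConst_nonneg (q : ℝ) : 0 ≤ loveYoungConst q := tsum_nonneg fun j => by positivity

theorem summable_loveYoung (hq : 0 < q) (hq2 : q < 2) :
    -- The exponent `2 / q` exceeds one precisely because `q < 2`.
    Summable fun j : ℕ => (1 / ((j : ℝ) + 1)) ^ (2 / q) := by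
  have h1 : 1 < 2 / q := by rw [lt_div_iff₀ hq]; linarith
  have h := (summable_nat_add_iff 1).2 (Real.summable_one_div_nat_rpow.2 h1)
  refine h.congr fun j => ?_
  rw [Real.div_rpow (by positivity) (by positivity), Real.one_rpow]
  push_cast
  rfl

/-- **Love–Young inequality** for finite sums. -/
theorem love_young (hq : 1 ≤ q) (hq2 : q < 2) {A B S : ℝ} (hA : 0 ≤ A) (hB : 0 ≤ B) {a F : ℕ → ℝ}
    (hS : ∀ i, |a i| ≤ S) (ha : pVar q a ≤ ENNReal.ofReal A) (hF : pVar q F ≤ ENNReal.ofReal B)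
    (m : ℕ) :
    |∑ i ∈ Finset.range m, a i * (F (i + 1) - F i)|
      ≤ (S + loveYoungConst q * A ^ (1 / q)) * B ^ (1 / q) := by
  have hq0 : 0 < q := by linarith
  have hS0 : 0 ≤ S := (abs_nonneg _).trans (hS 0)
  have hC := loveYoungConst_nonneg q
  rcases m with _ | m
  · simp; positivity
  have h1 := love_young_aux hq0 hA hB m a F ha hF
  have h2 : ∑ i ∈ Finset.range (m + 1), a i * (F (i + 1) - F i)
      = a 0 * (F (m + 1) - F 0)
        + ∑ i ∈ Finset.range (m + 1), (a i - a 0) * (F (i + 1) - F i) := by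
    rw [← Finset.sum_range_sub F (m + 1), Finset.mul_sum, ← Finset.sum_add_distrib]
    exact Finset.sum_congr rfl fun i _ => by ring
  have h3 : |F (m + 1) - F 0| ≤ B ^ (1 / q) := by
    have := (enorm_sub_rpow_le_pVar hq F 0 (m + 1)).trans hF
    rw [Real.enorm_eq_ofReal_abs, ENNReal.ofReal_rpow_of_nonneg (abs_nonneg _) hq0.le,
      ENNReal.ofReal_le_ofReal_iff hB] at this
    rw [one_div]
    exact (Real.le_rpow_inv_iff_of_pos (abs_nonneg _) hB hq0).2 this
  have h4 : ∑ j ∈ Finset.range m, (1 / ((j : ℝ) + 1)) ^ (2 / q) ≤ loveYoungConst q :=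
    (summable_loveYoung hq0 hq2).sum_le_tsum _ fun j _ => by positivity
  rw [h2]
  calc _ ≤ |a 0| * |F (m + 1) - F 0| + (A * B) ^ (1 / q) * loveYoungConst q := by
        refine (abs_add_le _ _).trans (add_le_add (abs_mul _ _).le (h1.trans ?_))
        gcongr
    _ ≤ S * B ^ (1 / q) + (A * B) ^ (1 / q) * loveYoungConst q := by
        gcongr
        exact hS 0
    _ = _ := by rw [Real.mul_rpow hA hB]; ring

end LoveYoung

end CensRec
end

noncomputable section

namespace CensRec

/-! ### One-sided limits of functions of bounded `p`-variation -/

section Limits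

variable {p q : ℝ} {f g : ℝ≥0 → ℝ}

theorem pVarOn_ne_top (hf : pVar p f ≠ ∞) (S : Set ℝ≥0) : pVarOn p f S ≠ ∞ :=
  ne_top_of_le_ne_top hf (pVarOn_le_pVar S f)

/-- The `p`-variation on `[0, x]`, as a real number. -/
def varUpTo (p : ℝ) (f : ℝ≥0 → ℝ) (x : ℝ≥0) : ℝ := (pVarOn p f (Iic x)).toReal

theorem varUpTo_nonneg (p : ℝ) (f : ℝ≥0 → ℝ) (x : ℝ≥0) : 0 ≤ varUpTo p f x :=
  ENNReal.toReal_nonneg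

theorem varUpTo_mono (hf : pVar p f ≠ ∞) : Monotone (varUpTo p f) := fun _ _ hxy =>
  ENNReal.toReal_mono (pVarOn_ne_top hf _) (pVarOn_mono (Iic_subset_Iic.2 hxy) f)

theorem varUpTo_le (hf : pVar p f ≠ ∞) (x : ℝ≥0) : varUpTo p f x ≤ (pVar p f).toReal :=
  ENNReal.toReal_mono hf (pVarOn_le_pVar _ f)

/-- The increments of `f` are dominated by those of a bounded increasing function, so `f` inherits
one-sided limits and a limit at infinity from it. -/
theorem abs_sub_rpow_le (hp : 1 ≤ p) (hf : pVar p f ≠ ∞) (x y : ℝ≥0) :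
    |f y - f x| ^ p ≤ |varUpTo p f y - varUpTo p f x| := by
  wlog hxy : x ≤ y generalizing x y
  · rw [abs_sub_comm (f y), abs_sub_comm (varUpTo p f y)]
    exact this y x (le_of_not_ge hxy)
  have h := enorm_sub_rpow_add_le hp f hxy
  have h2 := ENNReal.toReal_mono (pVarOn_ne_top hf _) h
  rw [ENNReal.toReal_add (ENNReal.rpow_ne_top_of_nonneg (by linarith) enorm_ne_top)
    (pVarOn_ne_top hf _), ← ENNReal.toReal_rpow, toReal_enorm, Real.norm_eq_abs] at h2
  refine le_trans ?_ (le_abs_self _)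
  unfold varUpTo
  linarith

theorem exists_tendsto_of_varUpTo (hp : 1 ≤ p) (hf : pVar p f ≠ ∞) {l : Filter ℝ≥0} [l.NeBot]
    {L : ℝ} (hL : Tendsto (varUpTo p f) l (𝓝 L)) : ∃ y, Tendsto f l (𝓝 y) := by
  refine cauchy_map_iff_exists_tendsto.1 (cauchy_map_iff'.2 ?_)
  rw [tendsto_uniformity_iff_dist_tendsto_zero]
  have h1 : Tendsto (fun z : ℝ≥0 × ℝ≥0 => |varUpTo p f z.1 - varUpTo p f z.2| ^ (1 / p))
      (l ×ˢ l) (𝓝 0) := by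
    have := ((hL.comp (tendsto_fst (f := l) (g := l))).sub (hL.comp (tendsto_snd (f := l) (g := l)))).abs.rpow_const
      (p := 1 / p) (Or.inr (by positivity))
    simpa [Real.zero_rpow (show p⁻¹ ≠ 0 by positivity)] using this
  refine squeeze_zero (fun _ => dist_nonneg) (fun z => ?_) h1
  rw [Real.dist_eq, one_div, Real.le_rpow_inv_iff_of_pos (abs_nonneg _) (abs_nonneg _)
    (by linarith)]
  exact abs_sub_rpow_le hp hf _ _

theorem tendsto_leftLim_of_pVar (hp : 1 ≤ p) (hf : pVar p f ≠ ∞) (a : ℝ≥0) :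
    Tendsto f (𝓝[<] a) (𝓝 (Function.leftLim f a)) := by
  rcases eq_or_ne (𝓝[<] a) ⊥ with h | h
  · rw [h]; exact tendsto_bot
  have : (𝓝[<] a).NeBot := ⟨h⟩
  obtain ⟨y, hy⟩ := exists_tendsto_of_varUpTo hp hf ((varUpTo_mono hf).tendsto_leftLim a)
  rwa [leftLim_eq_of_tendsto hy]

theorem tendsto_atInfty_of_pVar (hp : 1 ≤ p) (hf : pVar p f ≠ ∞) :
    Tendsto f atTop (𝓝 (atInfty f)) := by
  have h : BddAbove (range (varUpTo p f)) :=
    ⟨(pVar p f).toReal, by rintro _ ⟨x, rfl⟩; exact varUpTo_le hf x⟩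
  obtain ⟨y, hy⟩ := exists_tendsto_of_varUpTo hp hf (tendsto_atTop_ciSup (varUpTo_mono hf) h)
  exact tendsto_nhds_limUnder ⟨y, hy⟩

/-- A shift to the left. -/
def shiftLeft (n : ℕ) (s : ℝ≥0) : ℝ≥0 := s - 1 / ((n : ℝ≥0) + 1)

theorem shiftLeft_mono (n : ℕ) : Monotone (shiftLeft n) := fun _ _ h => tsub_le_tsub_right h _

theorem shiftLeft_le (n : ℕ) (s : ℝ≥0) : shiftLeft n s ≤ s := tsub_le_self

theorem tendsto_shiftLeft (s : ℝ≥0) : Tendsto (fun n => shiftLeft n s) atTop (𝓝 s) := by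
  have h : Tendsto (fun n : ℕ => s - 1 / ((n : ℝ≥0) + 1)) atTop (𝓝 (s - 0)) :=
    tendsto_const_nhds.sub tendsto_one_div_add_atTop_nhds_zero_nat
  rwa [tsub_zero] at h

theorem tendsto_comp_shiftLeft (hl : ∀ a, Tendsto f (𝓝[<] a) (𝓝 (Function.leftLim f a)))
    (s : ℝ≥0) : Tendsto (fun n => f (shiftLeft n s)) atTop (𝓝 (Function.leftLim f s)) := by
  rcases eq_or_ne s 0 with rfl | hs
  -- At zero the truncated subtraction stays at zero, and the left limit at a bottom element is by
  -- convention the value.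
  · have : ∀ n, shiftLeft n 0 = 0 := fun n => by simp [shiftLeft]
    simp only [this]
    rw [leftLim_eq_of_isBot (fun _ => zero_le)]
    exact tendsto_const_nhds
  · refine (hl s).comp (tendsto_nhdsWithin_iff.2 ⟨tendsto_shiftLeft s, Eventually.of_forall ?_⟩)
    intro n
    exact tsub_lt_self (pos_iff_ne_zero.2 hs) (by positivity)

/-- The left limit is a pointwise limit of the monotone reparametrizations `f ∘ shiftLeft n`, none
of which has larger variation than `f`. -/
theorem pVar_leftLim_le (hp : 1 ≤ p) (hf : pVar p f ≠ ∞) :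
    pVar q (Function.leftLim f) ≤ pVar q f :=
  pVar_le_of_tendsto (tendsto_comp_shiftLeft (tendsto_leftLim_of_pVar hp hf))
    (Eventually.of_forall fun n => pVar_comp_le (shiftLeft_mono n) f)

end Limits

/-! ### Young sums -/

section YoungSum

variable {p q : ℝ} {f g : ℝ≥0 → ℝ}

theorem sum_range_two_mul (h : ℕ → ℝ) (m : ℕ) :
    ∑ j ∈ Finset.range (2 * m), h j = ∑ i ∈ Finset.range m, (h (2 * i) + h (2 * i + 1)) := by
  induction m with
  | zero => simp
  | succ m ih =>
    rw [show 2 * (m + 1) = 2 * m + 1 + 1 by ring, Finset.sum_range_succ, Finset.sum_range_succ, ih,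
      Finset.sum_range_succ]
    ring

/-- Interleaving `x 0, y 0, x 1, y 1, …` up to index `2 m`, constant equal to `c` from there on. -/
def interleave {α : Type*} (m : ℕ) (c : α) (x y : ℕ → α) (j : ℕ) : α :=
  if j < 2 * m then (if j % 2 = 0 then x (j / 2) else y (j / 2)) else c

theorem interleave_even {α : Type*} {m i : ℕ} (hi : i < m) (c : α) (x y : ℕ → α) :
    interleave m c x y (2 * i) = x i := by
  have h1 : 2 * i < 2 * m := by omega
  have h2 : 2 * i % 2 = 0 := by omega
  have h3 : 2 * i / 2 = i := by omega
  simp [interleave, h1]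

theorem interleave_odd {α : Type*} {m i : ℕ} (hi : i < m) (c : α) (x y : ℕ → α) :
    interleave m c x y (2 * i + 1) = y i := by
  have h1 : 2 * i + 1 < 2 * m := by omega
  have h2 : ¬ (2 * i + 1) % 2 = 0 := by omega
  have h3 : (2 * i + 1) / 2 = i := by omega
  simp only [interleave, h1, h2, h3, if_true, if_false]

theorem interleave_top {α : Type*} {m j : ℕ} (hj : 2 * m ≤ j) (c : α) (x y : ℕ → α) :
    interleave m c x y j = c := by
  have h1 : ¬ j < 2 * m := by omega
  simp only [interleave, h1, if_false]

theorem interleave_mono {α : Type*} [Preorder α] {m : ℕ} {c : α} {x y : ℕ → α}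
    (h1 : ∀ i < m, x i ≤ y i) (h2 : ∀ i, i + 1 < m → y i ≤ x (i + 1))
    (h3 : ∀ i, i + 1 = m → y i ≤ c) : Monotone (interleave m c x y) := by
  refine monotone_nat_of_le_succ fun j => ?_
  by_cases hj : j < 2 * m
  · obtain ⟨i, rfl | rfl⟩ := Nat.even_or_odd' j
    · rw [interleave_even (by omega), interleave_odd (by omega)]
      exact h1 i (by omega)
    · rw [interleave_odd (by omega)]
      by_cases hi : i + 1 < m
      · rw [show 2 * i + 1 + 1 = 2 * (i + 1) by ring, interleave_even hi]
        exact h2 i hi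
      · rw [interleave_top (by omega)]
        exact h3 i (by omega)
  · rw [interleave_top (by omega), interleave_top (by omega)]

theorem le_of_tags {m : ℕ} {u v : ℕ → ℝ≥0} (hv : ∀ i < m, v i ∈ Ioo (u i) (u (i + 1))) {i j : ℕ}
    (hij : i ≤ j) (hj : j ≤ m) : u i ≤ u j := by
  induction j, hij using Nat.le_induction with
  | base => exact le_rfl
  | succ j _ ih => exact (ih (by omega)).trans ((hv j (by omega)).1.trans (hv j (by omega)).2).le

/-- Replacing each left limit by the value at a slightly shifted point turns a Young sum into an
ordinary sum over `2 m` increments, with tags and partition points interleaved. The Love–Young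
inequality applies to it, and the bound survives the limit. -/
theorem youngSum_bound (hq : 1 ≤ q) (hq2 : q < 2)
    (hl : ∀ a, Tendsto f (𝓝[<] a) (𝓝 (Function.leftLim f a)))
    {S A B : ℝ} (hA : 0 ≤ A) (hB : 0 ≤ B) (hS : ∀ x, |g x| ≤ S) (hg : pVar q g ≤ ENNReal.ofReal A)
    {m : ℕ} {u v : ℕ → ℝ≥0} (hv : ∀ i < m, v i ∈ Ioo (u i) (u (i + 1)))
    (hf : pVarOn q f (Icc (u 0) (u m)) ≤ ENNReal.ofReal B) :
    |youngSum g f m u v| ≤ (S + loveYoungConst q * A ^ (1 / q)) * B ^ (1 / q) := by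
  have hlim : Tendsto (fun n => ∑ i ∈ Finset.range m,
      (g (v i) * (f (shiftLeft n (u (i + 1))) - f (u i))
        + g (u (i + 1)) * (f (u (i + 1)) - f (shiftLeft n (u (i + 1)))))) atTop
      (𝓝 (youngSum g f m u v)) := by
    refine tendsto_finsetSum _ fun i _ => ?_
    have h := tendsto_comp_shiftLeft hl (u (i + 1))
    exact ((h.sub_const _).const_mul _).add ((tendsto_const_nhds.sub h).const_mul _)
  refine le_of_tendsto hlim.abs ?_
  -- For large `n` the shifted point stays to the right of `u i`, so that the interleaved sequence
  -- is monotone.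
  have hev : ∀ᶠ n in atTop, ∀ i ∈ Finset.range m, u i < shiftLeft n (u (i + 1)) := by
    rw [eventually_all_finset]
    intro i hi
    have h := hv i (Finset.mem_range.1 hi)
    exact (tendsto_shiftLeft (u (i + 1))).eventually (lt_mem_nhds (h.1.trans h.2))
  filter_upwards [hev] with n hn
  have hn' : ∀ i < m, u i ≤ shiftLeft n (u (i + 1)) := fun i hi => (hn i (Finset.mem_range.2 hi)).le
  let tags := interleave m (u m) v (fun i => u (i + 1))
  let w := interleave m (u m) u (fun i => shiftLeft n (u (i + 1)))
  have htags : Monotone tags := interleave_mono (fun i hi => (hv i hi).2.le)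
    (fun i hi => (hv (i + 1) hi).1.le) (fun i hi => by rw [hi])
  have hw : Monotone w := interleave_mono hn' (fun i _ => shiftLeft_le _ _)
    (fun i hi => by rw [← hi]; exact shiftLeft_le _ _)
  have hw0 : w 0 = u 0 := by
    rcases Nat.eq_zero_or_pos m with rfl | hm
    · exact interleave_top (by omega) _ _ _
    · exact interleave_even (i := 0) hm _ _ _
  have hwm : ∀ j, w j ≤ u m := fun j => by
    have h := hw (show j ≤ max j (2 * m) from le_max_left _ _)
    rwa [show w (max j (2 * m)) = u m from interleave_top (le_max_right _ _) _ _ _] at h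
  have hF : pVar q (fun j => f (w j)) ≤ ENNReal.ofReal B :=
    (pVar_comp_le (φ := fun j => (⟨w j, hw0 ▸ hw j.zero_le, hwm j⟩ : Icc (u 0) (u m)))
      (fun i j hij => hw hij) (fun x : Icc (u 0) (u m) => f x)).trans hf
  have key := love_young hq hq2 hA hB (a := fun j => g (tags j)) (F := fun j => f (w j))
    (fun i => hS _) ((pVar_comp_le htags g).trans hg) hF (2 * m)
  rw [sum_range_two_mul] at key
  refine le_of_eq_of_le (congrArg _ (Finset.sum_congr rfl fun i hi => ?_)) key
  have hi := Finset.mem_range.1 hi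
  have e1 : tags (2 * i) = v i := interleave_even hi _ _ _
  have e2 : tags (2 * i + 1) = u (i + 1) := interleave_odd hi _ _ _
  have e3 : w (2 * i) = u i := interleave_even hi _ _ _
  have e4 : w (2 * i + 1) = shiftLeft n (u (i + 1)) := interleave_odd hi _ _ _
  have e5 : w (2 * i + 1 + 1) = u (i + 1) := by
    by_cases h : i + 1 < m
    · rw [show 2 * i + 1 + 1 = 2 * (i + 1) by ring]; exact interleave_even h _ _ _
    · have : i + 1 = m := by omega
      rw [this]; exact interleave_top (by omega) _ _ _
  simp only [e1, e2, e3, e4, e5]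

theorem youngSum_add_left (g h f : ℝ≥0 → ℝ) (m : ℕ) (u v : ℕ → ℝ≥0) :
    youngSum (fun x => g x + h x) f m u v = youngSum g f m u v + youngSum h f m u v := by
  simp only [youngSum, ← Finset.sum_add_distrib]
  exact Finset.sum_congr rfl fun i _ => by ring

theorem youngSum_const_mul_left (c : ℝ) (g f : ℝ≥0 → ℝ) (m : ℕ) (u v : ℕ → ℝ≥0) :
    youngSum (fun x => c * g x) f m u v = c * youngSum g f m u v := by
  simp only [youngSum, Finset.mul_sum]
  exact Finset.sum_congr rfl fun i _ => by ring

theorem youngSum_sub_left (g h f : ℝ≥0 → ℝ) (m : ℕ) (u v : ℕ → ℝ≥0) :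
    youngSum (fun x => g x - h x) f m u v = youngSum g f m u v - youngSum h f m u v := by
  simp only [youngSum, ← Finset.sum_sub_distrib]
  exact Finset.sum_congr rfl fun i _ => by ring

theorem leftLim_add (hf : ∀ a, Tendsto f (𝓝[<] a) (𝓝 (Function.leftLim f a)))
    (hg : ∀ a, Tendsto g (𝓝[<] a) (𝓝 (Function.leftLim g a))) (a : ℝ≥0) :
    Function.leftLim (fun x => f x + g x) a = Function.leftLim f a + Function.leftLim g a := by
  rcases eq_or_ne (𝓝[<] a) ⊥ with h | h
  · simp only [leftLim_eq_of_eq_bot _ h]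
  · have : (𝓝[<] a).NeBot := ⟨h⟩
    exact leftLim_eq_of_tendsto ((hf a).add (hg a))

theorem leftLim_const_mul (c : ℝ) (hf : ∀ a, Tendsto f (𝓝[<] a) (𝓝 (Function.leftLim f a)))
    (a : ℝ≥0) : Function.leftLim (fun x => c * f x) a = c * Function.leftLim f a := by
  rcases eq_or_ne (𝓝[<] a) ⊥ with h | h
  · simp only [leftLim_eq_of_eq_bot _ h]
  · have : (𝓝[<] a).NeBot := ⟨h⟩
    exact leftLim_eq_of_tendsto ((hf a).const_mul c)

end YoungSum

/-! ### Partitions and the Young integral -/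

section YoungIntegral

variable {p q : ℝ} {f g h : ℝ≥0 → ℝ} {s : ℝ≥0}

/-- A tagged partition `0 = u 0 < … < u m = s`. -/
structure IsPart (s : ℝ≥0) (m : ℕ) (u v : ℕ → ℝ≥0) : Prop where
  zero : u 0 = 0
  last : u m = s
  tag : ∀ i < m, v i ∈ Ioo (u i) (u (i + 1))

theorem exists_isPart (s : ℝ≥0) (T : Finset ℝ≥0) (hT : ∀ x ∈ T, x ≤ s) :
    ∃ (m : ℕ) (u v : ℕ → ℝ≥0), IsPart s m u v ∧ ∀ x ∈ T, ∃ i ≤ m, u i = x := by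
  classical
  -- With `0` and `s` included, the increasing enumeration of the set begins at `0` and ends at `s`;
  -- midpoints serve as tags.
  set T' := insert 0 (insert s T) with hT'
  have hne : T'.Nonempty := ⟨0, Finset.mem_insert_self _ _⟩
  have hcard : 0 < T'.card := hne.card_pos
  have hle : ∀ x ∈ T', x ≤ s := by
    intro x hx
    rcases Finset.mem_insert.1 hx with rfl | hx
    · exact zero_le
    rcases Finset.mem_insert.1 hx with rfl | hx
    · exact le_rfl
    exact hT x hx
  let e := T'.orderEmbOfFin rfl
  let u : ℕ → ℝ≥0 := fun i => if h : i < T'.card then e ⟨i, h⟩ else s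
  have hu0 : u 0 = 0 := by
    have h1 : u 0 = e ⟨0, hcard⟩ := dif_pos hcard
    rw [h1, Finset.orderEmbOfFin_zero rfl hcard]
    exact le_antisymm (Finset.min'_le _ _ (Finset.mem_insert_self _ _)) zero_le
  have hlast : T'.card - 1 < T'.card := by omega
  have hum : u (T'.card - 1) = s := by
    have h1 : u (T'.card - 1) = e ⟨T'.card - 1, hlast⟩ := dif_pos hlast
    rw [h1, Finset.orderEmbOfFin_last rfl hcard]
    exact le_antisymm (hle _ (Finset.max'_mem _ _))
      (Finset.le_max' _ _ (Finset.mem_insert_of_mem (Finset.mem_insert_self _ _)))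
  refine ⟨T'.card - 1, u, fun i => (u i + u (i + 1)) / 2, ⟨hu0, hum, fun i hi => ?_⟩, fun x hx => ?_⟩
  · have h1 : i < T'.card := by omega
    have h2 : i + 1 < T'.card := by omega
    have hlt : u i < u (i + 1) := by
      have e1 : u i = e ⟨i, h1⟩ := dif_pos h1
      have e2 : u (i + 1) = e ⟨i + 1, h2⟩ := dif_pos h2
      rw [e1, e2]
      exact e.strictMono (by simp)
    rw [← NNReal.coe_lt_coe] at hlt
    constructor <;> rw [← NNReal.coe_lt_coe] <;> push_cast <;> linarith
  · have hx' : x ∈ Set.range e := by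
      rw [Finset.range_orderEmbOfFin]
      exact Finset.mem_insert_of_mem (Finset.mem_insert_of_mem hx)
    obtain ⟨⟨i, hi⟩, rfl⟩ := hx'
    exact ⟨i, by omega, dif_pos hi⟩

theorem hasYoungIntegral_iff {I : ℝ} : HasYoungIntegral g f s I ↔
    ∀ ε > 0, ∃ T : Finset ℝ≥0, (∀ x ∈ T, x ≤ s) ∧ ∀ (m : ℕ) (u v : ℕ → ℝ≥0), IsPart s m u v →
      (∀ x ∈ T, ∃ i ≤ m, u i = x) → |youngSum g f m u v - I| < ε := by
  constructor
  · intro h ε hε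
    obtain ⟨T, hT, hT2⟩ := h ε hε
    exact ⟨T, hT, fun m u v hp hc => hT2 m u v hp.1 hp.2 hp.3 hc⟩
  · intro h ε hε
    obtain ⟨T, hT, hT2⟩ := h ε hε
    exact ⟨T, hT, fun m u v h0 h1 h2 hc => hT2 m u v ⟨h0, h1, h2⟩ hc⟩

theorem exists_common_part {g' f' : ℝ≥0 → ℝ} {I I' : ℝ} (h : HasYoungIntegral g f s I)
    (h' : HasYoungIntegral g' f' s I') {ε : ℝ} (hε : 0 < ε) :
    ∃ T : Finset ℝ≥0, (∀ x ∈ T, x ≤ s) ∧ ∀ (m : ℕ) (u v : ℕ → ℝ≥0), IsPart s m u v →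
      (∀ x ∈ T, ∃ i ≤ m, u i = x) →
      |youngSum g f m u v - I| < ε ∧ |youngSum g' f' m u v - I'| < ε := by
  classical
  obtain ⟨T, hT, hT2⟩ := hasYoungIntegral_iff.1 h ε hε
  obtain ⟨T', hT', hT2'⟩ := hasYoungIntegral_iff.1 h' ε hε
  refine ⟨T ∪ T', fun x hx => ?_, fun m u v hp hc => ⟨hT2 m u v hp fun x hx => hc x ?_,
    hT2' m u v hp fun x hx => hc x ?_⟩⟩
  · rcases Finset.mem_union.1 hx with hx | hx
    exacts [hT x hx, hT' x hx]
  · exact Finset.mem_union_left _ hx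
  · exact Finset.mem_union_right _ hx

/-- Both integrals are approximated along one common partition; uniqueness of the integral is the
case `η = 0`. -/
theorem abs_sub_le_of_hasYoungIntegral {g' f' : ℝ≥0 → ℝ} {I I' η : ℝ}
    (h : HasYoungIntegral g f s I) (h' : HasYoungIntegral g' f' s I')
    (hη : ∀ (m : ℕ) (u v : ℕ → ℝ≥0), IsPart s m u v →
      |youngSum g f m u v - youngSum g' f' m u v| ≤ η) : |I - I'| ≤ η := by
  refine le_of_forall_pos_le_add fun ε hε => ?_
  obtain ⟨T, hT, hT2⟩ := exists_common_part h h' (half_pos hε)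
  obtain ⟨m, u, v, hp, hc⟩ := exists_isPart s T hT
  obtain ⟨h1, h2⟩ := hT2 m u v hp hc
  have h3 := hη m u v hp
  rw [abs_lt] at h1 h2
  rw [abs_le] at h3 ⊢
  constructor <;> linarith [h1.1, h1.2, h2.1, h2.2, h3.1, h3.2]

theorem HasYoungIntegral.unique {I I' : ℝ} (h : HasYoungIntegral g f s I)
    (h' : HasYoungIntegral g f s I') : I = I' := by
  have := abs_sub_le_of_hasYoungIntegral h h' (η := 0) (fun m u v _ => by simp)
  linarith [abs_nonpos_iff.1 this]

theorem HasYoungIntegral.youngInt_eq {I : ℝ} (h : HasYoungIntegral g f s I) :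
    youngInt g f s = I := by
  have hex : ∃ I, HasYoungIntegral g f s I := ⟨I, h⟩
  rw [youngInt, dif_pos hex]
  exact hex.choose_spec.unique h

/-- One statement covers linearity in the integrand and in the integrator, since each is an identity
between Young sums. -/
theorem HasYoungIntegral.combine {g' f' g'' f'' : ℝ≥0 → ℝ} {I I' : ℝ} (c c' : ℝ)
    (h : HasYoungIntegral g f s I) (h' : HasYoungIntegral g' f' s I')
    (hsum : ∀ (m : ℕ) (u v : ℕ → ℝ≥0),
      youngSum g'' f'' m u v = c * youngSum g f m u v + c' * youngSum g' f' m u v) :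
    HasYoungIntegral g'' f'' s (c * I + c' * I') := by
  rw [hasYoungIntegral_iff]
  intro ε hε
  have hc : 0 < |c| + |c'| + 1 := by positivity
  obtain ⟨T, hT, hT2⟩ := exists_common_part h h' (div_pos hε hc)
  refine ⟨T, hT, fun m u v hp hcov => ?_⟩
  obtain ⟨h1, h2⟩ := hT2 m u v hp hcov
  rw [hsum, show c * youngSum g f m u v + c' * youngSum g' f' m u v - (c * I + c' * I')
    = c * (youngSum g f m u v - I) + c' * (youngSum g' f' m u v - I') by ring]
  refine (abs_add_le _ _).trans_lt ?_
  rw [abs_mul, abs_mul]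
  calc _ ≤ |c| * (ε / (|c| + |c'| + 1)) + |c'| * (ε / (|c| + |c'| + 1)) := by gcongr
    _ < (|c| + |c'| + 1) * (ε / (|c| + |c'| + 1)) := by
        rw [← add_mul]
        have := div_pos hε hc
        exact mul_lt_mul_of_pos_right (by linarith) this
    _ = ε := by field_simp

theorem HasYoungIntegral.add_left {I J : ℝ} (hg : HasYoungIntegral g f s I)
    (hh : HasYoungIntegral h f s J) : HasYoungIntegral (fun x => g x + h x) f s (I + J) := by
  simpa using hg.combine 1 1 hh (g'' := fun x => g x + h x) (f'' := f)
    (fun m u v => by rw [youngSum_add_left]; ring)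

theorem HasYoungIntegral.const_mul_left {I : ℝ} (c : ℝ) (hg : HasYoungIntegral g f s I) :
    HasYoungIntegral (fun x => c * g x) f s (c * I) := by
  simpa using hg.combine c 0 hg (g'' := fun x => c * g x) (f'' := f)
    (fun m u v => by rw [youngSum_const_mul_left]; ring)

theorem HasYoungIntegral.combine_right {f' : ℝ≥0 → ℝ} {I J : ℝ} (c c' : ℝ)
    (hf : ∀ a, Tendsto f (𝓝[<] a) (𝓝 (Function.leftLim f a)))
    (hf' : ∀ a, Tendsto f' (𝓝[<] a) (𝓝 (Function.leftLim f' a)))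
    (hI : HasYoungIntegral g f s I) (hJ : HasYoungIntegral g f' s J) :
    HasYoungIntegral g (fun x => c * f x + c' * f' x) s (c * I + c' * J) := by
  refine hI.combine c c' hJ fun m u v => ?_
  simp only [youngSum, Finset.mul_sum, ← Finset.sum_add_distrib]
  refine Finset.sum_congr rfl fun i _ => ?_
  rw [leftLim_add, leftLim_const_mul c hf, leftLim_const_mul c' hf']
  · ring
  · intro a; rw [leftLim_const_mul c hf]; exact (hf a).const_mul c
  · intro a; rw [leftLim_const_mul c' hf']; exact (hf' a).const_mul c'

theorem HasYoungIntegral.congr_left {I : ℝ} (hI : HasYoungIntegral g f s I)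
    (hgh : ∀ x, 0 < x → x ≤ s → g x = h x) : HasYoungIntegral h f s I := by
  rw [hasYoungIntegral_iff] at hI ⊢
  intro ε hε
  obtain ⟨T, hT, hT2⟩ := hI ε hε
  refine ⟨T, hT, fun m u v hp hc => ?_⟩
  convert! hT2 m u v hp hc using 3
  refine Finset.sum_congr rfl fun i hi => ?_
  have hi := Finset.mem_range.1 hi
  have ht := hp.tag i hi
  have h1 : u (i + 1) ≤ s := by
    rw [← hp.last]; exact le_of_tags hp.tag (show i + 1 ≤ m by omega) le_rfl
  rw [hgh (v i) (zero_le.trans_lt ht.1) (ht.2.le.trans h1),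
    hgh (u (i + 1)) (zero_le.trans_lt (ht.1.trans ht.2)) h1]

theorem hasYoungIntegral_zero_left : HasYoungIntegral (fun _ => 0) f s 0 := by
  rw [hasYoungIntegral_iff]
  intro ε hε
  exact ⟨∅, by simp, fun m u v _ _ => by simpa [youngSum] using hε⟩

theorem HasYoungIntegral.sum_left {ι : Type*} (S : Finset ι) {G : ι → ℝ≥0 → ℝ} {I : ι → ℝ}
    (hG : ∀ i ∈ S, HasYoungIntegral (G i) f s (I i)) :
    HasYoungIntegral (fun x => ∑ i ∈ S, G i x) f s (∑ i ∈ S, I i) := by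
  classical
  induction S using Finset.induction_on with
  | empty => simpa using hasYoungIntegral_zero_left
  | insert a S ha ih =>
    simp only [Finset.sum_insert ha]
    exact (hG a (Finset.mem_insert_self _ _)).add_left
      (ih fun i hi => hG i (Finset.mem_insert_of_mem hi))

/-- For an indicator that changes at `a` only, every partition containing that point gives a
telescoping sum, so the Young sums equal the integral exactly. -/
theorem hasYoungIntegral_of_telescope (a : ℝ≥0) (Φ : ℝ≥0 → ℝ)
    (hΦ : ∀ x y z, x < z → z < y → (a ≤ x ∨ y ≤ a) →
      g z * (Function.leftLim f y - f x) + g y * (f y - Function.leftLim f y) = Φ y - Φ x) :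
    HasYoungIntegral g f s (Φ s - Φ 0) := by
  rw [hasYoungIntegral_iff]
  intro ε hε
  -- The refinement point must lie in `[0, s]`; if `a > s` the whole partition lies to the left of
  -- `a`.
  refine ⟨{min a s}, by simp, fun m u v hp hc => ?_⟩
  obtain ⟨k, hk, hku⟩ := hc (min a s) (by simp)
  have : youngSum g f m u v = Φ s - Φ 0 := by
    rw [← hp.last, ← hp.zero, ← Finset.sum_range_sub (fun i => Φ (u i))]
    refine Finset.sum_congr rfl fun i hi => ?_
    have hi := Finset.mem_range.1 hi
    refine hΦ _ _ _ (hp.tag i hi).1 (hp.tag i hi).2 ?_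
    by_cases hik : k ≤ i
    · by_cases has : a ≤ s
      · rw [min_eq_left has] at hku
        exact Or.inl (hku ▸ le_of_tags hp.tag hik (by omega))
      · right
        refine le_trans ?_ (le_of_not_ge has)
        rw [← hp.last]; exact le_of_tags hp.tag (by omega) le_rfl
    · right
      exact ((le_of_tags hp.tag (show i + 1 ≤ k by omega) hk).trans hku.le).trans (min_le_left _ _)
  rw [this]
  simpa using hε

theorem hasYoungIntegral_indicator_Ioi (a : ℝ≥0) :
    HasYoungIntegral ((Ioi a).indicator 1) f s (f (max s a) - f a) := by
  have h := hasYoungIntegral_of_telescope (g := (Ioi a).indicator 1) (f := f) (s := s) a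
    (fun x => f (max x a)) ?_
  · simpa using h
  intro x y z hxz hzy hor
  rcases hor with hax | hya
  · have h1 : a < z := hax.trans_lt hxz
    have h2 : a < y := h1.trans hzy
    simp [h1, h2, hax, h2.le]
  · have h1 : ¬ a < z := not_lt.2 (hzy.le.trans hya)
    have h2 : ¬ a < y := not_lt.2 hya
    have h3 : x ≤ a := (hxz.trans hzy).le.trans hya
    simp [h1, h2, h3, hya]

theorem hasYoungIntegral_indicator_Ici (a : ℝ≥0) :
    HasYoungIntegral ((Ici a).indicator 1) f s (if s < a then 0 else f s - Function.leftLim f a) := by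
  have h := hasYoungIntegral_of_telescope (g := (Ici a).indicator 1) (f := f) (s := s) a
    -- Below `a` the primitive has the constant value `f (a-)`, so that its jump at `a` is the jump
    -- of `f`.
    (fun x => if x < a then Function.leftLim f a else f x) ?_
  · convert! h using 1
    have h0 : (if (0 : ℝ≥0) < a then Function.leftLim f a else f 0) = Function.leftLim f a := by
      split_ifs with h
      · rfl
      · have : a = 0 := le_antisymm (not_lt.1 h) zero_le
        rw [this, leftLim_eq_of_isBot (fun _ => zero_le)]
    rw [h0]
    split_ifs <;> simp
  intro x y z hxz hzy hor
  rcases hor with hax | hya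
  · have h1 : a ≤ z := (hax.trans_lt hxz).le
    have h2 : a ≤ y := h1.trans hzy.le
    simp [h1, h2, not_lt.2 hax, not_lt.2 h2]
  · have h1 : ¬ a ≤ z := not_le.2 (hzy.trans_le hya)
    have h3 : x < a := (hxz.trans hzy).trans_le hya
    rcases hya.lt_or_eq with h2 | rfl
    · simp [h1, h2, h3, not_le.2 h2]
    · simp [h1, h3]

end YoungIntegral

end CensRec
end

noncomputable section

namespace CensRec

/-! ### Bins of a monotone function and step approximation -/

section Bins

variable {V : ℝ≥0 → ℝ} {c : ℝ}

/-- The index of the level set `{x | j ≤ c * V x < j + 1}` that contains `x`. -/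
def bin (V : ℝ≥0 → ℝ) (c : ℝ) (x : ℝ≥0) : ℕ := ⌊c * V x⌋₊

open Classical in
/-- A point in the level set number `j`, if that is nonempty. -/
def binRep (V : ℝ≥0 → ℝ) (c : ℝ) (j : ℕ) : ℝ≥0 :=
  if h : ∃ x, bin V c x = j then h.choose else 0

theorem bin_mono (hV : Monotone V) (hc : 0 ≤ c) : Monotone (bin V c) := fun _ _ hxy =>
  Nat.floor_le_floor (mul_le_mul_of_nonneg_left (hV hxy) hc)

theorem bin_binRep {j : ℕ} (h : ∃ x, bin V c x = j) : bin V c (binRep V c j) = j := by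
  rw [binRep, dif_pos h]
  exact h.choose_spec

theorem bin_binRep_bin (x : ℝ≥0) : bin V c (binRep V c (bin V c x)) = bin V c x :=
  bin_binRep ⟨x, rfl⟩

theorem binRep_bin_mono (hV : Monotone V) (hc : 0 ≤ c) :
    Monotone fun x => binRep V c (bin V c x) := by
  intro x y hxy
  rcases (bin_mono hV hc hxy).eq_or_lt with h | h
  · simp only [h, le_refl]
  · by_contra hcon
    have := bin_mono hV hc (le_of_not_ge hcon)
    rw [bin_binRep_bin, bin_binRep_bin] at this
    omega

theorem abs_sub_le_of_bin_eq (hV : ∀ x, 0 ≤ V x) (hc : 0 < c) {x y : ℝ≥0}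
    (h : bin V c x = bin V c y) : |V x - V y| ≤ 1 / c := by
  unfold bin at h
  have hx := Nat.floor_le (mul_nonneg hc.le (hV x))
  have hx' := Nat.lt_floor_add_one (c * V x)
  have hy := Nat.floor_le (mul_nonneg hc.le (hV y))
  have hy' := Nat.lt_floor_add_one (c * V y)
  rw [h] at hx hx'
  have h3 : |c * V x - c * V y| ≤ 1 := by rw [abs_le]; constructor <;> linarith
  rw [← mul_sub, abs_mul, abs_of_pos hc] at h3
  rwa [le_div_iff₀ hc, mul_comm]

theorem isUpperSet_nnreal {U : Set ℝ≥0} (hU : IsUpperSet U) :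
    U = ∅ ∨ ∃ a, U = Ici a ∨ U = Ioi a := by
  rcases U.eq_empty_or_nonempty with h | h
  · exact Or.inl h
  refine Or.inr ⟨sInf U, ?_⟩
  have h1 : Ioi (sInf U) ⊆ U := fun x hx => by
    obtain ⟨y, hy, hyx⟩ := exists_lt_of_csInf_lt h hx
    exact hU hyx.le hy
  have h2 : U ⊆ Ici (sInf U) := fun x hx => csInf_le (OrderBot.bddBelow U) hx
  by_cases ha : sInf U ∈ U
  · left
    exact h2.antisymm fun x hx => hU hx ha
  · right
    refine Subset.antisymm (fun x hx => mem_Ioi.2 (lt_of_le_of_ne (h2 hx) fun h => ha ?_)) h1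
    rwa [h]

/-- A function of a bounded monotone integer is a combination of indicators of upper sets. -/
theorem exists_indicator_sum (Γ : ℕ → ℝ) {k : ℝ≥0 → ℕ} (hk : Monotone k) {M : ℕ}
    (hM : ∀ x, k x ≤ M) :
    ∃ (n : ℕ) (c : ℕ → ℝ) (U : ℕ → Set ℝ≥0), (∀ j, IsUpperSet (U j)) ∧
      ∀ x, Γ (k x) = ∑ j ∈ Finset.range n, c j * (U j).indicator 1 x := by
  refine ⟨M + 1, fun j => if j = 0 then Γ 0 else Γ j - Γ (j - 1), fun j => {x | j ≤ k x},
    fun j x y hxy hx => le_trans hx (hk hxy), fun x => ?_⟩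
  have h1 : ∀ r, Γ r = ∑ j ∈ Finset.range (r + 1), (if j = 0 then Γ 0 else Γ j - Γ (j - 1)) := by
    intro r
    induction r with
    | zero => simp
    | succ r ih => rw [Finset.sum_range_succ, ← ih]; simp
  rw [h1 (k x), ← Finset.sum_subset (Finset.range_subset_range.2 (Nat.succ_le_succ (hM x)))]
  · refine Finset.sum_congr rfl fun j hj => ?_
    have hj : j ≤ k x := by have := Finset.mem_range.1 hj; omega
    have : x ∈ {x | j ≤ k x} := hj
    simp [Set.indicator_of_mem this]
  · intro j _ hj
    have hj : ¬ j ≤ k x := by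
      intro h; exact hj (Finset.mem_range.2 (by omega))
    have : x ∉ {x | j ≤ k x} := hj
    simp [Set.indicator_of_notMem this]

/-- The level sets of `varUpTo p g` of width `ε ^ p` are finitely many, and `g` oscillates by at
most `ε` on each. Evaluating `g` at representatives gives `g ∘ φ` with `φ` monotone, so that the
variation does not grow. -/
theorem exists_step_approx {p : ℝ} {g : ℝ≥0 → ℝ} (hp : 1 ≤ p) (hg : pVar p g ≠ ∞) {ε : ℝ}
    (hε : 0 < ε) : ∃ φ : ℝ≥0 → ℝ≥0, Monotone φ ∧ (∀ x, |g x - g (φ x)| ≤ ε) ∧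
      ∃ (n : ℕ) (c : ℕ → ℝ) (U : ℕ → Set ℝ≥0), (∀ j, IsUpperSet (U j)) ∧
        ∀ x, g (φ x) = ∑ j ∈ Finset.range n, c j * (U j).indicator 1 x := by
  have hp0 : 0 < p := by linarith
  have hc : 0 < 1 / ε ^ p := by positivity
  have hV := varUpTo_mono hg
  refine ⟨_, binRep_bin_mono hV hc.le, fun x => ?_, exists_indicator_sum
    (fun j => g (binRep (varUpTo p g) (1 / ε ^ p) j)) (bin_mono hV hc.le)
    (M := ⌊1 / ε ^ p * (pVar p g).toReal⌋₊) fun x => ?_⟩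
  · have h1 := abs_sub_rpow_le hp hg (binRep (varUpTo p g) (1 / ε ^ p)
      (bin (varUpTo p g) (1 / ε ^ p) x)) x
    have h2 := abs_sub_le_of_bin_eq (varUpTo_nonneg p g) hc (bin_binRep_bin (V := varUpTo p g) x).symm
    rw [one_div_one_div] at h2
    exact (Real.rpow_le_rpow_iff (abs_nonneg _) hε.le hp0).1 (h1.trans h2)
  · exact Nat.floor_le_floor (mul_le_mul_of_nonneg_left (varUpTo_le hg x) hc.le)

end Bins

/-! ### Existence of the Young integral -/

section Existence

variable {p q : ℝ} {f g : ℝ≥0 → ℝ} {s : ℝ≥0}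

theorem exists_hasYoungIntegral_indicator {U : Set ℝ≥0} (hU : IsUpperSet U) (f : ℝ≥0 → ℝ)
    (s : ℝ≥0) : ∃ I, HasYoungIntegral (U.indicator 1) f s I := by
  rcases isUpperSet_nnreal hU with rfl | ⟨a, rfl | rfl⟩
  · exact ⟨0, by rw [Set.indicator_empty]; exact hasYoungIntegral_zero_left⟩
  · exact ⟨_, hasYoungIntegral_indicator_Ici a⟩
  · exact ⟨_, hasYoungIntegral_indicator_Ioi a⟩

theorem hasYoungIntegral_of_approx {J : ℝ} (h : ∀ η > 0, ∃ (g' : ℝ≥0 → ℝ) (I' : ℝ),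
    HasYoungIntegral g' f s I' ∧ (∀ (m : ℕ) (u v : ℕ → ℝ≥0), IsPart s m u v →
      |youngSum g f m u v - youngSum g' f m u v| ≤ η) ∧ |I' - J| ≤ η) :
    HasYoungIntegral g f s J := by
  rw [hasYoungIntegral_iff]
  intro ε hε
  obtain ⟨g', I', hI, h1, h2⟩ := h (ε / 3) (by positivity)
  obtain ⟨T, hT, hT2⟩ := hasYoungIntegral_iff.1 hI (ε / 3) (by positivity)
  refine ⟨T, hT, fun m u v hp hc => ?_⟩
  have h3 := hT2 m u v hp hc
  have h1 := h1 m u v hp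
  rw [abs_lt] at h3 ⊢
  rw [abs_le] at h1 h2
  constructor <;> linarith [h1.1, h1.2, h2.1, h2.2, h3.1, h3.2]

/-- The integrals of the approximants form a Cauchy sequence, because their Young sums are close
uniformly over all partitions; its limit is the integral. -/
theorem exists_hasYoungIntegral_of_approx (h : ∀ η > 0, ∃ (g' : ℝ≥0 → ℝ) (I' : ℝ),
    HasYoungIntegral g' f s I' ∧ ∀ (m : ℕ) (u v : ℕ → ℝ≥0), IsPart s m u v →
      |youngSum g f m u v - youngSum g' f m u v| ≤ η) : ∃ J, HasYoungIntegral g f s J := by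
  choose! G I hI hG using h
  let η : ℕ → ℝ := fun n => 1 / ((n : ℝ) + 1)
  have hη : ∀ n, 0 < η n := fun n => by positivity
  have hη0 : Tendsto η atTop (𝓝 0) := tendsto_one_div_add_atTop_nhds_zero_nat
  have hclose : ∀ n k, |I (η n) - I (η k)| ≤ η n + η k := fun n k =>
    abs_sub_le_of_hasYoungIntegral (hI _ (hη n)) (hI _ (hη k)) fun m u v hp => by
      have h1 := hG _ (hη n) m u v hp
      have h2 := hG _ (hη k) m u v hp
      rw [abs_le] at h1 h2 ⊢
      constructor <;> linarith [h1.1, h1.2, h2.1, h2.2]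
  have hcau : CauchySeq fun n => I (η n) := by
    rw [Metric.cauchySeq_iff']
    intro ε hε
    obtain ⟨n0, hn0⟩ := eventually_atTop.1 (hη0.eventually (gt_mem_nhds (half_pos hε)))
    refine ⟨n0, fun n hn => ?_⟩
    rw [Real.dist_eq]
    linarith [hclose n n0, hn0 n hn, hn0 n0 le_rfl]
  obtain ⟨J, hJ⟩ := cauchySeq_tendsto_of_complete hcau
  have hJ2 : ∀ n, |I (η n) - J| ≤ η n := fun n => by
    have h1 : Tendsto (fun k => |I (η n) - I (η k)|) atTop (𝓝 |I (η n) - J|) :=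
      (tendsto_const_nhds.sub hJ).abs
    have h2 : Tendsto (fun k => η n + η k) atTop (𝓝 (η n + 0)) := hη0.const_add _
    have := le_of_tendsto_of_tendsto' h1 h2 (hclose n)
    linarith
  refine ⟨J, hasYoungIntegral_of_approx fun ε hε => ?_⟩
  obtain ⟨n, hn⟩ := (hη0.eventually (gt_mem_nhds hε)).exists
  exact ⟨_, _, hI _ (hη n), fun m u v hp => (hG _ (hη n) m u v hp).trans hn.le,
    (hJ2 n).trans hn.le⟩

theorem pVar_sub_comp_le (hp : 1 ≤ p) (g : ℝ≥0 → ℝ) {φ : ℝ≥0 → ℝ≥0} (hφ : Monotone φ) :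
    pVar p (fun x => g x - g (φ x)) ≤ 2 ^ p * pVar p g := by
  have hp0 : 0 < p := by linarith
  have h1 := pVar_add_le hp g (fun x => -g (φ x))
  have h2 : pVar p (fun x => -g (φ x)) ≤ pVar p g := by
    rw [pVar_neg]; exact pVar_comp_le hφ g
  have h3 : pVar p (g + fun x => -g (φ x)) ^ (1 / p) ≤ 2 * pVar p g ^ (1 / p) := by
    rw [two_mul]
    exact h1.trans (by gcongr)
  rw [one_div, ENNReal.rpow_inv_le_iff hp0, ENNReal.mul_rpow_of_nonneg _ _ hp0.le,
    ENNReal.rpow_inv_rpow hp0.ne'] at h3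
  exact h3

/-- The difference `g - g ∘ φ` is uniformly small while its `p`-variation stays bounded. By
interpolation its `q`-variation is small for `q > p`, and the Love–Young inequality with exponent
`q` applies. -/
theorem exists_youngSum_approx (hp : 1 ≤ p) (hp2 : p < 2) (hg : pVar p g ≠ ∞)
    (hf : pVar p f ≠ ∞) {η : ℝ} (hη : 0 < η) : ∃ ε₀ > 0, ∀ ε, 0 < ε → ε ≤ ε₀ →
      ∀ φ : ℝ≥0 → ℝ≥0, Monotone φ → (∀ x, |g x - g (φ x)| ≤ ε) →
      ∀ (m : ℕ) (u v : ℕ → ℝ≥0), IsPart s m u v →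
        |youngSum g f m u v - youngSum (fun x => g (φ x)) f m u v| ≤ η := by
  have hp0 : 0 < p := by linarith
  -- The midpoint of `p` and `2`: larger than `p` for the interpolation, smaller than `2` for the
  -- Love–Young inequality.
  set q := (p + 2) / 2 with hq
  have hpq : p < q := by rw [hq]; linarith
  have hq2 : q < 2 := by rw [hq]; linarith
  have hq1 : 1 ≤ q := by linarith
  have hq0 : 0 < q := by linarith
  set W : ℝ := (2 ^ p * pVar p g).toReal with hW
  set B : ℝ := (pVar q f).toReal with hB
  have hWtop : 2 ^ p * pVar p g ≠ ∞ :=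
    ENNReal.mul_ne_top (ENNReal.rpow_ne_top_of_nonneg hp0.le (by simp)) hg
  have hlim : Tendsto (fun ε : ℝ => (ε + loveYoungConst q * ((2 * ε) ^ (q - p) * W) ^ (1 / q))
      * B ^ (1 / q)) (𝓝 0) (𝓝 0) := by
    have h1 : Tendsto (fun ε : ℝ => (2 * ε) ^ (q - p)) (𝓝 0) (𝓝 0) := by
      have := ((continuous_const.mul continuous_id).tendsto (0 : ℝ) :
        Tendsto (fun ε : ℝ => 2 * ε) (𝓝 0) _).rpow_const (p := q - p) (Or.inr (by linarith))
      simpa [Real.zero_rpow (show q - p ≠ 0 by linarith)] using this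
    have h2 : Tendsto (fun ε : ℝ => ((2 * ε) ^ (q - p) * W) ^ (1 / q)) (𝓝 0) (𝓝 0) := by
      have := (h1.mul_const W).rpow_const (p := 1 / q) (Or.inr (by positivity))
      simpa [Real.zero_rpow (show q⁻¹ ≠ 0 by positivity)] using this
    have h3 : Tendsto (fun ε : ℝ => ε) (𝓝 0) (𝓝 0) := tendsto_id
    simpa using (h3.add (h2.const_mul (loveYoungConst q))).mul_const (B ^ (1 / q))
  obtain ⟨ε₀, hε₀, hball⟩ := Metric.eventually_nhds_iff.1 (hlim.eventually (gt_mem_nhds hη))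
  refine ⟨ε₀ / 2, by positivity, fun ε hε hle φ hφ hclose m u v hpart => ?_⟩
  have h1 := hball (y := ε) (by rw [Real.dist_eq, sub_zero, abs_of_pos hε]; linarith)
  rw [← youngSum_sub_left]
  refine le_trans ?_ h1.le
  refine youngSum_bound hq1 hq2 (tendsto_leftLim_of_pVar hp hf)
    (mul_nonneg (by positivity) ENNReal.toReal_nonneg) ENNReal.toReal_nonneg
    hclose ?_ hpart.tag ?_
  · refine (pVar_le_mul_of_le hp0 hpq.le (D := ENNReal.ofReal (2 * ε)) fun x y => ?_).trans ?_
    · rw [Real.enorm_eq_ofReal_abs]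
      refine ENNReal.ofReal_le_ofReal ((abs_sub _ _).trans ?_)
      linarith [hclose x, hclose y]
    · rw [ENNReal.ofReal_mul (p := (2 * ε) ^ (q - p)) (by positivity),
        ENNReal.ofReal_rpow_of_nonneg (by positivity) (by linarith), ENNReal.ofReal_toReal hWtop]
      gcongr
      exact pVar_sub_comp_le hp g hφ
  · rw [ENNReal.ofReal_toReal (pVar_ne_top_of_le hp hpq.le hf)]
    exact pVarOn_le_pVar _ f

theorem exists_hasYoungIntegral (hp : 1 ≤ p) (hp2 : p < 2) (hg : pVar p g ≠ ∞)
    (hf : pVar p f ≠ ∞) (s : ℝ≥0) : ∃ I, HasYoungIntegral g f s I := by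
  refine exists_hasYoungIntegral_of_approx fun η hη => ?_
  obtain ⟨ε, hε, h⟩ := exists_youngSum_approx (s := s) hp hp2 hg hf hη
  obtain ⟨φ, hφ, hclose, n, c, U, hU, hsum⟩ := exists_step_approx hp hg hε
  choose I hI using fun j => exists_hasYoungIntegral_indicator (hU j) f s
  refine ⟨fun x => g (φ x), ∑ j ∈ Finset.range n, c j * I j, ?_, h ε hε le_rfl φ hφ hclose⟩
  simp only [hsum]
  exact HasYoungIntegral.sum_left _ fun j _ => (hI j).const_mul_left (c j)

theorem hasYoungIntegral_youngInt (hp : 1 ≤ p) (hp2 : p < 2) (hg : pVar p g ≠ ∞)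
    (hf : pVar p f ≠ ∞) (s : ℝ≥0) : HasYoungIntegral g f s (youngInt g f s) := by
  obtain ⟨I, hI⟩ := exists_hasYoungIntegral hp hp2 hg hf s
  rwa [hI.youngInt_eq]

/-! ### The integral as a function of its upper limit -/

/-- A partition of `[0, b]` through `a` splits into one of `[0, a]` and one of `[a, b]`. The
difference of the integrals is thus approximated by a Young sum over `[a, b]`. -/
theorem abs_sub_le_of_hasYoungIntegral_of_le (hq : 1 ≤ q) (hq2 : q < 2)
    (hl : ∀ a, Tendsto f (𝓝[<] a) (𝓝 (Function.leftLim f a)))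
    {S A B : ℝ} (hA : 0 ≤ A) (hB : 0 ≤ B) (hS : ∀ x, |g x| ≤ S) (hg : pVar q g ≤ ENNReal.ofReal A)
    {a b : ℝ≥0} (hab : a ≤ b) (hf : pVarOn q f (Icc a b) ≤ ENNReal.ofReal B) {I J : ℝ}
    (hI : HasYoungIntegral g f a I) (hJ : HasYoungIntegral g f b J) :
    |J - I| ≤ (S + loveYoungConst q * A ^ (1 / q)) * B ^ (1 / q) := by
  classical
  refine le_of_forall_pos_le_add fun ε hε => ?_
  obtain ⟨T, hT, hT2⟩ := hasYoungIntegral_iff.1 hI (ε / 2) (by positivity)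
  obtain ⟨T', hT', hT2'⟩ := hasYoungIntegral_iff.1 hJ (ε / 2) (by positivity)
  obtain ⟨m, u, v, hp, hc⟩ := exists_isPart b (insert a (T ∪ T')) (by
    intro x hx
    rcases Finset.mem_insert.1 hx with rfl | hx
    · exact hab
    rcases Finset.mem_union.1 hx with hx | hx
    exacts [(hT x hx).trans hab, hT' x hx])
  obtain ⟨k, hk, hka⟩ := hc a (Finset.mem_insert_self _ _)
  have h1 := hT2' m u v hp fun x hx =>
    hc x (Finset.mem_insert_of_mem (Finset.mem_union_right _ hx))
  have h2 := hT2 k u v ⟨hp.zero, hka, fun i hi => hp.tag i (by omega)⟩ fun x hx => by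
    obtain ⟨i, him, hi⟩ := hc x (Finset.mem_insert_of_mem (Finset.mem_union_left _ hx))
    by_cases hik : i ≤ k
    · exact ⟨i, hik, hi⟩
    -- A point of `T` lies in `[0, a]`; if it occurs after index `k` it is at least `a = u k`, hence
    -- equal to it.
    · refine ⟨k, le_rfl, le_antisymm ?_ ?_⟩
      · rw [← hi]; exact le_of_tags hp.tag (by omega) him
      · rw [hka]; exact hT x hx
  obtain ⟨l, rfl⟩ := Nat.exists_eq_add_of_le hk
  have hsplit : youngSum g f (k + l) u v
      = youngSum g f k u v + youngSum g f l (fun i => u (k + i)) (fun i => v (k + i)) := by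
    simp only [youngSum, Finset.sum_range_add, add_assoc]
  have h3 := youngSum_bound (g := g) (f := f) hq hq2 hl hA hB hS hg (m := l)
    (u := fun i => u (k + i)) (v := fun i => v (k + i)) (fun i hi => hp.tag (k + i) (by omega))
    (by simp only [add_zero, hka, hp.last]; exact hf)
  rw [abs_lt] at h1 h2
  rw [abs_le] at h3 ⊢
  constructor <;> linarith [h1.1, h1.2, h2.1, h2.2, h3.1, h3.2]

/-- Right continuity makes the oscillation on `[s, s']` small, and interpolation converts this into
small `q`-variation for `q > p`. -/
theorem pVarOn_Icc_le_of_right_cont {p q : ℝ} (hp : 1 ≤ p) (hpq : p < q) (hf : pVar p f ≠ ∞)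
    (hr : ContinuousWithinAt f (Ici s) s) {η : ℝ≥0∞} (hη : 0 < η) :
    ∃ δ > 0, ∀ s' ≥ s, s' < s + δ → pVarOn q f (Icc s s') ≤ η := by
  have hp0 : 0 < p := by linarith
  have hlim : Tendsto (fun ε : ℝ => ENNReal.ofReal (2 * ε) ^ (q - p) * pVar p f) (𝓝 0) (𝓝 0) := by
    have h1 : Tendsto (fun ε : ℝ => ENNReal.ofReal (2 * ε)) (𝓝 0) (𝓝 0) := by
      have := ENNReal.tendsto_ofReal (((continuous_const.mul continuous_id).tendsto (0 : ℝ) :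
        Tendsto (fun ε : ℝ => 2 * ε) (𝓝 0) _))
      simpa using this
    have h2 := ENNReal.Tendsto.mul_const (b := pVar p f) (h1.ennrpow_const (q - p)) (Or.inr hf)
    simpa [ENNReal.zero_rpow_of_pos (show 0 < q - p by linarith)] using h2
  obtain ⟨ε₀, hε₀, hball⟩ := Metric.eventually_nhds_iff.1 (hlim.eventually (gt_mem_nhds hη))
  have h1 := hball (y := ε₀ / 2) (by
    rw [Real.dist_eq, sub_zero, abs_of_pos (by positivity)]; linarith)
  obtain ⟨δ, hδ, hδ2⟩ := Metric.continuousWithinAt_iff.1 hr (ε₀ / 2) (by positivity)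
  refine ⟨⟨δ, hδ.le⟩, hδ, fun s' hs' hlt => ?_⟩
  have hx : ∀ x : Icc s s', |f x - f s| ≤ ε₀ / 2 := fun x => by
    refine (hδ2 (x := x) x.2.1 ?_).le
    have h3 : (x : ℝ≥0) < s + ⟨δ, hδ.le⟩ := x.2.2.trans_lt hlt
    have h3 : ((x : ℝ≥0) : ℝ) < s + δ := by exact_mod_cast h3
    have h4 : (s : ℝ) ≤ (x : ℝ≥0) := x.2.1
    rw [NNReal.dist_eq, abs_of_nonneg (by linarith)]
    linarith
  refine le_trans ?_ h1.le
  refine (pVar_le_mul_of_le hp0 hpq.le (D := ENNReal.ofReal (2 * (ε₀ / 2))) fun x y => ?_).trans ?_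
  · rw [Real.enorm_eq_ofReal_abs]
    refine ENNReal.ofReal_le_ofReal ?_
    have hx1 := abs_le.1 (hx x)
    have hy1 := abs_le.1 (hx y)
    rw [abs_le]
    constructor <;> linarith [hx1.1, hx1.2, hy1.1, hy1.2]
  · gcongr
    exact pVarOn_le_pVar _ f

/-- The increments of the integral are controlled by the variation of `f` over the same interval.
Since that variation is superadditive, a multiple of `x ↦ pVarOn p f (Iic x)` is a control function.
-/
theorem pVar_youngInt_le (hp : 1 ≤ p) (hp2 : p < 2) (hg : pVar p g ≠ ∞) (hf : pVar p f ≠ ∞)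
    {S : ℝ} (hS : ∀ x, |g x| ≤ S) (t : ℝ≥0) :
    pVar p (fun s : Icc 0 t => youngInt g f s)
      ≤ ENNReal.ofReal (S + loveYoungConst p * (pVar p g).toReal ^ (1 / p)) ^ p * pVar p f := by
  have hp0 : 0 < p := by linarith
  have hS0 : 0 ≤ S := (abs_nonneg _).trans (hS 0)
  have hc : 0 ≤ S + loveYoungConst p * (pVar p g).toReal ^ (1 / p) := by
    have := loveYoungConst_nonneg p
    positivity
  refine pVar_le_of_control (Ψ := fun x : Icc 0 t =>
    ENNReal.ofReal (S + loveYoungConst p * (pVar p g).toReal ^ (1 / p)) ^ p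
      * pVarOn p f (Iic (x : ℝ≥0))) (fun x y hxy => ?_) fun x => by gcongr; exact pVarOn_le_pVar _ f
  refine le_trans (add_le_add ?_ le_rfl) (by
    rw [← mul_add]; gcongr; exact pVarOn_Icc_add_pVarOn_Iic_le f hxy)
  have hfin : pVarOn p f (Icc (x : ℝ≥0) y) ≠ ∞ := pVarOn_ne_top hf _
  have h := abs_sub_le_of_hasYoungIntegral_of_le hp hp2 (tendsto_leftLim_of_pVar hp hf)
    (ENNReal.toReal_nonneg (a := pVar p g)) (ENNReal.toReal_nonneg (a := pVarOn p f (Icc (x : ℝ≥0) y)))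
    hS (ENNReal.ofReal_toReal hg).ge hxy (ENNReal.ofReal_toReal hfin).ge
    (hasYoungIntegral_youngInt hp hp2 hg hf x) (hasYoungIntegral_youngInt hp hp2 hg hf y)
  rw [Real.enorm_eq_ofReal_abs]
  calc _ ≤ ENNReal.ofReal ((S + loveYoungConst p * (pVar p g).toReal ^ (1 / p))
            * (pVarOn p f (Icc (x : ℝ≥0) y)).toReal ^ (1 / p)) ^ p := by gcongr
    _ = _ := by
        rw [ENNReal.ofReal_mul hc, ENNReal.mul_rpow_of_nonneg _ _ hp0.le,
          ← ENNReal.ofReal_rpow_of_nonneg ENNReal.toReal_nonneg (by positivity),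
          ENNReal.ofReal_toReal hfin, one_div, ENNReal.rpow_inv_rpow hp0.ne']

theorem right_cont_youngInt (hp : 1 ≤ p) (hp2 : p < 2) (hg : pVar p g ≠ ∞) (hf : pVar p f ≠ ∞)
    {S : ℝ} (hS : ∀ x, |g x| ≤ S) (hr : ∀ s, ContinuousWithinAt f (Ici s) s) (s : ℝ≥0) :
    ContinuousWithinAt (youngInt g f) (Ici s) s := by
  have hp0 : 0 < p := by linarith
  set q := (p + 2) / 2 with hq
  have hpq : p < q := by rw [hq]; linarith
  have hq2 : q < 2 := by rw [hq]; linarith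
  have hq1 : 1 ≤ q := by linarith
  have hq0 : 0 < q := by linarith
  have hgq := pVar_ne_top_of_le hp hpq.le hg
  have hS0 : 0 ≤ S := (abs_nonneg _).trans (hS 0)
  set c := S + loveYoungConst q * (pVar q g).toReal ^ (1 / q) with hc
  have hc0 : 0 ≤ c := by
    have := loveYoungConst_nonneg q
    positivity
  rw [Metric.continuousWithinAt_iff]
  intro ε hε
  have hη : 0 < (ε / (c + 1)) ^ q := by positivity
  obtain ⟨δ, hδ, h⟩ := pVarOn_Icc_le_of_right_cont hp hpq hf (hr s) (ENNReal.ofReal_pos.2 hη)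
  refine ⟨δ, hδ, fun {x} hx hdist => ?_⟩
  have hxs : x < s + δ := by
    rw [NNReal.dist_eq] at hdist
    have := (abs_lt.1 hdist).2
    rw [← NNReal.coe_lt_coe]
    push_cast
    linarith
  have h2 := abs_sub_le_of_hasYoungIntegral_of_le hq1 hq2 (tendsto_leftLim_of_pVar hp hf)
    (ENNReal.toReal_nonneg (a := pVar q g)) hη.le
    hS (ENNReal.ofReal_toReal hgq).ge hx (h x hx hxs)
    (hasYoungIntegral_youngInt hp hp2 hg hf s) (hasYoungIntegral_youngInt hp hp2 hg hf x)
  rw [one_div, Real.rpow_rpow_inv (by positivity) hq0.ne'] at h2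
  rw [Real.dist_eq]
  refine h2.trans_lt ?_
  rw [one_div] at hc
  rw [← hc, mul_div_assoc', div_lt_iff₀ (by positivity)]
  nlinarith

theorem memWr_youngInt (hp : 1 ≤ p) (hp2 : p < 2) (hg : pVar p g ≠ ∞) (hf : MemWr p f)
    {S : ℝ} (hS : ∀ x, |g x| ≤ S) (t : ℝ≥0) : MemWr p fun s : Icc 0 t => youngInt g f s := by
  refine ⟨ne_top_of_le_ne_top (ENNReal.mul_ne_top (ENNReal.rpow_ne_top_of_nonneg (by linarith)
    ENNReal.ofReal_ne_top) hf.1) (pVar_youngInt_le hp hp2 hg hf.1 hS t), fun s => ?_⟩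
  exact ContinuousWithinAt.comp (t := Ici (s : ℝ≥0))
    (right_cont_youngInt hp hp2 hg hf.1 hS hf.2 s)
    continuous_subtype_val.continuousWithinAt fun x hx => hx

theorem youngInt_zero (g f : ℝ≥0 → ℝ) : youngInt g f 0 = 0 := by
  refine HasYoungIntegral.youngInt_eq (hasYoungIntegral_iff.2 fun ε hε => ⟨∅, by simp, ?_⟩)
  intro m u v hp _
  rcases Nat.eq_zero_or_pos m with rfl | hm
  · simpa [youngSum] using hε
  -- Partition points increase strictly, so no partition of `[0, 0]` has a cell.
  · exfalso
    have h1 := (hp.tag 0 hm)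
    have h2 := le_of_tags hp.tag (show 0 + 1 ≤ m by omega) le_rfl
    rw [hp.last] at h2
    exact not_lt.2 h2 (zero_le.trans_lt (h1.1.trans h1.2))

end Existence

end CensRec
end

noncomputable section

namespace CensRec

/-! ### The Banach algebra of functions of bounded `p`-variation -/

section BvAlgebra

variable {α : Type*} [LinearOrder α]

theorem enorm_le_supENorm {β : Type*} (f : β → ℝ) (x : β) : ‖f x‖ₑ ≤ supENorm f :=
  le_iSup (fun s => ‖f s‖ₑ) x

/-- The product rule for increments, followed by Minkowski's inequality in `ℓ^p`. -/
theorem pVar_mul_le {p : ℝ} (hp : 1 ≤ p) (f g : α → ℝ) :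
    pVar p (f * g) ^ (1 / p)
      ≤ supENorm f * pVar p g ^ (1 / p) + supENorm g * pVar p f ^ (1 / p) := by
  have hp0 : 0 < p := by linarith
  have hp1 : 0 < 1 / p := by positivity
  have hsup : ∀ (a b : α → ℝ) (q : ℕ × {u : ℕ → α // Monotone u}),
      (∑ i ∈ Finset.range q.1, (supENorm a * ‖b (q.2.1 (i + 1)) - b (q.2.1 i)‖ₑ) ^ p) ^ (1 / p)
        ≤ supENorm a * pVar p b ^ (1 / p) := by
    intro a b q
    simp only [ENNReal.mul_rpow_of_nonneg _ _ hp0.le]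
    rw [← Finset.mul_sum, ENNReal.mul_rpow_of_nonneg _ _ hp1.le, one_div,
      ENNReal.rpow_rpow_inv hp0.ne']
    gcongr
    exact sum_le_pVar p b q.1 q.2.2
  rw [← ENNReal.le_rpow_inv_iff (by positivity), one_div, inv_inv]
  refine iSup_le fun q => ?_
  rw [← one_div, ← ENNReal.rpow_inv_le_iff hp0, ← one_div]
  calc (∑ i ∈ Finset.range q.1, ‖(f * g) (q.2.1 (i + 1)) - (f * g) (q.2.1 i)‖ₑ ^ p) ^ (1 / p)
      ≤ (∑ i ∈ Finset.range q.1, (supENorm f * ‖g (q.2.1 (i + 1)) - g (q.2.1 i)‖ₑ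
          + supENorm g * ‖f (q.2.1 (i + 1)) - f (q.2.1 i)‖ₑ) ^ p) ^ (1 / p) := by
        gcongr with i _
        have : (f * g) (q.2.1 (i + 1)) - (f * g) (q.2.1 i)
          = f (q.2.1 (i + 1)) * (g (q.2.1 (i + 1)) - g (q.2.1 i))
            + g (q.2.1 i) * (f (q.2.1 (i + 1)) - f (q.2.1 i)) := by
          simp only [Pi.mul_apply]; ring
        rw [this]
        refine (enorm_add_le _ _).trans ?_
        rw [enorm_mul, enorm_mul]
        gcongr <;> exact enorm_le_supENorm _ _
    _ ≤ _ := ENNReal.Lp_add_le _ _ _ hp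
    _ ≤ _ := add_le_add (hsup f g q) (hsup g f q)

theorem pVarENorm_mul_le {p : ℝ} (hp : 1 ≤ p) (f g : α → ℝ) :
    pVarENorm p (f * g) ≤ pVarENorm p f * pVarENorm p g := by
  have h1 : supENorm (f * g) ≤ supENorm f * supENorm g := iSup_le fun s => by
    rw [Pi.mul_apply, enorm_mul]
    gcongr <;> exact enorm_le_supENorm _ _
  calc _ ≤ (supENorm f * pVar p g ^ (1 / p) + supENorm g * pVar p f ^ (1 / p))
        + supENorm f * supENorm g := add_le_add (pVar_mul_le hp f g) h1
    -- Adding the one missing cross term completes the product of the two norms.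
    _ ≤ pVar p f ^ (1 / p) * pVar p g ^ (1 / p)
        + ((supENorm f * pVar p g ^ (1 / p) + supENorm g * pVar p f ^ (1 / p))
        + supENorm f * supENorm g) := le_add_self
    _ = _ := by unfold pVarENorm; ring

theorem pVar_le_of_lipschitz {p : ℝ} (hp : 0 ≤ p) {f g : α → ℝ} {L : ℝ≥0∞}
    (h : ∀ x y, ‖f y - f x‖ₑ ≤ L * ‖g y - g x‖ₑ) : pVar p f ≤ L ^ p * pVar p g := by
  refine pVar_le fun m u hu => ?_
  calc _ ≤ ∑ i ∈ Finset.range m, L ^ p * ‖g (u (i + 1)) - g (u i)‖ₑ ^ p := by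
        gcongr with i
        rw [← ENNReal.mul_rpow_of_nonneg _ _ hp]
        gcongr
        exact h _ _
    _ ≤ _ := by
        rw [← Finset.mul_sum]
        gcongr
        exact sum_le_pVar p g m hu

theorem abs_apply_le_of_pVarENorm {p : ℝ} {f : α → ℝ} (hf : pVarENorm p f ≠ ∞) (x : α) :
    |f x| ≤ (pVarENorm p f).toReal := by
  rw [← Real.norm_eq_abs, ← toReal_enorm]
  exact ENNReal.toReal_mono hf ((enorm_le_supENorm f x).trans le_add_self)

theorem toReal_pVarENorm_le {p : ℝ} {f : α → ℝ} {a b : ℝ} (ha : 0 ≤ a)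
    (hb : 0 ≤ b) (h1 : pVar p f ^ (1 / p) ≤ ENNReal.ofReal a) (h2 : ∀ x, |f x| ≤ b) :
    (pVarENorm p f).toReal ≤ a + b := by
  refine ENNReal.toReal_le_of_le_ofReal (by positivity) ?_
  rw [ENNReal.ofReal_add ha hb]
  refine add_le_add h1 (iSup_le fun x => ?_)
  rw [Real.enorm_eq_ofReal_abs]
  exact ENNReal.ofReal_le_ofReal (h2 x)

variable (α) (p : ℝ) [hp : Fact (1 ≤ p)]

/-- The functions of bounded `p`-variation as a subalgebra. -/
def bvSubalgebra : Subalgebra ℝ (α → ℝ) where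
  carrier := {f | pVar p f ≠ ∞}
  add_mem' := fun hf hg => pVar_add_ne_top hp.out hf hg
  mul_mem' := by
    intro f g hf hg
    have h := ne_top_of_le_ne_top (ENNReal.mul_ne_top (pVarENorm_ne_top hp.out hf)
      (pVarENorm_ne_top hp.out hg)) (pVarENorm_mul_le hp.out f g)
    have hp0 : 0 < p := by linarith [hp.out]
    intro h2
    have h2 : pVar p (f * g) = ∞ := h2
    rw [pVarENorm, h2, ENNReal.top_rpow_of_pos (by positivity)] at h
    simp at h
  algebraMap_mem' := fun r => by
    have hp0 : 0 < p := by linarith [hp.out]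
    have : pVar p (fun _ : α => r) ≠ ∞ := by rw [pVar_const hp0]; simp
    exact this

/-- The algebra of functions of bounded `p`-variation. -/
def Bv : Type _ := ↥(bvSubalgebra α p)

instance : CommRing (Bv α p) := inferInstanceAs (CommRing ↥(bvSubalgebra α p))

instance : Algebra ℝ (Bv α p) := inferInstanceAs (Algebra ℝ ↥(bvSubalgebra α p))

variable {α} {p}

instance : CoeFun (Bv α p) (fun _ => α → ℝ) := ⟨fun f => f.1⟩

instance : Norm (Bv α p) := ⟨fun f => (pVarENorm p f).toReal⟩

theorem bv_norm_def (f : Bv α p) : ‖f‖ = (pVarENorm p f).toReal := rfl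

theorem bv_core : NormedSpace.Core ℝ (Bv α p) where
  norm_nonneg f := ENNReal.toReal_nonneg
  norm_smul c f := by
    have h : ((c • f : Bv α p) : α → ℝ) = c • (f : α → ℝ) := rfl
    rw [bv_norm_def, bv_norm_def, h, pVarENorm_smul hp.out, ENNReal.toReal_mul]
    simp
  norm_triangle f g := by
    have h : ((f + g : Bv α p) : α → ℝ) = (f : α → ℝ) + (g : α → ℝ) := rfl
    have hf := pVarENorm_ne_top hp.out f.2
    have hg := pVarENorm_ne_top hp.out g.2
    rw [bv_norm_def, bv_norm_def, bv_norm_def, h, ← ENNReal.toReal_add hf hg]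
    exact ENNReal.toReal_mono (ENNReal.add_ne_top.2 ⟨hf, hg⟩) (pVarENorm_add_le hp.out _ _)
  norm_eq_zero_iff f := by
    have hp0 : 0 < p := by linarith [hp.out]
    constructor
    · intro h
      rw [bv_norm_def, ENNReal.toReal_eq_zero_iff, or_iff_left (pVarENorm_ne_top hp.out f.2),
        pVarENorm, add_eq_zero, supENorm] at h
      refine Subtype.ext (funext fun s => ?_)
      have h2 := h.2
      simp only [ENNReal.iSup_eq_zero, enorm_eq_zero] at h2
      exact h2 s
    · rintro rfl
      have h : ((0 : Bv α p) : α → ℝ) = (0 : ℝ) • (0 : α → ℝ) := by rw [zero_smul]; rfl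
      rw [bv_norm_def, h, pVarENorm_smul hp.out]
      simp

instance : NormedAddCommGroup (Bv α p) := NormedAddCommGroup.ofCore bv_core

instance : NormedCommRing (Bv α p) :=
  { (inferInstance : CommRing (Bv α p)), (inferInstance : NormedAddCommGroup (Bv α p)) with
    norm_mul_le := fun f g => by
      have h : ((f * g : Bv α p) : α → ℝ) = (f : α → ℝ) * (g : α → ℝ) := rfl
      have hf := pVarENorm_ne_top hp.out f.2
      have hg := pVarENorm_ne_top hp.out g.2
      rw [bv_norm_def, bv_norm_def, bv_norm_def, h, ← ENNReal.toReal_mul]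
      exact ENNReal.toReal_mono (ENNReal.mul_ne_top hf hg) (pVarENorm_mul_le hp.out _ _) }

instance : NormedAlgebra ℝ (Bv α p) where
  norm_smul_le c f := (bv_core.norm_smul c f).le

theorem bv_abs_le (f : Bv α p) (x : α) : |f x| ≤ ‖f‖ :=
  abs_apply_le_of_pVarENorm (pVarENorm_ne_top hp.out f.2) x

theorem pVar_le_of_pVarENorm_le {f : α → ℝ} {c : ℝ≥0∞} (h : pVarENorm p f ≤ c) :
    pVar p f ≤ c ^ p := by
  have hp0 : 0 < p := by linarith [hp.out]
  have h1 : pVar p f ^ (1 / p) ≤ c := le_self_add.trans h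
  rwa [one_div, ENNReal.rpow_inv_le_iff hp0] at h1

/-- The variation and the supremum are bounded by `c` separately, hence `c + c`; the factor two is
harmless for completeness. -/
theorem pVarENorm_le_of_tendsto {F : ℕ → α → ℝ} {f : α → ℝ}
    (h : ∀ s, Tendsto (fun i => F i s) atTop (𝓝 (f s))) {c : ℝ≥0∞}
    (hc : ∀ᶠ i in atTop, pVarENorm p (F i) ≤ c) : pVarENorm p f ≤ c + c := by
  have hp0 : 0 < p := by linarith [hp.out]
  refine add_le_add ?_ (iSup_le fun s => ?_)
  · rw [one_div, ENNReal.rpow_inv_le_iff hp0]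
    exact pVar_le_of_tendsto h (hc.mono fun i hi => pVar_le_of_pVarENorm_le hi)
  · exact le_of_tendsto ((continuous_enorm.tendsto _).comp (h s))
      (hc.mono fun i hi => (enorm_le_supENorm (F i) s).trans (le_add_self.trans hi))

/-- A Cauchy sequence converges pointwise, and lower semicontinuity upgrades this to convergence in
norm. Completeness makes the set of units open and inversion smooth. -/
instance : CompleteSpace (Bv α p) := by
  refine Metric.complete_of_cauchySeq_tendsto fun F hF => ?_
  have hpt : ∀ x, ∃ y, Tendsto (fun n => F n x) atTop (𝓝 y) := fun x => by
    refine cauchySeq_tendsto_of_complete (Metric.cauchySeq_iff'.2 fun ε hε => ?_)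
    obtain ⟨n, hn⟩ := Metric.cauchySeq_iff'.1 hF ε hε
    refine ⟨n, fun k hk => ?_⟩
    have h2 := hn k hk
    rw [dist_eq_norm] at h2 ⊢
    exact (bv_abs_le (F k - F n) x).trans_lt h2
  choose f hf using hpt
  have key : ∀ ε > 0, ∃ n, ∀ k ≥ n, pVarENorm p (fun x => F k x - f x)
      ≤ ENNReal.ofReal ε + ENNReal.ofReal ε := by
    intro ε hε
    obtain ⟨n, hn⟩ := Metric.cauchySeq_iff.1 hF ε hε
    refine ⟨n, fun k hk => pVarENorm_le_of_tendsto (F := fun j x => F k x - F j x)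
      (fun s => tendsto_const_nhds.sub (hf s)) ?_⟩
    filter_upwards [eventually_ge_atTop n] with j hj
    have h1 := hn k hk j hj
    rw [dist_eq_norm, bv_norm_def] at h1
    exact (ENNReal.le_ofReal_iff_toReal_le (pVarENorm_ne_top hp.out (F k - F j).2) hε.le).2 h1.le
  have hmem : pVar p f ≠ ∞ := by
    obtain ⟨n, hn⟩ := key 1 one_pos
    have h1 : pVar p (fun x => F n x - f x) ≠ ∞ := ne_top_of_le_ne_top
      (ENNReal.rpow_ne_top_of_nonneg (by linarith [hp.out]) (by simp))
      (pVar_le_of_pVarENorm_le (hn n le_rfl))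
    have h2 := pVar_sub_ne_top hp.out (F n).2 h1
    simpa using h2
  refine ⟨⟨f, hmem⟩, Metric.tendsto_atTop.2 fun ε hε => ?_⟩
  obtain ⟨n, hn⟩ := key (ε / 3) (by positivity)
  refine ⟨n, fun k hk => ?_⟩
  have h1 := hn k hk
  rw [← ENNReal.ofReal_add (by positivity) (by positivity)] at h1
  refine (dist_eq_norm _ _).trans_lt ?_
  refine (ENNReal.toReal_le_of_le_ofReal (by positivity) h1).trans_lt ?_
  linarith

/-- On `|z| ≥ c` the map `z ↦ 1 / z` is Lipschitz with constant `1 / c ^ 2`, so the pointwise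
inverse has bounded `p`-variation. -/
theorem bv_isUnit {g : Bv α p} {c : ℝ} (hc : 0 < c) (hg : ∀ x, c ≤ |g x|) : IsUnit g := by
  have hne : ∀ x, g x ≠ 0 := fun x h => by
    have := hg x
    rw [h, abs_zero] at this
    linarith
  have hinv : pVar p (fun x => (g x)⁻¹) ≠ ∞ := by
    refine ne_top_of_le_ne_top (ENNReal.mul_ne_top (ENNReal.rpow_ne_top_of_nonneg
      (by linarith [hp.out]) (ENNReal.ofReal_ne_top (r := 1 / (c * c)))) g.2)
      (pVar_le_of_lipschitz (by linarith [hp.out]) (g := g) fun x y => ?_)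
    rw [Real.enorm_eq_ofReal_abs, Real.enorm_eq_ofReal_abs, ← ENNReal.ofReal_mul (by positivity)]
    refine ENNReal.ofReal_le_ofReal ?_
    rw [inv_sub_inv (hne y) (hne x), abs_div, abs_mul, abs_sub_comm, one_div_mul_eq_div]
    gcongr
    exacts [hg y, hg x]
  refine IsUnit.of_mul_eq_one ⟨fun x => (g x)⁻¹, hinv⟩ (Subtype.ext (funext fun x => ?_))
  exact mul_inv_cancel₀ (hne x)

theorem bv_inverse_apply {g : Bv α p} (hg : IsUnit g) (x : α) : (Ring.inverse g) x = 1 / g x := by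
  have h := congrArg (fun f : Bv α p => f x) (Ring.mul_inverse_cancel g hg)
  have h : g x * (Ring.inverse g) x = 1 := h
  exact eq_one_div_of_mul_eq_one_right h

end BvAlgebra

/-! ### The estimating functional as a smooth map -/

section Functional

variable {p : ℝ} [hp : Fact (1 ≤ p)]

theorem wr_abs_le {α : Type*} [LinearOrder α] [TopologicalSpace α] (f : Wr α p) (x : α) :
    |f x| ≤ ‖f‖ :=
  abs_apply_le_of_pVarENorm (pVarENorm_ne_top hp.out f.2.1) x

theorem wr_tendsto_leftLim (f : Wr ℝ≥0 p) (a : ℝ≥0) :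
    Tendsto f (𝓝[<] a) (𝓝 (Function.leftLim f a)) :=
  tendsto_leftLim_of_pVar hp.out f.2.1 a

theorem wr_tendsto_atInfty (f : Wr ℝ≥0 p) : Tendsto f atTop (𝓝 (atInfty f)) :=
  tendsto_atInfty_of_pVar hp.out f.2.1

theorem pVar_kFun_le (f : Wr ℝ≥0 p × Wr ℝ≥0 p) : pVar p (kFun f) ≤ pVar p f.2 := by
  have h : pVar p (kFun f) = pVar p (Function.leftLim f.2) := pVar_congr_sub fun x y => by
    rw [← enorm_neg]; congr 1; simp only [kFun]; ring
  rw [h]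
  exact pVar_leftLim_le hp.out f.2.2.1

theorem abs_kFun_le (f : Wr ℝ≥0 p × Wr ℝ≥0 p) (s : ℝ≥0) : |kFun f s| ≤ 2 * ‖f.2‖ := by
  have h : Tendsto (fun n : ℕ => f.2 (n : ℝ≥0) - f.2 (shiftLeft n s)) atTop (𝓝 (kFun f s)) :=
    ((wr_tendsto_atInfty f.2).comp tendsto_natCast_atTop_atTop).sub
      (tendsto_comp_shiftLeft (wr_tendsto_leftLim f.2) s)
  refine le_of_tendsto' h.abs fun n => (abs_sub _ _).trans ?_
  linarith [wr_abs_le f.2 (n : ℝ≥0), wr_abs_le f.2 (shiftLeft n s)]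

theorem kFun_add (f g : Wr ℝ≥0 p × Wr ℝ≥0 p) (s : ℝ≥0) : kFun (f + g) s = kFun f s + kFun g s := by
  have h1 : atInfty (f + g).2 = atInfty f.2 + atInfty g.2 :=
    ((wr_tendsto_atInfty f.2).add (wr_tendsto_atInfty g.2)).limUnder_eq
  have h2 : Function.leftLim (f + g).2 s = Function.leftLim f.2 s + Function.leftLim g.2 s :=
    leftLim_add (wr_tendsto_leftLim f.2) (wr_tendsto_leftLim g.2) s
  simp only [kFun, h1, h2]
  ring

theorem kFun_smul (c : ℝ) (f : Wr ℝ≥0 p × Wr ℝ≥0 p) (s : ℝ≥0) : kFun (c • f) s = c * kFun f s := by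
  have h1 : atInfty (c • f).2 = c * atInfty f.2 :=
    ((wr_tendsto_atInfty f.2).const_mul c).limUnder_eq
  have h2 : Function.leftLim (c • f).2 s = c * Function.leftLim f.2 s :=
    leftLim_const_mul c (wr_tendsto_leftLim f.2) s
  simp only [kFun, h1, h2]
  ring

theorem pVar_rpow_le_norm {α : Type*} [LinearOrder α] {f : α → ℝ} (hf : pVar p f ≠ ∞) :
    pVar p f ^ (1 / p) ≤ ENNReal.ofReal (pVarENorm p f).toReal := by
  rw [ENNReal.ofReal_toReal (pVarENorm_ne_top hp.out hf)]
  exact le_self_add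

/-- `f ↦ K(f; ·)` on `[0, t]` as a continuous linear map. -/
def kMap (p : ℝ) [hp : Fact (1 ≤ p)] (t : ℝ≥0) : (Wr ℝ≥0 p × Wr ℝ≥0 p) →L[ℝ] Bv (Icc 0 t) p :=
  LinearMap.mkContinuous
    { toFun := fun f => ⟨fun s => kFun f s, ne_top_of_le_ne_top f.2.2.1
        ((pVar_comp_le (φ := fun s : Icc 0 t => (s : ℝ≥0)) (fun _ _ h => h) (kFun f)).trans
          (pVar_kFun_le f))⟩
      map_add' := fun f g => Subtype.ext (funext fun s => kFun_add f g s)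
      map_smul' := fun c f => Subtype.ext (funext fun s => kFun_smul c f s) } 3 fun f => by
    have hp0 : 0 < p := by linarith [hp.out]
    have h2 : ‖f.2‖ ≤ ‖f‖ := norm_snd_le f
    have h3 : ‖f.2‖ + 2 * ‖f.2‖ ≤ 3 * ‖f‖ := by linarith
    refine le_trans (toReal_pVarENorm_le (norm_nonneg f.2) (by positivity) ?_
      fun s => abs_kFun_le f s) h3
    refine le_trans ?_ (pVar_rpow_le_norm f.2.2.1)
    gcongr
    exact (pVar_comp_le (φ := fun s : Icc 0 t => (s : ℝ≥0)) (fun _ _ h => h) (kFun f)).trans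
      (pVar_kFun_le f)

theorem kMap_apply (t : ℝ≥0) (f : Wr ℝ≥0 p × Wr ℝ≥0 p) (s : Icc 0 t) : kMap p t f s = kFun f s :=
  rfl

/-- Constant extension of a function on `[0, t]`. -/
def extendIcc {t : ℝ≥0} (g : Icc 0 t → ℝ) (x : ℝ≥0) : ℝ := g (projIcc 0 t zero_le x)

theorem extendIcc_of_le {t : ℝ≥0} (g : Icc 0 t → ℝ) {x : ℝ≥0} (hx : x ≤ t) :
    extendIcc g x = g ⟨x, zero_le, hx⟩ := by
  rw [extendIcc, projIcc_of_mem zero_le ⟨zero_le, hx⟩]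

theorem pVar_extendIcc_le {q : ℝ} {t : ℝ≥0} (g : Icc 0 t → ℝ) : pVar q (extendIcc g) ≤ pVar q g :=
  pVar_comp_le (φ := fun x : ℝ≥0 => projIcc 0 t zero_le x) (monotone_projIcc zero_le) g

theorem bv_pVar_extendIcc_ne_top {t : ℝ≥0} (g : Bv (Icc 0 t) p) : pVar p (extendIcc g) ≠ ∞ :=
  ne_top_of_le_ne_top g.2 (pVar_extendIcc_le g)

theorem hasYoungIntegral_extendIcc (hp2 : p < 2) {t : ℝ≥0} (g : Bv (Icc 0 t) p) (f : Wr ℝ≥0 p)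
    (s : ℝ≥0) : HasYoungIntegral (extendIcc g) f s (youngInt (extendIcc g) f s) :=
  hasYoungIntegral_youngInt hp.out hp2 (bv_pVar_extendIcc_ne_top g) f.2.1 s

/-- The Young integral as an element of `W_p^r([0, t])`. -/
def youngWr (hp2 : p < 2) {t : ℝ≥0} (g : Bv (Icc 0 t) p) (f : Wr ℝ≥0 p) : Wr (Icc 0 t) p :=
  ⟨fun s => youngInt (extendIcc g) f s, memWr_youngInt hp.out hp2 (bv_pVar_extendIcc_ne_top g) f.2
    (S := ‖g‖) (fun _ => bv_abs_le g _) t⟩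

theorem norm_youngWr_le (hp2 : p < 2) {t : ℝ≥0} (g : Bv (Icc 0 t) p) (f : Wr ℝ≥0 p) :
    ‖youngWr hp2 g f‖ ≤ 2 * (1 + loveYoungConst p) * ‖g‖ * ‖f‖ := by
  have hp0 : 0 < p := by linarith [hp.out]
  have hC := loveYoungConst_nonneg p
  have hb : 0 ≤ (1 + loveYoungConst p) * ‖g‖ * ‖f‖ := by positivity
  have h1 : pVar p (fun s : Icc 0 t => youngInt (extendIcc g) f s) ^ (1 / p)
      ≤ ENNReal.ofReal ((1 + loveYoungConst p) * ‖g‖ * ‖f‖) := by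
    have h := pVar_youngInt_le hp.out hp2 (bv_pVar_extendIcc_ne_top g) f.2.1
      (S := ‖g‖) (fun _ => bv_abs_le g _) t
    have h2 := ENNReal.rpow_le_rpow h (show 0 ≤ 1 / p by positivity)
    rw [ENNReal.mul_rpow_of_nonneg _ _ (by positivity), one_div, ENNReal.rpow_rpow_inv hp0.ne',
      ← one_div] at h2
    refine h2.trans ?_
    rw [ENNReal.ofReal_mul (by positivity)]
    refine mul_le_mul' (ENNReal.ofReal_le_ofReal ?_) (pVar_rpow_le_norm f.2.1)
    have h3 : (pVar p (extendIcc g)).toReal ^ (1 / p) ≤ ‖g‖ := by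
      rw [ENNReal.toReal_rpow]
      refine ENNReal.toReal_le_of_le_ofReal (norm_nonneg g) ?_
      refine le_trans ?_ (pVar_rpow_le_norm g.2)
      gcongr
      exact pVar_extendIcc_le g
    calc _ ≤ ‖g‖ + loveYoungConst p * ‖g‖ := by gcongr
      _ = _ := by ring
  refine (toReal_pVarENorm_le hb hb h1 fun s => ?_).trans (by linarith)
  -- The integral vanishes at time zero, so its supremum is bounded by its variation.
  have h3 := (enorm_sub_le_pVar hp.out (fun s : Icc 0 t => youngInt (extendIcc g) f s)
    ⟨0, le_rfl, zero_le⟩ s).trans h1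
  simp only [youngInt_zero, sub_zero] at h3
  rwa [Real.enorm_eq_ofReal_abs, ENNReal.ofReal_le_ofReal_iff hb] at h3

/-- The Young integral as a continuous bilinear map. -/
def youngMap (hp2 : p < 2) (t : ℝ≥0) : Bv (Icc 0 t) p →L[ℝ] Wr ℝ≥0 p →L[ℝ] Wr (Icc 0 t) p :=
  LinearMap.mkContinuous₂ (LinearMap.mk₂ ℝ (youngWr hp2)
    (fun g h f => Subtype.ext (funext fun s => HasYoungIntegral.youngInt_eq
      ((hasYoungIntegral_extendIcc hp2 g f s).add_left (hasYoungIntegral_extendIcc hp2 h f s))))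
    (fun c g f => Subtype.ext (funext fun s => HasYoungIntegral.youngInt_eq
      ((hasYoungIntegral_extendIcc hp2 g f s).const_mul_left c)))
    (fun g f h => Subtype.ext (funext fun s => by
      have := ((hasYoungIntegral_extendIcc hp2 g f s).combine_right 1 1 (wr_tendsto_leftLim f)
        (wr_tendsto_leftLim h) (hasYoungIntegral_extendIcc hp2 g h s)).youngInt_eq
      simp only [one_mul] at this
      exact this))
    (fun c g f => Subtype.ext (funext fun s => by
      have := ((hasYoungIntegral_extendIcc hp2 g f s).combine_right c 0 (wr_tendsto_leftLim f)
        (wr_tendsto_leftLim f) (hasYoungIntegral_extendIcc hp2 g f s)).youngInt_eq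
      simp only [zero_mul, add_zero] at this
      exact this)))
    (2 * (1 + loveYoungConst p)) fun g f => norm_youngWr_le hp2 g f

theorem youngMap_apply (hp2 : p < 2) (t : ℝ≥0) (g : Bv (Icc 0 t) p) (f : Wr ℝ≥0 p) (s : Icc 0 t) :
    youngMap hp2 t g f s = youngInt (extendIcc g) f s := rfl

/-- An integral over `(0, s]` with `s ≤ t` sees the integrand on `[0, t]` only; the constant
extension beyond `t` is immaterial. -/
theorem hasYoungIntegral_youngMap (hp2 : p < 2) {t : ℝ≥0} (g : Bv (Icc 0 t) p) (f : Wr ℝ≥0 p)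
    (s : Icc 0 t) {h : ℝ≥0 → ℝ} (hgh : ∀ x : Icc 0 t, h x = g x) :
    HasYoungIntegral h f s (youngMap hp2 t g f s) :=
  (hasYoungIntegral_extendIcc hp2 g f s).congr_left fun x _ hx => by
    rw [extendIcc_of_le _ (hx.trans s.2.2), ← hgh]

theorem muPath_eq (hp2 : p < 2) {t : ℝ≥0} {f : Wr ℝ≥0 p × Wr ℝ≥0 p} (hf : IsUnit (kMap p t f)) :
    muPath t f = youngMap hp2 t (Ring.inverse (kMap p t f)) f.1 :=
  funext fun s => HasYoungIntegral.youngInt_eq (hasYoungIntegral_youngMap hp2 _ _ s fun x => by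
    rw [bv_inverse_apply hf]; rfl)

theorem toWr_of_memWr {α : Type*} [LinearOrder α] [TopologicalSpace α] {f : α → ℝ}
    (h : MemWr p f) : (toWr p f : α → ℝ) = f := by
  have : toWr p f = (⟨f, h⟩ : Wr α p) := dif_pos h
  rw [this]

theorem muFun_eq (hp2 : p < 2) {t : ℝ≥0} {f : Wr ℝ≥0 p × Wr ℝ≥0 p} (hf : IsUnit (kMap p t f)) :
    muFun p t f = youngMap hp2 t (Ring.inverse (kMap p t f)) f.1 := by
  refine Subtype.ext ?_
  have h : MemWr p (muPath t f) := by
    rw [muPath_eq hp2 hf]; exact (youngMap hp2 t (Ring.inverse (kMap p t f)) f.1).2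
  exact (toWr_of_memWr h).trans (muPath_eq hp2 hf)

/-- The units of `Bv` form an open set, so the algebraic formula holds in a whole neighbourhood and
may be differentiated there. -/
theorem muFun_eventuallyEq (hp2 : p < 2) {t : ℝ≥0} {f : Wr ℝ≥0 p × Wr ℝ≥0 p}
    (hf : IsUnit (kMap p t f)) :
    muFun p t =ᶠ[𝓝 f] fun f => youngMap hp2 t (Ring.inverse (kMap p t f)) f.1 := by
  filter_upwards [(kMap p t).continuous.continuousAt.eventually (Units.isOpen.mem_nhds hf)]
    with f' hf'
  exact muFun_eq hp2 hf'

theorem isUnit_kMap {t : ℝ≥0} {f : Wr ℝ≥0 p × Wr ℝ≥0 p} (h : ∃ c > 0, ∀ s ≤ t, c ≤ |kFun f s|) :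
    IsUnit (kMap p t f) := by
  obtain ⟨c, hc, h⟩ := h
  exact bv_isUnit hc fun x => h x x.2.2

theorem contDiffAt_muFun (hp2 : p < 2) {t : ℝ≥0} {f : Wr ℝ≥0 p × Wr ℝ≥0 p}
    (hf : IsUnit (kMap p t f)) (k : ℕ) : ContDiffAt ℝ k (muFun p t) f := by
  refine ContDiffAt.congr_of_eventuallyEq ?_ (muFun_eventuallyEq hp2 hf)
  obtain ⟨x, hx⟩ := hf
  have h1 : ContDiffAt ℝ k (fun f => Ring.inverse (kMap p t f)) f := by
    refine ContDiffAt.comp f (g := Ring.inverse) ?_ (kMap p t).contDiff.contDiffAt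
    rw [← hx]
    exact contDiffAt_ringInverse ℝ x
  exact ((youngMap hp2 t).contDiff.contDiffAt.comp f h1).clm_apply contDiffAt_fst

/-- Inversion has derivative `h ↦ -x⁻¹ h x⁻¹`; the rest is the product rule for the bilinear Young
integral. -/
theorem hasFDerivAt_muFun (hp2 : p < 2) {t : ℝ≥0} {f : Wr ℝ≥0 p × Wr ℝ≥0 p}
    (hf : IsUnit (kMap p t f)) (g : Wr ℝ≥0 p × Wr ℝ≥0 p) :
    fderiv ℝ (muFun p t) f g = youngMap hp2 t (Ring.inverse (kMap p t f)) g.1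
      - youngMap hp2 t (Ring.inverse (kMap p t f) * kMap p t g * Ring.inverse (kMap p t f)) f.1 := by
  rw [(muFun_eventuallyEq hp2 hf).fderiv_eq]
  obtain ⟨x, hx⟩ := hf
  have h0 : HasFDerivAt Ring.inverse (-ContinuousLinearMap.mulLeftRight ℝ (Bv (Icc 0 t) p)
      ↑x⁻¹ ↑x⁻¹) (kMap p t f) := by rw [← hx]; exact hasFDerivAt_ringInverse x
  have h1 := h0.comp f (kMap p t).hasFDerivAt
  have h2 := ((youngMap hp2 t).hasFDerivAt.comp f h1).clm_apply
    (hasFDerivAt_fst (𝕜 := ℝ) (E := Wr ℝ≥0 p) (F := Wr ℝ≥0 p) (p := f))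
  have h3 := h2.fderiv
  simp only [Function.comp_def] at h3
  rw [h3]
  have hinv : Ring.inverse (kMap p t f) = ↑x⁻¹ := by rw [← hx, Ring.inverse_unit]
  rw [hinv]
  simp [sub_eq_add_neg]

end Functional

end CensRec
end

noncomputable section

namespace CensRec

/-! ### Lebesgue–Stieltjes measures -/

section Stieltjes

/-- Increasing and right-continuous functions. -/
structure IncRC (f : ℝ≥0 → ℝ) : Prop where
  mono : Monotone f
  right_cont : ∀ s, ContinuousWithinAt f (Ici s) s

variable {f g : ℝ≥0 → ℝ} {s : ℝ≥0}

theorem IncRC.coe_stieltjes (hf : IncRC f) : (hf.mono.stieltjesFunction : ℝ≥0 → ℝ) = f :=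
  funext fun x => by
    rw [hf.mono.stieltjesFunction_eq]
    exact (hf.right_cont x).rightLim_eq

theorem IncRC.lsMeasure_eq (hf : IncRC f) : lsMeasure f = hf.mono.stieltjesFunction.measure :=
  dif_pos hf.mono

instance (f : ℝ≥0 → ℝ) : IsLocallyFiniteMeasure (lsMeasure f) := by
  unfold lsMeasure
  split_ifs <;> infer_instance

instance (f : ℝ≥0 → ℝ) (a b : ℝ≥0) : IsFiniteMeasure ((lsMeasure f).restrict (Ioc a b)) :=
  ⟨by rw [Measure.restrict_apply_univ]; exact measure_Ioc_lt_top⟩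

theorem IncRC.lsMeasure_Ioc (hf : IncRC f) (a b : ℝ≥0) :
    lsMeasure f (Ioc a b) = ENNReal.ofReal (f b - f a) := by
  rw [hf.lsMeasure_eq, StieltjesFunction.measure_Ioc, hf.coe_stieltjes]

theorem IncRC.lsMeasure_real_Ioc (hf : IncRC f) {a b : ℝ≥0} (hab : a ≤ b) :
    (lsMeasure f).real (Ioc a b) = f b - f a := by
  rw [measureReal_def, hf.lsMeasure_Ioc, ENNReal.toReal_ofReal (sub_nonneg.2 (hf.mono hab))]

theorem IncRC.lsMeasure_real_Icc (hf : IncRC f) {a b : ℝ≥0} (hab : a ≤ b) :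
    (lsMeasure f).real (Icc a b) = f b - Function.leftLim f a := by
  rw [measureReal_def, hf.lsMeasure_eq, StieltjesFunction.measure_Icc, hf.coe_stieltjes,
    ENNReal.toReal_ofReal (sub_nonneg.2 (hf.mono.leftLim_le hab))]

/-- Finite measures are determined by the half-lines, which cut out intervals `(0, a]` here. A
possible atom at `0` is never seen. -/
theorem IncRC.lsMeasure_restrict_eq (hf : IncRC f) {m : Measure ℝ≥0}
    (h : ∀ a ≤ s, m (Ioc 0 a) = ENNReal.ofReal (f a - f 0)) :
    (lsMeasure f).restrict (Ioc 0 s) = m.restrict (Ioc 0 s) := by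
  refine Measure.ext_of_Iic _ _ fun a => ?_
  have h1 : Iic a ∩ Ioc 0 s = Ioc 0 (min a s) := by
    ext x; simp only [mem_inter_iff, mem_Iic, mem_Ioc, le_min_iff]; tauto
  rw [Measure.restrict_apply measurableSet_Iic, Measure.restrict_apply measurableSet_Iic, h1,
    hf.lsMeasure_Ioc, h _ (min_le_right _ _)]

theorem IncRC.stopped (hf : IncRC f) (c : ℝ≥0) : IncRC fun s => f (min s c) where
  mono := fun _ _ h => hf.mono (min_le_min_right c h)
  right_cont s := by
    have h1 : Tendsto (fun x => min x c) (𝓝[≥] s) (𝓝[≥] (min s c)) :=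
      tendsto_nhdsWithin_of_tendsto_nhds_of_eventually_within _
        (((continuous_id.min continuous_const).tendsto s).mono_left nhdsWithin_le_nhds)
        (eventually_nhdsWithin_of_forall fun x hx => min_le_min_right c hx)
    exact (hf.right_cont (min s c)).tendsto.comp h1

theorem lsInt_congr {h : ℝ≥0 → ℝ} (H : ∀ u, 0 < u → u ≤ s → g u = h u) :
    lsInt g f s = lsInt h f s :=
  setIntegral_congr_fun measurableSet_Ioc fun u hu => H u hu.1 hu.2

theorem IncRC.lsInt_stopped (hf : IncRC f) (g : ℝ≥0 → ℝ) (c : ℝ≥0) :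
    lsInt g (fun s => f (min s c)) s = lsInt g f (min s c) := by
  have h1 : Ioc 0 s ∩ Iic c = Ioc 0 (min s c) := by
    ext x; simp only [mem_inter_iff, mem_Iic, mem_Ioc, le_min_iff]; tauto
  have h2 : (lsMeasure fun s => f (min s c)).restrict (Ioc 0 s)
      = ((lsMeasure f).restrict (Iic c)).restrict (Ioc 0 s) := by
    refine (hf.stopped c).lsMeasure_restrict_eq fun a _ => ?_
    have h3 : Ioc 0 a ∩ Iic c = Ioc 0 (min a c) := by
      ext x; simp only [mem_inter_iff, mem_Iic, mem_Ioc, le_min_iff]; tauto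
    rw [Measure.restrict_apply measurableSet_Ioc, h3, hf.lsMeasure_Ioc, min_eq_left zero_le]
  rw [lsInt, lsInt, h2, Measure.restrict_restrict measurableSet_Ioc, h1]

theorem lsInt_indicator_mul (g f : ℝ≥0 → ℝ) (c s : ℝ≥0) :
    lsInt (fun u => (Iic c).indicator 1 u * g u) f s = lsInt g f (min s c) := by
  have h1 : Ioc 0 s ∩ Iic c = Ioc 0 (min s c) := by
    ext x; simp only [mem_inter_iff, mem_Iic, mem_Ioc, le_min_iff]; tauto
  have h2 : (fun u => (Iic c).indicator (1 : ℝ≥0 → ℝ) u * g u) = (Iic c).indicator g := by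
    funext u
    by_cases hu : u ∈ Iic c
    · simp [Set.indicator_of_mem hu]
    · simp [Set.indicator_of_notMem hu]
  rw [lsInt, lsInt, h2, setIntegral_indicator measurableSet_Iic, h1]

theorem IncRC.lsInt_one (hf : IncRC f) (s : ℝ≥0) : lsInt (fun _ => 1) f s = f s - f 0 := by
  rw [lsInt, setIntegral_const, smul_eq_mul, mul_one, hf.lsMeasure_real_Ioc zero_le]

theorem IsCountingPath.incRC {x : ℝ≥0 → ℝ} (hx : IsCountingPath x) : IncRC x :=
  ⟨hx.mono, hx.right_cont⟩

theorem IsCountingPath.nonneg {x : ℝ≥0 → ℝ} (hx : IsCountingPath x) (s : ℝ≥0) : 0 ≤ x s := by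
  rw [← hx.zero]; exact hx.mono zero_le

theorem censor_apply {x : ℝ≥0 → ℝ} (hx : IsCountingPath x) (c s : ℝ≥0) :
    censor x c s = x (min s c) := by
  have h := lsInt_indicator_mul (fun _ => 1) x c s
  simp only [mul_one] at h
  rw [hx.incRC.lsInt_one, hx.zero, sub_zero] at h
  exact h

theorem censor_eq {x : ℝ≥0 → ℝ} (hx : IsCountingPath x) (c : ℝ≥0) :
    censor x c = fun s => x (min s c) :=
  funext (censor_apply hx c)

theorem isCountingPath_censor {x : ℝ≥0 → ℝ} (hx : IsCountingPath x) (c : ℝ≥0) :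
    IsCountingPath (censor x c) := by
  rw [censor_eq hx]
  refine ⟨fun s => hx.nat_valued _, (hx.incRC.stopped c).mono, (hx.incRC.stopped c).right_cont,
    by rw [min_eq_left zero_le, hx.zero], ?_⟩
  obtain ⟨b, hb⟩ := hx.bdd
  exact ⟨b, by rintro _ ⟨s, rfl⟩; exact hb ⟨_, rfl⟩⟩

theorem incRC_simplePath (c : ℝ≥0) : IncRC (simplePath c) where
  mono := by
    intro x y hxy
    by_cases hx : c ≤ x
    · simp [simplePath, hx, hx.trans hxy]
    · simp only [simplePath, Set.indicator, mem_Ici, hx, if_false]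
      split_ifs <;> simp
  right_cont s := by
    by_cases hs : c ≤ s
    · refine (continuousWithinAt_const (b := (1 : ℝ))).congr (fun x hx => ?_) ?_
      · simp [simplePath, hs.trans hx]
      · simp [simplePath, hs]
    · have h : simplePath c =ᶠ[𝓝 s] fun _ => 0 := by
        filter_upwards [gt_mem_nhds (not_le.1 hs)] with x hx
        simp [simplePath, hx]
      exact (continuousAt_const.congr h.symm).continuousWithinAt

theorem simplePath_nonneg (c s : ℝ≥0) : 0 ≤ simplePath c s :=
  Set.indicator_nonneg (fun _ _ => zero_le_one) s

theorem simplePath_le_one (c s : ℝ≥0) : simplePath c s ≤ 1 :=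
  Set.indicator_le_self' (fun _ _ => zero_le_one) s

theorem IncRC.memWr {p : ℝ} (hp : 1 ≤ p) (hf : IncRC f) {M : ℝ} (hM : ∀ x y, f y - f x ≤ M) :
    MemWr p f :=
  ⟨ne_top_of_le_ne_top (ENNReal.rpow_ne_top_of_nonneg (by linarith) ENNReal.ofReal_ne_top)
    (pVar_monotone_le hp hf.mono hM), hf.right_cont⟩

theorem memWr_simplePath {p : ℝ} (hp : 1 ≤ p) (c : ℝ≥0) : MemWr p (simplePath c) :=
  (incRC_simplePath c).memWr hp (M := 1) fun x y => by
    linarith [simplePath_nonneg c x, simplePath_le_one c y]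

theorem IsCountingPath.tendsto_atInfty {x : ℝ≥0 → ℝ} (hx : IsCountingPath x) :
    Tendsto x atTop (𝓝 (atInfty x)) :=
  tendsto_nhds_limUnder ⟨_, tendsto_atTop_ciSup hx.mono hx.bdd⟩

theorem IsCountingPath.le_atInfty {x : ℝ≥0 → ℝ} (hx : IsCountingPath x) (s : ℝ≥0) :
    x s ≤ atInfty x :=
  hx.mono.ge_of_tendsto hx.tendsto_atInfty s

theorem IsCountingPath.memWr {p : ℝ} (hp : 1 ≤ p) {x : ℝ≥0 → ℝ} (hx : IsCountingPath x) :
    MemWr p x :=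
  hx.incRC.memWr hp (M := atInfty x) fun a b => by linarith [hx.nonneg a, hx.le_atInfty b]

end Stieltjes

/-! ### Young integrals with respect to increasing functions -/

section YoungStieltjes

variable {p : ℝ} {f g : ℝ≥0 → ℝ} {s : ℝ≥0}

theorem pVar_indicator_ne_top (hp : 1 ≤ p) {U : Set ℝ≥0} (hU : IsUpperSet U) :
    pVar p (U.indicator (1 : ℝ≥0 → ℝ)) ≠ ∞ := by
  have hmono : Monotone (U.indicator (1 : ℝ≥0 → ℝ)) := fun x y hxy => by
    by_cases hx : x ∈ U
    · simp [hx, hU hxy hx]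
    · rw [Set.indicator_of_notMem hx]
      exact Set.indicator_nonneg (fun _ _ => zero_le_one) y
  refine ne_top_of_le_ne_top (ENNReal.rpow_ne_top_of_nonneg (by linarith)
    (ENNReal.ofReal_ne_top (r := 1))) (pVar_monotone_le hp hmono fun x y => ?_)
  have h1 : U.indicator (1 : ℝ≥0 → ℝ) y ≤ 1 := Set.indicator_le_self' (fun _ _ => zero_le_one) y
  have h2 : 0 ≤ U.indicator (1 : ℝ≥0 → ℝ) x := Set.indicator_nonneg (fun _ _ => zero_le_one) x
  linarith

theorem measurableSet_of_isUpperSet {U : Set ℝ≥0} (hU : IsUpperSet U) : MeasurableSet U :=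
  hU.ordConnected.measurableSet

/-- A uniform limit of finite combinations of indicators of upper sets. -/
theorem measurable_of_pVar (hp : 1 ≤ p) (hg : pVar p g ≠ ∞) : Measurable g := by
  have h : ∀ n : ℕ, ∃ G : ℝ≥0 → ℝ, Measurable G ∧ ∀ x, |g x - G x| ≤ 1 / ((n : ℝ) + 1) := by
    intro n
    obtain ⟨φ, _, hclose, N, c, U, hU, hsum⟩ := exists_step_approx hp hg
      (show (0 : ℝ) < 1 / ((n : ℝ) + 1) by positivity)
    refine ⟨fun x => g (φ x), ?_, hclose⟩
    simp only [hsum]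
    exact Finset.measurable_fun_sum _ fun j _ =>
      (measurable_one.indicator (measurableSet_of_isUpperSet (hU j))).const_mul _
  choose G hG hclose using h
  refine measurable_of_tendsto_metrizable hG (tendsto_pi_nhds.2 fun x => ?_)
  rw [tendsto_iff_dist_tendsto_zero]
  refine squeeze_zero (fun _ => dist_nonneg) (fun n => ?_) tendsto_one_div_add_atTop_nhds_zero_nat
  rw [dist_comm, Real.dist_eq]
  exact hclose n x

theorem bounded_of_pVar (hp : 1 ≤ p) (hg : pVar p g ≠ ∞) : ∃ S, ∀ x, |g x| ≤ S :=
  ⟨_, abs_apply_le_of_pVarENorm (pVarENorm_ne_top hp hg)⟩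

theorem integrableOn_lsMeasure_of_bound (hg : Measurable g) {S : ℝ} (hS : ∀ x, |g x| ≤ S)
    (f : ℝ≥0 → ℝ) (s : ℝ≥0) : IntegrableOn g (Ioc 0 s) (lsMeasure f) :=
  Integrable.of_bound hg.aestronglyMeasurable S (ae_of_all _ hS)

theorem hasYoungIntegral_indicator_lsInt (hf : IncRC f) {U : Set ℝ≥0} (hU : IsUpperSet U) :
    HasYoungIntegral (U.indicator 1) f s (lsInt (U.indicator 1) f s) := by
  have hint : lsInt (U.indicator 1) f s = (lsMeasure f).real (Ioc 0 s ∩ U) := by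
    rw [lsInt, setIntegral_indicator (measurableSet_of_isUpperSet hU)]
    simp
  rw [hint]
  rcases isUpperSet_nnreal hU with rfl | ⟨a, rfl | rfl⟩
  · simpa using hasYoungIntegral_zero_left
  · convert! hasYoungIntegral_indicator_Ici (f := f) (s := s) a using 1
    split_ifs with h
    · have : Ioc 0 s ∩ Ici a = ∅ := by
        ext x; simp only [mem_inter_iff, mem_Ioc, mem_Ici, mem_empty_iff_false, iff_false]
        rintro ⟨⟨_, h1⟩, h2⟩
        exact not_le.2 h (h2.trans h1)
      rw [this, measureReal_empty]
    -- For `a = 0` both sides ignore the point `0`: the set is `(0, s]`, and the left limit of `f`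
    -- at zero is `f 0`.
    · rcases eq_or_ne a 0 with rfl | ha
      · have : Ioc 0 s ∩ Ici 0 = Ioc 0 s := by ext x; simp
        rw [this, hf.lsMeasure_real_Ioc zero_le, leftLim_eq_of_isBot (fun _ => zero_le)]
      · have : Ioc 0 s ∩ Ici a = Icc a s := by
          ext x; simp only [mem_inter_iff, mem_Ioc, mem_Ici, mem_Icc]
          constructor
          · rintro ⟨⟨_, h1⟩, h2⟩; exact ⟨h2, h1⟩
          · rintro ⟨h1, h2⟩; exact ⟨⟨(pos_iff_ne_zero.2 ha).trans_le h1, h2⟩, h1⟩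
        rw [this, hf.lsMeasure_real_Icc (not_lt.1 h)]
  · convert! hasYoungIntegral_indicator_Ioi (f := f) (s := s) a using 1
    have : Ioc 0 s ∩ Ioi a = Ioc a (max s a) := by
      ext x; simp only [mem_inter_iff, mem_Ioc, mem_Ioi, le_max_iff]
      constructor
      · rintro ⟨⟨_, h1⟩, h2⟩; exact ⟨h2, Or.inl h1⟩
      · rintro ⟨h1, h2 | h2⟩
        · exact ⟨⟨zero_le.trans_lt h1, h2⟩, h1⟩
        · exact absurd h1 (not_lt.2 h2)
    rw [this, hf.lsMeasure_real_Ioc (le_max_right _ _)]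

/-- The Young integral with respect to an increasing function is the Lebesgue–Stieltjes integral. -/
theorem hasYoungIntegral_lsInt (hp : 1 ≤ p) (hp2 : p < 2) (hg : pVar p g ≠ ∞) (hf : IncRC f)
    (hfv : pVar p f ≠ ∞) (s : ℝ≥0) : HasYoungIntegral g f s (lsInt g f s) := by
  obtain ⟨S, hS⟩ := bounded_of_pVar hp hg
  refine hasYoungIntegral_of_approx fun η hη => ?_
  obtain ⟨ε, hε, h⟩ := exists_youngSum_approx (s := s) hp hp2 hg hfv hη
  have hM : 0 ≤ f s - f 0 := sub_nonneg.2 (hf.mono zero_le)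
  -- The first bound keeps the Young sums within `η`; the second does the same for the
  -- Lebesgue–Stieltjes integrals, whose total mass is `f s - f 0`.
  have hε' : 0 < min ε (η / (f s - f 0 + 1)) := lt_min hε (by positivity)
  obtain ⟨φ, hφ, hclose, n, c, U, hU, hsum⟩ := exists_step_approx hp hg hε'
  have hmeas : ∀ j, Measurable ((U j).indicator (1 : ℝ≥0 → ℝ)) := fun j =>
    measurable_one.indicator (measurableSet_of_isUpperSet (hU j))
  have hint : ∀ j, IntegrableOn ((U j).indicator (1 : ℝ≥0 → ℝ)) (Ioc 0 s) (lsMeasure f) := fun j =>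
    integrableOn_lsMeasure_of_bound (hmeas j) (S := 1) (fun x => by
      by_cases hx : x ∈ U j <;> simp [hx]) f s
  refine ⟨fun x => g (φ x), lsInt (fun x => g (φ x)) f s, ?_,
    h _ hε' (min_le_left _ _) φ hφ hclose, ?_⟩
  · simp only [hsum]
    have h1 : lsInt (fun x => ∑ j ∈ Finset.range n, c j * (U j).indicator 1 x) f s
        = ∑ j ∈ Finset.range n, c j * lsInt ((U j).indicator 1) f s := by
      simp only [lsInt]
      rw [integral_finsetSum _ fun j _ => (hint j).const_mul _]
      simp only [integral_const_mul]
    rw [h1]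
    exact HasYoungIntegral.sum_left _ fun j _ =>
      (hasYoungIntegral_indicator_lsInt hf (hU j)).const_mul_left (c j)
  · have hgm := measurable_of_pVar hp hg
    have h1 : IntegrableOn g (Ioc 0 s) (lsMeasure f) := integrableOn_lsMeasure_of_bound hgm hS f s
    have h2 : IntegrableOn (fun x => g (φ x)) (Ioc 0 s) (lsMeasure f) :=
      integrableOn_lsMeasure_of_bound (by
        simp only [hsum]
        exact Finset.measurable_fun_sum _ fun j _ => (hmeas j).const_mul _) (fun x => hS _) f s
    rw [lsInt, lsInt, ← integral_sub h2 h1, ← Real.norm_eq_abs]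
    refine (norm_setIntegral_le_of_norm_le_const (C := η / (f s - f 0 + 1)) measure_Ioc_lt_top
      fun x _ => ?_).trans ?_
    · rw [Real.norm_eq_abs, abs_sub_comm]
      exact (hclose x).trans (min_le_right _ _)
    · rw [hf.lsMeasure_real_Ioc zero_le, div_mul_eq_mul_div, div_le_iff₀ (by positivity)]
      gcongr
      linarith

theorem youngMap_eq_lsInt [hp : Fact (1 ≤ p)] (hp2 : p < 2) {t : ℝ≥0} (G : Bv (Icc 0 t) p)
    {w : Wr ℝ≥0 p} (hw : (w : ℝ≥0 → ℝ) = f) (hf : IncRC f) {h : ℝ≥0 → ℝ}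
    (hgh : ∀ x : Icc 0 t, G x = h x) (s : Icc 0 t) : youngMap hp2 t G w s = lsInt h f s := by
  have h1 := (hasYoungIntegral_lsInt hp.out hp2 (bv_pVar_extendIcc_ne_top G) hf
    (by rw [← hw]; exact w.2.1) s).youngInt_eq
  rw [youngMap_apply, hw, h1]
  exact lsInt_congr fun u _ hu => by rw [extendIcc_of_le _ (hu.trans s.2.2), hgh]

end YoungStieltjes

end CensRec
end

noncomputable section

namespace CensRec

/-! ### The survival function and its odds measure -/

section Survival

variable (γ : Measure ℝ≥0)

/-- `γ [u, ∞)`. -/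
def surv (u : ℝ≥0) : ℝ := γ.real (Ici u)

/-- `γ (u, ∞)`. -/
def survGT (u : ℝ≥0) : ℝ := γ.real (Ioi u)

theorem surv_nonneg (u : ℝ≥0) : 0 ≤ surv γ u := measureReal_nonneg

theorem odds_density_nonneg (v : ℝ≥0) : 0 ≤ 1 / (surv γ v * survGT γ v) := by
  have := surv_nonneg γ v
  have : 0 ≤ survGT γ v := measureReal_nonneg
  positivity

variable [IsProbabilityMeasure γ]

theorem surv_anti : Antitone (surv γ) := fun _ _ h => measureReal_mono (Ici_subset_Ici.2 h)

theorem survGT_anti : Antitone (survGT γ) := fun _ _ h => measureReal_mono (Ioi_subset_Ioi h)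

theorem surv_le_survGT {u w : ℝ≥0} (h : u < w) : surv γ w ≤ survGT γ u :=
  measureReal_mono (Ici_subset_Ioi.2 h)

theorem survGT_le_surv (u : ℝ≥0) : survGT γ u ≤ surv γ u := measureReal_mono Ioi_subset_Ici_self

theorem surv_zero : surv γ 0 = 1 := by
  have : Ici (0 : ℝ≥0) = univ := by ext; simp
  rw [surv, this, probReal_univ]

theorem surv_le_one (u : ℝ≥0) : surv γ u ≤ 1 := measureReal_le_one

theorem measureReal_Ico_eq {a b : ℝ≥0} (hab : a ≤ b) : γ.real (Ico a b) = surv γ a - surv γ b := by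
  rw [← Ici_sdiff_Ici, surv, surv, measureReal_sdiff (Ici_subset_Ici.2 hab) measurableSet_Ici]

theorem measureReal_singleton_eq (a : ℝ≥0) : γ.real {a} = surv γ a - survGT γ a := by
  rw [surv, survGT, ← measureReal_sdiff Ioi_subset_Ici_self measurableSet_Ioi, Ici_sdiff_Ioi_same]

theorem tendsto_real_of_eventually {l : Filter ℝ≥0} [l.IsCountablyGenerated] {S : ℝ≥0 → Set ℝ≥0}
    {T : Set ℝ≥0} (hS : ∀ a, MeasurableSet (S a)) (h : ∀ x, ∀ᶠ a in l, x ∈ S a ↔ x ∈ T) :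
    Tendsto (fun a => γ.real (S a)) l (𝓝 (γ.real T)) := by
  rcases l.eq_or_neBot with rfl | _
  · exact tendsto_bot
  · exact (ENNReal.continuousAt_toReal (measure_ne_top γ T)).tendsto.comp
      (tendsto_measure_of_tendsto_indicator_of_isFiniteMeasure l γ hS h)

theorem tendsto_surv_left (u : ℝ≥0) : Tendsto (surv γ) (𝓝[≤] u) (𝓝 (surv γ u)) := by
  refine tendsto_real_of_eventually γ (fun _ => measurableSet_Ici) fun x => ?_
  rcases le_or_gt u x with hx | hx
  · filter_upwards [self_mem_nhdsWithin] with a ha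
    exact iff_of_true (le_trans ha hx) hx
  · filter_upwards [nhdsWithin_le_nhds (lt_mem_nhds hx)] with a ha
    exact iff_of_false (not_le.2 ha) (not_le.2 hx)

theorem tendsto_surv_right (u : ℝ≥0) : Tendsto (surv γ) (𝓝[>] u) (𝓝 (survGT γ u)) := by
  refine tendsto_real_of_eventually γ (fun _ => measurableSet_Ici) fun x => ?_
  rcases lt_or_ge u x with hx | hx
  · filter_upwards [nhdsWithin_le_nhds (gt_mem_nhds hx)] with a ha
    exact iff_of_true (le_of_lt ha) hx
  · filter_upwards [self_mem_nhdsWithin] with a ha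
    exact iff_of_false (not_le.2 (lt_of_le_of_lt hx ha)) (not_lt.2 hx)

theorem rightLim_surv (u : ℝ≥0) : Function.rightLim (surv γ) u = survGT γ u :=
  rightLim_eq_of_tendsto (tendsto_surv_right γ u)

/-- The measure `γ(dv) / (γ[v, ∞) γ(v, ∞))`. -/
def odds : Measure ℝ≥0 :=
  γ.withDensity fun v => ENNReal.ofReal (1 / (surv γ v * survGT γ v))

theorem measurable_surv : Measurable (surv γ) := (surv_anti γ).measurable

theorem measurable_survGT : Measurable (survGT γ) := (survGT_anti γ).measurable

/-- The largest point of the grid `ℕ / (k + 1)` that is at most `v`. -/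
def gridBelow (k : ℕ) (v : ℝ≥0) : ℝ≥0 := (⌊((k : ℝ≥0) + 1) * v⌋₊ : ℝ≥0) / ((k : ℝ≥0) + 1)

/-- The smallest point of the grid `ℕ / (k + 1)` that is larger than `v`. -/
def gridAbove (k : ℕ) (v : ℝ≥0) : ℝ≥0 := ((⌊((k : ℝ≥0) + 1) * v⌋₊ : ℝ≥0) + 1) / ((k : ℝ≥0) + 1)

theorem gridBelow_le (k : ℕ) (v : ℝ≥0) : gridBelow k v ≤ v := by
  rw [gridBelow, div_le_iff₀ (by positivity), mul_comm v]
  exact Nat.floor_le zero_le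

theorem lt_gridAbove (k : ℕ) (v : ℝ≥0) : v < gridAbove k v := by
  rw [gridAbove, lt_div_iff₀ (by positivity), mul_comm v]
  exact Nat.lt_floor_add_one _

theorem gridAbove_eq (k : ℕ) (v : ℝ≥0) : gridAbove k v = gridBelow k v + 1 / ((k : ℝ≥0) + 1) := by
  rw [gridAbove, gridBelow, add_div]

theorem measurable_gridBelow (k : ℕ) : Measurable (gridBelow k) := by
  unfold gridBelow
  exact ((measurable_from_nat (f := fun n : ℕ => (n : ℝ≥0))).comp
    (Nat.measurable_floor.comp (measurable_const.mul measurable_id))).div_const _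

theorem measurable_gridAbove (k : ℕ) : Measurable (gridAbove k) := by
  have : gridAbove k = fun v => gridBelow k v + 1 / ((k : ℝ≥0) + 1) := funext (gridAbove_eq k)
  rw [this]
  exact (measurable_gridBelow k).add_const _

theorem tendsto_gridBelow (v : ℝ≥0) : Tendsto (fun k => gridBelow k v) atTop (𝓝[≤] v) := by
  refine tendsto_nhdsWithin_of_tendsto_nhds_of_eventually_within _ ?_
    (Eventually.of_forall fun k => gridBelow_le k v)
  refine tendsto_of_tendsto_of_tendsto_of_le_of_le (tendsto_shiftLeft v) tendsto_const_nhds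
    (fun k => ?_) fun k => gridBelow_le k v
  rw [shiftLeft, tsub_le_iff_right, ← gridAbove_eq]
  exact (lt_gridAbove k v).le

theorem tendsto_gridAbove (v : ℝ≥0) : Tendsto (fun k => gridAbove k v) atTop (𝓝[>] v) := by
  refine tendsto_nhdsWithin_of_tendsto_nhds_of_eventually_within _ ?_
    (Eventually.of_forall fun k => lt_gridAbove k v)
  have h1 : Tendsto (fun k : ℕ => v + 1 / ((k : ℝ≥0) + 1)) atTop (𝓝 (v + 0)) :=
    tendsto_one_div_add_atTop_nhds_zero_nat.const_add v
  rw [add_zero] at h1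
  refine tendsto_of_tendsto_of_tendsto_of_le_of_le tendsto_const_nhds h1
    (fun k => (lt_gridAbove k v).le) fun k => ?_
  rw [gridAbove_eq]
  gcongr
  exact gridBelow_le k v

variable {γ}

/-- On a grid cell `[a, b)` the integrand is the constant `1 / (S(a) S(b))` and the mass is `S(a) -
S(b)`, so the cell contributes `1 / S(b) - 1 / S(a)` and the sum telescopes. Capping at `w` keeps
the denominators positive. -/
theorem integral_grid {w : ℝ≥0} (hw : 0 < surv γ w) (k J : ℕ) :
    ∫ v in Ico 0 (min ((J : ℝ≥0) / ((k : ℝ≥0) + 1)) w),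
        1 / (surv γ (gridBelow k v) * surv γ (min (gridAbove k v) w)) ∂γ
      = 1 / surv γ (min ((J : ℝ≥0) / ((k : ℝ≥0) + 1)) w) - 1 := by
  have hpos : ∀ u ≤ w, 0 < surv γ u := fun u hu => hw.trans_le (surv_anti γ hu)
  induction J with
  | zero => simp [surv_zero]
  | succ J ih =>
    -- Once the grid has passed `w`, further cells contribute nothing.
    rcases le_or_gt w ((J : ℝ≥0) / ((k : ℝ≥0) + 1)) with h | h
    · have h2 : w ≤ ((J + 1 : ℕ) : ℝ≥0) / ((k : ℝ≥0) + 1) := h.trans (by gcongr; simp)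
      rw [min_eq_right h] at ih
      rw [min_eq_right h2]
      exact ih
    · set a := (J : ℝ≥0) / ((k : ℝ≥0) + 1) with ha
      set b := min (((J + 1 : ℕ) : ℝ≥0) / ((k : ℝ≥0) + 1)) w with hb
      have hab : a ≤ b := le_min (by rw [ha]; gcongr; simp) h.le
      rw [min_eq_left h.le] at ih
      have hsplit : Ico 0 b = Ico 0 a ∪ Ico a b := (Ico_union_Ico_eq_Ico zero_le hab).symm
      have hconst : ∀ v ∈ Ico a b, 1 / (surv γ (gridBelow k v) * surv γ (min (gridAbove k v) w))
          = 1 / (surv γ a * surv γ b) := by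
        intro v hv
        have hfl : ⌊((k : ℝ≥0) + 1) * v⌋₊ = J := by
          rw [Nat.floor_eq_iff zero_le]
          constructor
          · have := hv.1
            rw [ha, div_le_iff₀ (by positivity)] at this
            rwa [mul_comm]
          · have := hv.2.trans_le (min_le_left _ _)
            rw [lt_div_iff₀ (by positivity)] at this
            rw [mul_comm]
            exact_mod_cast this
        rw [gridBelow, gridAbove, hfl, hb]
        push_cast
        rfl
      have hint : ∀ c ≤ w, IntegrableOn
          (fun v => 1 / (surv γ (gridBelow k v) * surv γ (min (gridAbove k v) w))) (Ico 0 c) γ := by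
        intro c hc
        refine IntegrableOn.of_bound (measure_lt_top _ _) (Measurable.aestronglyMeasurable ?_)
          (1 / (surv γ w * surv γ w)) ?_
        · exact measurable_const.div (((measurable_surv γ).comp (measurable_gridBelow k)).mul
            ((measurable_surv γ).comp ((measurable_gridAbove k).min measurable_const)))
        · filter_upwards [ae_restrict_mem measurableSet_Ico] with v hv
          have h1 : surv γ w ≤ surv γ (gridBelow k v) :=
            surv_anti γ ((gridBelow_le k v).trans (hv.2.le.trans hc))
          have h2 : surv γ w ≤ surv γ (min (gridAbove k v) w) := surv_anti γ (min_le_right _ _)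
          have h3 : 0 < surv γ (gridBelow k v) := hw.trans_le h1
          have h4 : 0 < surv γ (min (gridAbove k v) w) := hw.trans_le h2
          rw [Real.norm_of_nonneg (by positivity)]
          gcongr
      rw [hsplit, setIntegral_union (by
          rw [Set.disjoint_left]; exact fun x hx hx' => not_lt.2 hx'.1 hx.2) measurableSet_Ico
        (hint a h.le) ((hint b (min_le_right _ _)).mono_set (Ico_subset_Ico_left zero_le)), ih,
        setIntegral_congr_fun measurableSet_Ico hconst, setIntegral_const, smul_eq_mul,
        measureReal_Ico_eq γ hab]
      have h1 := (hpos a h.le).ne'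
      have h2 := (hpos b (min_le_right _ _)).ne'
      field_simp
      ring

/-- Refine the grid. The grid point below `v` gives `γ[v, ∞)` in the limit and the one strictly
above gives `γ(v, ∞)`, which explains the asymmetric density at atoms. The integrands are dominated
by `1 / S(w) ^ 2`. -/
theorem integral_Ico_odds {w : ℝ≥0} (hw : 0 < surv γ w) :
    ∫ v in Ico 0 w, 1 / (surv γ v * survGT γ v) ∂γ = 1 / surv γ w - 1 := by
  have hlim : Tendsto (fun k : ℕ => ∫ v in Ico 0 w,
      1 / (surv γ (gridBelow k v) * surv γ (min (gridAbove k v) w)) ∂γ) atTop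
      (𝓝 (∫ v in Ico 0 w, 1 / (surv γ v * survGT γ v) ∂γ)) := by
    refine tendsto_integral_of_dominated_convergence (fun _ => 1 / (surv γ w * surv γ w))
      (fun k => Measurable.aestronglyMeasurable ?_) (integrable_const _) (fun k => ?_) ?_
    · exact measurable_const.div (((measurable_surv γ).comp (measurable_gridBelow k)).mul
        ((measurable_surv γ).comp ((measurable_gridAbove k).min measurable_const)))
    · filter_upwards [ae_restrict_mem measurableSet_Ico] with v hv
      have h1 : surv γ w ≤ surv γ (gridBelow k v) :=
        surv_anti γ ((gridBelow_le k v).trans hv.2.le)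
      have h2 : surv γ w ≤ surv γ (min (gridAbove k v) w) := surv_anti γ (min_le_right _ _)
      have h3 : 0 < surv γ (gridBelow k v) := hw.trans_le h1
      have h4 : 0 < surv γ (min (gridAbove k v) w) := hw.trans_le h2
      rw [Real.norm_of_nonneg (by positivity)]
      gcongr
    · filter_upwards [ae_restrict_mem measurableSet_Ico] with v hv
      have h1 := (tendsto_surv_left γ v).comp (tendsto_gridBelow v)
      have h2 := (tendsto_surv_right γ v).comp (tendsto_gridAbove v)
      have h3 : Tendsto (fun k => surv γ (min (gridAbove k v) w)) atTop (𝓝 (survGT γ v)) := by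
        refine h2.congr' ?_
        have h4 := (tendsto_gridAbove v).mono_right nhdsWithin_le_nhds
        filter_upwards [h4.eventually (gt_mem_nhds hv.2)] with k hk
        rw [Function.comp_apply, min_eq_left (le_of_lt hk)]
      have h5 : surv γ v * survGT γ v ≠ 0 :=
        (mul_pos (hw.trans_le (surv_anti γ hv.2.le)) (hw.trans_le (surv_le_survGT γ hv.2))).ne'
      exact tendsto_const_nhds.div (h1.mul h3) h5
  refine tendsto_nhds_unique hlim (tendsto_const_nhds.congr fun k => ?_)
  obtain ⟨J, hJ⟩ := exists_nat_ge (w * ((k : ℝ≥0) + 1))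
  have h1 := integral_grid hw k J
  rw [min_eq_right (by rwa [le_div_iff₀ (by positivity)])] at h1
  exact h1.symm

theorem measurable_odds_density : Measurable fun v => 1 / (surv γ v * survGT γ v) :=
  measurable_const.div ((measurable_surv γ).mul (measurable_survGT γ))

theorem integrableOn_odds_density {w : ℝ≥0} (hw : 0 < surv γ w) :
    IntegrableOn (fun v => 1 / (surv γ v * survGT γ v)) (Ico 0 w) γ := by
  refine IntegrableOn.of_bound (measure_lt_top _ _)
    measurable_odds_density.aestronglyMeasurable (1 / (surv γ w * surv γ w)) ?_
  filter_upwards [ae_restrict_mem measurableSet_Ico] with v hv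
  rw [Real.norm_of_nonneg (odds_density_nonneg γ v)]
  have h1 := surv_anti γ hv.2.le
  have h2 := surv_le_survGT γ hv.2
  have h3 := surv_nonneg γ v
  exact one_div_le_one_div_of_le (mul_pos hw hw) (mul_le_mul h1 h2 hw.le h3)

theorem odds_Ioo (h0 : γ {0} = 0) {w : ℝ≥0} (hw : 0 < surv γ w) :
    odds γ (Ioo 0 w) = ENNReal.ofReal (1 / surv γ w - 1) := by
  rw [odds, withDensity_apply _ measurableSet_Ioo]
  have hae : (Ioo 0 w : Set ℝ≥0) =ᵐ[γ] Ico 0 w := by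
    refine (ae_eq_set).2 ⟨by rw [sdiff_eq_bot_iff.2 Ioo_subset_Ico_self]; exact measure_empty, ?_⟩
    refine measure_mono_null (fun x hx => ?_) h0
    by_contra hne
    exact hx.2 ⟨pos_iff_ne_zero.2 hne, hx.1.2⟩
  rw [setLIntegral_congr hae, ← integral_Ico_odds hw, ofReal_integral_eq_lintegral_ofReal
    (integrableOn_odds_density hw) (ae_of_all _ (odds_density_nonneg γ))]

theorem odds_real_Ioo (h0 : γ {0} = 0) {w : ℝ≥0} (hw : 0 < surv γ w) :
    (odds γ).real (Ioo 0 w) = 1 / surv γ w - 1 := by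
  rw [measureReal_def, odds_Ioo h0 hw, ENNReal.toReal_ofReal]
  rw [sub_nonneg, one_le_div hw]
  exact surv_le_one γ w

theorem isFiniteMeasure_odds (h0 : γ {0} = 0) {w : ℝ≥0} (hw : 0 < surv γ w) :
    IsFiniteMeasure ((odds γ).restrict (Ioo 0 w)) :=
  ⟨by rw [Measure.restrict_apply_univ, odds_Ioo h0 hw]; exact ENNReal.ofReal_lt_top⟩

/-- An atom at `c` contributes `(S(c) - S(c+)) / (S(c) S(c+)) = 1 / S(c+) - 1 / S(c)`, which turns
`S(c)` into `S(c+)`. -/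
theorem odds_real_Ioc (h0 : γ {0} = 0) {c : ℝ≥0} (hc0 : 0 < c) (hc : 0 < survGT γ c) :
    (odds γ).real (Ioc 0 c) = 1 / survGT γ c - 1 := by
  have hs : 0 < surv γ c := hc.trans_le (survGT_le_surv γ c)
  have h1 : Ioc 0 c = Ioo 0 c ∪ {c} := (Ioo_union_right hc0).symm
  have h2 : odds γ {c} = ENNReal.ofReal ((surv γ c - survGT γ c) / (surv γ c * survGT γ c)) := by
    rw [odds, withDensity_apply _ (measurableSet_singleton c), lintegral_singleton,
      ← measureReal_singleton_eq, ← ofReal_measureReal, ← ENNReal.ofReal_mul (by positivity)]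
    congr 1
    ring
  have h3 : (odds γ).real {c} = (surv γ c - survGT γ c) / (surv γ c * survGT γ c) := by
    rw [measureReal_def, h2, ENNReal.toReal_ofReal]
    have := survGT_le_surv γ c
    exact div_nonneg (by linarith) (by positivity)
  rw [h1, measureReal_union (by simp) (measurableSet_singleton c)
    (by rw [odds_Ioo h0 hs]; exact ENNReal.ofReal_ne_top) (by rw [h2]; exact ENNReal.ofReal_ne_top),
    odds_real_Ioo h0 hs, h3]
  have := hs.ne'
  have := hc.ne'
  field_simp
  ring

/-! ### Integrals of the reciprocal survival function -/

theorem integral_indicator_lt_left (e : Measure ℝ≥0) (u : ℝ≥0) :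
    ∫ v, {z : ℝ≥0 × ℝ≥0 | z.2 < z.1}.indicator (1 : ℝ≥0 × ℝ≥0 → ℝ) (u, v) ∂e = e.real (Iio u) := by
  rw [← integral_indicator_one measurableSet_Iio]
  rfl

/-- The reciprocal survival function as the mass of a half-line, the form in which Fubini's theorem
can be applied. -/
theorem inv_surv_eq (h0 : γ {0} = 0) {s u : ℝ≥0} (hu : u ≤ s) (hs : 0 < surv γ s) :
    1 / surv γ u = 1 + ((odds γ).restrict (Ioo 0 s)).real (Iio u) := by
  have h1 : Iio u ∩ Ioo 0 s = Ioo 0 u := by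
    ext x; simp only [mem_inter_iff, mem_Iio, mem_Ioo]
    exact ⟨fun h => ⟨h.2.1, h.1⟩, fun h => ⟨h.2, h.1, h.2.trans_le hu⟩⟩
  rw [measureReal_restrict_apply measurableSet_Iio, h1,
    odds_real_Ioo h0 (hs.trans_le (surv_anti γ hu))]
  ring

theorem IncRC.real_restrict_Ioi {f : ℝ≥0 → ℝ} (hf : IncRC f) {s v : ℝ≥0} (hv : v ≤ s) :
    ((lsMeasure f).restrict (Ioc 0 s)).real (Ioi v) = f s - f v := by
  have h1 : Ioi v ∩ Ioc 0 s = Ioc v s := by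
    ext x; simp only [mem_inter_iff, mem_Ioi, mem_Ioc]
    exact ⟨fun h => ⟨h.1, h.2.2⟩, fun h => ⟨h.1, zero_le.trans_lt h.1, h.2⟩⟩
  rw [measureReal_restrict_apply measurableSet_Ioi, h1, hf.lsMeasure_real_Ioc hv]

theorem IncRC.real_restrict_univ {f : ℝ≥0 → ℝ} (hf : IncRC f) (s : ℝ≥0) :
    ((lsMeasure f).restrict (Ioc 0 s)).real univ = f s - f 0 := by
  rw [measureReal_restrict_apply_univ, hf.lsMeasure_real_Ioc zero_le]

/-- `∫_0^s K⁻¹ df` by partial integration. -/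
theorem lsInt_inv_surv (h0 : γ {0} = 0) {f : ℝ≥0 → ℝ} (hf : IncRC f) {s : ℝ≥0}
    (hs : 0 < surv γ s) : lsInt (fun u => 1 / surv γ u) f s
      = (f s - f 0) + ∫ v in Ioo 0 s, (f s - f v) ∂(odds γ) := by
  have := isFiniteMeasure_odds h0 hs
  set m := (lsMeasure f).restrict (Ioc 0 s) with hm
  set e := (odds γ).restrict (Ioo 0 s) with he
  have hint : Integrable (fun z : ℝ≥0 × ℝ≥0 =>
      {z : ℝ≥0 × ℝ≥0 | z.2 < z.1}.indicator (1 : ℝ≥0 × ℝ≥0 → ℝ) z) (m.prod e) :=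
    (integrable_const (1 : ℝ)).indicator (measurableSet_lt measurable_snd measurable_fst)
  have h1 : lsInt (fun u => 1 / surv γ u) f s = ∫ u, (1 + ∫ v,
      {z : ℝ≥0 × ℝ≥0 | z.2 < z.1}.indicator (1 : ℝ≥0 × ℝ≥0 → ℝ) (u, v) ∂e) ∂m := by
    refine setIntegral_congr_fun measurableSet_Ioc fun u hu => ?_
    simp only [integral_indicator_lt_left]
    exact inv_surv_eq h0 hu.2 hs
  rw [h1, integral_add (integrable_const _) hint.integral_prod_left,
    integral_integral_swap (f := fun u v =>
      {z : ℝ≥0 × ℝ≥0 | z.2 < z.1}.indicator (1 : ℝ≥0 × ℝ≥0 → ℝ) (u, v)) hint]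
  congr 1
  · rw [integral_const, smul_eq_mul, mul_one, hf.real_restrict_univ]
  · refine setIntegral_congr_fun measurableSet_Ioo fun v hv => ?_
    have h2 : ∫ u, {z : ℝ≥0 × ℝ≥0 | z.2 < z.1}.indicator (1 : ℝ≥0 × ℝ≥0 → ℝ) (u, v) ∂m
        = m.real (Ioi v) := by
      rw [← integral_indicator_one measurableSet_Ioi]
      rfl
    simp only [h2]
    exact hf.real_restrict_Ioi hv.2.le

/-- The covariance identity for stopped integrals of the reciprocal survival function. -/
theorem integral_lsInt_mul_lsInt (h0 : γ {0} = 0) {f g : ℝ≥0 → ℝ} (hf : IncRC f) (hg : IncRC g)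
    {s : ℝ≥0} (hs : 0 < surv γ s) :
    ∫ c, lsInt (fun u => 1 / surv γ u) f (min s c) * lsInt (fun u => 1 / surv γ u) g (min s c) ∂γ
      = (f s - f 0) * (g s - g 0)
        + ∫ v in Ioo 0 s, (f s - f v) * (g s - g v) ∂(odds γ) := by
  have := isFiniteMeasure_odds h0 hs
  set m := (lsMeasure f).restrict (Ioc 0 s) with hm
  set m' := (lsMeasure g).restrict (Ioc 0 s) with hm'
  set e := (odds γ).restrict (Ioo 0 s) with he
  -- Capping the argument at `s` makes the weight bounded on the whole line without changing it on
  -- `(0, s]`.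
  let k : ℝ≥0 → ℝ := fun u => 1 / surv γ (min u s)
  have hk : Measurable k := measurable_const.div
    ((measurable_surv γ).comp (measurable_id.min measurable_const))
  have hkpos : ∀ u, 0 < surv γ (min u s) := fun u => hs.trans_le (surv_anti γ (min_le_right _ _))
  have hkb : ∀ u, |k u| ≤ 1 / surv γ s := fun u => by
    rw [abs_of_nonneg (by have := hkpos u; positivity)]
    exact one_div_le_one_div_of_le hs (surv_anti γ (min_le_right _ _))
  let H : ℝ≥0 → ℝ≥0 → ℝ := fun c u => (Iic c).indicator 1 u * k u
  have hH : ∀ (F : ℝ≥0 → ℝ) (c : ℝ≥0), lsInt (fun u => 1 / surv γ u) F (min s c)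
      = ∫ u, H c u ∂((lsMeasure F).restrict (Ioc 0 s)) := fun F c => by
    rw [← lsInt_indicator_mul]
    refine lsInt_congr fun u _ hu => ?_
    simp only [H, k, min_eq_left hu]
  have hHm : Measurable (fun q : ℝ≥0 × ℝ≥0 => H q.1 q.2) := by
    have : (fun q : ℝ≥0 × ℝ≥0 => H q.1 q.2) = fun q =>
        {q : ℝ≥0 × ℝ≥0 | q.2 ≤ q.1}.indicator (1 : ℝ≥0 × ℝ≥0 → ℝ) q * k q.2 := rfl
    rw [this]
    exact (measurable_one.indicator (measurableSet_le measurable_snd measurable_fst)).mul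
      (hk.comp measurable_snd)
  have hHb : ∀ c u, |H c u| ≤ 1 / surv γ s := fun c u => by
    by_cases hu : u ∈ Iic c
    · simpa [H, hu] using hkb u
    · simp only [H, Set.indicator_of_notMem hu, zero_mul, abs_zero]
      positivity
  have hHH : Integrable (fun q : ℝ≥0 × (ℝ≥0 × ℝ≥0) => H q.1 q.2.1 * H q.1 q.2.2)
      (γ.prod (m.prod m')) := by
    refine Integrable.of_bound (Measurable.aestronglyMeasurable ?_)
      (1 / surv γ s * (1 / surv γ s)) (ae_of_all _ fun q => ?_)
    · exact (hHm.comp (measurable_fst.prodMk (measurable_fst.comp measurable_snd))).mul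
        (hHm.comp (measurable_fst.prodMk (measurable_snd.comp measurable_snd)))
    · rw [Real.norm_eq_abs, abs_mul]
      gcongr <;> exact hHb _ _
  have hpair : Integrable (fun q : (ℝ≥0 × ℝ≥0) × ℝ≥0 =>
      (if q.2 < q.1.1 then (1 : ℝ) else 0) * (if q.2 < q.1.2 then 1 else 0)) ((m.prod m').prod e) := by
    refine Integrable.of_bound (Measurable.aestronglyMeasurable ?_) 1 (ae_of_all _ fun q => ?_)
    · exact (Measurable.ite (measurableSet_lt measurable_snd (measurable_fst.comp measurable_fst))
        measurable_const measurable_const).mul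
        (Measurable.ite (measurableSet_lt measurable_snd (measurable_snd.comp measurable_fst))
        measurable_const measurable_const)
    · split_ifs <;> simp
  calc _ = ∫ c, ∫ z : ℝ≥0 × ℝ≥0, H c z.1 * H c z.2 ∂(m.prod m') ∂γ := by
        congr 1
        funext c
        rw [hH, hH, ← integral_prod_mul]
    _ = ∫ z : ℝ≥0 × ℝ≥0, ∫ c, H c z.1 * H c z.2 ∂γ ∂(m.prod m') :=
        integral_integral_swap (f := fun c (z : ℝ≥0 × ℝ≥0) => H c z.1 * H c z.2) hHH
    _ = ∫ z : ℝ≥0 × ℝ≥0, (1 + ∫ v, (if v < z.1 then (1 : ℝ) else 0) * (if v < z.2 then 1 else 0) ∂e)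
          ∂(m.prod m') := by
        rw [hm, hm', Measure.prod_restrict]
        refine setIntegral_congr_fun (measurableSet_Ioc.prod measurableSet_Ioc) fun z hz => ?_
        obtain ⟨⟨_, hz1⟩, ⟨_, hz2⟩⟩ := hz
        -- The product of indicators integrates to `S(max)`, and `S(max) / (S(z₁) S(z₂)) = 1 /
        -- S(min)`. By `inv_surv_eq` this is one plus a mass, and the indicator of `v < min`
        -- factorizes again.
        have h1 : ∫ c, H c z.1 * H c z.2 ∂γ = surv γ (max z.1 z.2) * (k z.1 * k z.2) := by
          rw [surv, ← integral_indicator_one measurableSet_Ici, ← integral_mul_const]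
          congr 1
          funext c
          by_cases hc1 : z.1 ≤ c <;> by_cases hc2 : z.2 ≤ c <;> simp [H, hc1, hc2]
        have h2 : ∫ v, (if v < z.1 then (1 : ℝ) else 0) * (if v < z.2 then 1 else 0) ∂e
            = e.real (Iio (min z.1 z.2)) := by
          rw [← integral_indicator_one measurableSet_Iio]
          congr 1
          funext v
          by_cases hc1 : v < z.1 <;> by_cases hc2 : v < z.2 <;> simp [hc1, hc2]
        simp only [h1, h2, k, min_eq_left hz1, min_eq_left hz2]
        rw [← inv_surv_eq h0 ((min_le_left _ _).trans hz1) hs]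
        have h3 := hs.trans_le (surv_anti γ hz1)
        have h4 := hs.trans_le (surv_anti γ hz2)
        rcases le_total z.1 z.2 with h | h
        · rw [max_eq_right h, min_eq_left h]; field_simp
        · rw [max_eq_left h, min_eq_right h]; field_simp
    _ = _ := by
        rw [integral_add (integrable_const _) hpair.integral_prod_left,
          integral_integral_swap (f := fun (z : ℝ≥0 × ℝ≥0) v =>
            (if v < z.1 then (1 : ℝ) else 0) * (if v < z.2 then 1 else 0)) hpair]
        congr 1
        · rw [integral_const, smul_eq_mul, mul_one, ← univ_prod_univ, measureReal_prod_prod,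
            hf.real_restrict_univ, hg.real_restrict_univ]
        · refine setIntegral_congr_fun measurableSet_Ioo fun v hv => ?_
          have h2 : ∀ m : Measure ℝ≥0, ∫ u, (if v < u then (1 : ℝ) else 0) ∂m = m.real (Ioi v) := by
            intro m
            rw [← integral_indicator_one measurableSet_Ioi]
            rfl
          rw [integral_prod_mul (fun u => if v < u then (1 : ℝ) else 0)
            (fun u => if v < u then (1 : ℝ) else 0), h2, h2, hf.real_restrict_Ioi hv.2.le,
            hg.real_restrict_Ioi hv.2.le]

end Survival

end CensRec
end

noncomputable section

namespace CensRec

/-! ### Measurability of Lebesgue–Stieltjes integrals -/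

section Grid

/-- For a left-continuous bounded integrand the integral is a limit of finite combinations of values
of `f`. Measurability and the exchange with expectations both rest on this. -/
theorem tendsto_lsInt_grid {g f : ℝ≥0 → ℝ} {s : ℝ≥0} {S : ℝ} (hf : IncRC f)
    (hg : ∀ u, 0 < u → u ≤ s → Tendsto g (𝓝[<] u) (𝓝 (g u))) (hS : ∀ u, |g u| ≤ S) :
    Tendsto (fun k : ℕ => ∑ j ∈ Finset.range ⌈((k : ℝ≥0) + 1) * s⌉₊,
        g ((j : ℝ≥0) / ((k : ℝ≥0) + 1)) * (f (min s (((j : ℝ≥0) + 1) / ((k : ℝ≥0) + 1)))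
          - f (min s ((j : ℝ≥0) / ((k : ℝ≥0) + 1))))) atTop (𝓝 (lsInt g f s)) := by
  -- The cells are open on the left and closed on the right, so the cell of `u` has index `⌈(k + 1)
  -- u⌉ - 1`; its left endpoint is strictly below `u`.
  let tag : ℕ → ℝ≥0 → ℝ≥0 := fun k u => ((⌈((k : ℝ≥0) + 1) * u⌉₊ - 1 : ℕ) : ℝ≥0) / ((k : ℝ≥0) + 1)
  have htag1 : ∀ k u, 0 < u → tag k u < u := by
    intro k u hu
    have h1 : ⌈((k : ℝ≥0) + 1) * u⌉₊ ≠ 0 := (Nat.ceil_pos.2 (by positivity)).ne'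
    have h2 := ((Nat.ceil_eq_iff h1).1 rfl).1
    rw [div_lt_iff₀ (by positivity), mul_comm u]
    exact h2
  have htag2 : ∀ k u, u ≤ tag k u + 1 / ((k : ℝ≥0) + 1) := by
    intro k u
    rw [← add_div, le_div_iff₀ (by positivity), mul_comm u]
    refine (Nat.le_ceil _).trans ?_
    norm_cast
    omega
  have htag : ∀ u, 0 < u → Tendsto (fun k => tag k u) atTop (𝓝[<] u) := by
    intro u hu
    refine tendsto_nhdsWithin_of_tendsto_nhds_of_eventually_within _ ?_
      (Eventually.of_forall fun k => htag1 k u hu)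
    have h0 : Tendsto (fun k : ℕ => 1 / ((k : ℝ≥0) + 1)) atTop (𝓝 0) :=
      tendsto_one_div_add_atTop_nhds_zero_nat
    have h1 : Tendsto (fun k : ℕ => u - 1 / ((k : ℝ≥0) + 1)) atTop (𝓝 (u - 0)) :=
      tendsto_const_nhds.sub h0
    rw [tsub_zero] at h1
    exact tendsto_of_tendsto_of_tendsto_of_le_of_le h1 tendsto_const_nhds
      (fun k => tsub_le_iff_right.2 (htag2 k u)) (fun k => (htag1 k u hu).le)
  have hlim : Tendsto (fun k => ∫ u in Ioc 0 s, g (tag k u) ∂(lsMeasure f)) atTop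
      (𝓝 (lsInt g f s)) := by
    refine tendsto_integral_of_dominated_convergence (fun _ => S) (fun k => ?_)
      (integrable_const S) (fun k => ae_of_all _ fun u => hS _) ?_
    · have h1 : Measurable fun u : ℝ≥0 => ⌈((k : ℝ≥0) + 1) * u⌉₊ :=
        Nat.measurable_ceil.comp (measurable_const.mul measurable_id)
      exact (Measurable.comp (g := fun n : ℕ => g (((n - 1 : ℕ) : ℝ≥0) / ((k : ℝ≥0) + 1)))
        (measurable_from_nat) h1).aestronglyMeasurable
    · filter_upwards [ae_restrict_mem measurableSet_Ioc] with u hu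
      exact (hg u hu.1 hu.2).comp (htag u hu.1)
  refine hlim.congr fun k => ?_
  have hk : (0 : ℝ≥0) < (k : ℝ≥0) + 1 := by positivity
  have hind : ∀ u ∈ Ioc 0 s, g (tag k u) = ∑ j ∈ Finset.range ⌈((k : ℝ≥0) + 1) * s⌉₊,
      (Ioc ((j : ℝ≥0) / ((k : ℝ≥0) + 1)) (((j : ℝ≥0) + 1) / ((k : ℝ≥0) + 1))).indicator
        (fun _ => g ((j : ℝ≥0) / ((k : ℝ≥0) + 1))) u := by
    intro u hu
    have h1 : ⌈((k : ℝ≥0) + 1) * u⌉₊ ≠ 0 := (Nat.ceil_pos.2 (mul_pos hk hu.1)).ne'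
    have h2 : ⌈((k : ℝ≥0) + 1) * u⌉₊ ≤ ⌈((k : ℝ≥0) + 1) * s⌉₊ :=
      Nat.ceil_mono (mul_le_mul_right hu.2 _)
    rw [Finset.sum_eq_single (⌈((k : ℝ≥0) + 1) * u⌉₊ - 1)]
    · have h3 := htag2 k u
      rw [← add_div] at h3
      have h4 : u ∈ Ioc (tag k u) ((((⌈((k : ℝ≥0) + 1) * u⌉₊ - 1 : ℕ) : ℝ≥0) + 1)
          / ((k : ℝ≥0) + 1)) := ⟨htag1 k u hu.1, h3⟩
      exact (Set.indicator_of_mem h4 (fun _ => g (tag k u))).symm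
    · intro j _ hj
      refine Set.indicator_of_notMem (fun hmem => hj ?_) _
      have h3 : ⌈((k : ℝ≥0) + 1) * u⌉₊ = j + 1 := by
        rw [Nat.ceil_eq_iff (by omega)]
        have h4 := (div_lt_iff₀ hk).1 hmem.1
        have h5 := (le_div_iff₀ hk).1 hmem.2
        rw [mul_comm u] at h4 h5
        exact ⟨by simpa using h4, by push_cast; exact h5⟩
      omega
    · intro h3
      exact absurd (Finset.mem_range.2 (by omega)) h3
  rw [setIntegral_congr_fun measurableSet_Ioc hind, integral_finsetSum]
  · refine Finset.sum_congr rfl fun j _ => ?_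
    have h1 : Ioc ((j : ℝ≥0) / ((k : ℝ≥0) + 1)) (((j : ℝ≥0) + 1) / ((k : ℝ≥0) + 1)) ∩ Ioc 0 s
        = Ioc (min s ((j : ℝ≥0) / ((k : ℝ≥0) + 1))) (min s (((j : ℝ≥0) + 1) / ((k : ℝ≥0) + 1))) := by
      ext x
      simp only [mem_inter_iff, mem_Ioc, min_lt_iff, le_min_iff]
      constructor
      · rintro ⟨⟨h1, h2⟩, h3, h4⟩
        exact ⟨Or.inr h1, h4, h2⟩
      · rintro ⟨h1, h4, h2⟩
        have h5 := h1.resolve_left (not_lt.2 h4)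
        exact ⟨⟨h5, h2⟩, zero_le.trans_lt h5, h4⟩
    rw [integral_indicator_const _ measurableSet_Ioc, smul_eq_mul, mul_comm,
      measureReal_restrict_apply measurableSet_Ioc, h1, hf.lsMeasure_real_Ioc]
    exact min_le_min_left _ (by gcongr; exact le_self_add)
  · exact fun j _ => (integrable_const _).indicator measurableSet_Ioc

theorem measurable_lsInt {β : Type*} [MeasurableSpace β] {g : ℝ≥0 → ℝ} {F : β → ℝ≥0 → ℝ}
    {s : ℝ≥0} {S : ℝ} (hF : ∀ b, IncRC (F b)) (hm : ∀ u, Measurable fun b => F b u)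
    (hg : ∀ u, 0 < u → u ≤ s → Tendsto g (𝓝[<] u) (𝓝 (g u))) (hS : ∀ u, |g u| ≤ S) :
    Measurable fun b => lsInt g (F b) s := by
  refine measurable_of_tendsto_metrizable (fun k => ?_)
    (tendsto_pi_nhds.2 fun b => tendsto_lsInt_grid (hF b) hg hS)
  exact Finset.measurable_sum _ fun j _ => ((hm _).sub (hm _)).const_mul _

theorem aemeasurable_lsInt {β : Type*} [MeasurableSpace β] {m : Measure β} {g F : β → ℝ≥0 → ℝ}
    {s : ℝ≥0} {S : ℝ} (hF : ∀ b, IncRC (F b)) (hm : ∀ u, AEMeasurable (fun b => F b u) m)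
    (hgm : ∀ u, AEMeasurable (fun b => g b u) m)
    (hg : ∀ b u, 0 < u → u ≤ s → Tendsto (g b) (𝓝[<] u) (𝓝 (g b u))) (hS : ∀ b u, |g b u| ≤ S) :
    AEMeasurable (fun b => lsInt (g b) (F b) s) m := by
  refine aemeasurable_of_tendsto_metrizable_ae atTop (fun k => ?_)
    (ae_of_all _ fun b => tendsto_lsInt_grid (hF b) (hg b) (hS b))
  exact Finset.aemeasurable_fun_sum _ fun j _ => (hgm _).mul ((hm _).sub (hm _))

end Grid

/-! ### The space of counting paths -/

/-- The paths of counting processes, with the σ-algebra generated by the evaluations. -/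
abbrev Path := {x : ℝ≥0 → ℝ // IsCountingPath x}

section PathSpace

variable {Ω : Type*}

theorem measurable_path_eval (u : ℝ≥0) : Measurable fun x : Path => x.1 u :=
  (measurable_pi_apply u).comp measurable_subtype_coe

/-- By right continuity a path may be evaluated at the next grid point instead, and grid points are
countable in number. -/
theorem measurable_eval : Measurable fun z : Path × ℝ≥0 => z.1.1 z.2 := by
  refine measurable_of_tendsto_metrizable (f := fun (k : ℕ) (z : Path × ℝ≥0) => z.1.1 (gridAbove k z.2))
    (fun k => ?_) (tendsto_pi_nhds.2 fun z => ?_)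
  · have h1 : Measurable fun z : Path × ℕ => z.1.1 (((z.2 : ℝ≥0) + 1) / ((k : ℝ≥0) + 1)) :=
      measurable_from_prod_countable_left fun n =>
        measurable_path_eval (((n : ℝ≥0) + 1) / ((k : ℝ≥0) + 1))
    exact h1.comp (measurable_fst.prodMk (Nat.measurable_floor.comp
      (measurable_const.mul measurable_snd)))
  · exact (z.1.2.right_cont z.2).tendsto.comp
      ((tendsto_gridAbove z.2).mono_right (nhdsWithin_mono _ Ioi_subset_Ici_self))

theorem measurable_path_atInfty : Measurable fun x : Path => atInfty x.1 :=
  measurable_of_tendsto_metrizable (f := fun (k : ℕ) (x : Path) => x.1 (k : ℝ≥0))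
    (fun _ => measurable_path_eval _)
    (tendsto_pi_nhds.2 fun x => x.2.tendsto_atInfty.comp tendsto_natCast_atTop_atTop)

/-- The inclusion of the observations into the product space. -/
def pathIncl (z : Path × ℝ≥0) : (ℝ≥0 → ℝ) × ℝ≥0 := (z.1.1, z.2)

/-- The σ-algebra on the path space is exactly the trace of the product σ-algebra. Independence and
equality in law therefore transfer to it, although the set of counting paths need not be measurable.
-/
theorem comap_pathIncl : MeasurableSpace.comap pathIncl inferInstance
    = (inferInstance : MeasurableSpace (Path × ℝ≥0)) := by
  change MeasurableSpace.comap pathIncl (MeasurableSpace.comap Prod.fst _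
    ⊔ MeasurableSpace.comap Prod.snd _) = MeasurableSpace.comap Prod.fst (MeasurableSpace.comap
      Subtype.val _) ⊔ MeasurableSpace.comap Prod.snd _
  rw [MeasurableSpace.comap_sup, MeasurableSpace.comap_comp, MeasurableSpace.comap_comp,
    MeasurableSpace.comap_comp]
  rfl

/-- An observation as an element of the path space. -/
def obs {X : Ω → (ℝ≥0 → ℝ) × ℝ≥0} (h : ∀ ω, IsCountingPath (X ω).1) (ω : Ω) : Path × ℝ≥0 :=
  (⟨(X ω).1, h ω⟩, (X ω).2)

theorem comap_obs {X : Ω → (ℝ≥0 → ℝ) × ℝ≥0} (h : ∀ ω, IsCountingPath (X ω).1) :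
    MeasurableSpace.comap (obs h) inferInstance = MeasurableSpace.comap X inferInstance := by
  rw [← comap_pathIncl, MeasurableSpace.comap_comp]
  rfl

variable [MeasurableSpace Ω]

theorem aemeasurable_obs {P : Measure Ω} {X : Ω → (ℝ≥0 → ℝ) × ℝ≥0}
    (h : ∀ ω, IsCountingPath (X ω).1) (hX : AEMeasurable X P) : AEMeasurable (obs h) P :=
  (AEMeasurable.subtype_mk (measurable_fst.comp_aemeasurable hX)).prodMk
    (measurable_snd.comp_aemeasurable hX)

theorem iIndepFun_obs {P : Measure Ω} {X : ℕ → Ω → (ℝ≥0 → ℝ) × ℝ≥0}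
    (h : ∀ i ω, IsCountingPath (X i ω).1) (hX : iIndepFun X P) :
    iIndepFun (fun i => obs (h i)) P := by
  rw [iIndepFun_iff_iIndep] at hX ⊢
  simpa only [comap_obs] using hX

theorem identDistrib_obs {Ω' : Type*} [MeasurableSpace Ω'] {P : Measure Ω} {P' : Measure Ω'}
    {X : Ω → (ℝ≥0 → ℝ) × ℝ≥0} {Y : Ω' → (ℝ≥0 → ℝ) × ℝ≥0} (hX : ∀ ω, IsCountingPath (X ω).1)
    (hY : ∀ ω, IsCountingPath (Y ω).1) (h : IdentDistrib X Y P P') :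
    IdentDistrib (obs hX) (obs hY) P P' where
  aemeasurable_fst := aemeasurable_obs hX h.aemeasurable_fst
  aemeasurable_snd := aemeasurable_obs hY h.aemeasurable_snd
  map_eq := by
    refine Measure.ext fun S hS => ?_
    have hS' : MeasurableSet[MeasurableSpace.comap pathIncl inferInstance] S := by
      rw [comap_pathIncl]; exact hS
    obtain ⟨T, hT, rfl⟩ := hS'
    rw [Measure.map_apply_of_aemeasurable (aemeasurable_obs hX h.aemeasurable_fst) hS,
      Measure.map_apply_of_aemeasurable (aemeasurable_obs hY h.aemeasurable_snd) hS]
    exact h.measure_mem_eq hT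

/-- The law of a counting process and an independent time is a product measure. -/
theorem map_obs_eq {P : Measure Ω} [IsProbabilityMeasure P] {N : Ω → ℝ≥0 → ℝ} {C : Ω → ℝ≥0}
    (hN : Measurable N) (h : ∀ ω, IsCountingPath (N ω)) (hC : Measurable C)
    (hindep : IndepFun N C P) :
    P.map (fun ω => ((⟨N ω, h ω⟩ : Path), C ω))
      = (P.prod (P.map C)).map fun z => ((⟨N z.1, h z.1⟩ : Path), z.2) := by
  have hN' : Measurable fun ω => (⟨N ω, h ω⟩ : Path) := hN.subtype_mk
  have := Measure.isProbabilityMeasure_map (μ := P) hC.aemeasurable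
  have hind : IndepFun (fun ω => (⟨N ω, h ω⟩ : Path)) C P := by
    rw [IndepFun_iff_Indep] at hindep ⊢
    have : MeasurableSpace.comap (fun ω => (⟨N ω, h ω⟩ : Path)) inferInstance
        = MeasurableSpace.comap N inferInstance := by
      change MeasurableSpace.comap _ (MeasurableSpace.comap Subtype.val _) = _
      rw [MeasurableSpace.comap_comp]
      rfl
    rw [this]
    exact hindep
  rw [(indepFun_iff_map_prod_eq_prod_map_map hN'.aemeasurable hC.aemeasurable).1 hind]
  have h2 := Measure.map_prod_map P (P.map C) hN' measurable_id
  rw [Measure.map_id] at h2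
  exact h2

end PathSpace

end CensRec
end

noncomputable section

namespace CensRec

/-! ### Mean functions -/

section Mean

variable {Ω : Type*} [MeasurableSpace Ω]

/-- A nonnegative process with increasing right-continuous paths and an integrable bound. -/
structure DomProc (P : Measure Ω) (Z : Ω → ℝ≥0 → ℝ) (B : Ω → ℝ) : Prop where
  incRC : ∀ ω, IncRC (Z ω)
  aemeas : ∀ u, AEMeasurable (fun ω => Z ω u) P
  nonneg : ∀ ω u, 0 ≤ Z ω u
  le : ∀ ω u, Z ω u ≤ B ω
  integrable_bound : Integrable B P

variable {P : Measure Ω} {Z : Ω → ℝ≥0 → ℝ} {B : Ω → ℝ}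

theorem DomProc.integrable (h : DomProc P Z B) (u : ℝ≥0) : Integrable (fun ω => Z ω u) P :=
  h.integrable_bound.mono' (h.aemeas u).aestronglyMeasurable
    (ae_of_all _ fun ω => by rw [Real.norm_of_nonneg (h.nonneg ω u)]; exact h.le ω u)

theorem DomProc.incRC_meanFun (h : DomProc P Z B) : IncRC (meanFun P Z) where
  mono := fun _ _ huv => integral_mono (h.integrable _) (h.integrable _)
    fun ω => (h.incRC ω).mono huv
  right_cont := fun s => tendsto_integral_filter_of_dominated_convergence B
    (Eventually.of_forall fun u => (h.aemeas u).aestronglyMeasurable)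
    (Eventually.of_forall fun u => ae_of_all _ fun ω => by
      rw [Real.norm_of_nonneg (h.nonneg ω u)]; exact h.le ω u) h.integrable_bound
    (ae_of_all _ fun ω => (h.incRC ω).right_cont s)

theorem DomProc.meanFun_nonneg (h : DomProc P Z B) (u : ℝ≥0) : 0 ≤ meanFun P Z u :=
  integral_nonneg fun ω => h.nonneg ω u

theorem DomProc.meanFun_le (h : DomProc P Z B) (u : ℝ≥0) : meanFun P Z u ≤ ∫ ω, B ω ∂P :=
  integral_mono (h.integrable u) h.integrable_bound fun ω => h.le ω u

theorem DomProc.memWr_meanFun (h : DomProc P Z B) {p : ℝ} (hp : 1 ≤ p) : MemWr p (meanFun P Z) :=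
  h.incRC_meanFun.memWr hp (M := ∫ ω, B ω ∂P) fun x y => by linarith [h.meanFun_nonneg x, h.meanFun_le y]

theorem domProc_counting [IsProbabilityMeasure P] (hZ : ∀ ω, IsCountingPath (Z ω))
    (hm : ∀ u, AEMeasurable (fun ω => Z ω u) P)
    (h2 : MemLp (fun ω => atInfty (Z ω)) 2 P) : DomProc P Z (fun ω => atInfty (Z ω)) where
  incRC ω := (hZ ω).incRC
  aemeas := hm
  nonneg ω := (hZ ω).nonneg
  le ω := (hZ ω).le_atInfty
  integrable_bound := h2.integrable one_le_two

end Mean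

/-! ### The censoring distribution -/

section Censoring

variable {Ω : Type*} [MeasurableSpace Ω] {P : Measure Ω} {C : Ω → ℝ≥0}

theorem survFun_eq (hC : Measurable C) : survFun P C = surv (P.map C) := by
  funext s
  rw [surv, map_measureReal_apply hC measurableSet_Ici]
  rfl

theorem distFun_eq (hC : Measurable C) (s : ℝ≥0) : distFun P C s = (P.map C).real (Iic s) := by
  rw [map_measureReal_apply hC measurableSet_Iic]
  rfl

theorem map_singleton_zero (hC : Measurable C) (hpos : ∀ ω, 0 < C ω) : (P.map C) {0} = 0 := by
  rw [Measure.map_apply hC (measurableSet_singleton 0)]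
  convert! measure_empty (μ := P)
  ext ω
  simp [(hpos ω).ne']

theorem distFun_nonneg (s : ℝ≥0) : 0 ≤ distFun P C s := measureReal_nonneg

theorem survGT_nonneg (γ : Measure ℝ≥0) (u : ℝ≥0) : 0 ≤ survGT γ u := measureReal_nonneg

theorem measurable_ofReal_inv_survGT (γ : Measure ℝ≥0) [IsProbabilityMeasure γ] :
    Measurable fun u => ENNReal.ofReal (1 / survGT γ u) :=
  (measurable_const.div (measurable_survGT γ)).ennreal_ofReal

variable [IsProbabilityMeasure P]

theorem incRC_distFun (hC : Measurable C) : IncRC (distFun P C) := by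
  have := Measure.isProbabilityMeasure_map (μ := P) hC.aemeasurable
  rw [show distFun P C = _ from funext (distFun_eq hC)]
  refine ⟨fun _ _ h => measureReal_mono (Iic_subset_Iic.2 h), fun s => ?_⟩
  refine tendsto_real_of_eventually _ (fun _ => measurableSet_Iic) fun x => ?_
  rcases le_or_gt x s with hx | hx
  · filter_upwards [self_mem_nhdsWithin] with a ha
    exact iff_of_true (hx.trans ha) hx
  · filter_upwards [nhdsWithin_le_nhds (gt_mem_nhds hx)] with a ha
    exact iff_of_false (not_le.2 ha) (not_le.2 hx)

theorem distFun_le_one (s : ℝ≥0) : distFun P C s ≤ 1 := measureReal_le_one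

theorem memWr_distFun (hC : Measurable C) {p : ℝ} (hp : 1 ≤ p) : MemWr p (distFun P C) :=
  (incRC_distFun hC).memWr hp (M := 1) fun x y => by
    linarith [distFun_nonneg (P := P) (C := C) x, distFun_le_one (P := P) (C := C) y]

theorem atInfty_distFun (hC : Measurable C) : atInfty (distFun P C) = 1 := by
  have := Measure.isProbabilityMeasure_map (μ := P) hC.aemeasurable
  refine Tendsto.limUnder_eq ?_
  rw [show distFun P C = _ from funext (distFun_eq hC), ← probReal_univ (μ := P.map C)]
  refine tendsto_real_of_eventually _ (fun _ => measurableSet_Iic) fun x => ?_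
  filter_upwards [eventually_ge_atTop x] with a ha
  exact iff_of_true ha trivial

theorem leftLim_distFun (hC : Measurable C) (hpos : ∀ ω, 0 < C ω) (s : ℝ≥0) :
    Function.leftLim (distFun P C) s = (P.map C).real (Iio s) := by
  have := Measure.isProbabilityMeasure_map (μ := P) hC.aemeasurable
  rcases eq_or_ne s 0 with rfl | hs
  -- The left limit at zero is by convention the value `P(C ≤ 0)`, which is zero since `C` is
  -- positive.
  · have h1 : Iio (0 : ℝ≥0) = ∅ := by ext; simp
    have h2 : Iic (0 : ℝ≥0) = {0} := by ext; simp
    rw [leftLim_eq_of_eq_bot _ (by rw [h1, nhdsWithin_empty]), distFun_eq hC, h1, h2,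
      measureReal_def, map_singleton_zero hC hpos]
    simp
  · have hne : (𝓝[<] s).NeBot := nhdsLT_neBot_of_exists_lt ⟨0, pos_iff_ne_zero.2 hs⟩
    refine leftLim_eq_of_tendsto ?_
    rw [show distFun P C = _ from funext (distFun_eq hC)]
    refine tendsto_real_of_eventually _ (fun _ => measurableSet_Iic) fun x => ?_
    rcases lt_or_ge x s with hx | hx
    · filter_upwards [nhdsWithin_le_nhds (lt_mem_nhds hx)] with a ha
      exact iff_of_true (le_of_lt ha) hx
    · filter_upwards [self_mem_nhdsWithin] with a ha
      exact iff_of_false (not_le.2 (lt_of_lt_of_le ha hx)) (not_lt.2 hx)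

theorem kFun_distFun (hC : Measurable C) (hpos : ∀ ω, 0 < C ω) {p : ℝ} [hp : Fact (1 ≤ p)]
    {f : Wr ℝ≥0 p × Wr ℝ≥0 p} (hf : (f.2 : ℝ≥0 → ℝ) = distFun P C) (s : ℝ≥0) :
    kFun f s = surv (P.map C) s := by
  have := Measure.isProbabilityMeasure_map (μ := P) hC.aemeasurable
  rw [kFun, hf, atInfty_distFun hC, leftLim_distFun hC hpos, surv, ← compl_Iio,
    probReal_compl_eq_one_sub measurableSet_Iio]

theorem lsMeasure_distFun_restrict (hC : Measurable C) (s : ℝ≥0) :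
    (lsMeasure (distFun P C)).restrict (Ioc 0 s) = (P.map C).restrict (Ioc 0 s) := by
  have := Measure.isProbabilityMeasure_map (μ := P) hC.aemeasurable
  refine (incRC_distFun hC).lsMeasure_restrict_eq fun a _ => ?_
  rw [distFun_eq hC, distFun_eq hC, ← measureReal_sdiff (Iic_subset_Iic.2 zero_le)
    measurableSet_Iic, Iic_sdiff_Iic, ofReal_measureReal]

/-- The density `1 / (S(u) S(u+))` splits into the hazard density `1 / S(u)` and the factor `1 /
S(u+)` of the asymptotic variance. -/
theorem odds_restrict_eq (hC : Measurable C) (s : ℝ≥0) :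
    (odds (P.map C)).restrict (Ioo 0 s) = ((hazard P C).restrict (Ioo 0 s)).withDensity
      fun u => ENNReal.ofReal (1 / survGT (P.map C) u) := by
  have := Measure.isProbabilityMeasure_map (μ := P) hC.aemeasurable
  have h1 : (lsMeasure (distFun P C)).restrict (Ioo 0 s) = (P.map C).restrict (Ioo 0 s) := by
    have h := congrArg (fun m => m.restrict (Ioo 0 s)) (lsMeasure_distFun_restrict (P := P) hC s)
    simpa only [Measure.restrict_restrict measurableSet_Ioo,
      inter_eq_left.2 Ioo_subset_Ioc_self] using h
  rw [hazard, survFun_eq hC, odds, restrict_withDensity measurableSet_Ioo,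
    restrict_withDensity measurableSet_Ioo, h1, ← withDensity_mul]
  · congr 1
    funext u
    rw [Pi.mul_apply, ← ENNReal.ofReal_mul (one_div_nonneg.2 (surv_nonneg _ _)),
      one_div_mul_one_div]
  · exact (measurable_const.div (measurable_surv _)).ennreal_ofReal
  · exact (measurable_ofReal_inv_survGT _)

theorem setIntegral_odds_eq (hC : Measurable C) (h : ℝ≥0 → ℝ) (s : ℝ≥0) :
    ∫ u in Ioo 0 s, h u ∂(odds (P.map C))
      = ∫ u in Ioo 0 s, h u * (1 / Function.rightLim (survFun P C) u) ∂(hazard P C) := by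
  have := Measure.isProbabilityMeasure_map (μ := P) hC.aemeasurable
  rw [odds_restrict_eq hC, integral_withDensity_eq_integral_toReal_smul
    (measurable_ofReal_inv_survGT _)
    (ae_of_all _ fun _ => ENNReal.ofReal_lt_top)]
  refine integral_congr_ae (ae_of_all _ fun u => ?_)
  simp only
  rw [survFun_eq hC, rightLim_surv, ENNReal.toReal_ofReal (one_div_nonneg.2 (survGT_nonneg _ u)),
    smul_eq_mul, mul_comm]

theorem integrableOn_odds_iff (hC : Measurable C) (h : ℝ≥0 → ℝ) (s : ℝ≥0) :
    IntegrableOn h (Ioo 0 s) (odds (P.map C)) ↔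
      IntegrableOn (fun u => h u * (1 / Function.rightLim (survFun P C) u)) (Ioo 0 s)
        (hazard P C) := by
  have := Measure.isProbabilityMeasure_map (μ := P) hC.aemeasurable
  rw [IntegrableOn, odds_restrict_eq hC, integrable_withDensity_iff_integrable_smul'
    (measurable_ofReal_inv_survGT _)
    (ae_of_all _ fun _ => ENNReal.ofReal_lt_top), IntegrableOn]
  refine integrable_congr (ae_of_all _ fun u => ?_)
  simp only
  rw [survFun_eq hC, rightLim_surv, ENNReal.toReal_ofReal (one_div_nonneg.2 (survGT_nonneg _ u)),
    smul_eq_mul, mul_comm]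

end Censoring

/-! ### The mean functions of the censored and the uncensored process -/

section MeanIdentities

variable {γ : Measure ℝ≥0} [IsProbabilityMeasure γ]

theorem lsInt_indicator_Iic {f : ℝ≥0 → ℝ} (hf : IncRC f) (c s : ℝ≥0) :
    lsInt ((Iic c).indicator 1) f s = f (min s c) - f 0 := by
  have h := lsInt_indicator_mul (fun _ => 1) f c s
  simp only [mul_one] at h
  rw [hf.lsInt_one] at h
  exact h

/-- Fubini's theorem, with the survival function written as `∫ 1{u ≤ c} γ(dc)`. -/
theorem lsInt_surv {f : ℝ≥0 → ℝ} (hf : IncRC f) (s : ℝ≥0) :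
    lsInt (surv γ) f s = ∫ c, (f (min s c) - f 0) ∂γ := by
  have hint : Integrable (fun z : ℝ≥0 × ℝ≥0 =>
      {z : ℝ≥0 × ℝ≥0 | z.1 ≤ z.2}.indicator (1 : ℝ≥0 × ℝ≥0 → ℝ) z)
      (((lsMeasure f).restrict (Ioc 0 s)).prod γ) :=
    (integrable_const (1 : ℝ)).indicator (measurableSet_le measurable_fst measurable_snd)
  have h1 := integral_integral_swap (f := fun u v =>
    {z : ℝ≥0 × ℝ≥0 | z.1 ≤ z.2}.indicator (1 : ℝ≥0 × ℝ≥0 → ℝ) (u, v)) hint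
  have h2 : ∀ u, ∫ v, {z : ℝ≥0 × ℝ≥0 | z.1 ≤ z.2}.indicator (1 : ℝ≥0 × ℝ≥0 → ℝ) (u, v) ∂γ
      = surv γ u := fun u => by
    rw [surv, ← integral_indicator_one measurableSet_Ici]
    rfl
  simp only [h2] at h1
  rw [lsInt, h1]
  refine integral_congr_ae (ae_of_all _ fun c => ?_)
  exact lsInt_indicator_Iic hf c s

theorem lsInt_eq_of_density {f g : ℝ≥0 → ℝ} (hg : IncRC g) (hg0 : g 0 = 0)
    (h : ∀ s, g s = lsInt (surv γ) f s) (φ : ℝ≥0 → ℝ) (s : ℝ≥0) :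
    lsInt φ g s = lsInt (fun u => surv γ u * φ u) f s := by
  have h1 : (lsMeasure g).restrict (Ioc 0 s) = ((lsMeasure f).restrict (Ioc 0 s)).withDensity
      fun u => ENNReal.ofReal (surv γ u) := by
    rw [← restrict_withDensity measurableSet_Ioc]
    refine hg.lsMeasure_restrict_eq fun a _ => ?_
    rw [withDensity_apply _ measurableSet_Ioc, hg0, sub_zero, h, lsInt,
      ofReal_integral_eq_lintegral_ofReal]
    · exact integrableOn_lsMeasure_of_bound (measurable_surv γ) (S := 1)
        (fun x => by rw [abs_of_nonneg (surv_nonneg γ x)]; exact surv_le_one γ x) f a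
    · exact ae_of_all _ (surv_nonneg γ)
  rw [lsInt, h1, integral_withDensity_eq_integral_toReal_smul
    (measurable_surv γ).ennreal_ofReal (ae_of_all _ fun _ => ENNReal.ofReal_lt_top), lsInt]
  refine integral_congr_ae (ae_of_all _ fun u => ?_)
  simp only [ENNReal.toReal_ofReal (surv_nonneg γ u), smul_eq_mul]

end MeanIdentities

end CensRec
end

noncomputable section

namespace CensRec

/-! ### The influence function -/

section Influence

variable {γ : Measure ℝ≥0}

theorem lsInt_inv_surv_min {a s : ℝ≥0} (ha : a ≤ s) (f : ℝ≥0 → ℝ) :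
    lsInt (fun u => 1 / surv γ u) f a = lsInt (fun u => 1 / surv γ (min u s)) f a :=
  lsInt_congr fun u _ hu => by rw [min_eq_left (hu.trans ha)]

theorem lsInt_inv_surv_nonneg (f : ℝ≥0 → ℝ) (a : ℝ≥0) : 0 ≤ lsInt (fun u => 1 / surv γ u) f a :=
  integral_nonneg fun u => one_div_nonneg.2 (surv_nonneg γ u)

theorem influence_apply {K f : ℝ≥0 → ℝ} (x : ℝ≥0 → ℝ) (c s : ℝ≥0) :
    influence K f (x, c) s = lsInt (fun u => 1 / K u) x s
      - lsInt (fun u => 1 / K u) f (min s c) := by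
  rw [influence, ← lsInt_indicator_mul]
  simp only [mul_one_div]

theorem influence_censor {K f x : ℝ≥0 → ℝ} (hx : IsCountingPath x) (c s : ℝ≥0) :
    influence K f (censor x c, c) s = lsInt (fun u => 1 / K u) x (min s c)
      - lsInt (fun u => 1 / K u) f (min s c) := by
  rw [influence_apply, censor_eq hx, hx.incRC.lsInt_stopped]

variable [IsProbabilityMeasure γ]

theorem tendsto_inv_surv_left {s u : ℝ≥0} (hs : 0 < surv γ s) (hu : u ≤ s) :
    Tendsto (fun v => 1 / surv γ (min v s)) (𝓝[<] u) (𝓝 (1 / surv γ (min u s))) := by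
  rw [min_eq_left hu]
  refine Tendsto.congr' (f₁ := fun v => 1 / surv γ v) ?_ (tendsto_const_nhds.div
    ((tendsto_surv_left γ u).mono_left (nhdsWithin_mono _ Iio_subset_Iic_self))
    (hs.trans_le (surv_anti γ hu)).ne')
  filter_upwards [self_mem_nhdsWithin] with v hv
  rw [min_eq_left (le_of_lt (lt_of_lt_of_le hv hu))]

theorem abs_inv_surv_le {s : ℝ≥0} (hs : 0 < surv γ s) (u : ℝ≥0) :
    |1 / surv γ (min u s)| ≤ 1 / surv γ s := by
  rw [abs_of_nonneg (one_div_nonneg.2 (surv_nonneg γ _))]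
  exact one_div_le_one_div_of_le hs (surv_anti γ (min_le_right _ _))

theorem measurable_inv_surv_min (s : ℝ≥0) : Measurable fun u => 1 / surv γ (min u s) :=
  measurable_const.div ((measurable_surv γ).comp (measurable_id.min measurable_const))

theorem lsInt_inv_surv_le {a s : ℝ≥0} (hs : 0 < surv γ s) (ha : a ≤ s) {f : ℝ≥0 → ℝ}
    (hf : IncRC f) : lsInt (fun u => 1 / surv γ u) f a ≤ 1 / surv γ s * (f s - f 0) := by
  rw [lsInt_inv_surv_min ha]
  calc lsInt (fun u => 1 / surv γ (min u s)) f a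
      ≤ ∫ _ in Ioc 0 a, 1 / surv γ s ∂(lsMeasure f) :=
        integral_mono (integrableOn_lsMeasure_of_bound (measurable_inv_surv_min s)
          (abs_inv_surv_le hs) f a) (integrable_const _)
          fun u => (le_abs_self _).trans (abs_inv_surv_le hs u)
    _ = 1 / surv γ s * (f a - f 0) := by
        rw [setIntegral_const, smul_eq_mul, hf.lsMeasure_real_Ioc zero_le, mul_comm]
    _ ≤ _ := mul_le_mul_of_nonneg_left (sub_le_sub_right (hf.mono ha) _)
        (one_div_nonneg.2 hs.le)

theorem measurable_lsInt_inv_surv {β : Type*} [MeasurableSpace β] {F : β → ℝ≥0 → ℝ}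
    {T : β → ℝ≥0} {s : ℝ≥0} (hs : 0 < surv γ s) (hF : ∀ b, IncRC (F b))
    (hm : ∀ u, Measurable fun b => F b (min u (T b))) :
    Measurable fun b => lsInt (fun u => 1 / surv γ u) (F b) (min s (T b)) := by
  have h := measurable_lsInt (S := 1 / surv γ s) (s := s) (fun b => (hF b).stopped (T b)) hm
    (fun u _ hu => tendsto_inv_surv_left hs hu) (abs_inv_surv_le hs)
  convert! h using 2 with b
  rw [(hF b).lsInt_stopped, ← lsInt_inv_surv_min (min_le_left _ _)]

theorem measurable_influence {f : ℝ≥0 → ℝ} (hf : IncRC f) {s : ℝ≥0} (hs : 0 < surv γ s) :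
    Measurable fun z : Path × ℝ≥0 => influence (surv γ) f (z.1.1, z.2) s := by
  simp only [influence_apply]
  refine Measurable.sub ?_ (measurable_lsInt_inv_surv hs (fun _ => hf) fun u =>
    hf.mono.measurable.comp (measurable_const.min measurable_snd))
  have h := measurable_lsInt_inv_surv (β := Path × ℝ≥0) (F := fun z => z.1.1) (T := fun _ => s) hs
    (fun z => z.1.2.incRC) fun u => (measurable_path_eval _).comp measurable_fst
  simpa only [min_self] using h

theorem measurable_influence_censor {f : ℝ≥0 → ℝ} (hf : IncRC f) {s : ℝ≥0} (hs : 0 < surv γ s) :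
    Measurable fun z : Path × ℝ≥0 => influence (surv γ) f (censor z.1.1 z.2, z.2) s := by
  have h : ∀ z : Path × ℝ≥0, influence (surv γ) f (censor z.1.1 z.2, z.2) s
      = lsInt (fun u => 1 / surv γ u) z.1.1 (min s z.2)
        - lsInt (fun u => 1 / surv γ u) f (min s z.2) := fun z => influence_censor z.1.2 z.2 s
  simp only [h]
  refine (measurable_lsInt_inv_surv (β := Path × ℝ≥0) (F := fun z => z.1.1) hs (fun z => z.1.2.incRC)
    fun u => ?_).sub (measurable_lsInt_inv_surv hs (fun _ => hf) fun u =>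
    hf.mono.measurable.comp (measurable_const.min measurable_snd))
  exact measurable_eval.comp (measurable_fst.prodMk (measurable_const.min measurable_snd))

theorem integrableOn_sub_mul_sub (h0 : γ {0} = 0) {f g : ℝ≥0 → ℝ} (hf : IncRC f) (hg : IncRC g)
    {s : ℝ≥0} (hs : 0 < surv γ s) :
    IntegrableOn (fun v => (f s - f v) * (g s - g v)) (Ioo 0 s) (odds γ) := by
  have := isFiniteMeasure_odds h0 hs
  refine Integrable.of_bound (((measurable_const.sub hf.mono.measurable).mul
    (measurable_const.sub hg.mono.measurable)).aestronglyMeasurable)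
    ((f s - f 0) * (g s - g 0)) ?_
  filter_upwards [ae_restrict_mem measurableSet_Ioo] with v hv
  have h1 := hf.mono hv.2.le
  have h2 := hg.mono hv.2.le
  have h3 : f 0 ≤ f v := hf.mono zero_le
  have h4 : g 0 ≤ g v := hg.mono zero_le
  rw [Real.norm_of_nonneg (mul_nonneg (sub_nonneg.2 h1) (sub_nonneg.2 h2))]
  exact mul_le_mul (by linarith) (by linarith) (by linarith) (by linarith)

theorem integrableOn_sub (h0 : γ {0} = 0) {f : ℝ≥0 → ℝ} (hf : IncRC f) {s : ℝ≥0}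
    (hs : 0 < surv γ s) (d : ℝ) : IntegrableOn (fun v => d - f v) (Ioo 0 s) (odds γ) := by
  have := isFiniteMeasure_odds h0 hs
  refine (integrable_const d).sub (Integrable.of_bound hf.mono.measurable.aestronglyMeasurable
    (max |f 0| |f s|) ?_)
  filter_upwards [ae_restrict_mem measurableSet_Ioo] with v hv
  exact abs_le_max_abs_abs (hf.mono zero_le) (hf.mono hv.2.le)

theorem integral_sub_two_mul_add {β : Type*} [MeasurableSpace β] {m : Measure β} {a b c : β → ℝ}
    (ha : Integrable a m) (hb : Integrable b m) (hc : Integrable c m) :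
    ∫ x, (a x - 2 * b x + c x) ∂m = ∫ x, a x ∂m - 2 * ∫ x, b x ∂m + ∫ x, c x ∂m := by
  have h1 : Integrable (fun x => a x - 2 * b x) m := ha.sub (hb.const_mul 2)
  rw [integral_add h1 hc, integral_sub ha (hb.const_mul 2), integral_const_mul]

/-- Expand the square and use the covariance identity for each of the three products. With `f` a
path of `N` and `g = μ` this is the second moment of the influence function given `N`. -/
theorem integral_lsInt_sub_sq (h0 : γ {0} = 0) {f g : ℝ≥0 → ℝ} (hf : IncRC f) (hg : IncRC g)
    {s : ℝ≥0} (hs : 0 < surv γ s) :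
    ∫ c, (lsInt (fun u => 1 / surv γ u) f (min s c) - lsInt (fun u => 1 / surv γ u) g (min s c)) ^ 2
      ∂γ = ((f s - f 0) - (g s - g 0)) ^ 2
        + ∫ v in Ioo 0 s, ((f s - f v) - (g s - g v)) ^ 2 ∂(odds γ) := by
  have hint : ∀ {f g : ℝ≥0 → ℝ}, IncRC f → IncRC g → Integrable (fun c =>
      lsInt (fun u => 1 / surv γ u) f (min s c) * lsInt (fun u => 1 / surv γ u) g (min s c)) γ := by
    intro f g hf hg
    have hm : ∀ {f : ℝ≥0 → ℝ}, IncRC f → Measurable fun c =>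
        lsInt (fun u => 1 / surv γ u) f (min s c) := fun {f} hf =>
      measurable_lsInt_inv_surv (F := fun _ => f) (T := fun c => c) hs (fun _ => hf) fun u =>
        hf.mono.measurable.comp (measurable_const.min measurable_id)
    refine Integrable.of_bound ((hm hf).mul (hm hg)).aestronglyMeasurable
      (1 / surv γ s * (f s - f 0) * (1 / surv γ s * (g s - g 0))) (ae_of_all _ fun c => ?_)
    rw [Real.norm_of_nonneg (mul_nonneg (lsInt_inv_surv_nonneg _ _) (lsInt_inv_surv_nonneg _ _))]
    exact mul_le_mul (lsInt_inv_surv_le hs (min_le_left _ _) hf)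
      (lsInt_inv_surv_le hs (min_le_left _ _) hg) (lsInt_inv_surv_nonneg _ _)
      ((lsInt_inv_surv_nonneg _ _).trans (lsInt_inv_surv_le hs (min_le_left s 0) hf))
  have hff := hint hf hf
  have hfg := hint hf hg
  have hgg := hint hg hg
  have e1 : ∀ a b : ℝ, (a - b) ^ 2 = a * a - 2 * (a * b) + b * b := fun a b => by ring
  simp only [e1]
  rw [integral_sub_two_mul_add hff hfg hgg, integral_lsInt_mul_lsInt h0 hf hf hs,
    integral_lsInt_mul_lsInt h0 hf hg hs, integral_lsInt_mul_lsInt h0 hg hg hs,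
    integral_sub_two_mul_add (integrableOn_sub_mul_sub h0 hf hf hs)
      (integrableOn_sub_mul_sub h0 hf hg hs) (integrableOn_sub_mul_sub h0 hg hg hs)]
  ring

theorem lsInt_sub_lsInt (h0 : γ {0} = 0) {f g : ℝ≥0 → ℝ} (hf : IncRC f) (hg : IncRC g)
    {a : ℝ≥0} (ha : 0 < surv γ a) :
    lsInt (fun u => 1 / surv γ u) f a - lsInt (fun u => 1 / surv γ u) g a
      = (f a - f 0) - (g a - g 0) + ∫ v in Ioo 0 a, (f a - g a - (f v - g v)) ∂(odds γ) := by
  rw [lsInt_inv_surv h0 hf ha, lsInt_inv_surv h0 hg ha]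
  have h1 : ∀ v, f a - g a - (f v - g v) = (f a - f v) - (g a - g v) := fun v => by ring
  simp only [h1]
  rw [integral_sub (integrableOn_sub h0 hf ha _) (integrableOn_sub h0 hg ha _)]
  ring

theorem lsMeasure_simplePath_restrict {c : ℝ≥0} (hc : 0 < c) (s : ℝ≥0) :
    (lsMeasure (simplePath c)).restrict (Ioc 0 s) = (Measure.dirac c).restrict (Ioc 0 s) := by
  refine (incRC_simplePath c).lsMeasure_restrict_eq fun a _ => ?_
  rw [Measure.dirac_apply' _ measurableSet_Ioc]
  by_cases h : c ≤ a <;> simp [simplePath, Set.indicator, h, hc, hc.ne']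

theorem setIntegral_simplePath {c : ℝ≥0} (hc : 0 < c) (h : ℝ≥0 → ℝ) (s : ℝ≥0) :
    ∫ u in Ioo 0 s, h u ∂(lsMeasure (simplePath c)) = if c < s then h c else 0 := by
  have h1 : (lsMeasure (simplePath c)).restrict (Ioo 0 s) = (Measure.dirac c).restrict (Ioo 0 s) := by
    have h := congrArg (fun m => m.restrict (Ioo 0 s)) (lsMeasure_simplePath_restrict hc s)
    simpa only [Measure.restrict_restrict measurableSet_Ioo,
      inter_eq_left.2 Ioo_subset_Ioc_self] using h
  rw [h1, ← integral_indicator measurableSet_Ioo, integral_dirac]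
  by_cases h2 : c < s <;> simp [Set.indicator, h2, hc]

end Influence

/-! ### The martingale form of the influence function -/

section Representation

variable {Ω : Type*} [MeasurableSpace Ω] {P : Measure Ω} [IsProbabilityMeasure P] {C : Ω → ℝ≥0}

/-- The martingale representation of the influence function. -/
theorem influence_eq_martInt (hC : Measurable C) (hpos : ∀ ω, 0 < C ω) {x f : ℝ≥0 → ℝ}
    (hx : IsCountingPath x) (hf : IncRC f) (hf0 : f 0 = 0) {c s : ℝ≥0} (hc : 0 < c)
    (hs : 0 < survFun P C s) :
    influence (survFun P C) f (censor x c, c) s = x s - f s - martInt (hazard P C) c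
      (fun u => (x s - f s - (x u - f u)) / Function.rightLim (survFun P C) u) s := by
  have := Measure.isProbabilityMeasure_map (μ := P) hC.aemeasurable
  have h0 := map_singleton_zero (P := P) hC hpos
  rw [martInt, setIntegral_simplePath hc]
  have h1 : ∫ u in Ioo 0 s, (Iic c).indicator 1 u * ((x s - f s - (x u - f u))
      / Function.rightLim (survFun P C) u) ∂(hazard P C)
      = ∫ u in Ioo 0 s, (Iic c).indicator (fun u => x s - f s - (x u - f u)) u
        ∂(odds (P.map C)) := by
    rw [setIntegral_odds_eq hC]
    refine integral_congr_ae (ae_of_all _ fun u => ?_)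
    by_cases hu : u ∈ Iic c <;> simp [hu, div_eq_mul_inv]
  rw [h1]
  rw [survFun_eq hC] at hs ⊢
  have hint : ∀ {a : ℝ≥0}, 0 < surv (P.map C) a → ∀ d,
      IntegrableOn (fun v => d - (x v - f v)) (Ioo 0 a) (odds (P.map C)) := by
    intro a ha d
    have h2 := (integrableOn_sub h0 hx.incRC ha d).sub (integrableOn_sub h0 hf ha 0)
    refine h2.congr (ae_of_all _ fun v => ?_)
    simp only [Pi.sub_apply]
    ring
  have ha : 0 < surv (P.map C) (min s c) := hs.trans_le (surv_anti _ (min_le_left _ _))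
  rw [influence_censor hx, lsInt_sub_lsInt h0 hx.incRC hf ha, hx.zero, hf0,
    setIntegral_indicator measurableSet_Iic]
  -- If `s ≤ c` there is no jump before `s` and the compensator covers all of `(0, s)`; otherwise
  -- the jump term at `c` has to cancel.
  rcases le_or_gt s c with hsc | hsc
  · rw [if_neg (not_lt.2 hsc), min_eq_left hsc, inter_eq_left.2 fun u hu => hu.2.le.trans hsc]
    ring
  · have hcG : 0 < survGT (P.map C) c := hs.trans_le (surv_le_survGT _ hsc)
    have h3 : Ioo 0 s ∩ Iic c = Ioc 0 c := by
      ext u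
      exact ⟨fun h => ⟨h.1.1, h.2⟩, fun h => ⟨⟨h.1, lt_of_le_of_lt h.2 hsc⟩, h.2⟩⟩
    have := isFiniteMeasure_odds h0 hs
    have h4 : ∫ v in Ioo 0 c, (x c - f c - (x v - f v)) ∂(odds (P.map C))
        = ∫ v in Ioc 0 c, (x c - f c - (x v - f v)) ∂(odds (P.map C)) := by
      symm
      refine setIntegral_eq_of_subset_of_forall_sdiff_eq_zero measurableSet_Ioc
        Ioo_subset_Ioc_self fun v hv => ?_
      have : v = c := le_antisymm hv.1.2 (not_lt.1 fun h => hv.2 ⟨hv.1.1, h⟩)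
      simp [this]
    have hsub : Ioc 0 c ⊆ Ioo 0 s := fun u hu => ⟨hu.1, lt_of_le_of_lt hu.2 hsc⟩
    have hfin : odds (P.map C) (Ioc 0 c) ≠ ∞ := by
      have h7 := measure_ne_top ((odds (P.map C)).restrict (Ioo 0 s)) univ
      rw [Measure.restrict_apply_univ] at h7
      exact measure_ne_top_of_subset hsub h7
    -- Replacing the value at `c` by the value at `s` adds a constant times the mass `1 / S(c+) - 1`
    -- of `(0, c]`. The part with `1 / S(c+)` cancels the jump term, and the part with `-1` moves
    -- the leading term from `s` to `c`.
    have h5 : ∫ v in Ioc 0 c, (x s - f s - (x v - f v)) ∂(odds (P.map C))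
        = ∫ v in Ioc 0 c, (x c - f c - (x v - f v)) ∂(odds (P.map C))
          + (1 / survGT (P.map C) c - 1) * (x s - f s - (x c - f c)) := by
      rw [← odds_real_Ioc h0 hc hcG, ← smul_eq_mul, ← setIntegral_const, ← integral_add
        ((hint hs _).mono_set hsub) (integrableOn_const hfin)]
      refine integral_congr_ae (ae_of_all _ fun v => ?_)
      simp only
      ring
    rw [if_pos hsc, min_eq_right hsc.le, h3, h4, h5, rightLim_surv]
    ring

end Representation

end CensRec
end

noncomputable section

namespace CensRec

/-! ### Moments of the influence function -/

section Moments

variable {Ω : Type*} [MeasurableSpace Ω] {P : Measure Ω}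

/-- Expectation commutes with the grid sums. They are dominated by `S * B ω`, because the increments
of an increasing path telescope. -/
theorem integral_lsInt_meanFun [IsFiniteMeasure P] {Z : Ω → ℝ≥0 → ℝ} {B : Ω → ℝ}
    (h : DomProc P Z B) {g : ℝ≥0 → ℝ} {s : ℝ≥0} {S : ℝ}
    (hg : ∀ u, 0 < u → u ≤ s → Tendsto g (𝓝[<] u) (𝓝 (g u))) (hS : ∀ u, |g u| ≤ S) :
    ∫ ω, lsInt g (Z ω) s ∂P = lsInt g (meanFun P Z) s := by
  have h1 := tendsto_lsInt_grid h.incRC_meanFun hg hS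
  have h2 := tendsto_integral_of_dominated_convergence (μ := P) (fun ω => S * B ω)
    (fun k => (Finset.aemeasurable_fun_sum (Finset.range ⌈((k : ℝ≥0) + 1) * s⌉₊) fun j _ =>
      ((h.aemeas (min s (((j : ℝ≥0) + 1) / ((k : ℝ≥0) + 1)))).sub
        (h.aemeas (min s ((j : ℝ≥0) / ((k : ℝ≥0) + 1))))).const_mul
          (g ((j : ℝ≥0) / ((k : ℝ≥0) + 1)))).aestronglyMeasurable)
    (h.integrable_bound.const_mul S) (fun k => ae_of_all _ fun ω => ?_)
    (ae_of_all _ fun ω => tendsto_lsInt_grid (h.incRC ω) hg hS)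
  · refine tendsto_nhds_unique (h2.congr fun k => ?_) h1
    rw [integral_finsetSum]
    · refine Finset.sum_congr rfl fun j _ => ?_
      rw [integral_const_mul]
      congr 1
      exact integral_sub (h.integrable _) (h.integrable _)
    · exact fun j _ => ((h.integrable _).sub (h.integrable _)).const_mul _
  · have hS0 : 0 ≤ S := (abs_nonneg _).trans (hS 0)
    have hinc : ∀ j : ℕ, 0 ≤ Z ω (min s (((j : ℝ≥0) + 1) / ((k : ℝ≥0) + 1)))
        - Z ω (min s ((j : ℝ≥0) / ((k : ℝ≥0) + 1))) := fun j =>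
      sub_nonneg.2 ((h.incRC ω).mono (min_le_min_left _ (by gcongr; exact le_self_add)))
    refine (norm_sum_le _ _).trans ?_
    calc ∑ j ∈ Finset.range ⌈((k : ℝ≥0) + 1) * s⌉₊, ‖g ((j : ℝ≥0) / ((k : ℝ≥0) + 1))
          * (Z ω (min s (((j : ℝ≥0) + 1) / ((k : ℝ≥0) + 1)))
            - Z ω (min s ((j : ℝ≥0) / ((k : ℝ≥0) + 1))))‖
        ≤ ∑ j ∈ Finset.range ⌈((k : ℝ≥0) + 1) * s⌉₊,
          S * (Z ω (min s (((j + 1 : ℕ) : ℝ≥0) / ((k : ℝ≥0) + 1)))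
            - Z ω (min s ((j : ℝ≥0) / ((k : ℝ≥0) + 1)))) := by
          refine Finset.sum_le_sum fun j _ => ?_
          rw [norm_mul, Real.norm_of_nonneg (hinc j)]
          push_cast
          exact mul_le_mul_of_nonneg_right (hS _) (hinc j)
      _ = S * (Z ω (min s ((⌈((k : ℝ≥0) + 1) * s⌉₊ : ℝ≥0) / ((k : ℝ≥0) + 1)))
            - Z ω (min s (((0 : ℕ) : ℝ≥0) / ((k : ℝ≥0) + 1)))) := by
          rw [← Finset.mul_sum, Finset.sum_range_sub (fun j : ℕ =>
            Z ω (min s ((j : ℝ≥0) / ((k : ℝ≥0) + 1))))]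
      _ ≤ S * B ω := by
          refine mul_le_mul_of_nonneg_left ?_ hS0
          have h3 := h.nonneg ω (min s (((0 : ℕ) : ℝ≥0) / ((k : ℝ≥0) + 1)))
          have h4 := h.le ω (min s ((⌈((k : ℝ≥0) + 1) * s⌉₊ : ℝ≥0) / ((k : ℝ≥0) + 1)))
          linarith

variable {N : Ω → ℝ≥0 → ℝ} {C : Ω → ℝ≥0}

theorem abs_centered_le {B : Ω → ℝ} (hd : DomProc P N B) (s v : ℝ≥0) (ω : Ω) :
    |N ω s - N ω v - (meanFun P N s - meanFun P N v)| ≤ B ω + ∫ ω, B ω ∂P := by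
  have h1 := hd.nonneg ω s
  have h2 := hd.nonneg ω v
  have h3 := hd.le ω s
  have h4 := hd.le ω v
  have h5 := hd.meanFun_nonneg s
  have h6 := hd.meanFun_nonneg v
  have h7 := hd.meanFun_le s
  have h8 := hd.meanFun_le v
  rw [abs_le]
  constructor <;> linarith

theorem variance_sub_eq {B : Ω → ℝ} (hd : DomProc P N B) (s v : ℝ≥0) :
    Var[fun ω => N ω s - N ω v; P]
      = ∫ ω, (N ω s - N ω v - (meanFun P N s - meanFun P N v)) ^ 2 ∂P := by
  have h1 : AEMeasurable (fun ω => N ω s - N ω v) P := (hd.aemeas s).sub (hd.aemeas v)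
  rw [variance_eq_integral h1, integral_sub (hd.integrable s) (hd.integrable v)]
  rfl

variable [IsProbabilityMeasure P]

theorem integral_comp_indep (hN : Measurable N) (h : ∀ ω, IsCountingPath (N ω))
    (hC : Measurable C) (hindep : IndepFun N C P) {Φ : Path × ℝ≥0 → ℝ} (hΦ : Measurable Φ) :
    ∫ ω, Φ (⟨N ω, h ω⟩, C ω) ∂P = ∫ z, Φ (⟨N z.1, h z.1⟩, z.2) ∂(P.prod (P.map C)) := by
  have h1 : Measurable fun z : Ω × ℝ≥0 => ((⟨N z.1, h z.1⟩ : Path), z.2) :=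
    (hN.subtype_mk.comp measurable_fst).prodMk measurable_snd
  rw [← integral_map (hN.subtype_mk.prodMk hC).aemeasurable hΦ.aestronglyMeasurable,
    map_obs_eq hN h hC hindep, integral_map h1.aemeasurable hΦ.aestronglyMeasurable]

theorem integrable_comp_indep (hN : Measurable N) (h : ∀ ω, IsCountingPath (N ω))
    (hC : Measurable C) (hindep : IndepFun N C P) {Φ : Path × ℝ≥0 → ℝ} (hΦ : Measurable Φ)
    (hint : Integrable (fun ω => Φ (⟨N ω, h ω⟩, C ω)) P) :
    Integrable (fun z : Ω × ℝ≥0 => Φ (⟨N z.1, h z.1⟩, z.2)) (P.prod (P.map C)) := by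
  have h1 := (integrable_map_measure hΦ.aestronglyMeasurable
    (hN.subtype_mk.prodMk hC).aemeasurable).2 hint
  rw [map_obs_eq hN h hC hindep] at h1
  exact (integrable_map_measure hΦ.aestronglyMeasurable ((hN.subtype_mk.comp measurable_fst).prodMk
      measurable_snd).aemeasurable).1 h1

theorem measurable_process_eval (hN : Measurable N) (h : ∀ ω, IsCountingPath (N ω)) :
    Measurable fun z : Ω × ℝ≥0 => N z.1 z.2 :=
  measurable_eval.comp (((hN.subtype_mk (h := h)).comp measurable_fst).prodMk measurable_snd)

variable {s : ℝ≥0}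

/-- Both stopped integrals are nonnegative, with bounds `N(∞) / K(s)` and `μ(s) / K(s)`. -/
theorem memLp_influence (hN : Measurable N) (h : ∀ ω, IsCountingPath (N ω))
    (h2 : MemLp (fun ω => atInfty (N ω)) 2 P) (hC : Measurable C) (hs : 0 < surv (P.map C) s) :
    MemLp (fun ω => influence (surv (P.map C)) (meanFun P N) (censor (N ω) (C ω), C ω) s) 2 P := by
  have := Measure.isProbabilityMeasure_map (μ := P) hC.aemeasurable
  have hd := domProc_counting h (fun u => ((measurable_pi_apply u).comp hN).aemeasurable) h2
  have hm := hd.incRC_meanFun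
  refine MemLp.of_le (g := fun ω => 1 / surv (P.map C) s * (atInfty (N ω) + meanFun P N s))
    ((h2.add (memLp_const _)).const_mul _) ?_ (ae_of_all _ fun ω => ?_)
  · exact ((measurable_influence_censor hm hs).comp
      ((hN.subtype_mk (h := h)).prodMk hC)).aestronglyMeasurable
  · have hK : 0 ≤ 1 / surv (P.map C) s := one_div_nonneg.2 hs.le
    have h3 := lsInt_inv_surv_le hs (min_le_left s (C ω)) (h ω).incRC
    have h4 := lsInt_inv_surv_le hs (min_le_left s (C ω)) hm
    have h5 := lsInt_inv_surv_nonneg (γ := P.map C) (N ω) (min s (C ω))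
    have h6 := lsInt_inv_surv_nonneg (γ := P.map C) (meanFun P N) (min s (C ω))
    have h7 := mul_le_mul_of_nonneg_left ((h ω).le_atInfty s) hK
    have h8 := mul_nonneg hK (hd.meanFun_nonneg 0)
    have h9 := mul_nonneg hK ((h ω).nonneg 0)
    rw [influence_censor (h ω), Real.norm_eq_abs]
    refine le_trans (abs_le.2 ⟨?_, ?_⟩) (le_abs_self _)
    · nlinarith [mul_nonneg hK ((h ω).nonneg s)]
    · nlinarith [mul_nonneg hK (hd.meanFun_nonneg s)]

/-- For each fixed `c` the two integrals stopped at `min s c` have the same mean; independence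
allows `C` to be fixed. -/
theorem integral_influence (hN : Measurable N) (h : ∀ ω, IsCountingPath (N ω))
    (h2 : MemLp (fun ω => atInfty (N ω)) 2 P) (hC : Measurable C) (hindep : IndepFun N C P)
    (hs : 0 < surv (P.map C) s) :
    ∫ ω, influence (surv (P.map C)) (meanFun P N) (censor (N ω) (C ω), C ω) s ∂P = 0 := by
  have := Measure.isProbabilityMeasure_map (μ := P) hC.aemeasurable
  have hd := domProc_counting h (fun u => ((measurable_pi_apply u).comp hN).aemeasurable) h2
  have hm := hd.incRC_meanFun
  have hint := integrable_comp_indep hN h hC hindep (measurable_influence_censor hm hs)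
    ((memLp_influence hN h h2 hC hs).integrable one_le_two)
  have h1 := integral_comp_indep hN h hC hindep (measurable_influence_censor hm hs)
  simp only at h1
  rw [h1, integral_prod_symm _ hint]
  refine integral_eq_zero_of_ae (ae_of_all _ fun c => ?_)
  simp only [Pi.zero_apply]
  have h3 : ∀ ω, influence (surv (P.map C)) (meanFun P N) (censor (N ω) c, c) s
      = lsInt (fun u => 1 / surv (P.map C) (min u s)) (N ω) (min s c)
        - lsInt (fun u => 1 / surv (P.map C) (min u s)) (meanFun P N) (min s c) := fun ω => by
    rw [influence_censor (h ω), lsInt_inv_surv_min (min_le_left _ _),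
      lsInt_inv_surv_min (min_le_left _ _)]
  simp only [h3]
  have hg : ∀ u, 0 < u → u ≤ min s c → Tendsto (fun v => 1 / surv (P.map C) (min v s)) (𝓝[<] u)
      (𝓝 (1 / surv (P.map C) (min u s))) := fun u _ hu =>
    tendsto_inv_surv_left hs (hu.trans (min_le_left _ _))
  rw [integral_sub ?_ (integrable_const _), integral_lsInt_meanFun hd hg (abs_inv_surv_le hs),
    integral_const, probReal_univ, one_smul, sub_self]
  refine (hd.integrable_bound.const_mul (1 / surv (P.map C) s)).mono' ?_ (ae_of_all _ fun ω => ?_)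
  · exact (measurable_lsInt hd.incRC (fun u => (measurable_pi_apply u).comp hN) hg
      (abs_inv_surv_le hs)).aestronglyMeasurable
  · rw [← lsInt_inv_surv_min (min_le_left _ _), Real.norm_of_nonneg (lsInt_inv_surv_nonneg _ _)]
    refine (lsInt_inv_surv_le hs (min_le_left s c) (h ω).incRC).trans
      (mul_le_mul_of_nonneg_left ?_ (one_div_nonneg.2 hs.le))
    linarith [(h ω).le_atInfty s, (h ω).nonneg 0]

theorem integrable_centered_sq (hN : Measurable N) (h : ∀ ω, IsCountingPath (N ω))
    (h2 : MemLp (fun ω => atInfty (N ω)) 2 P) (e : Measure ℝ≥0) [IsFiniteMeasure e] :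
    Integrable (fun z : Ω × ℝ≥0 =>
      (N z.1 s - N z.1 z.2 - (meanFun P N s - meanFun P N z.2)) ^ 2) (P.prod e) := by
  have hd := domProc_counting h (fun u => ((measurable_pi_apply u).comp hN).aemeasurable) h2
  have h3 : Integrable (fun ω => (atInfty (N ω) + ∫ ω, atInfty (N ω) ∂P) ^ 2) P :=
    (h2.add (memLp_const _)).integrable_sq
  refine (h3.comp_fst e).mono' ?_ (ae_of_all _ fun z => ?_)
  · refine Measurable.aestronglyMeasurable (Measurable.pow_const ?_ 2)
    exact ((((measurable_pi_apply s).comp hN).comp measurable_fst).sub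
      (measurable_process_eval hN h)).sub (measurable_const.sub
        (hd.incRC_meanFun.mono.measurable.comp measurable_snd))
  · rw [Real.norm_of_nonneg (sq_nonneg _)]
    exact sq_le_sq.2 ((abs_centered_le hd s z.2 z.1).trans (le_abs_self _))

theorem integrableOn_variance (hN : Measurable N) (h : ∀ ω, IsCountingPath (N ω))
    (h2 : MemLp (fun ω => atInfty (N ω)) 2 P) (hC : Measurable C) (hpos : ∀ ω, 0 < C ω)
    (hs : 0 < surv (P.map C) s) :
    IntegrableOn (fun u => Var[fun ω => N ω s - N ω u; P]) (Ioo 0 s) (odds (P.map C)) := by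
  have := Measure.isProbabilityMeasure_map (μ := P) hC.aemeasurable
  have := isFiniteMeasure_odds (map_singleton_zero (P := P) hC hpos) hs
  have hd := domProc_counting h (fun u => ((measurable_pi_apply u).comp hN).aemeasurable) h2
  simp only [variance_sub_eq hd]
  exact (integrable_centered_sq hN h h2 ((odds (P.map C)).restrict (Ioo 0 s))).integral_prod_right

/-- By independence the path may be fixed and `C` integrated out first, with the pathwise identity
`integral_lsInt_sub_sq`. The outer expectation is then moved inside by Fubini's theorem. -/
theorem variance_influence (hN : Measurable N) (h : ∀ ω, IsCountingPath (N ω))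
    (h2 : MemLp (fun ω => atInfty (N ω)) 2 P) (hC : Measurable C) (hpos : ∀ ω, 0 < C ω)
    (hindep : IndepFun N C P) (hs : 0 < surv (P.map C) s) :
    Var[fun ω => influence (surv (P.map C)) (meanFun P N) (censor (N ω) (C ω), C ω) s; P]
      = Var[fun ω => N ω s; P] + ∫ u in Ioo 0 s, Var[fun ω => N ω s - N ω u; P]
        ∂(odds (P.map C)) := by
  have := Measure.isProbabilityMeasure_map (μ := P) hC.aemeasurable
  have h0 := map_singleton_zero (P := P) hC hpos
  have := isFiniteMeasure_odds h0 hs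
  have hd := domProc_counting h (fun u => ((measurable_pi_apply u).comp hN).aemeasurable) h2
  have hm := hd.incRC_meanFun
  have hL := memLp_influence hN h h2 hC hs
  have hΦ := (measurable_influence_censor hm hs).pow_const 2
  have hint := integrable_comp_indep hN h hC hindep hΦ hL.integrable_sq
  have h1 := integral_comp_indep hN h hC hindep hΦ
  simp only at h1
  have hcent := integrable_centered_sq (s := s) hN h h2 ((odds (P.map C)).restrict (Ioo 0 s))
  have hm0 : meanFun P N 0 = 0 := by simp [meanFun, (h _).zero]
  rw [variance_of_integral_eq_zero hL.aestronglyMeasurable.aemeasurable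
    (integral_influence hN h h2 hC hindep hs), h1, integral_prod _ hint]
  have h3 : ∀ ω, ∫ c, influence (surv (P.map C)) (meanFun P N) (censor (N ω) c, c) s ^ 2 ∂(P.map C)
      = (N ω s - meanFun P N s) ^ 2 + ∫ v in Ioo 0 s,
        (N ω s - N ω v - (meanFun P N s - meanFun P N v)) ^ 2 ∂(odds (P.map C)) := fun ω => by
    simp only [influence_censor (h ω)]
    rw [integral_lsInt_sub_sq h0 (h ω).incRC hm hs, (h ω).zero, hm0, sub_zero, sub_zero]
  simp only [h3]
  have hNs : MemLp (fun ω => N ω s) 2 P := h2.of_le ((measurable_pi_apply s).comp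
    hN).aestronglyMeasurable (ae_of_all _ fun ω => by
      rw [Real.norm_of_nonneg ((h ω).nonneg s)]
      exact ((h ω).le_atInfty s).trans (le_abs_self _))
  have h4 : Integrable (fun ω => (N ω s - meanFun P N s) ^ 2) P :=
    (hNs.sub (memLp_const _)).integrable_sq
  rw [integral_add h4 hcent.integral_prod_left,
    variance_eq_integral (hd.aemeas s),
    integral_integral_swap (f := fun ω v =>
      (N ω s - N ω v - (meanFun P N s - meanFun P N v)) ^ 2) hcent]
  simp only [variance_sub_eq hd]
  rfl

end Moments

end CensRec
end

noncomputable section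

namespace CensRec

/-! ### The functional at the distribution and at the empirical distribution -/

section AtDelta

variable {p : ℝ} [hp : Fact (1 ≤ p)]

theorem atInfty_simplePath (c : ℝ≥0) : atInfty (simplePath c) = 1 := by
  refine Tendsto.limUnder_eq (tendsto_const_nhds.congr' ?_)
  filter_upwards [eventually_ge_atTop c] with a ha
  simp [simplePath, Set.indicator, ha]

/-- Only `c = u = 0` is excluded: there the left limit is by convention the value `1`, not `0`. -/
theorem leftLim_simplePath (c : ℝ≥0) {u : ℝ≥0} (h : 0 < c ∨ 0 < u) :
    Function.leftLim (simplePath c) u = 1 - (Iic c).indicator 1 u := by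
  rcases eq_or_ne u 0 with rfl | hu
  · have h1 : Iio (0 : ℝ≥0) = ∅ := by ext; simp
    have hc : 0 < c := h.resolve_right (lt_irrefl _)
    rw [leftLim_eq_of_eq_bot _ (by rw [h1, nhdsWithin_empty])]
    simp [simplePath, Set.indicator, hc.ne']
  · have hne : (𝓝[<] u).NeBot := nhdsLT_neBot_of_exists_lt ⟨0, pos_iff_ne_zero.2 hu⟩
    refine leftLim_eq_of_tendsto (tendsto_const_nhds.congr' ?_)
    rcases le_or_gt u c with huc | huc
    · filter_upwards [self_mem_nhdsWithin] with v hv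
      have hv' : ¬ c ≤ v := not_le.2 (lt_of_lt_of_le hv huc)
      simp [simplePath, Set.indicator, huc, hv']
    · filter_upwards [nhdsWithin_le_nhds (lt_mem_nhds huc)] with v hv
      simp [simplePath, Set.indicator, not_le.2 huc, le_of_lt hv]

theorem kFun_delta (x : ℝ≥0 → ℝ) {c u : ℝ≥0} (h : 0 < c ∨ 0 < u) :
    kFun (delta p (x, c)) u = (Iic c).indicator 1 u := by
  have h1 : ((delta p (x, c)).2 : ℝ≥0 → ℝ) = simplePath c :=
    toWr_of_memWr (memWr_simplePath hp.out c)
  rw [kFun, h1, atInfty_simplePath, leftLim_simplePath c h, sub_sub_cancel]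

theorem kFun_sum {ι : Type*} (S : Finset ι) (f : ι → Wr ℝ≥0 p × Wr ℝ≥0 p) (u : ℝ≥0) :
    kFun (∑ i ∈ S, f i) u = ∑ i ∈ S, kFun (f i) u := by
  classical
  induction S using Finset.induction_on with
  | empty =>
    have h := kFun_smul (0 : ℝ) (0 : Wr ℝ≥0 p × Wr ℝ≥0 p) u
    simpa using h
  | insert i S hi ih => rw [Finset.sum_insert hi, Finset.sum_insert hi, kFun_add, ih]

theorem wr_sum_apply {α : Type*} [LinearOrder α] [TopologicalSpace α] {ι : Type*} (S : Finset ι)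
    (f : ι → Wr α p) (u : α) : (∑ i ∈ S, f i : Wr α p) u = ∑ i ∈ S, f i u := by
  classical
  induction S using Finset.induction_on with
  | empty => rfl
  | insert i S hi ih =>
    rw [Finset.sum_insert hi, Finset.sum_insert hi, ← ih]
    rfl

/-- The derivative at `f` in direction `f` is zero, since the functional is homogeneous of degree
zero; algebraically, `k⁻¹ k k⁻¹ = k⁻¹`. -/
theorem fderiv_muFun_sub_self (hp2 : p < 2) {t : ℝ≥0} {f : Wr ℝ≥0 p × Wr ℝ≥0 p}
    (hf : IsUnit (kMap p t f)) (g : Wr ℝ≥0 p × Wr ℝ≥0 p) :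
    fderiv ℝ (muFun p t) f (g - f) = youngMap hp2 t (Ring.inverse (kMap p t f)) g.1
      - youngMap hp2 t (Ring.inverse (kMap p t f) * kMap p t g * Ring.inverse (kMap p t f)) f.1 := by
  rw [hasFDerivAt_muFun hp2 hf, map_sub, mul_sub, sub_mul, Ring.inverse_mul_cancel _ hf, one_mul,
    Prod.fst_sub, map_sub, map_sub, sub_apply]
  abel

end AtDelta

/-! ### The functional and its derivative at the true distribution -/

section AtDistribution

variable {p : ℝ} [hp : Fact (1 ≤ p)] {γ : Measure ℝ≥0} [IsProbabilityMeasure γ]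
  {F : Wr ℝ≥0 p × Wr ℝ≥0 p} {μ ν : ℝ≥0 → ℝ} {t : ℝ≥0}

theorem exists_le_abs_kFun (hK : ∀ u, kFun F u = surv γ u) (ht : 0 < surv γ t) :
    ∃ c > 0, ∀ s ≤ t, c ≤ |kFun F s| :=
  ⟨surv γ t, ht, fun s hs => by
    rw [hK, abs_of_nonneg (surv_nonneg γ s)]; exact surv_anti γ hs⟩

theorem lsInt_inv_density (hμ : IncRC μ) (hμ0 : μ 0 = 0) (hν : IncRC ν) (hν0 : ν 0 = 0)
    (h : ∀ s, ν s = lsInt (surv γ) μ s) {s : ℝ≥0} (hs : 0 < surv γ s) :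
    lsInt (fun u => 1 / surv γ u) ν s = μ s := by
  rw [lsInt_eq_of_density hν hν0 h, lsInt_congr (h := fun _ => 1), hμ.lsInt_one, hμ0, sub_zero]
  exact fun u _ hu => mul_one_div_cancel (hs.trans_le (surv_anti γ hu)).ne'

theorem muFun_apply_distribution (hp2 : p < 2) (hK : ∀ u, kFun F u = surv γ u)
    (hF : (F.1 : ℝ≥0 → ℝ) = ν) (hμ : IncRC μ) (hμ0 : μ 0 = 0) (hν : IncRC ν) (hν0 : ν 0 = 0)
    (h : ∀ s, ν s = lsInt (surv γ) μ s) (ht : 0 < surv γ t) (s : Icc 0 t) :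
    muFun p t F s = μ s := by
  have hu := isUnit_kMap (exists_le_abs_kFun hK ht)
  rw [muFun_eq hp2 hu, youngMap_eq_lsInt hp2 _ hF hν (h := fun u => 1 / surv γ u),
    lsInt_inv_density hμ hμ0 hν hν0 h (ht.trans_le (surv_anti γ s.2.2))]
  intro x
  rw [bv_inverse_apply hu, kMap_apply, hK]

theorem derivDelta_distribution (hp2 : p < 2) (hK : ∀ u, kFun F u = surv γ u)
    (hF : (F.1 : ℝ≥0 → ℝ) = ν) (hν : IncRC ν) (hν0 : ν 0 = 0)
    (h : ∀ s, ν s = lsInt (surv γ) μ s) (ht : 0 < surv γ t) {x : ℝ≥0 → ℝ} {c : ℝ≥0}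
    (hx : IsCountingPath x) (hc : 0 < c) (s : Icc 0 t) :
    derivDelta p t F (x, c) s = influence (surv γ) μ (x, c) s := by
  have hu := isUnit_kMap (exists_le_abs_kFun hK ht)
  have h1 : ((delta p (x, c)).1 : ℝ≥0 → ℝ) = x := toWr_of_memWr (hx.memWr hp.out)
  have h2 : ∀ u : Icc 0 t, (Ring.inverse (kMap p t F)) u = 1 / surv γ u := fun u => by
    rw [bv_inverse_apply hu, kMap_apply, hK]
  have h3 : ∀ u : Icc 0 t, (Ring.inverse (kMap p t F) * kMap p t (delta p (x, c))
      * Ring.inverse (kMap p t F)) u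
      = 1 / surv γ u * (Iic c).indicator 1 (u : ℝ≥0) * (1 / surv γ u) := fun u => by
    rw [← kFun_delta (p := p) x (Or.inl hc), ← h2]
    rfl
  rw [derivDelta, fderiv_muFun_sub_self hp2 hu]
  change youngMap hp2 t _ (delta p (x, c)).1 s - youngMap hp2 t _ F.1 s = _
  -- Since `ν(du) = K(u) μ(du)`, one of the two factors `1 / K` disappears when the second integral
  -- is rewritten with respect to `μ`.
  rw [youngMap_eq_lsInt hp2 _ h1 hx.incRC (h := fun u => 1 / surv γ u) h2, youngMap_eq_lsInt hp2 _ hF hν (h := fun u =>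
    1 / surv γ u * (Iic c).indicator 1 u * (1 / surv γ u)) h3, lsInt_eq_of_density hν hν0 h,
    influence]
  congr 1
  refine lsInt_congr fun u _ hu => ?_
  have := (ht.trans_le (surv_anti γ (hu.trans s.2.2))).ne'
  field_simp

end AtDistribution

/-! ### The estimator as the functional at the empirical distribution -/

section AtEmpirical

variable {Ω : Type*} {X : ℕ → Ω → (ℝ≥0 → ℝ) × ℝ≥0}

open Classical in
theorem survHat_eq_card (X : ℕ → Ω → (ℝ≥0 → ℝ) × ℝ≥0) (n : ℕ) (ω : Ω) (u : ℝ≥0) :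
    survHat X n ω u = (n : ℝ)⁻¹ * (({i ∈ Finset.range n | u ≤ (X i ω).2}.card : ℕ) : ℝ) := by
  rw [survHat, Finset.card_filter]
  push_cast
  rfl

/-- A nonzero value of `survHat` is at least `1 / n`, and where it is zero the quotient is zero by
convention. -/
theorem abs_inv_survHat_le (X : ℕ → Ω → (ℝ≥0 → ℝ) × ℝ≥0) (n : ℕ) (ω : Ω) (u : ℝ≥0) :
    |1 / survHat X n ω u| ≤ n := by
  classical
  rw [survHat_eq_card, abs_of_nonneg (by positivity), one_div, mul_inv, inv_inv]
  rcases Nat.eq_zero_or_pos ({i ∈ Finset.range n | u ≤ (X i ω).2}.card) with h | h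
  · simp [h]
  · exact mul_le_of_le_one_right (Nat.cast_nonneg n) (inv_le_one_of_one_le₀ (by exact_mod_cast h))

theorem survHat_eventually_eq (X : ℕ → Ω → (ℝ≥0 → ℝ) × ℝ≥0) (n : ℕ) (ω : Ω) (u : ℝ≥0) :
    ∀ᶠ v in 𝓝[<] u, survHat X n ω v = survHat X n ω u := by
  have h : ∀ᶠ v in 𝓝[<] u, ∀ i ∈ Finset.range n,
      (Iic (X i ω).2).indicator (1 : ℝ≥0 → ℝ) v = (Iic (X i ω).2).indicator 1 u := by
    rw [Filter.eventually_all_finset]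
    intro i _
    rcases le_or_gt u (X i ω).2 with hu | hu
    · filter_upwards [self_mem_nhdsWithin] with v hv
      rw [Set.indicator_of_mem (show u ∈ Iic _ from hu),
        Set.indicator_of_mem (show v ∈ Iic _ from (le_of_lt hv).trans hu)]
      rfl
    · filter_upwards [nhdsWithin_le_nhds (lt_mem_nhds hu)] with v hv
      rw [Set.indicator_of_notMem (show u ∉ Iic _ from not_le.2 hu),
        Set.indicator_of_notMem (show v ∉ Iic _ from not_le.2 hv)]
  filter_upwards [h] with v hv
  rw [survHat, survHat, Finset.sum_congr rfl hv]

theorem incRC_nuHat (hX : ∀ i ω, IsCountingPath (X i ω).1) (n : ℕ) (ω : Ω) :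
    IncRC (nuHat X n ω) where
  mono := fun _ _ h => mul_le_mul_of_nonneg_left
    (Finset.sum_le_sum fun i _ => (hX i ω).mono h) (by positivity)
  right_cont s := continuousWithinAt_const.mul
    (tendsto_finsetSum _ fun i _ => (hX i ω).right_cont s)

theorem aemeasurable_muHat [MeasurableSpace Ω] {P : Measure Ω}
    (hX : ∀ i ω, IsCountingPath (X i ω).1) (hm : ∀ i, AEMeasurable (X i) P) (n : ℕ) (s : ℝ≥0) :
    AEMeasurable (fun ω => muHat X n ω s) P := by
  refine aemeasurable_lsInt (S := n) (incRC_nuHat hX n) (fun u => ?_) (fun u => ?_)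
    (fun ω u _ _ => ?_) (abs_inv_survHat_le X n)
  · exact (Finset.aemeasurable_fun_sum _ fun i _ => ((measurable_pi_apply u).comp
      measurable_fst).comp_aemeasurable (hm i)).const_mul _
  · refine AEMeasurable.const_div ((Finset.aemeasurable_fun_sum _ fun i _ => ?_).const_mul _) _
    have h1 : Measurable fun c : ℝ≥0 => (Iic c).indicator (1 : ℝ≥0 → ℝ) u :=
      (measurable_const (a := (1 : ℝ))).indicator (s := Ici u) measurableSet_Ici
    exact (h1.comp measurable_snd).comp_aemeasurable (hm i)
  · refine tendsto_const_nhds.congr' ?_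
    filter_upwards [survHat_eventually_eq X n ω u] with v hv
    rw [hv]

variable {p : ℝ} [hp : Fact (1 ≤ p)]

/-- At `u = 0` the identity can fail if some censoring time is zero; the integrals never see that
point. -/
theorem kFun_empMean (X : ℕ → Ω → (ℝ≥0 → ℝ) × ℝ≥0) (n : ℕ) (ω : Ω) {u : ℝ≥0} (hu : 0 < u) :
    kFun (empMean p X n ω) u = survHat X n ω u := by
  rw [empMean, kFun_smul, kFun_sum, survHat]
  congr 1
  exact Finset.sum_congr rfl fun i _ => kFun_delta _ (Or.inr hu)

theorem empMean_fst (hX : ∀ i ω, IsCountingPath (X i ω).1) (n : ℕ) (ω : Ω) :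
    ((empMean p X n ω).1 : ℝ≥0 → ℝ) = nuHat X n ω := by
  funext s
  rw [nuHat, empMean]
  change (n : ℝ)⁻¹ * (∑ i ∈ Finset.range n, delta p (X i ω)).1 s = _
  rw [Prod.fst_sum, wr_sum_apply]
  congr 1
  exact Finset.sum_congr rfl fun i _ => congrFun (toWr_of_memWr ((hX i ω).memWr hp.out)) s

theorem empMean_snd (X : ℕ → Ω → (ℝ≥0 → ℝ) × ℝ≥0) (n : ℕ) (ω : Ω) :
    ((empMean p X n ω).2 : ℝ≥0 → ℝ) = distHat X n ω := by
  funext s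
  rw [distHat, empMean]
  change (n : ℝ)⁻¹ * (∑ i ∈ Finset.range n, delta p (X i ω)).2 s = _
  rw [Prod.snd_sum, wr_sum_apply]
  congr 1
  exact Finset.sum_congr rfl fun i _ => congrFun (toWr_of_memWr (memWr_simplePath hp.out _)) s

/-- The quotient is a function of the increasing integer `#{i | C_i < u}`, hence a step function,
even beyond the largest censoring time. -/
theorem pVar_inv_survHat_ne_top (X : ℕ → Ω → (ℝ≥0 → ℝ) × ℝ≥0) (n : ℕ) (ω : Ω) :
    pVar p (fun u => 1 / survHat X n ω u) ≠ ∞ := by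
  classical
  let k : ℝ≥0 → ℕ := fun u => {i ∈ Finset.range n | (X i ω).2 < u}.card
  have hk : Monotone k := fun a b hab => Finset.card_le_card fun i hi => by
    rw [Finset.mem_filter] at hi ⊢
    exact ⟨hi.1, hi.2.trans_le hab⟩
  have hM : ∀ u, k u ≤ n := fun u => (Finset.card_filter_le _ _).trans (Finset.card_range n).le
  obtain ⟨m, c, U, hU, h⟩ := exists_indicator_sum
    (fun j => 1 / ((n : ℝ)⁻¹ * ((n - j : ℕ) : ℝ))) hk hM
  have h1 : (fun u => 1 / survHat X n ω u)
      = fun u => ∑ j ∈ Finset.range m, c j * (U j).indicator 1 u := by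
    funext u
    rw [← h, survHat_eq_card]
    have h2 : {i ∈ Finset.range n | u ≤ (X i ω).2}.card + k u = n := by
      have h3 := Finset.card_filter_add_card_filter_not (s := Finset.range n)
        (fun i => u ≤ (X i ω).2)
      simpa only [not_le, Finset.card_range] using h3
    congr 4
    omega
  rw [h1]
  exact pVar_sum_ne_top hp.out _ fun j _ => pVar_const_mul_ne_top hp.out _
    (pVar_indicator_ne_top hp.out (hU j))

/-- No positivity of `survHat` on `[0, t]` is required: both sides use the same convention for
division by zero, and the integrand still has bounded variation. -/
theorem muHat_eq_muFun (hp2 : p < 2) (hX : ∀ i ω, IsCountingPath (X i ω).1) (n : ℕ) (ω : Ω)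
    (t : ℝ≥0) : (fun s : Icc 0 t => muHat X n ω s) = muFun p t (empMean p X n ω) := by
  have hf := incRC_nuHat hX n ω
  have h1 := empMean_fst (p := p) hX n ω
  have hmem : MemWr p (nuHat X n ω) := by rw [← h1]; exact (empMean p X n ω).1.2
  have hg := pVar_inv_survHat_ne_top (p := p) X n ω
  have hY : ∀ s, HasYoungIntegral (fun u => 1 / survHat X n ω u) (nuHat X n ω) s
      (muHat X n ω s) := hasYoungIntegral_lsInt hp.out hp2 hg hf hmem.1
  have h2 : muPath t (empMean p X n ω) = fun s : Icc 0 t => muHat X n ω s := by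
    funext s
    rw [muPath, h1]
    exact ((hY s).congr_left fun x hx _ => by rw [kFun_empMean X n ω hx]).youngInt_eq
  have h3 : MemWr p fun s : Icc 0 t => muHat X n ω s := by
    have h4 := memWr_youngInt hp.out hp2 hg hmem (abs_inv_survHat_le X n ω) t
    simpa only [(hY _).youngInt_eq] using h4
  rw [muFun, h2, toWr_of_memWr h3]

end AtEmpirical

end CensRec
end

noncomputable section

namespace CensRec

/-! ### Moment bounds for the `p`-variation of centered increasing processes -/

section Deterministic

variable {α : Type*} [LinearOrder α] {p : ℝ}

/-- An increment between two bins costs at most a multiple of the sum of their `o ^ p`. Inside a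
bin, `|Δh| ^ p ≤ o ^ (p - 1) ΔE`, and these add up to at most `o ^ p`. One control function accounts
for both. -/
theorem pVar_le_of_bins (hp : 1 ≤ p) {h E : α → ℝ} {κ : α → ℕ} (hκ : Monotone κ) {J : ℕ}
    (hJ : ∀ x, κ x < J) {o : ℕ → ℝ≥0∞} (ho : ∀ x, ‖h x‖ₑ ≤ o (κ x)) (hEm : Monotone E)
    (hE : ∀ x y, x ≤ y → κ x = κ y → ‖h y - h x‖ₑ ≤ ENNReal.ofReal (E y - E x))
    (hEo : ∀ x y, x ≤ y → κ x = κ y → ENNReal.ofReal (E y - E x) ≤ o (κ x)) :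
    pVar p h ≤ (2 ^ p + 1) * ∑ l ∈ Finset.range J, o l ^ p := by
  have hp0 : 0 < p := by linarith
  let S : ℕ → ℝ≥0∞ := fun j => ∑ l ∈ Finset.range j, o l ^ p
  have hS : Monotone S := fun i j hij =>
    Finset.sum_le_sum_of_subset (Finset.range_mono hij)
  have hS1 : ∀ j, S (j + 1) = S j + o j ^ p := fun j => Finset.sum_range_succ _ _
  -- The growth of `E` since the beginning of the bin of `x`, as a supremum because the bin need not
  -- contain its infimum.
  let T : α → ℝ≥0∞ := fun x => ⨆ z : {z // z ≤ x ∧ κ z = κ x}, ENNReal.ofReal (E x - E z)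
  have hT : ∀ x, T x ≤ o (κ x) := fun x => iSup_le fun z => by
    exact (hEo z x z.2.1 z.2.2).trans_eq (congrArg o z.2.2)
  have hpow : ∀ a : ℝ≥0∞, a ^ (p - 1) * a = a ^ p := fun a => by
    conv_lhs => rw [← ENNReal.rpow_one a, ← ENNReal.rpow_mul, one_mul]
    rw [← ENNReal.rpow_add_of_nonneg _ _ (by linarith) zero_le_one, sub_add_cancel]
  have hST : ∀ x, S (κ x) + o (κ x) ^ (p - 1) * T x ≤ S (κ x + 1) := fun x => by
    rw [hS1]
    gcongr
    refine (mul_le_mul_right (hT x) _).trans (hpow _).le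
  -- The first summand of the control pays for increments that cross bins, the second for those
  -- inside a bin.
  refine pVar_le_of_control (Ψ := fun x => 2 ^ (p - 1) * (S (κ x) + S (κ x + 1))
    + (S (κ x) + o (κ x) ^ (p - 1) * T x)) (fun x y hxy => ?_) (fun x => ?_)
  · rcases (hκ hxy).eq_or_lt with hk | hk
    · have h1 : ENNReal.ofReal (E y - E x) + T x ≤ T y := by
        have : Nonempty {z // z ≤ x ∧ κ z = κ x} := ⟨⟨x, le_rfl, rfl⟩⟩
        rw [ENNReal.add_iSup]
        refine iSup_le fun z => ?_
        rw [← ENNReal.ofReal_add (sub_nonneg.2 (hEm hxy)) (sub_nonneg.2 (hEm z.2.1)),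
          sub_add_sub_cancel]
        exact le_iSup (fun z : {z // z ≤ y ∧ κ z = κ y} => ENNReal.ofReal (E y - E z))
          ⟨z, z.2.1.trans hxy, z.2.2.trans hk⟩
      have h2 : ‖h y - h x‖ₑ ^ p ≤ o (κ x) ^ (p - 1) * ENNReal.ofReal (E y - E x) := by
        rw [← hpow]
        exact mul_le_mul' (ENNReal.rpow_le_rpow ((hE x y hxy hk).trans (hEo x y hxy hk))
          (by linarith)) (hE x y hxy hk)
      simp only [← hk]
      calc _ ≤ o (κ x) ^ (p - 1) * ENNReal.ofReal (E y - E x) + (2 ^ (p - 1)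
            * (S (κ x) + S (κ x + 1)) + (S (κ x) + o (κ x) ^ (p - 1) * T x)) := by gcongr
        _ = 2 ^ (p - 1) * (S (κ x) + S (κ x + 1)) + (S (κ x) + o (κ x) ^ (p - 1)
            * (ENNReal.ofReal (E y - E x) + T x)) := by ring
        _ ≤ _ := by gcongr
    · have h1 : ‖h y - h x‖ₑ ^ p ≤ 2 ^ (p - 1) * (o (κ y) ^ p + o (κ x) ^ p) :=
        (ENNReal.rpow_le_rpow (enorm_sub_le.trans (add_le_add (ho y) (ho x))) hp0.le).trans
          (ENNReal.rpow_add_le_mul_rpow_add_rpow _ _ hp)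
      have h2 : S (κ x + 1) ≤ S (κ y) := hS hk
      calc _ ≤ 2 ^ (p - 1) * (o (κ y) ^ p + o (κ x) ^ p) + (2 ^ (p - 1)
            * (S (κ x) + S (κ x + 1)) + S (κ x + 1)) := by
            gcongr
            exact hST x
        _ = 2 ^ (p - 1) * ((S (κ x) + o (κ x) ^ p) + (S (κ x + 1) + o (κ y) ^ p))
            + S (κ x + 1) := by ring
        _ ≤ 2 ^ (p - 1) * (S (κ y) + (S (κ y) + o (κ y) ^ p)) + S (κ y) := by
            rw [← hS1]
            gcongr
        _ ≤ _ := by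
            rw [← hS1]
            gcongr
            exact le_self_add
  · have h1 : S (κ x + 1) ≤ S J := hS (hJ x)
    have h2 : S (κ x) ≤ S J := hS (hJ x).le
    calc _ ≤ 2 ^ (p - 1) * (S J + S J) + S J := by
          gcongr
          exact (hST x).trans h1
      _ = (2 ^ (p - 1) * 2 + 1) * S J := by ring
      _ = _ := by
          congr 2
          conv_lhs => rw [← ENNReal.rpow_one 2, ← ENNReal.rpow_mul, one_mul]
          rw [← ENNReal.rpow_add_of_nonneg _ _ (by linarith) zero_le_one, sub_add_cancel]

theorem pVar_sum_le (hp : 1 ≤ p) {ι : Type*} (s : Finset ι) (f : ι → α → ℝ) :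
    pVar p (∑ i ∈ s, f i) ^ (1 / p) ≤ ∑ i ∈ s, pVar p (f i) ^ (1 / p) := by
  classical
  have hp0 : 0 < p := by linarith
  induction s using Finset.induction_on with
  | empty =>
    have : pVar p (0 : α → ℝ) = 0 := pVar_const hp0 0
    simp [this, hp0]
  | insert i s hi ih =>
    rw [Finset.sum_insert hi, Finset.sum_insert hi]
    exact (pVar_add_le hp _ _).trans (by gcongr)

/-- Monotone sequences that exhaust `S` from both sides reduce a supremum over `S` to a countable
monotone one. The case `x i = y i` is there for the empty set. -/
theorem exists_cofinal_seq (S : Set ℝ≥0) [hS : S.OrdConnected] :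
    ∃ x y : ℕ → ℝ≥0, Antitone x ∧ Monotone y ∧ (∀ i, x i ≤ y i) ∧
      (∀ i, (x i ∈ S ∧ y i ∈ S) ∨ x i = y i) ∧
      ∀ z ∈ S, ∃ i, x i ≤ z ∧ z ≤ y i := by
  rcases S.eq_empty_or_nonempty with rfl | hne
  · exact ⟨fun _ => 0, fun _ => 0, antitone_const, monotone_const, fun _ => le_rfl,
      fun _ => Or.inr rfl, by simp⟩
  have : Nonempty S := hne.to_subtype
  obtain ⟨y, hy, hy'⟩ := exists_seq_monotone_tendsto_atTop_atTop S
  obtain ⟨x, hx, hx'⟩ := exists_seq_antitone_tendsto_atTop_atBot S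
  obtain ⟨r⟩ := this
  refine ⟨fun i => min (x i) r, fun i => max (y i) r, fun i j h => min_le_min_right _ (hx h),
    fun i j h => max_le_max_right _ (hy h), fun i => (min_le_right _ _).trans (le_max_right _ _),
    fun i => Or.inl ⟨?_, ?_⟩, fun z hz => ?_⟩
  · rcases min_choice (x i : ℝ≥0) r with h | h <;> simp only [h, Subtype.coe_prop]
  · rcases max_choice (y i : ℝ≥0) r with h | h <;> simp only [h, Subtype.coe_prop]
  · obtain ⟨i, h1, h2⟩ := ((hy'.eventually_ge_atTop ⟨z, hz⟩).and
      (hx'.eventually_le_atBot ⟨z, hz⟩)).exists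
    exact ⟨i, (min_le_left _ _).trans h2, le_trans (show z ≤ y i from h1) (le_max_left _ _)⟩

end Deterministic

section Moment

variable {Ω : Type*} [MeasurableSpace Ω] {P : Measure Ω} [IsProbabilityMeasure P] {p : ℝ}

theorem lintegral_rpow_le_rpow_lintegral {f : Ω → ℝ≥0∞} (hf : AEMeasurable f P) {r : ℝ}
    (hr : 0 < r) (hr1 : r ≤ 1) : ∫⁻ ω, f ω ^ r ∂P ≤ (∫⁻ ω, f ω ∂P) ^ r := by
  have h := eLpNorm'_le_eLpNorm'_of_exponent_le hr hr1 P hf.aestronglyMeasurable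
  simp only [eLpNorm', enorm_eq_self, ENNReal.rpow_one, div_one] at h
  rwa [one_div, ENNReal.rpow_inv_le_iff hr] at h

/-- Jensen's inequality twice: `p ≤ 2` passes from second to `p`-th moments, and `p ≥ 1` moves the
root outside the integral. -/
theorem lintegral_sum_rpow_le (hp : 1 ≤ p) (hp2 : p ≤ 2) {f : ℕ → Ω → ℝ≥0∞} {J : ℕ} {σ : ℝ}
    (hσ : 0 ≤ σ) (hf : ∀ j, AEMeasurable (f j) P)
    (h : ∀ j, ∫⁻ ω, f j ω ^ (2 : ℝ) ∂P ≤ ENNReal.ofReal (σ ^ 2)) (c : ℝ≥0∞) (hc : c ≠ ∞) :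
    ∫⁻ ω, (c * ∑ j ∈ Finset.range J, f j ω ^ p) ^ (1 / p) ∂P
      ≤ c ^ (1 / p) * ENNReal.ofReal ((J : ℝ) ^ (1 / p) * σ) := by
  have hp0 : 0 < p := by linarith
  have h1 : ∀ j, ∫⁻ ω, f j ω ^ p ∂P ≤ ENNReal.ofReal σ ^ p := fun j => by
    calc ∫⁻ ω, f j ω ^ p ∂P = ∫⁻ ω, (f j ω ^ (2 : ℝ)) ^ (p / 2) ∂P := by
          refine lintegral_congr fun ω => ?_
          rw [← ENNReal.rpow_mul]
          congr 1
          ring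
      _ ≤ (∫⁻ ω, f j ω ^ (2 : ℝ) ∂P) ^ (p / 2) :=
          lintegral_rpow_le_rpow_lintegral ((hf j).pow_const _) (by positivity) (by linarith)
      _ ≤ ENNReal.ofReal (σ ^ 2) ^ (p / 2) := by gcongr; exact h j
      _ = ENNReal.ofReal σ ^ p := by
          rw [← Real.rpow_two, ← ENNReal.ofReal_rpow_of_nonneg hσ zero_le_two,
            ← ENNReal.rpow_mul]
          congr 1
          ring
  calc ∫⁻ ω, (c * ∑ j ∈ Finset.range J, f j ω ^ p) ^ (1 / p) ∂P
      ≤ (∫⁻ ω, c * ∑ j ∈ Finset.range J, f j ω ^ p ∂P) ^ (1 / p) :=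
        lintegral_rpow_le_rpow_lintegral ((Finset.aemeasurable_fun_sum _ fun j _ =>
          (hf j).pow_const _).const_mul _) (by positivity) ((div_le_one hp0).2 hp)
    _ = (c * ∑ j ∈ Finset.range J, ∫⁻ ω, f j ω ^ p ∂P) ^ (1 / p) := by
        rw [lintegral_const_mul' _ _ hc, lintegral_finsetSum' _ fun j _ => (hf j).pow_const _]
    _ ≤ (c * ∑ _ ∈ Finset.range J, ENNReal.ofReal σ ^ p) ^ (1 / p) := by
        gcongr
        exact h1 _
    _ = _ := by
        have hp1 : 0 ≤ 1 / p := by positivity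
        rw [Finset.sum_const, Finset.card_range, nsmul_eq_mul, ENNReal.mul_rpow_of_nonneg _ _ hp1,
          ENNReal.mul_rpow_of_nonneg _ _ hp1, one_div, ENNReal.rpow_rpow_inv hp0.ne',
          ENNReal.ofReal_mul (by positivity), ← ENNReal.ofReal_rpow_of_nonneg (by positivity)
            (by positivity), ENNReal.ofReal_natCast]

/-- The oscillation of an increasing process on an interval has a measurable bound with the second
moment of its increments. -/
theorem exists_oscillation {E : Ω → ℝ≥0 → ℝ} (hE : ∀ ω, Monotone (E ω))
    (hm : ∀ u, AEMeasurable (fun ω => E ω u) P) (S : Set ℝ≥0) [S.OrdConnected] {V : ℝ≥0∞}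
    (hV : ∀ x ∈ S, ∀ y ∈ S, x ≤ y →
      ∫⁻ ω, ENNReal.ofReal (E ω y - E ω x) ^ (2 : ℝ) ∂P ≤ V) :
    ∃ o : Ω → ℝ≥0∞, AEMeasurable o P ∧ ∫⁻ ω, o ω ^ (2 : ℝ) ∂P ≤ V ∧
      ∀ ω, ∀ x ∈ S, ∀ y ∈ S, x ≤ y → ENNReal.ofReal (E ω y - E ω x) ≤ o ω := by
  obtain ⟨x, y, hx, hy, hxy, hS, hcof⟩ := exists_cofinal_seq S
  have hmeas : ∀ i, AEMeasurable (fun ω => ENNReal.ofReal (E ω (y i) - E ω (x i))) P := fun i =>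
    ((hm _).sub (hm _)).ennreal_ofReal
  have hmono : ∀ ω, Monotone fun i => ENNReal.ofReal (E ω (y i) - E ω (x i)) := fun ω i j hij =>
    ENNReal.ofReal_le_ofReal (sub_le_sub (hE ω (hy hij)) (hE ω (hx hij)))
  refine ⟨fun ω => ⨆ i, ENNReal.ofReal (E ω (y i) - E ω (x i)), AEMeasurable.iSup hmeas, ?_, ?_⟩
  · have h1 : ∀ ω, (⨆ i, ENNReal.ofReal (E ω (y i) - E ω (x i))) ^ (2 : ℝ)
        = ⨆ i, ENNReal.ofReal (E ω (y i) - E ω (x i)) ^ (2 : ℝ) := fun ω =>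
      (ENNReal.orderIsoRpow 2 two_pos).map_iSup _
    simp only [h1]
    rw [lintegral_iSup' (fun i => (hmeas i).pow_const _) (ae_of_all _ fun ω i j hij =>
      ENNReal.rpow_le_rpow (hmono ω hij) zero_le_two)]
    refine iSup_le fun i => ?_
    rcases hS i with h | h
    · exact hV _ h.1 _ h.2 (hxy i)
    · simp [h]
  · intro ω a ha b hb hab
    obtain ⟨i, hi, _⟩ := hcof a ha
    obtain ⟨j, _, hj⟩ := hcof b hb
    refine le_trans (ENNReal.ofReal_le_ofReal ?_)
      (le_iSup (fun i => ENNReal.ofReal (E ω (y i) - E ω (x i))) (max i j))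
    exact sub_le_sub (hE ω (hj.trans (hy (le_max_right i j))))
      (hE ω ((hx (le_max_left i j)).trans hi))

end Moment

end CensRec
end

noncomputable section

namespace CensRec

/-! ### Dyadic chaining along the level sets of a bounded increasing function -/

section Chaining

/-- The dyadic level sets are nested: each bin of level `k + 1` lies in one bin of level `k`. -/
theorem bin_div_two {m : ℝ≥0 → ℝ} (k : ℕ) (x : ℝ≥0) :
    bin m (2 ^ k) x = bin m (2 ^ (k + 1)) x / 2 := by
  have h := Nat.floor_div_natCast ((2 : ℝ) ^ (k + 1) * m x) 2
  rw [bin, bin, ← h]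
  congr 1
  push_cast
  ring

theorem bin_lt {m : ℝ≥0 → ℝ} (h0 : ∀ x, 0 ≤ m x) (h1 : ∀ x, m x < 1) (k : ℕ) (x : ℝ≥0) :
    bin m (2 ^ k) x < 2 ^ k := by
  have h2 : (0 : ℝ) < 2 ^ k := by positivity
  rw [bin, Nat.floor_lt (mul_nonneg h2.le (h0 x))]
  push_cast
  nlinarith [h1 x]

/-- The representative of the bin of `x` at level `k`. -/
def binPoint (m : ℝ≥0 → ℝ) (k : ℕ) (x : ℝ≥0) : ℝ≥0 := binRep m (2 ^ k) (bin m (2 ^ k) x)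

theorem ordConnected_bin {m : ℝ≥0 → ℝ} (hm : Monotone m) (k j : ℕ) :
    {x | bin m (2 ^ k) x = j}.OrdConnected :=
  ⟨fun x hx y hy z hz => by
    have hb := bin_mono hm (c := 2 ^ k) (by positivity)
    have h1 := hb hz.1
    have h2 := hb hz.2
    simp only [mem_ofPred_eq] at hx hy ⊢
    omega⟩

/-- The terms are a constant times `n ^ (-1/2) θ ^ k` with `θ = 2 ^ (1/p - 1/2) > 1`. So the finest
level dominates, and `2 ^ L ≤ 2 n` gives the order `n ^ (1/p - 1)`. -/
theorem sum_geometric_bound {p B : ℝ} (hp : 1 < p) (hp2 : p < 2) (hB : 0 ≤ B) {n L : ℕ}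
    (hn : 0 < n) (hL : (2 : ℝ) ^ L ≤ 2 * n) :
    ∑ k ∈ Finset.range L, ((2 ^ (k + 1) : ℕ) : ℝ) ^ (1 / p) * √(B / (2 ^ k * n))
      ≤ 2 ^ (1 / p) * √B * (2 ^ (1 / p - 1 / 2) / (2 ^ (1 / p - 1 / 2) - 1))
        * (n : ℝ) ^ (1 / p - 1) := by
  have hn' : (0 : ℝ) < n := by exact_mod_cast hn
  have hr : 0 < 1 / p - 1 / 2 := by
    rw [sub_pos]; exact one_div_lt_one_div_of_lt (by linarith) hp2
  set θ : ℝ := 2 ^ (1 / p - 1 / 2) with hθ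
  have hθ1 : 1 < θ := Real.one_lt_rpow one_lt_two hr
  have hterm : ∀ k : ℕ, ((2 ^ (k + 1) : ℕ) : ℝ) ^ (1 / p) * √(B / (2 ^ k * n))
      = 2 ^ (1 / p) * √B * (n : ℝ) ^ (-(1 / 2 : ℝ)) * θ ^ k := fun k => by
    have h1 : θ ^ k = ((2 : ℝ) ^ k) ^ (1 / p) * ((2 : ℝ) ^ k) ^ (-(1 / 2 : ℝ)) := by
      rw [← Real.rpow_add (by positivity), hθ, ← Real.rpow_natCast, ← Real.rpow_natCast,
        ← Real.rpow_mul zero_le_two, ← Real.rpow_mul zero_le_two]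
      congr 1
      ring
    have h2 : √(B / (2 ^ k * n)) = √B * (((2 : ℝ) ^ k) ^ (-(1 / 2 : ℝ)) * (n : ℝ) ^ (-(1 / 2 : ℝ))) := by
      rw [Real.sqrt_div hB, Real.sqrt_mul (by positivity), Real.sqrt_eq_rpow (2 ^ k),
        Real.sqrt_eq_rpow n, Real.rpow_neg (by positivity), Real.rpow_neg (by positivity),
        ← mul_inv, div_eq_mul_inv]
    push_cast
    rw [pow_succ', Real.mul_rpow zero_le_two (by positivity), h2, h1]
    ring
  simp only [hterm]
  rw [← Finset.mul_sum, geom_sum_eq hθ1.ne']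
  have hθL : θ ^ L ≤ θ * (n : ℝ) ^ (1 / p - 1 / 2) := by
    rw [hθ, ← Real.rpow_natCast, ← Real.rpow_mul zero_le_two, mul_comm (1 / p - 1 / 2),
      Real.rpow_mul zero_le_two, Real.rpow_natCast, ← Real.mul_rpow zero_le_two hn'.le]
    exact Real.rpow_le_rpow (by positivity) hL hr.le
  have hnp : (n : ℝ) ^ (1 / p - 1) = (n : ℝ) ^ (-(1 / 2 : ℝ)) * (n : ℝ) ^ (1 / p - 1 / 2) := by
    rw [← Real.rpow_add hn']
    congr 1
    ring
  have h3 : 0 < θ - 1 := by linarith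
  calc 2 ^ (1 / p) * √B * (n : ℝ) ^ (-(1 / 2 : ℝ)) * ((θ ^ L - 1) / (θ - 1))
      ≤ 2 ^ (1 / p) * √B * (n : ℝ) ^ (-(1 / 2 : ℝ))
        * (θ * (n : ℝ) ^ (1 / p - 1 / 2) / (θ - 1)) := by
        gcongr
        linarith
    _ = _ := by rw [hnp]; ring

variable {Ω : Type*} [MeasurableSpace Ω] {P : Measure Ω} {p B : ℝ}
  {m a : ℝ≥0 → ℝ} {A : Ω → ℝ≥0 → ℝ} {n : ℕ}

theorem lintegral_increment_sq_le (hB : 0 ≤ B) (hm0 : ∀ x, 0 ≤ m x)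
    (hV : ∀ x y, x ≤ y → ∫⁻ ω, ‖A ω y - a y - (A ω x - a x)‖ₑ ^ (2 : ℝ) ∂P
      ≤ ENNReal.ofReal (B * (m y - m x) / n)) (k : ℕ) (x y : ℝ≥0)
    (h : bin m (2 ^ k) x = bin m (2 ^ k) y) :
    ∫⁻ ω, ‖A ω y - a y - (A ω x - a x)‖ₑ ^ (2 : ℝ) ∂P
      ≤ ENNReal.ofReal (√(B / (2 ^ k * n)) ^ 2) := by
  have h1 : |m x - m y| ≤ 1 / 2 ^ k := abs_sub_le_of_bin_eq hm0 (by positivity) h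
  have h2 : ∀ d : ℝ, d ≤ 1 / 2 ^ k → B * d / n ≤ √(B / (2 ^ k * n)) ^ 2 := fun d hd => by
    rw [Real.sq_sqrt (by positivity)]
    calc B * d / n ≤ B * (1 / 2 ^ k) / n := by gcongr
      _ = _ := by field_simp
  rcases le_total x y with hxy | hxy
  · exact (hV x y hxy).trans (ENNReal.ofReal_le_ofReal
      (h2 _ ((le_abs_self _).trans (by rwa [abs_sub_comm]))))
  · have h3 := (hV y x hxy).trans (ENNReal.ofReal_le_ofReal (h2 _ ((le_abs_self _).trans h1)))
    refine le_trans (lintegral_mono fun ω => ?_) h3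
    rw [← enorm_neg, neg_sub]

variable [IsProbabilityMeasure P]

/-- A link of the chain is constant on the at most `2 ^ (k + 1)` bins of level `k + 1`, and on each
it is an increment of `A - a` within one bin of level `k`, hence with second moment at most `B / (2
^ k n)`. -/
theorem exists_increment_majorant (hp : 1 < p) (hp2 : p < 2) (hB : 0 ≤ B) (hm : Monotone m)
    (hm0 : ∀ x, 0 ≤ m x) (hm1 : ∀ x, m x < 1) (hA : ∀ u, AEMeasurable (fun ω => A ω u) P)
    (hV : ∀ x y, x ≤ y → ∫⁻ ω, ‖A ω y - a y - (A ω x - a x)‖ₑ ^ (2 : ℝ) ∂P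
      ≤ ENNReal.ofReal (B * (m y - m x) / n)) (k : ℕ) :
    ∃ W : Ω → ℝ≥0∞, AEMeasurable W P ∧
      (∀ ω, pVar p (fun x => A ω (binPoint m (k + 1) x) - a (binPoint m (k + 1) x)
        - (A ω (binPoint m k x) - a (binPoint m k x))) ^ (1 / p) ≤ W ω) ∧
      ∫⁻ ω, W ω ∂P ≤ (2 ^ p + 1) ^ (1 / p)
        * ENNReal.ofReal (((2 ^ (k + 1) : ℕ) : ℝ) ^ (1 / p) * √(B / (2 ^ k * n))) := by
  let r : ℕ → ℝ≥0 := binRep m (2 ^ (k + 1))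
  let o : ℕ → Ω → ℝ≥0∞ := fun j ω =>
    ‖A ω (r j) - a (r j) - (A ω (binPoint m k (r j)) - a (binPoint m k (r j)))‖ₑ
  have ho : ∀ j, AEMeasurable (o j) P := fun j =>
    (((hA _).sub_const _).sub ((hA _).sub_const _)).enorm
  have hc : ((2 : ℝ≥0∞) ^ p + 1) ≠ ∞ :=
    ENNReal.add_ne_top.2 ⟨ENNReal.rpow_ne_top_of_nonneg (by linarith) (by simp), by simp⟩
  refine ⟨fun ω => ((2 ^ p + 1) * ∑ j ∈ Finset.range (2 ^ (k + 1)), o j ω ^ p) ^ (1 / p),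
    ((Finset.aemeasurable_fun_sum _ fun j _ => (ho j).pow_const _).const_mul _).pow_const _,
    fun ω => ?_, ?_⟩
  · have hp0 : 0 ≤ 1 / p := by positivity
    refine ENNReal.rpow_le_rpow ?_ hp0
    have hval : ∀ x, r (bin m (2 ^ (k + 1)) x) = binPoint m (k + 1) x := fun x => rfl
    -- Nestedness of the bins: the representative at level `k + 1` and the point itself have the
    -- same representative at level `k`.
    have hval2 : ∀ x, binPoint m k (binPoint m (k + 1) x) = binPoint m k x := fun x => by
      have h : bin m (2 ^ (k + 1)) (binPoint m (k + 1) x) = bin m (2 ^ (k + 1)) x :=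
        bin_binRep_bin x
      have h' : bin m (2 ^ k) (binPoint m (k + 1) x) = bin m (2 ^ k) x := by
        rw [bin_div_two, h, ← bin_div_two]
      exact congrArg (binRep m (2 ^ k)) h'
    refine pVar_le_of_bins (E := fun _ => 0) (κ := bin m (2 ^ (k + 1))) (o := fun j => o j ω) hp.le
      (bin_mono hm (by positivity)) (bin_lt hm0 hm1 (k + 1)) (fun x => ?_) monotone_const
      (fun x y _ hxy => ?_) (fun x y _ _ => by simp)
    · simp only [o, hval, hval2]
      exact le_rfl
    · have h1 : binPoint m (k + 1) y = binPoint m (k + 1) x := by rw [← hval, ← hval, hxy]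
      have h2 : binPoint m k y = binPoint m k x := by rw [← hval2, h1, hval2]
      simp [h1, h2]
  · refine lintegral_sum_rpow_le hp.le hp2.le (Real.sqrt_nonneg _) ho (fun j => ?_) _ hc
    exact lintegral_increment_sq_le hB hm0 hV k _ _ (bin_binRep_bin (r j))

/-- Below width `1 / n` of `m` monotonicity replaces chaining. The increments of `A - a` are
dominated by those of the increasing function `A + a`, whose oscillation on a bin has second moment
of order `n ^ (-2)`. -/
theorem exists_remainder_majorant (hp : 1 < p) (hp2 : p < 2) (hB : 0 ≤ B) (hm : Monotone m)
    (hm0 : ∀ x, 0 ≤ m x) (hm1 : ∀ x, m x < 1) (hA : ∀ u, AEMeasurable (fun ω => A ω u) P)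
    (hAm : ∀ ω, Monotone (A ω)) (ham : Monotone a)
    (haB : ∀ x y, x ≤ y → a y - a x ≤ B * (m y - m x))
    (hV : ∀ x y, x ≤ y → ∫⁻ ω, ‖A ω y - a y - (A ω x - a x)‖ₑ ^ (2 : ℝ) ∂P
      ≤ ENNReal.ofReal (B * (m y - m x) / n)) (hn : 0 < n) {L : ℕ} (hL : (n : ℝ) ≤ 2 ^ L) :
    ∃ W : Ω → ℝ≥0∞, AEMeasurable W P ∧
      (∀ ω, pVar p (fun x => A ω x - a x
        - (A ω (binPoint m L x) - a (binPoint m L x))) ^ (1 / p) ≤ W ω) ∧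
      ∫⁻ ω, W ω ∂P ≤ (2 ^ p + 1) ^ (1 / p)
        * ENNReal.ofReal (((2 ^ L : ℕ) : ℝ) ^ (1 / p) * (√(2 * B + 8 * B ^ 2) / n)) := by
  have hn' : (0 : ℝ) < n := by exact_mod_cast hn
  let S : ℕ → Set ℝ≥0 := fun j => {x | bin m (2 ^ L) x = j}
  have hEm : ∀ ω, Monotone fun x => A ω x + a x := fun ω => (hAm ω).add ham
  have hosc : ∀ j, ∃ o : Ω → ℝ≥0∞, AEMeasurable o P ∧
      ∫⁻ ω, o ω ^ (2 : ℝ) ∂P ≤ ENNReal.ofReal ((√(2 * B + 8 * B ^ 2) / n) ^ 2) ∧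
      ∀ ω, ∀ x ∈ S j, ∀ y ∈ S j, x ≤ y →
        ENNReal.ofReal ((A ω y + a y) - (A ω x + a x)) ≤ o ω := fun j => by
    have := ordConnected_bin hm L j
    refine exists_oscillation (E := fun ω x => A ω x + a x) hEm (fun u => (hA u).add_const _) (S j)
      fun x hx y hy hxy => ?_
    have hbin : bin m (2 ^ L) x = bin m (2 ^ L) y := Eq.trans hx (Eq.symm hy)
    have h1 := lintegral_increment_sq_le hB hm0 hV L x y hbin
    have h2 : a y - a x ≤ B / n := by
      have h3 := abs_sub_le_of_bin_eq hm0 (by positivity) hbin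
      rw [abs_sub_comm] at h3
      have h4 : (1 : ℝ) / 2 ^ L ≤ 1 / n := one_div_le_one_div_of_le hn' hL
      calc a y - a x ≤ B * (m y - m x) := haB x y hxy
        _ ≤ B * (1 / n) := mul_le_mul_of_nonneg_left
            ((le_abs_self _).trans (h3.trans h4)) hB
        _ = B / n := by ring
    have hBn : 0 ≤ B / n := by positivity
    -- The increment of `A + a` is the centered increment plus `2 (a y - a x) ≤ 2 B / n`. With `(x +
    -- y) ^ 2 ≤ 2 (x ^ 2 + y ^ 2)` this gives `(2 B + 8 B ^ 2) / n ^ 2`.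
    calc ∫⁻ ω, ENNReal.ofReal ((A ω y + a y) - (A ω x + a x)) ^ (2 : ℝ) ∂P
        ≤ ∫⁻ ω, 2 * (‖A ω y - a y - (A ω x - a x)‖ₑ ^ (2 : ℝ)
            + ENNReal.ofReal (2 * (B / n)) ^ (2 : ℝ)) ∂P := by
          refine lintegral_mono fun ω => ?_
          have h5 := ENNReal.rpow_add_le_mul_rpow_add_rpow ‖A ω y - a y - (A ω x - a x)‖ₑ
            (ENNReal.ofReal (2 * (B / n))) one_le_two
          rw [show (2 : ℝ) - 1 = 1 by norm_num, ENNReal.rpow_one] at h5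
          refine le_trans (ENNReal.rpow_le_rpow ?_ zero_le_two) h5
          rw [← ofReal_norm, ← ENNReal.ofReal_add (norm_nonneg _) (by positivity)]
          refine ENNReal.ofReal_le_ofReal ?_
          have := Real.le_norm_self (A ω y - a y - (A ω x - a x))
          linarith
      _ = 2 * (∫⁻ ω, ‖A ω y - a y - (A ω x - a x)‖ₑ ^ (2 : ℝ) ∂P
            + ENNReal.ofReal (2 * (B / n)) ^ (2 : ℝ)) := by
          rw [lintegral_const_mul' _ _ (by simp), lintegral_add_right' _ aemeasurable_const,
            lintegral_const, measure_univ, mul_one]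
      _ ≤ ENNReal.ofReal 2 * (ENNReal.ofReal (√(B / (2 ^ L * n)) ^ 2)
            + ENNReal.ofReal ((2 * (B / n)) ^ 2)) := by
          rw [ENNReal.ofReal_rpow_of_nonneg (by positivity) zero_le_two, Real.rpow_two]
          gcongr
          simp
      _ ≤ _ := by
          rw [← ENNReal.ofReal_add (by positivity) (by positivity),
            ← ENNReal.ofReal_mul zero_le_two, Real.sq_sqrt (by positivity), div_pow,
            Real.sq_sqrt (by positivity)]
          refine ENNReal.ofReal_le_ofReal ?_
          have h6 : B / (2 ^ L * n) ≤ B / (n * n) := by gcongr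
          calc 2 * (B / (2 ^ L * n) + (2 * (B / n)) ^ 2)
              ≤ 2 * (B / (n * n) + (2 * (B / n)) ^ 2) := by gcongr
            _ = _ := by field_simp; ring
  choose o ho ho2 hoS using hosc
  have hc : ((2 : ℝ≥0∞) ^ p + 1) ≠ ∞ :=
    ENNReal.add_ne_top.2 ⟨ENNReal.rpow_ne_top_of_nonneg (by linarith) (by simp), by simp⟩
  refine ⟨fun ω => ((2 ^ p + 1) * ∑ j ∈ Finset.range (2 ^ L), o j ω ^ p) ^ (1 / p),
    ((Finset.aemeasurable_fun_sum _ fun j _ => (ho j).pow_const _).const_mul _).pow_const _,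
    fun ω => ?_, lintegral_sum_rpow_le hp.le hp2.le (by positivity) ho ho2 _ hc⟩
  have hp0 : 0 ≤ 1 / p := by positivity
  refine ENNReal.rpow_le_rpow ?_ hp0
  have hinc : ∀ x y, x ≤ y → ‖A ω y - a y - (A ω x - a x)‖ₑ
      ≤ ENNReal.ofReal ((A ω y + a y) - (A ω x + a x)) := fun x y hxy => by
    rw [← ofReal_norm, Real.norm_eq_abs]
    refine ENNReal.ofReal_le_ofReal (abs_le.2 ⟨?_, ?_⟩) <;> linarith [hAm ω hxy, ham hxy]
  have hbp : ∀ x, bin m (2 ^ L) (binPoint m L x) = bin m (2 ^ L) x := fun x => bin_binRep_bin x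
  refine pVar_le_of_bins (E := fun x => A ω x + a x) (κ := bin m (2 ^ L)) (o := fun j => o j ω)
    hp.le (bin_mono hm (by positivity)) (bin_lt hm0 hm1 L) (fun x => ?_) (hEm ω)
    (fun x y hxy hk => ?_) (fun x y hxy hk => hoS _ ω x rfl y hk.symm hxy)
  · rcases le_total x (binPoint m L x) with h | h
    · rw [← enorm_neg, neg_sub]
      exact (hinc _ _ h).trans (hoS _ ω _ rfl _ (hbp x) h)
    · exact (hinc _ _ h).trans (hoS _ ω _ (hbp x) _ rfl h)
  · have h1 : binPoint m L y = binPoint m L x := by rw [binPoint, binPoint, hk]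
    rw [h1, sub_sub_sub_cancel_right]
    exact hinc x y hxy

/-- A bound of order `n ^ (1 / p - 1)` for the mean of the `p`-variation seminorm of a centered
increasing process whose increments have variances of order `1 / n`. -/
theorem exists_pVar_majorant (hp : 1 < p) (hp2 : p < 2) (hB : 0 ≤ B) :
    ∃ c : ℝ≥0∞, c ≠ ∞ ∧ ∀ (m a : ℝ≥0 → ℝ) (A : Ω → ℝ≥0 → ℝ) (n : ℕ), Monotone m →
      (∀ x, 0 ≤ m x) → (∀ x, m x < 1) → (∀ u, AEMeasurable (fun ω => A ω u) P) →
      (∀ ω, Monotone (A ω)) → Monotone a →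
      (∀ x y, x ≤ y → a y - a x ≤ B * (m y - m x)) →
      (∀ x y, x ≤ y → ∫⁻ ω, ‖A ω y - a y - (A ω x - a x)‖ₑ ^ (2 : ℝ) ∂P
        ≤ ENNReal.ofReal (B * (m y - m x) / n)) → 0 < n →
      ∃ W : Ω → ℝ≥0∞, AEMeasurable W P ∧
        (∀ ω, pVar p (fun x => A ω x - a x) ^ (1 / p) ≤ W ω) ∧
        ∫⁻ ω, W ω ∂P ≤ c * ENNReal.ofReal ((n : ℝ) ^ (1 / p - 1)) := by
  have hp0 : 0 < p := by linarith
  have hc : ((2 : ℝ≥0∞) ^ p + 1) ^ (1 / p) ≠ ∞ :=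
    ENNReal.rpow_ne_top_of_nonneg (by positivity)
      (ENNReal.add_ne_top.2 ⟨ENNReal.rpow_ne_top_of_nonneg (by linarith) (by simp), by simp⟩)
  refine ⟨(2 ^ p + 1) ^ (1 / p) * ENNReal.ofReal (2 ^ (1 / p) * √B
    * (2 ^ (1 / p - 1 / 2) / (2 ^ (1 / p - 1 / 2) - 1)) + 2 ^ (1 / p) * √(2 * B + 8 * B ^ 2)),
    ENNReal.mul_ne_top hc ENNReal.ofReal_ne_top, ?_⟩
  intro m a A n hm hm0 hm1 hA hAm ham haB hV hn
  have hn' : (0 : ℝ) < n := by exact_mod_cast hn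
  -- Since `2 ^ l ≤ n < 2 ^ (l + 1)`, the finest level `l + 1` has bins of `m`-width less than `1 /
  -- n`, and their number is at most `2 n`.
  obtain ⟨l, hl1, hl2⟩ := exists_nat_pow_near (x := (n : ℝ)) (y := 2) (by exact_mod_cast hn)
    one_lt_two
  have hL : (2 : ℝ) ^ (l + 1) ≤ 2 * n := by rw [pow_succ']; linarith
  choose W hW hWp hWi using exists_increment_majorant hp hp2 hB hm hm0 hm1 hA hV
  obtain ⟨R, hR, hRp, hRi⟩ := exists_remainder_majorant hp hp2 hB hm hm0 hm1 hA hAm ham haB hV hn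
    hl2.le
  refine ⟨fun ω => ∑ k ∈ Finset.range (l + 1), W k ω + R ω,
    (Finset.aemeasurable_fun_sum _ fun k _ => hW k).add hR, fun ω => ?_, ?_⟩
  · let D : ℝ≥0 → ℝ := fun x => A ω x - a x
    have h0 : ∀ x, bin m (2 ^ 0) x = 0 := fun x => by
      have := bin_lt hm0 hm1 0 x
      omega
    -- At level zero there is a single bin because `0 ≤ m < 1`; the chain starts from a constant,
    -- which has no variation.
    have hdec : (fun x => A ω x - a x) = (fun _ => D (binRep m (2 ^ 0) 0))
        + ((∑ k ∈ Finset.range (l + 1), fun x => D (binPoint m (k + 1) x) - D (binPoint m k x))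
          + fun x => D x - D (binPoint m (l + 1) x)) := by
      funext x
      have h1 : D (binRep m (2 ^ 0) 0) = D (binPoint m 0 x) := by rw [binPoint, h0]
      have h2 := Finset.sum_range_sub (fun k => D (binPoint m k x)) (l + 1)
      simp only [Pi.add_apply, Finset.sum_apply, h1, h2]
      simp only [D]
      ring
    rw [hdec]
    refine (pVar_add_le hp.le _ _).trans ?_
    rw [pVar_const hp0, ENNReal.zero_rpow_of_pos (by positivity), zero_add]
    refine (pVar_add_le hp.le _ _).trans (add_le_add ((pVar_sum_le hp.le _ _).trans
      (Finset.sum_le_sum fun k _ => hWp k ω)) (hRp ω))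
  · rw [lintegral_add_right' _ hR, lintegral_finsetSum' _ fun k _ => hW k]
    have hsum := sum_geometric_bound hp hp2 hB hn hL
    have hθ : (0 : ℝ) < 2 ^ (1 / p - 1 / 2) - 1 := by
      have hr : 0 < 1 / p - 1 / 2 := by
        rw [sub_pos]; exact one_div_lt_one_div_of_lt (by linarith) hp2
      linarith [Real.one_lt_rpow one_lt_two hr]
    have hrem : ((2 ^ (l + 1) : ℕ) : ℝ) ^ (1 / p) * (√(2 * B + 8 * B ^ 2) / n)
        ≤ 2 ^ (1 / p) * √(2 * B + 8 * B ^ 2) * (n : ℝ) ^ (1 / p - 1) := by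
      rw [Real.rpow_sub_one hn'.ne']
      calc ((2 ^ (l + 1) : ℕ) : ℝ) ^ (1 / p) * (√(2 * B + 8 * B ^ 2) / n)
          ≤ (2 * (n : ℝ)) ^ (1 / p) * (√(2 * B + 8 * B ^ 2) / n) := by
            push_cast
            gcongr
        _ = _ := by rw [Real.mul_rpow zero_le_two hn'.le]; ring
    calc ∑ k ∈ Finset.range (l + 1), ∫⁻ ω, W k ω ∂P + ∫⁻ ω, R ω ∂P
        ≤ ∑ k ∈ Finset.range (l + 1), (2 ^ p + 1) ^ (1 / p)
            * ENNReal.ofReal (((2 ^ (k + 1) : ℕ) : ℝ) ^ (1 / p) * √(B / (2 ^ k * n)))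
          + (2 ^ p + 1) ^ (1 / p) * ENNReal.ofReal (((2 ^ (l + 1) : ℕ) : ℝ) ^ (1 / p)
            * (√(2 * B + 8 * B ^ 2) / n)) := add_le_add (Finset.sum_le_sum fun k _ => hWi k) hRi
      _ = (2 ^ p + 1) ^ (1 / p) * ENNReal.ofReal (∑ k ∈ Finset.range (l + 1),
            ((2 ^ (k + 1) : ℕ) : ℝ) ^ (1 / p) * √(B / (2 ^ k * n))
          + ((2 ^ (l + 1) : ℕ) : ℝ) ^ (1 / p) * (√(2 * B + 8 * B ^ 2) / n)) := by
          rw [← Finset.mul_sum, ← mul_add, ENNReal.ofReal_add (Finset.sum_nonneg fun k _ => by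
            positivity) (by positivity), ENNReal.ofReal_sum_of_nonneg fun k _ => by positivity]
      _ ≤ _ := by
          rw [mul_assoc, ← ENNReal.ofReal_mul (by positivity)]
          gcongr
          rw [add_mul]
          exact add_le_add hsum hrem

end Chaining

end CensRec
end

noncomputable section

namespace CensRec

/-! ### The empirical mean of independent increasing processes -/

section EmpiricalProcess

variable {Ω : Type*} [MeasurableSpace Ω] {P : Measure Ω} [IsProbabilityMeasure P]

theorem lintegral_mean_sub_sq {X : ℕ → Ω → ℝ} (hX : MemLp (X 0) 2 P)
    (hind : ∀ i j, i ≠ j → IndepFun (X i) (X j) P) (hid : ∀ i, IdentDistrib (X i) (X 0) P P)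
    {n : ℕ} (hn : 0 < n) :
    ∫⁻ ω, ‖(n : ℝ)⁻¹ * ∑ i ∈ Finset.range n, X i ω - ∫ ω, X 0 ω ∂P‖ₑ ^ (2 : ℝ) ∂P
      = ENNReal.ofReal (Var[X 0; P] / n) := by
  have hn' : (n : ℝ) ≠ 0 := by exact_mod_cast hn.ne'
  have hL : ∀ i, MemLp (X i) 2 P := fun i => (hid i).symm.memLp_snd hX
  have hS : MemLp (∑ i ∈ Finset.range n, X i) 2 P := memLp_finsetSum' _ fun i _ => hL i
  have hM : MemLp (fun ω => (n : ℝ)⁻¹ * (∑ i ∈ Finset.range n, X i) ω) 2 P := hS.const_mul _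
  have hvar : Var[fun ω => (n : ℝ)⁻¹ * (∑ i ∈ Finset.range n, X i) ω; P] = Var[X 0; P] / n := by
    rw [variance_const_mul, IndepFun.variance_sum (fun i _ => hL i) fun i _ j _ hij => hind i j hij,
      Finset.sum_congr rfl fun i _ => (hid i).variance_eq, Finset.sum_const, Finset.card_range,
      nsmul_eq_mul]
    field_simp
  have hmean : ∫ ω, (n : ℝ)⁻¹ * (∑ i ∈ Finset.range n, X i) ω ∂P = ∫ ω, X 0 ω ∂P := by
    simp only [Finset.sum_apply]
    rw [integral_const_mul, integral_finsetSum _ fun i _ => (hL i).integrable one_le_two,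
      Finset.sum_congr rfl fun i _ => (hid i).integral_eq, Finset.sum_const, Finset.card_range,
      nsmul_eq_mul, inv_mul_cancel_left₀ hn']
  rw [← hvar, ofReal_variance hM, evariance, hmean]
  simp only [Finset.sum_apply, ENNReal.rpow_two]

variable {E : Type*} [MeasurableSpace E]

/-- The empirical mean of independent increasing processes converges in `p`-variation at a rate. -/
theorem exists_mean_pVar_majorant {p : ℝ} (hp : 1 < p) (hp2 : p < 2) {Y : ℕ → Ω → E}
    (hind : iIndepFun Y P) (hid : ∀ i, IdentDistrib (Y i) (Y 0) P P) {Z : E → ℝ≥0 → ℝ} {b : E → ℝ}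
    (hZ : ∀ e, Monotone (Z e)) (hZm : ∀ u, Measurable fun e => Z e u) (hZ0 : ∀ e u, 0 ≤ Z e u)
    (hZb : ∀ e u, Z e u ≤ b e) (hb : MemLp (fun ω => b (Y 0 ω)) 2 P) :
    ∃ c : ℝ≥0∞, c ≠ ∞ ∧ ∀ n : ℕ, 0 < n → ∃ W : Ω → ℝ≥0∞, AEMeasurable W P ∧
      (∀ ω, pVar p (fun s => (n : ℝ)⁻¹ * ∑ i ∈ Finset.range n, Z (Y i ω) s
        - ∫ ω, Z (Y 0 ω) s ∂P) ^ (1 / p) ≤ W ω) ∧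
      ∫⁻ ω, W ω ∂P ≤ c * ENNReal.ofReal ((n : ℝ) ^ (1 / p - 1)) := by
  have hb0 : ∀ e, 0 ≤ b e := fun e => (hZ0 e 0).trans (hZb e 0)
  have hYm : ∀ i, AEMeasurable (Y i) P := fun i => (hid i).aemeasurable_fst
  have hZY : ∀ i u, AEMeasurable (fun ω => Z (Y i ω) u) P := fun i u =>
    (hZm u).comp_aemeasurable (hYm i)
  have hL : ∀ u, MemLp (fun ω => Z (Y 0 ω) u) 2 P := fun u =>
    hb.of_le (hZY 0 u).aestronglyMeasurable (ae_of_all _ fun ω => by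
      rw [Real.norm_of_nonneg (hZ0 _ _)]
      exact (hZb _ _).trans (le_abs_self _))
  have hint : ∀ u, Integrable (fun ω => Z (Y 0 ω) u) P := fun u => (hL u).integrable one_le_two
  have hb1 : MemLp (fun ω => b (Y 0 ω) + 1) 2 P := hb.add (memLp_const 1)
  have hprod : ∀ u, Integrable (fun ω => (b (Y 0 ω) + 1) * Z (Y 0 ω) u) P := fun u =>
    hb1.integrable_mul (hL u)
  have hprodb : Integrable (fun ω => (b (Y 0 ω) + 1) * b (Y 0 ω)) P := hb1.integrable_mul hb
  set M : ℝ := ∫ ω, (b (Y 0 ω) + 1) * b (Y 0 ω) ∂P with hM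
  have hM0 : 0 ≤ M := integral_nonneg fun ω =>
    mul_nonneg (by linarith [hb0 (Y 0 ω)]) (hb0 _)
  -- An increment of `Z` is at most `b`, so its second moment is at most its `(b + 1)`-weighted
  -- mean. As the weight is at least one, the same function dominates the increments of the mean.
  let m0 : ℝ≥0 → ℝ := fun u => ∫ ω, (b (Y 0 ω) + 1) * Z (Y 0 ω) u ∂P
  have hm0M : ∀ u, m0 u ≤ M := fun u => integral_mono (hprod u) hprodb fun ω =>
    mul_le_mul_of_nonneg_left (hZb _ _) (by linarith [hb0 (Y 0 ω)])
  have hm00 : ∀ u, 0 ≤ m0 u := fun u => integral_nonneg fun ω =>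
    mul_nonneg (by linarith [hb0 (Y 0 ω)]) (hZ0 _ _)
  have hdiff : ∀ x y, m0 y - m0 x = ∫ ω, (b (Y 0 ω) + 1) * (Z (Y 0 ω) y - Z (Y 0 ω) x) ∂P :=
    fun x y => by
      rw [← integral_sub (hprod y) (hprod x)]
      simp only [mul_sub]
  have hdint : ∀ x y, Integrable (fun ω => (b (Y 0 ω) + 1) * (Z (Y 0 ω) y - Z (Y 0 ω) x)) P :=
    fun x y => hb1.integrable_mul ((hL y).sub (hL x))
  have hscale : ∀ x y, (M + 1) * (m0 y / (M + 1) - m0 x / (M + 1)) = m0 y - m0 x := fun x y => by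
    field_simp
  -- Since `m0 ≤ M`, dividing by `M + 1` brings it strictly below one; the factor reappears as the
  -- constant `B = M + 1`.
  obtain ⟨c, hc, H⟩ := exists_pVar_majorant (P := P) hp hp2 (show 0 ≤ M + 1 by linarith)
  refine ⟨c, hc, fun n hn => H (fun u => m0 u / (M + 1)) (fun s => ∫ ω, Z (Y 0 ω) s ∂P)
    (fun ω s => (n : ℝ)⁻¹ * ∑ i ∈ Finset.range n, Z (Y i ω) s) n (fun x y hxy => ?_)
    (fun x => div_nonneg (hm00 x) (by linarith))
    (fun x => (div_lt_one (by linarith)).2 (by linarith [hm0M x])) (fun u => ?_)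
    (fun ω x y hxy => ?_) (fun x y hxy => ?_) (fun x y hxy => ?_) (fun x y hxy => ?_) hn⟩
  · refine div_le_div_of_nonneg_right ?_ (by linarith)
    exact integral_mono (hprod x) (hprod y) fun ω =>
      mul_le_mul_of_nonneg_left (hZ _ hxy) (by linarith [hb0 (Y 0 ω)])
  · exact (Finset.aemeasurable_fun_sum _ fun i _ => hZY i u).const_mul _
  · exact mul_le_mul_of_nonneg_left (Finset.sum_le_sum fun i _ => hZ _ hxy) (by positivity)
  · exact integral_mono (hint x) (hint y) fun ω => hZ _ hxy
  · rw [hscale, hdiff, ← integral_sub (hint y) (hint x)]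
    refine integral_mono ((hint y).sub (hint x)) (hdint x y) fun ω => ?_
    have h1 : 0 ≤ Z (Y 0 ω) y - Z (Y 0 ω) x := sub_nonneg.2 (hZ _ hxy)
    exact le_mul_of_one_le_left h1 (by linarith [hb0 (Y 0 ω)])
  · have hmeas : Measurable fun e => Z e y - Z e x := (hZm y).sub (hZm x)
    have h1 := lintegral_mean_sub_sq (P := P) (X := fun i ω => Z (Y i ω) y - Z (Y i ω) x)
      ((hL y).sub (hL x)) (fun i j hij => (hind.indepFun hij).comp hmeas hmeas)
      (fun i => (hid i).comp hmeas) hn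
    rw [hscale]
    have h2 : ∀ ω, (n : ℝ)⁻¹ * ∑ i ∈ Finset.range n, Z (Y i ω) y - ∫ ω, Z (Y 0 ω) y ∂P
        - ((n : ℝ)⁻¹ * ∑ i ∈ Finset.range n, Z (Y i ω) x - ∫ ω, Z (Y 0 ω) x ∂P)
        = (n : ℝ)⁻¹ * ∑ i ∈ Finset.range n, (Z (Y i ω) y - Z (Y i ω) x)
          - ∫ ω, (Z (Y 0 ω) y - Z (Y 0 ω) x) ∂P := fun ω => by
      rw [Finset.sum_sub_distrib, integral_sub (hint y) (hint x)]
      ring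
    simp only [h2]
    rw [h1]
    refine ENNReal.ofReal_le_ofReal (div_le_div_of_nonneg_right ?_ (Nat.cast_nonneg n))
    refine (variance_le_expectation_sq ((hL y).sub (hL x)).aestronglyMeasurable).trans ?_
    rw [hdiff]
    refine integral_mono ((hL y).sub (hL x)).integrable_sq (hdint x y) fun ω => ?_
    have h3 : 0 ≤ Z (Y 0 ω) y - Z (Y 0 ω) x := sub_nonneg.2 (hZ _ hxy)
    simp only [Pi.pow_apply, sq]
    have h4 : Z (Y 0 ω) y - Z (Y 0 ω) x ≤ b (Y 0 ω) + 1 := by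
      linarith [hZ0 (Y 0 ω) x, hZb (Y 0 ω) y]
    exact mul_le_mul_of_nonneg_right h4 h3

end EmpiricalProcess

end CensRec
end

noncomputable section

namespace CensRec

/-! ### Convergence of the empirical mean in the `p`-variation norm -/

section NormBound

theorem wr_enorm_le {p : ℝ} [hp : Fact (1 ≤ p)] (w : Wr ℝ≥0 p) :
    ‖w‖ₑ ≤ 2 * pVar p w ^ (1 / p) + ‖w 0‖ₑ := by
  have h1 : supENorm w ≤ pVar p w ^ (1 / p) + ‖w 0‖ₑ := iSup_le fun s => by
    calc ‖w s‖ₑ = ‖w s - w 0 + w 0‖ₑ := by rw [sub_add_cancel]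
      _ ≤ _ := (enorm_add_le _ _).trans (by gcongr; exact enorm_sub_le_pVar hp.out _ _ _)
  calc ‖w‖ₑ = ENNReal.ofReal ‖w‖ := (ofReal_norm w).symm
    _ ≤ pVarENorm p w := ENNReal.ofReal_toReal_le
    _ ≤ pVar p w ^ (1 / p) + (pVar p w ^ (1 / p) + ‖w 0‖ₑ) := add_le_add le_rfl h1
    _ = _ := by ring

theorem prod_enorm_le {V W : Type*} [NormedAddCommGroup V] [NormedAddCommGroup W] (f : V × W) :
    ‖f‖ₑ ≤ ‖f.1‖ₑ + ‖f.2‖ₑ := by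
  rw [← ofReal_norm, ← ofReal_norm, ← ofReal_norm, ← ENNReal.ofReal_add (norm_nonneg _)
    (norm_nonneg _), Prod.norm_def]
  exact ENNReal.ofReal_le_ofReal (max_le_add_of_nonneg (norm_nonneg _) (norm_nonneg _))

variable {Ω Ω₀ : Type*} [MeasurableSpace Ω] [MeasurableSpace Ω₀] {P : Measure Ω}
  {P₀ : Measure Ω₀} {X : ℕ → Ω → (ℝ≥0 → ℝ) × ℝ≥0} {X₀ : Ω₀ → (ℝ≥0 → ℝ) × ℝ≥0}

theorem ae_time_pos (hpos : ∀ ω, 0 < (X₀ ω).2) (hid : ∀ i, IdentDistrib (X i) X₀ P P₀) :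
    ∀ᵐ ω ∂P, ∀ i, 0 < (X i ω).2 := by
  rw [ae_all_iff]
  intro i
  have hS : MeasurableSet {z : (ℝ≥0 → ℝ) × ℝ≥0 | 0 < z.2} :=
    measurableSet_lt measurable_const measurable_snd
  exact (hid i).symm.ae_mem_snd hS (ae_of_all _ hpos)

/-- Markov's inequality for a measurable majorant, so that measurability of `Q n` itself, later a
`p`-variation norm, is not needed. -/
theorem tendsto_measure_of_majorant {Q : ℕ → Ω → ℝ≥0∞} {r : ℝ} (hr : r < -(1 / 4))
    (h : ∃ c : ℝ≥0∞, c ≠ ∞ ∧ ∀ n : ℕ, 0 < n → ∃ W : Ω → ℝ≥0∞, AEMeasurable W P ∧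
      (∀ᵐ ω ∂P, Q n ω ≤ W ω) ∧ ∫⁻ ω, W ω ∂P ≤ c * ENNReal.ofReal ((n : ℝ) ^ r)) {δ : ℝ}
    (hδ : 0 < δ) :
    Tendsto (fun n : ℕ => P {ω | ENNReal.ofReal (δ * (n : ℝ) ^ (-(1 / 4 : ℝ))) ≤ Q n ω}) atTop
      (𝓝 0) := by
  obtain ⟨c, hc, H⟩ := h
  have hlim : Tendsto (fun n : ℕ => c * ENNReal.ofReal (δ⁻¹ * (n : ℝ) ^ (r + 1 / 4))) atTop
      (𝓝 0) := by
    have h1 : Tendsto (fun n : ℕ => (n : ℝ) ^ (r + 1 / 4)) atTop (𝓝 0) := by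
      have h2 := (tendsto_rpow_neg_atTop (show 0 < -(r + 1 / 4) by linarith)).comp
        tendsto_natCast_atTop_atTop
      refine h2.congr fun n => ?_
      rw [Function.comp_apply, neg_neg]
    have h3 := ENNReal.tendsto_ofReal (h1.const_mul δ⁻¹)
    rw [mul_zero, ENNReal.ofReal_zero] at h3
    have h4 := ENNReal.Tendsto.const_mul (a := c) h3 (Or.inr hc)
    rwa [mul_zero] at h4
  refine tendsto_of_tendsto_of_tendsto_of_le_of_le' tendsto_const_nhds hlim
    (Eventually.of_forall fun _ => zero_le) ?_
  filter_upwards [eventually_gt_atTop 0] with n hn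
  have hn' : (0 : ℝ) < n := by exact_mod_cast hn
  obtain ⟨W, hW, hQ, hi⟩ := H n hn
  have hd : 0 < δ * (n : ℝ) ^ (-(1 / 4 : ℝ)) := by positivity
  calc P {ω | ENNReal.ofReal (δ * (n : ℝ) ^ (-(1 / 4 : ℝ))) ≤ Q n ω}
      ≤ P {ω | ENNReal.ofReal (δ * (n : ℝ) ^ (-(1 / 4 : ℝ))) ≤ W ω} := by
        refine measure_mono_ae ?_
        filter_upwards [hQ] with ω hω h3
        exact le_trans h3 hω
    _ ≤ (∫⁻ ω, W ω ∂P) / ENNReal.ofReal (δ * (n : ℝ) ^ (-(1 / 4 : ℝ))) :=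
        meas_ge_le_lintegral_div hW (by positivity) ENNReal.ofReal_ne_top
    _ ≤ c * ENNReal.ofReal ((n : ℝ) ^ r) / ENNReal.ofReal (δ * (n : ℝ) ^ (-(1 / 4 : ℝ))) := by
        gcongr
    _ = _ := by
        rw [mul_div_assoc, ← ENNReal.ofReal_div_of_pos hd]
        congr 2
        rw [Real.rpow_neg hn'.le, Real.rpow_add hn']
        field_simp

variable [IsProbabilityMeasure P]

/-- Both components are empirical means of increasing processes, bounded by the total number of
observed events and by one. They agree with `F` at time zero, so the variation bounds the norm. -/
theorem exists_empMean_majorant {p : ℝ} [hp : Fact (1 ≤ p)] (hp1 : 1 < p) (hp2 : p < 2)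
    (hX : ∀ i ω, IsCountingPath (X i ω).1) (hX₀ : ∀ ω, IsCountingPath (X₀ ω).1)
    (hpos : ∀ ω, 0 < (X₀ ω).2) (hind : iIndepFun X P) (hid : ∀ i, IdentDistrib (X i) X₀ P P₀)
    (h2 : MemLp (fun ω => atInfty (X₀ ω).1) 2 P₀) {F : Wr ℝ≥0 p × Wr ℝ≥0 p}
    (hF1 : ∀ s, F.1 s = ∫ ω, (X₀ ω).1 s ∂P₀)
    (hF2 : ∀ s, F.2 s = ∫ ω, simplePath (X₀ ω).2 s ∂P₀) :
    ∃ c : ℝ≥0∞, c ≠ ∞ ∧ ∀ n : ℕ, 0 < n → ∃ W : Ω → ℝ≥0∞, AEMeasurable W P ∧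
      (∀ᵐ ω ∂P, ‖empMean p X n ω - F‖ₑ ≤ W ω) ∧
      ∫⁻ ω, W ω ∂P ≤ c * ENNReal.ofReal ((n : ℝ) ^ (1 / p - 1)) := by
  have hidO : ∀ i, IdentDistrib (obs (hX i)) (obs hX₀) P P₀ := fun i =>
    identDistrib_obs (hX i) hX₀ (hid i)
  have hidO' : ∀ i, IdentDistrib (obs (hX i)) (obs (hX 0)) P P := fun i =>
    (hidO i).trans (hidO 0).symm
  have hindO := iIndepFun_obs hX hind
  have hms : ∀ u, Measurable fun z : Path × ℝ≥0 => simplePath z.2 u := fun u =>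
    (Measurable.indicator (f := fun _ : ℝ≥0 => (1 : ℝ)) measurable_const
      (measurableSet_Iic (a := u))).comp measurable_snd
  have hmp : ∀ u, Measurable fun z : Path × ℝ≥0 => z.1.1 u := fun u =>
    (measurable_path_eval u).comp measurable_fst
  obtain ⟨c1, hc1, H1⟩ := exists_mean_pVar_majorant (P := P) hp1 hp2 (Y := fun i => obs (hX i))
    hindO hidO' (Z := fun z => z.1.1) (b := fun z => atInfty z.1.1) (fun z => z.1.2.mono) hmp
    (fun z => z.1.2.nonneg) (fun z => z.1.2.le_atInfty)
    (((hidO 0).comp (measurable_path_atInfty.comp measurable_fst)).symm.memLp_snd h2)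
  obtain ⟨c2, hc2, H2⟩ := exists_mean_pVar_majorant (P := P) hp1 hp2 (Y := fun i => obs (hX i))
    hindO hidO' (Z := fun z => simplePath z.2) (b := fun _ => 1)
    (fun z => (incRC_simplePath z.2).mono) hms
    (fun z => simplePath_nonneg z.2) (fun z => simplePath_le_one z.2) (memLp_const 1)
  have hI1 : ∀ s, ∫ ω, (obs (hX 0) ω).1.1 s ∂P = F.1 s := fun s => by
    rw [hF1]; exact ((hidO 0).comp (hmp s)).integral_eq
  have hI2 : ∀ s, ∫ ω, simplePath (obs (hX 0) ω).2 s ∂P = F.2 s := fun s => by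
    rw [hF2]; exact ((hidO 0).comp (hms s)).integral_eq
  refine ⟨2 * (c1 + c2), ENNReal.mul_ne_top (by simp) (ENNReal.add_ne_top.2 ⟨hc1, hc2⟩),
    fun n hn => ?_⟩
  obtain ⟨W1, hW1, hp1', hi1⟩ := H1 n hn
  obtain ⟨W2, hW2, hp2', hi2⟩ := H2 n hn
  refine ⟨fun ω => 2 * W1 ω + 2 * W2 ω, (hW1.const_mul _).add (hW2.const_mul _), ?_, ?_⟩
  -- The times `C_i` are positive only almost surely, being known through their law; this is needed
  -- for the value at zero.
  · filter_upwards [ae_time_pos hpos hid] with ω hω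
    have hD1 : ((empMean p X n ω - F).1 : ℝ≥0 → ℝ) = fun s =>
        (n : ℝ)⁻¹ * ∑ i ∈ Finset.range n, (obs (hX i) ω).1.1 s
          - ∫ ω, (obs (hX 0) ω).1.1 s ∂P := by
      funext s
      rw [hI1]
      exact congrArg (· - F.1 s) (congrFun (empMean_fst hX n ω) s)
    have hD2 : ((empMean p X n ω - F).2 : ℝ≥0 → ℝ) = fun s =>
        (n : ℝ)⁻¹ * ∑ i ∈ Finset.range n, simplePath (obs (hX i) ω).2 s
          - ∫ ω, simplePath (obs (hX 0) ω).2 s ∂P := by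
      funext s
      rw [hI2]
      exact congrArg (· - F.2 s) (congrFun (empMean_snd X n ω) s)
    have hz : ∀ c : ℝ≥0, 0 < c → simplePath c 0 = 0 := fun c hc => by
      simp [simplePath, Set.indicator, hc.ne']
    have h01 : (empMean p X n ω - F).1 0 = 0 := by
      rw [hD1]
      simp only [hI1, hF1, (hX₀ _).zero, integral_zero, sub_zero]
      exact mul_eq_zero_of_right _ (Finset.sum_eq_zero fun i _ => (hX i ω).zero)
    have h02 : (empMean p X n ω - F).2 0 = 0 := by
      rw [hD2]
      simp only [hI2, hF2, hz _ (hpos _), integral_zero, sub_zero]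
      exact mul_eq_zero_of_right _ (Finset.sum_eq_zero fun i _ => hz _ (hω i))
    have e1 := wr_enorm_le (empMean p X n ω - F).1
    have e2 := wr_enorm_le (empMean p X n ω - F).2
    rw [h01, hD1, enorm_zero, add_zero] at e1
    rw [h02, hD2, enorm_zero, add_zero] at e2
    refine (prod_enorm_le _).trans (add_le_add (e1.trans ?_) (e2.trans ?_))
    · gcongr
      exact hp1' ω
    · gcongr
      exact hp2' ω
  · rw [lintegral_add_right' _ (hW2.const_mul _), lintegral_const_mul' _ _ (by simp),
      lintegral_const_mul' _ _ (by simp)]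
    calc _ ≤ 2 * (c1 * ENNReal.ofReal ((n : ℝ) ^ (1 / p - 1)))
          + 2 * (c2 * ENNReal.ofReal ((n : ℝ) ^ (1 / p - 1))) := by gcongr
      _ = _ := by ring

end NormBound

end CensRec
end

noncomputable section

namespace CensRec

/-! ### The asymptotic expansion -/

section Expansion

/-- A function that is `C²` at a point has a quadratic first order Taylor remainder there. -/
theorem exists_taylor_bound {V W : Type*} [NormedAddCommGroup V] [NormedSpace ℝ V]
    [NormedAddCommGroup W] [NormedSpace ℝ W] {f : V → W} {x : V} (hf : ContDiffAt ℝ (2 : ℕ) f x) :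
    ∃ r > 0, ∃ M : ℝ, 0 ≤ M ∧ ∀ y, ‖y - x‖ ≤ r → ‖fderiv ℝ f y - fderiv ℝ f x‖ ≤ M * ‖y - x‖ ∧
      ‖f y - f x - fderiv ℝ f x (y - x)‖ ≤ M * ‖y - x‖ ^ 2 := by
  have h1 : ContDiffAt ℝ 1 (fderiv ℝ f) x := hf.fderiv_right (by norm_num)
  obtain ⟨K, s, hs, hK⟩ := h1.exists_lipschitzOnWith
  have h2 : ∀ᶠ y in 𝓝 x, DifferentiableAt ℝ f y := by
    filter_upwards [hf.eventually (by simp)] with y hy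
    exact hy.differentiableAt (by simp)
  obtain ⟨r, hr, hball⟩ := Metric.nhds_basis_closedBall.mem_iff.1 (inter_mem hs h2)
  have hlip : ∀ y ∈ Metric.closedBall x r, ‖fderiv ℝ f y - fderiv ℝ f x‖ ≤ K * ‖y - x‖ :=
    fun y hy => by
      have h3 := hK.dist_le_mul y (hball hy).1 x (hball (Metric.mem_closedBall_self hr.le)).1
      rwa [dist_eq_norm, dist_eq_norm] at h3
  refine ⟨r, hr, K, K.2, fun y hy => ⟨hlip y (by rwa [mem_closedBall_iff_norm]), ?_⟩⟩
  have hsub : Metric.closedBall x ‖y - x‖ ⊆ Metric.closedBall x r := Metric.closedBall_subset_closedBall hy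
  have h4 := (convex_closedBall x ‖y - x‖).norm_image_sub_le_of_norm_hasFDerivWithin_le'
    (f := f) (f' := fderiv ℝ f) (φ := fderiv ℝ f x) (C := K * ‖y - x‖)
    (fun z hz => ((hball (hsub hz)).2.hasFDerivAt).hasFDerivWithinAt)
    (fun z hz => (hlip z (hsub hz)).trans (mul_le_mul_of_nonneg_left
      (by rwa [← mem_closedBall_iff_norm]) K.2))
    (Metric.mem_closedBall_self (norm_nonneg _)) (by rw [mem_closedBall_iff_norm] : y ∈ _)
  rwa [mul_assoc, ← sq] at h4

theorem wr_pVarENorm_eq {α : Type*} [LinearOrder α] [TopologicalSpace α] {p : ℝ}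
    [hp : Fact (1 ≤ p)] (w : Wr α p) : pVarENorm p w = ENNReal.ofReal ‖w‖ :=
  (ENNReal.ofReal_toReal (pVarENorm_ne_top hp.out w.2.1)).symm

variable {Ω : Type*} {X : ℕ → Ω → (ℝ≥0 → ℝ) × ℝ≥0} {p : ℝ} [hp : Fact (1 ≤ p)]
  {γ : Measure ℝ≥0} [IsProbabilityMeasure γ] {F : Wr ℝ≥0 p × Wr ℝ≥0 p} {μ ν : ℝ≥0 → ℝ} {t : ℝ≥0}

theorem empMean_sub (X : ℕ → Ω → (ℝ≥0 → ℝ) × ℝ≥0) {n : ℕ} (hn : 0 < n) (ω : Ω) :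
    empMean p X n ω - F = (n : ℝ)⁻¹ • ∑ i ∈ Finset.range n, (delta p (X i ω) - F) := by
  have hn' : (n : ℝ) ≠ 0 := by exact_mod_cast hn.ne'
  rw [Finset.sum_sub_distrib, smul_sub, Finset.sum_const, Finset.card_range, empMean,
    ← Nat.cast_smul_eq_nsmul ℝ, smul_smul, inv_mul_cancel₀ hn', one_smul]

/-- The derivative is linear, so its value in direction `F_n - F` is the average of the influence
functions. The error of the expansion is therefore exactly `√n` times a Taylor remainder. -/
theorem expansion_eq (hp2 : p < 2) (hX : ∀ i ω, IsCountingPath (X i ω).1)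
    (hK : ∀ u, kFun F u = surv γ u) (hF : (F.1 : ℝ≥0 → ℝ) = ν) (hμ : IncRC μ) (hμ0 : μ 0 = 0)
    (hν : IncRC ν) (hν0 : ν 0 = 0) (h : ∀ s, ν s = lsInt (surv γ) μ s) (ht : 0 < surv γ t)
    {n : ℕ} (hn : 0 < n) {ω : Ω} (hω : ∀ i, 0 < (X i ω).2) :
    (fun s : Icc 0 t => √(n : ℝ) * (muHat X n ω s - μ s)
        - (√(n : ℝ))⁻¹ * ∑ i ∈ Finset.range n, influence (surv γ) μ (X i ω) s)
      = (√(n : ℝ) • (muFun p t (empMean p X n ω) - muFun p t F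
        - fderiv ℝ (muFun p t) F (empMean p X n ω - F)) : Wr (Icc 0 t) p) := by
  funext s
  have h1 : (fderiv ℝ (muFun p t) F (empMean p X n ω - F) : Wr (Icc 0 t) p) s
      = (n : ℝ)⁻¹ * ∑ i ∈ Finset.range n, influence (surv γ) μ (X i ω) s := by
    rw [empMean_sub X hn, map_smul, map_sum]
    change (n : ℝ)⁻¹ * (∑ i ∈ Finset.range n, fderiv ℝ (muFun p t) F (delta p (X i ω) - F) :
      Wr (Icc 0 t) p) s = _
    rw [wr_sum_apply]
    congr 1
    refine Finset.sum_congr rfl fun i _ => ?_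
    exact derivDelta_distribution hp2 hK hF hν hν0 h ht (hX i ω) (hω i) s
  have h2 : muFun p t (empMean p X n ω) s = muHat X n ω s :=
    (congrFun (muHat_eq_muFun hp2 hX n ω t) s).symm
  have h3 := muFun_apply_distribution hp2 hK hF hμ hμ0 hν hν0 h ht s
  change _ = √(n : ℝ) * (muFun p t (empMean p X n ω) s - muFun p t F s
    - (fderiv ℝ (muFun p t) F (empMean p X n ω - F) : Wr (Icc 0 t) p) s)
  rw [h1, h2, h3]
  have hn' : (0 : ℝ) < n := by exact_mod_cast hn
  have h4 : √(n : ℝ) * (n : ℝ)⁻¹ = (√(n : ℝ))⁻¹ := by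
    rw [← div_eq_mul_inv, Real.sqrt_div_self]
  rw [← h4]
  ring

variable [MeasurableSpace Ω] {P : Measure Ω}

/-- On the event `‖F_n - F‖ < δ n ^ (-1/4)` the quadratic remainder times `√n` is at most `M δ ^ 2`.
-/
theorem tendsto_measure_expansion (hp2 : p < 2) (hX : ∀ i ω, IsCountingPath (X i ω).1)
    (hK : ∀ u, kFun F u = surv γ u) (hF : (F.1 : ℝ≥0 → ℝ) = ν) (hμ : IncRC μ) (hμ0 : μ 0 = 0)
    (hν : IncRC ν) (hν0 : ν 0 = 0) (h : ∀ s, ν s = lsInt (surv γ) μ s) (ht : 0 < surv γ t)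
    (hpos : ∀ᵐ ω ∂P, ∀ i, 0 < (X i ω).2)
    (hlim : ∀ δ : ℝ, 0 < δ → Tendsto (fun n : ℕ =>
      P {ω | ENNReal.ofReal (δ * (n : ℝ) ^ (-(1 / 4 : ℝ))) ≤ ‖empMean p X n ω - F‖ₑ}) atTop (𝓝 0))
    {ε : ℝ≥0∞} (hε : 0 < ε) :
    Tendsto (fun n : ℕ => P {ω | ε ≤ pVarENorm p (fun s : Icc 0 t =>
      √(n : ℝ) * (muHat X n ω s - μ s)
        - (√(n : ℝ))⁻¹ * ∑ i ∈ Finset.range n, influence (surv γ) μ (X i ω) s)}) atTop (𝓝 0) := by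
  have hu := isUnit_kMap (exists_le_abs_kFun hK ht)
  obtain ⟨r, hr, M, hM, hT⟩ := exists_taylor_bound (contDiffAt_muFun hp2 hu 2)
  obtain ⟨e, he, heε⟩ : ∃ e : ℝ, 0 < e ∧ ENNReal.ofReal e < ε := by
    obtain ⟨q, hq, hqε⟩ := ENNReal.lt_iff_exists_nnreal_btwn.1 hε
    exact ⟨q, by simpa using hq, by simpa using hqε⟩
  -- Small enough for the Taylor bound to apply and for `M δ ^ 2 ≤ e < ε`.
  set δ := min r √(e / (M + 1)) with hδ
  have hδ0 : 0 < δ := lt_min hr (Real.sqrt_pos.2 (by positivity))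
  have hδe : M * δ ^ 2 ≤ e := by
    calc M * δ ^ 2 ≤ M * √(e / (M + 1)) ^ 2 := by gcongr; exact min_le_right _ _
      _ = M / (M + 1) * e := by rw [Real.sq_sqrt (by positivity)]; ring
      _ ≤ e := mul_le_of_le_one_left he.le ((div_le_one (by positivity)).2 (by linarith))
  refine tendsto_of_tendsto_of_tendsto_of_le_of_le' tendsto_const_nhds (hlim δ hδ0)
    (Eventually.of_forall fun _ => zero_le) ?_
  filter_upwards [eventually_gt_atTop 0] with n hn
  have hn' : (1 : ℝ) ≤ n := by exact_mod_cast hn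
  refine measure_mono_ae ?_
  filter_upwards [hpos] with ω hω hmem
  by_contra hcon
  have hcon : ¬ ENNReal.ofReal (δ * (n : ℝ) ^ (-(1 / 4 : ℝ))) ≤ ‖empMean p X n ω - F‖ₑ := hcon
  have hmem : ε ≤ pVarENorm p _ := hmem
  rw [expansion_eq hp2 hX hK hF hμ hμ0 hν hν0 h ht hn hω, wr_pVarENorm_eq, norm_smul,
    Real.norm_of_nonneg (Real.sqrt_nonneg _)] at hmem
  rw [← ofReal_norm, ENNReal.ofReal_le_ofReal_iff (norm_nonneg _), not_le] at hcon
  have h1 : (n : ℝ) ^ (-(1 / 4 : ℝ)) ≤ 1 := Real.rpow_le_one_of_one_le_of_nonpos hn' (by norm_num)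
  have h2 : ‖empMean p X n ω - F‖ ≤ r := hcon.le.trans
    ((mul_le_of_le_one_right hδ0.le h1).trans (min_le_left _ _))
  have h3 : √(n : ℝ) * ((n : ℝ) ^ (-(1 / 4 : ℝ))) ^ 2 = 1 := by
    rw [Real.sqrt_eq_rpow, ← Real.rpow_natCast, ← Real.rpow_mul (by linarith),
      ← Real.rpow_add (by linarith)]
    norm_num
  refine absurd (heε.trans_le hmem) (not_lt.2 (ENNReal.ofReal_le_ofReal ?_))
  calc √(n : ℝ) * ‖muFun p t (empMean p X n ω) - muFun p t F
        - fderiv ℝ (muFun p t) F (empMean p X n ω - F)‖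
      ≤ √(n : ℝ) * (M * (δ * (n : ℝ) ^ (-(1 / 4 : ℝ))) ^ 2) := by
        refine mul_le_mul_of_nonneg_left ((hT _ h2).2.trans ?_) (Real.sqrt_nonneg _)
        gcongr
    _ = M * δ ^ 2 * (√(n : ℝ) * ((n : ℝ) ^ (-(1 / 4 : ℝ))) ^ 2) := by ring
    _ ≤ e := by rw [h3, mul_one]; exact hδe

end Expansion

end CensRec
end

noncomputable section

namespace CensRec

/-! ### Asymptotic normality and variance estimation -/

section Limits

variable {Ω : Type*} [MeasurableSpace Ω] {P : Measure Ω}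

/-- With `d = κ η` one has `|a ^ 2 - b ^ 2| ≤ d ((d + 1) q ^ 2 + b ^ 2)`. The averages of `q ^ 2`
and `b ^ 2` are bounded with high probability, so the averages of `a ^ 2` and `b ^ 2` have the same
limit. -/
theorem tendstoInMeasure_mean_sq {a : ℕ → ℕ → Ω → ℝ} {b q D : ℕ → Ω → ℝ} {κ r v Q : ℝ}
    (hr : 0 < r) (hκ : 0 ≤ κ) (hq0 : ∀ i ω, 0 ≤ q i ω)
    (hab : ∀ᵐ ω ∂P, ∀ n, 0 < n → D n ω ≤ r → ∀ i, |a n i ω - b i ω| ≤ κ * D n ω * q i ω)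
    (hD : ∀ δ : ℝ, 0 < δ → Tendsto (fun n : ℕ => P {ω | δ ≤ D n ω}) atTop (𝓝 0))
    (hb : TendstoInMeasure P (fun (n : ℕ) ω => (n : ℝ)⁻¹ * ∑ i ∈ Finset.range n, b i ω ^ 2) atTop
      (fun _ => v))
    (hq : TendstoInMeasure P (fun (n : ℕ) ω => (n : ℝ)⁻¹ * ∑ i ∈ Finset.range n, q i ω ^ 2) atTop
      (fun _ => Q)) :
    TendstoInMeasure P (fun (n : ℕ) ω => (n : ℝ)⁻¹ * ∑ i ∈ Finset.range n, a n i ω ^ 2) atTop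
      (fun _ => v) := by
  rw [tendstoInMeasure_iff_norm] at hb hq ⊢
  intro ε hε
  -- Bounds the difference of the two averages divided by `η`, on the event where the averages of `q
  -- ^ 2` and `b ^ 2` are within one of their limits.
  set E : ℝ := (κ + 1) * ((κ + 1) * (|Q| + 1) + |v| + 1) with hE
  have hE0 : 0 < E := by positivity
  set η : ℝ := min r (min 1 (ε / (4 * E))) with hη
  have hη0 : 0 < η := lt_min hr (lt_min one_pos (by positivity))
  have hη1 : η ≤ 1 := (min_le_right _ _).trans (min_le_left _ _)
  have hηE : η * E ≤ ε / 4 := by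
    calc η * E ≤ ε / (4 * E) * E := by
          gcongr
          exact (min_le_right _ _).trans (min_le_right _ _)
      _ = ε / 4 := by field_simp
  have hlim := ((hD η hη0).add (hq 1 one_pos)).add (hb (min (ε / 2) 1) (by positivity))
  rw [add_zero, add_zero] at hlim
  refine tendsto_of_tendsto_of_tendsto_of_le_of_le' tendsto_const_nhds hlim
    (Eventually.of_forall fun _ => zero_le) ?_
  filter_upwards [eventually_gt_atTop 0] with n hn
  refine le_trans (measure_mono_ae ?_) ((measure_union_le _ _).trans
    (add_le_add (measure_union_le _ _) le_rfl))
  filter_upwards [hab] with ω hω hmem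
  by_contra hcon
  have hcon : ¬ ((η ≤ D n ω ∨ 1 ≤ ‖(n : ℝ)⁻¹ * ∑ i ∈ Finset.range n, q i ω ^ 2 - Q‖)
    ∨ min (ε / 2) 1 ≤ ‖(n : ℝ)⁻¹ * ∑ i ∈ Finset.range n, b i ω ^ 2 - v‖) := hcon
  have hmem : ε ≤ ‖(n : ℝ)⁻¹ * ∑ i ∈ Finset.range n, a n i ω ^ 2 - v‖ := hmem
  push Not at hcon
  obtain ⟨⟨h1, h2⟩, h3⟩ := hcon
  set qn := (n : ℝ)⁻¹ * ∑ i ∈ Finset.range n, q i ω ^ 2 with hqn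
  set bn := (n : ℝ)⁻¹ * ∑ i ∈ Finset.range n, b i ω ^ 2 with hbn
  set an := (n : ℝ)⁻¹ * ∑ i ∈ Finset.range n, a n i ω ^ 2 with han
  have hqQ : qn ≤ |Q| + 1 := by
    have h4 := (abs_lt.1 (Real.norm_eq_abs _ ▸ h2)).2
    linarith [le_abs_self Q]
  have hbv : bn ≤ |v| + 1 := by
    have h4 := (abs_lt.1 (Real.norm_eq_abs _ ▸ (h3.trans_le (min_le_right _ _)))).2
    linarith [le_abs_self v]
  have hbε : |bn - v| < ε / 2 := h3.trans_le (min_le_left _ _)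
  set d := κ * η with hd
  have hd0 : 0 ≤ d := by positivity
  have hterm : ∀ i, |a n i ω ^ 2 - b i ω ^ 2| ≤ d * ((d + 1) * q i ω ^ 2 + b i ω ^ 2) := fun i => by
    have h5 : |a n i ω - b i ω| ≤ d * q i ω := (hω n hn (h1.le.trans (min_le_left _ _)) i).trans
      (mul_le_mul_of_nonneg_right (mul_le_mul_of_nonneg_left h1.le hκ) (hq0 i ω))
    have h6 : |a n i ω + b i ω| ≤ d * q i ω + 2 * |b i ω| := by
      calc |a n i ω + b i ω| = |(a n i ω - b i ω) + 2 * b i ω| := by ring_nf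
        _ ≤ |a n i ω - b i ω| + |2 * b i ω| := abs_add_le _ _
        _ ≤ _ := by rw [abs_mul, abs_two]; gcongr
    have h7 : 0 ≤ d * q i ω := mul_nonneg hd0 (hq0 i ω)
    calc |a n i ω ^ 2 - b i ω ^ 2| = |a n i ω - b i ω| * |a n i ω + b i ω| := by
          rw [← abs_mul]; ring_nf
      _ ≤ d * q i ω * (d * q i ω + 2 * |b i ω|) := mul_le_mul h5 h6 (abs_nonneg _) h7
      _ = d * (d * q i ω ^ 2 + 2 * q i ω * |b i ω|) := by ring
      _ ≤ d * (d * q i ω ^ 2 + (q i ω ^ 2 + |b i ω| ^ 2)) := by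
          gcongr
          exact two_mul_le_add_sq _ _
      _ = _ := by rw [sq_abs]; ring
  have hdiff : |an - bn| ≤ ε / 4 := by
    have hn0 : (0 : ℝ) ≤ (n : ℝ)⁻¹ := by positivity
    calc |an - bn| = (n : ℝ)⁻¹ * |∑ i ∈ Finset.range n, (a n i ω ^ 2 - b i ω ^ 2)| := by
          rw [han, hbn, ← mul_sub, ← Finset.sum_sub_distrib, abs_mul, abs_of_nonneg hn0]
      _ ≤ (n : ℝ)⁻¹ * ∑ i ∈ Finset.range n, d * ((d + 1) * q i ω ^ 2 + b i ω ^ 2) := by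
          gcongr
          exact (Finset.abs_sum_le_sum_abs _ _).trans (Finset.sum_le_sum fun i _ => hterm i)
      _ = d * ((d + 1) * qn + bn) := by
          rw [← Finset.mul_sum, Finset.sum_add_distrib, ← Finset.mul_sum, hqn, hbn]
          ring
      _ ≤ d * ((d + 1) * (|Q| + 1) + (|v| + 1)) := by gcongr
      _ ≤ ((κ + 1) * η) * ((κ + 1) * (|Q| + 1) + (|v| + 1)) := by
          have h8 : d ≤ κ := mul_le_of_le_one_right hκ hη1
          have h9 : d ≤ (κ + 1) * η := by rw [hd]; gcongr; linarith
          gcongr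
      _ = η * E := by rw [hE]; ring
      _ ≤ ε / 4 := hηE
  have h10 : |an - v| ≤ |an - bn| + |bn - v| := abs_sub_le _ _ _
  rw [Real.norm_eq_abs] at hmem
  linarith

variable [IsProbabilityMeasure P]

/-- The central limit theorem for the linear part and Slutsky's lemma for the remainder. -/
theorem tendstoInDistribution_of_expansion {I T : ℕ → Ω → ℝ} {v : ℝ} (hI : MemLp (I 0) 2 P)
    (hind : iIndepFun I P) (hid : ∀ i, IdentDistrib (I i) (I 0) P P) (hmean : ∫ ω, I 0 ω ∂P = 0)
    (hvar : Var[I 0; P] = v) (hT : ∀ n, AEMeasurable (T n) P)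
    (hexp : ∀ ε : ℝ≥0∞, 0 < ε → Tendsto (fun n : ℕ => P {ω | ε ≤ ‖T n ω
      - (√(n : ℝ))⁻¹ * ∑ i ∈ Finset.range n, I i ω‖ₑ}) atTop (𝓝 0)) :
    TendstoInDistribution T atTop (id : ℝ → ℝ) (fun _ => P) (gaussianReal 0 v.toNNReal) := by
  have hY : HasLaw (id : ℝ → ℝ) (gaussianReal 0 Var[I 0; P].toNNReal)
      (gaussianReal 0 Var[I 0; P].toNNReal) := ⟨aemeasurable_id, Measure.map_id⟩
  have h1 := tendstoInDistribution_inv_sqrt_mul_sum_sub hY hI hind hid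
  rw [hvar] at h1
  simp only [hmean, mul_zero, sub_zero] at h1
  refine tendstoInDistribution_of_tendstoInMeasure_sub T id h1 (fun ε hε => ?_) hT
  refine (hexp ε hε).congr fun n => ?_
  simp only [Pi.sub_apply, Pi.zero_apply, edist_zero_right]

theorem tendstoInMeasure_mean {X : ℕ → Ω → ℝ} (hX : Integrable (X 0) P)
    (hind : iIndepFun X P) (hid : ∀ i, IdentDistrib (X i) (X 0) P P) :
    TendstoInMeasure P (fun (n : ℕ) ω => (n : ℝ)⁻¹ * ∑ i ∈ Finset.range n, X i ω) atTop
      (fun _ => ∫ ω, X 0 ω ∂P) := by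
  refine tendstoInMeasure_of_tendsto_ae (fun n => ?_) ?_
  · exact ((Finset.aemeasurable_fun_sum _ fun i _ =>
      (hid i).aemeasurable_fst).const_mul _).aestronglyMeasurable
  · filter_upwards [strong_law_ae_real X hX (fun i j hij => hind.indepFun hij) hid] with ω hω
    simpa only [div_eq_inv_mul] using hω

end Limits

/-! ### Lipschitz dependence of the derivative on the distribution -/

section DerivativeBound

variable {p : ℝ} [hp : Fact (1 ≤ p)]

theorem norm_delta_le {x : ℝ≥0 → ℝ} (hx : IsCountingPath x) (c : ℝ≥0) :
    ‖delta p (x, c)‖ ≤ 2 * atInfty x + 3 := by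
  have hp0 : 0 < p := by linarith [hp.out]
  have hinf : 0 ≤ atInfty x := (hx.nonneg 0).trans (hx.le_atInfty 0)
  have hroot : ∀ {f : ℝ≥0 → ℝ} {M : ℝ}, Monotone f → (∀ a b, f b - f a ≤ M) →
      pVar p f ^ (1 / p) ≤ ENNReal.ofReal M := fun hf hM => by
    have h := ENNReal.rpow_le_rpow (pVar_monotone_le hp.out hf hM) (one_div_nonneg.2 hp0.le)
    rwa [one_div, ENNReal.rpow_rpow_inv hp0.ne', ← one_div] at h
  have h1 : ((delta p (x, c)).1 : ℝ≥0 → ℝ) = x := toWr_of_memWr (hx.memWr hp.out)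
  have h2 : ((delta p (x, c)).2 : ℝ≥0 → ℝ) = simplePath c :=
    toWr_of_memWr (memWr_simplePath hp.out c)
  have e1 := wr_enorm_le (delta p (x, c)).1
  have e2 := wr_enorm_le (delta p (x, c)).2
  rw [h1, hx.zero, enorm_zero, add_zero] at e1
  rw [h2] at e2
  have e3 : ‖simplePath c 0‖ₑ ≤ ENNReal.ofReal 1 := by
    rw [← ofReal_norm, Real.norm_of_nonneg (simplePath_nonneg c 0)]
    exact ENNReal.ofReal_le_ofReal (simplePath_le_one c 0)
  have e4 := hroot hx.mono (M := atInfty x) fun a b => by linarith [hx.nonneg a, hx.le_atInfty b]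
  have e5 := hroot (incRC_simplePath c).mono (M := 1) fun a b => by
    linarith [simplePath_nonneg c a, simplePath_le_one c b]
  have h3 : ‖delta p (x, c)‖ₑ ≤ ENNReal.ofReal (2 * atInfty x + 3) := by
    calc ‖delta p (x, c)‖ₑ ≤ ‖(delta p (x, c)).1‖ₑ + ‖(delta p (x, c)).2‖ₑ := prod_enorm_le _
      _ ≤ 2 * ENNReal.ofReal (atInfty x) + (2 * ENNReal.ofReal 1 + ENNReal.ofReal 1) :=
          add_le_add (e1.trans (by gcongr)) (e2.trans (by gcongr))
      _ = _ := by
          rw [ENNReal.ofReal_add (by positivity) (by norm_num), ENNReal.ofReal_mul zero_le_two,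
            ENNReal.ofReal_ofNat, ENNReal.ofReal_one, ENNReal.ofReal_ofNat]
          norm_num
  rwa [← ofReal_norm, ENNReal.ofReal_le_ofReal_iff (by positivity)] at h3

/-- The difference is `(D_f - D_F)(δ_x - f) - D_F (f - F)`. Both terms are of order `‖f - F‖` with a
factor linear in `x(∞)`, which is square integrable along the sample. -/
theorem exists_derivDelta_bound (hp2 : p < 2) {t : ℝ≥0} {F : Wr ℝ≥0 p × Wr ℝ≥0 p}
    (hF : IsUnit (kMap p t F)) :
    ∃ r > 0, ∃ κ : ℝ, 0 ≤ κ ∧ ∀ f, ‖f - F‖ ≤ r → ∀ (x : ℝ≥0 → ℝ) (c : ℝ≥0), IsCountingPath x →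
      ∀ s : Icc 0 t, |derivDelta p t f (x, c) s - derivDelta p t F (x, c) s|
        ≤ κ * ‖f - F‖ * (2 * atInfty x + 4) := by
  obtain ⟨r, hr, M, hM, hT⟩ := exists_taylor_bound (contDiffAt_muFun hp2 hF 2)
  refine ⟨r, hr, M + M * (‖F‖ + r) + ‖fderiv ℝ (muFun p t) F‖, by positivity,
    fun f hf x c hx s => ?_⟩
  set δ := delta p (x, c) with hδ
  have h1 : derivDelta p t f (x, c) - derivDelta p t F (x, c)
      = (fderiv ℝ (muFun p t) f - fderiv ℝ (muFun p t) F) (δ - f)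
        - fderiv ℝ (muFun p t) F (f - F) := by
    simp only [derivDelta, sub_apply, map_sub]
    abel
  have hq := norm_delta_le (p := p) hx c
  have hinf : 0 ≤ atInfty x := (hx.nonneg 0).trans (hx.le_atInfty 0)
  have hδf : ‖δ - f‖ ≤ (2 * atInfty x + 3) + (‖F‖ + r) := by
    calc ‖δ - f‖ = ‖δ - (f - F) - F‖ := by congr 1; abel
      _ ≤ ‖δ‖ + ‖f - F‖ + ‖F‖ := (norm_sub_le _ _).trans (by gcongr; exact norm_sub_le _ _)
      _ ≤ _ := by linarith
  have h2 : |derivDelta p t f (x, c) s - derivDelta p t F (x, c) s|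
      ≤ ‖derivDelta p t f (x, c) - derivDelta p t F (x, c)‖ :=
    wr_abs_le (derivDelta p t f (x, c) - derivDelta p t F (x, c)) s
  refine h2.trans ?_
  rw [h1]
  have hFr : 0 ≤ ‖F‖ + r := by positivity
  calc _ ≤ ‖(fderiv ℝ (muFun p t) f - fderiv ℝ (muFun p t) F) (δ - f)‖
        + ‖fderiv ℝ (muFun p t) F (f - F)‖ := norm_sub_le _ _
    _ ≤ M * ‖f - F‖ * ((2 * atInfty x + 3) + (‖F‖ + r))
        + ‖fderiv ℝ (muFun p t) F‖ * ‖f - F‖ := by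
        refine add_le_add ((ContinuousLinearMap.le_opNorm _ _).trans ?_)
          (ContinuousLinearMap.le_opNorm _ _)
        exact mul_le_mul (hT f hf).1 hδf (norm_nonneg _) (by positivity)
    _ = (M * (2 * atInfty x + 3) + M * (‖F‖ + r) * 1 + ‖fderiv ℝ (muFun p t) F‖ * 1)
          * ‖f - F‖ := by ring
    _ ≤ (M * (2 * atInfty x + 4) + M * (‖F‖ + r) * (2 * atInfty x + 4)
          + ‖fderiv ℝ (muFun p t) F‖ * (2 * atInfty x + 4)) * ‖f - F‖ := by
        gcongr <;> linarith
    _ = _ := by ring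

end DerivativeBound

end CensRec
end

noncomputable section

namespace CensRec

/-! ### The censored process -/

section Censored

variable {Ω : Type*} [MeasurableSpace Ω] {P : Measure Ω} {N : Ω → ℝ≥0 → ℝ} {C : Ω → ℝ≥0}

theorem measurable_censor_apply (hN : Measurable N) (h : ∀ ω, IsCountingPath (N ω))
    (hC : Measurable C) (s : ℝ≥0) : Measurable fun ω => censor (N ω) (C ω) s := by
  simp only [censor_apply (h _)]
  exact measurable_eval.comp ((hN.subtype_mk (h := h)).prodMk (measurable_const.min hC))

theorem IsCountingPath.atInfty_nonneg {x : ℝ≥0 → ℝ} (hx : IsCountingPath x) : 0 ≤ atInfty x :=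
  (hx.nonneg 0).trans (hx.le_atInfty 0)

theorem memLp_atInfty_censor (hN : Measurable N) (h : ∀ ω, IsCountingPath (N ω))
    (h2 : MemLp (fun ω => atInfty (N ω)) 2 P) (hC : Measurable C) :
    MemLp (fun ω => atInfty (censor (N ω) (C ω))) 2 P := by
  have hc : ∀ ω, IsCountingPath (censor (N ω) (C ω)) := fun ω => isCountingPath_censor (h ω) _
  refine h2.of_le ?_ (ae_of_all _ fun ω => ?_)
  · exact (measurable_path_atInfty.comp ((measurable_pi_iff.2 fun s =>
      measurable_censor_apply hN h hC s).subtype_mk (h := hc))).aestronglyMeasurable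
  · rw [Real.norm_of_nonneg (hc ω).atInfty_nonneg, Real.norm_of_nonneg (h ω).atInfty_nonneg]
    refine le_of_tendsto' (hc ω).tendsto_atInfty fun s => ?_
    rw [censor_apply (h ω)]
    exact (h ω).le_atInfty _

theorem meanFun_zero {Z : Ω → ℝ≥0 → ℝ} (h : ∀ ω, IsCountingPath (Z ω)) : meanFun P Z 0 = 0 := by
  simp [meanFun, (h _).zero]

theorem distFun_eq_integral (hC : Measurable C) (s : ℝ≥0) :
    distFun P C s = ∫ ω, simplePath (C ω) s ∂P := by
  rw [distFun, ← integral_indicator_one (measurableSet_le hC measurable_const)]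
  rfl

variable [IsProbabilityMeasure P]

theorem domProc_censor (hN : Measurable N) (h : ∀ ω, IsCountingPath (N ω))
    (h2 : MemLp (fun ω => atInfty (N ω)) 2 P) (hC : Measurable C) :
    DomProc P (fun ω => censor (N ω) (C ω)) (fun ω => atInfty (censor (N ω) (C ω))) :=
  domProc_counting (fun ω => isCountingPath_censor (h ω) _)
    (fun s => (measurable_censor_apply hN h hC s).aemeasurable) (memLp_atInfty_censor hN h h2 hC)

/-- The censored path is `N` stopped at `C`; by independence its mean at `s` is `∫ μ(min s c)
γ(dc)`, and `lsInt_surv` identifies this. -/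
theorem meanFun_censor_eq (hN : Measurable N) (h : ∀ ω, IsCountingPath (N ω))
    (h2 : MemLp (fun ω => atInfty (N ω)) 2 P) (hC : Measurable C) (hindep : IndepFun N C P)
    (s : ℝ≥0) :
    meanFun P (fun ω => censor (N ω) (C ω)) s = lsInt (surv (P.map C)) (meanFun P N) s := by
  have := Measure.isProbabilityMeasure_map (μ := P) hC.aemeasurable
  have hd := domProc_counting h (fun u => ((measurable_pi_apply u).comp hN).aemeasurable) h2
  have hΦ : Measurable fun z : Path × ℝ≥0 => z.1.1 (min s z.2) :=
    measurable_eval.comp (measurable_fst.prodMk (measurable_const.min measurable_snd))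
  have hint := integrable_comp_indep hN h hC hindep hΦ (by
    have h3 := (domProc_censor hN h h2 hC).integrable s
    simpa only [censor_apply (h _)] using h3)
  have h1 := integral_comp_indep hN h hC hindep hΦ
  simp only at h1
  simp only [meanFun, censor_apply (h _)]
  rw [h1, integral_prod_symm _ hint]
  have h4 := lsInt_surv (γ := P.map C) hd.incRC_meanFun s
  simp only [meanFun_zero h, sub_zero] at h4
  exact h4.symm

theorem variance_influence_eq_asympVar (hN : Measurable N) (h : ∀ ω, IsCountingPath (N ω))
    (h2 : MemLp (fun ω => atInfty (N ω)) 2 P) (hC : Measurable C) (hpos : ∀ ω, 0 < C ω)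
    (hindep : IndepFun N C P) {s : ℝ≥0} (hs : 0 < surv (P.map C) s) :
    Var[fun ω => influence (surv (P.map C)) (meanFun P N) (censor (N ω) (C ω), C ω) s; P]
      = asympVar P N (survFun P C) (hazard P C) s := by
  rw [variance_influence hN h h2 hC hpos hindep hs, setIntegral_odds_eq hC, asympVar]

end Censored

section Differentiability

variable {p : ℝ} [Fact (1 ≤ p)]

theorem muFun_differentiability (hp2 : p < 2) {t : ℝ≥0} {f : Wr ℝ≥0 p × Wr ℝ≥0 p}
    (hf : ∃ c > 0, ∀ s ≤ t, c ≤ |kFun f s|) :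
    (∀ s : Icc 0 t, HasYoungIntegral (fun u => 1 / kFun f u) f.1 s (muPath t f s)) ∧
      MemWr p (muPath t f) ∧
      (∀ k : ℕ, ContDiffAt ℝ k (muFun p t) f) ∧
      ∀ (g : Wr ℝ≥0 p × Wr ℝ≥0 p) (s : Icc 0 t), ∃ I J : ℝ,
        HasYoungIntegral (fun u => 1 / kFun f u) g.1 s I ∧
        HasYoungIntegral (fun u => kFun g u / kFun f u ^ 2) f.1 s J ∧
        (fderiv ℝ (muFun p t) f g : Wr (Icc 0 t) p) s = I - J := by
  have hu := isUnit_kMap hf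
  have hinv : ∀ x : Icc 0 t, 1 / kFun f x = (Ring.inverse (kMap p t f)) x := fun x => by
    rw [bv_inverse_apply hu, kMap_apply]
  refine ⟨fun s => ?_, ?_, contDiffAt_muFun hp2 hu, fun g s =>
    ⟨youngMap hp2 t (Ring.inverse (kMap p t f)) g.1 s,
      youngMap hp2 t (Ring.inverse (kMap p t f) * kMap p t g * Ring.inverse (kMap p t f)) f.1 s,
      hasYoungIntegral_youngMap hp2 _ _ s hinv,
      hasYoungIntegral_youngMap hp2 _ _ s fun x => ?_, ?_⟩⟩
  · rw [muPath_eq hp2 hu]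
    exact hasYoungIntegral_youngMap hp2 _ _ s hinv
  · rw [muPath_eq hp2 hu]
    exact (youngMap hp2 t (Ring.inverse (kMap p t f)) f.1).2
  · change kFun g x / kFun f x ^ 2 = (Ring.inverse (kMap p t f)) x * kFun g x
      * (Ring.inverse (kMap p t f)) x
    rw [← hinv]
    ring
  · rw [hasFDerivAt_muFun hp2 hu]
    rfl

end Differentiability

/-! ### Limit theorems for the sample -/

section Sample

variable {Ω Ω₀ : Type*} [MeasurableSpace Ω] [MeasurableSpace Ω₀] {P : Measure Ω}
  [IsProbabilityMeasure P] {P₀ : Measure Ω₀} {X : ℕ → Ω → (ℝ≥0 → ℝ) × ℝ≥0}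
  {X₀ : Ω₀ → (ℝ≥0 → ℝ) × ℝ≥0}
  {γ : Measure ℝ≥0} [IsProbabilityMeasure γ] {μ : ℝ≥0 → ℝ} {s : ℝ≥0}

theorem tendstoInDistribution_muHat (hX : ∀ i ω, IsCountingPath (X i ω).1)
    (hX₀ : ∀ ω, IsCountingPath (X₀ ω).1) (hind : iIndepFun X P)
    (hid : ∀ i, IdentDistrib (X i) X₀ P P₀) (hμ : IncRC μ) (hs : 0 < surv γ s) {v : ℝ}
    (hL : MemLp (fun ω => influence (surv γ) μ (X₀ ω) s) 2 P₀)
    (hmean : ∫ ω, influence (surv γ) μ (X₀ ω) s ∂P₀ = 0)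
    (hvar : Var[fun ω => influence (surv γ) μ (X₀ ω) s; P₀] = v)
    (hexp : ∀ ε : ℝ≥0∞, 0 < ε → Tendsto (fun n : ℕ => P {ω | ε ≤ ‖√(n : ℝ) * (muHat X n ω s - μ s)
      - (√(n : ℝ))⁻¹ * ∑ i ∈ Finset.range n, influence (surv γ) μ (X i ω) s‖ₑ}) atTop (𝓝 0)) :
    TendstoInDistribution (fun (n : ℕ) ω => √(n : ℝ) * (muHat X n ω s - μ s)) atTop
      (id : ℝ → ℝ) (fun _ => P) (gaussianReal 0 v.toNNReal) := by
  have hΦ := measurable_influence (γ := γ) hμ hs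
  have hidI : ∀ i, IdentDistrib (fun ω => influence (surv γ) μ (X i ω) s)
      (fun ω => influence (surv γ) μ (X₀ ω) s) P P₀ := fun i =>
    (identDistrib_obs (hX i) hX₀ (hid i)).comp hΦ
  refine tendstoInDistribution_of_expansion (I := fun i ω => influence (surv γ) μ (X i ω) s)
    ((hidI 0).symm.memLp_snd hL) ((iIndepFun_obs hX hind).comp (fun _ => _) fun _ => hΦ)
    (fun i => (hidI i).trans (hidI 0).symm) ((hidI 0).integral_eq.trans hmean)
    ((hidI 0).variance_eq.trans hvar) (fun n => ?_) hexp
  exact ((aemeasurable_muHat hX (fun i => (hid i).aemeasurable_fst) n s).sub_const _).const_mul _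

variable [IsProbabilityMeasure P₀] {p : ℝ} [hp : Fact (1 ≤ p)] {F : Wr ℝ≥0 p × Wr ℝ≥0 p} {ν : ℝ≥0 → ℝ} {t : ℝ≥0}

/-- The law of large numbers gives the limit for the squared influence functions.
`exists_derivDelta_bound` shows that replacing the derivative at `F` by the one at `F_n` does not
matter. -/
theorem tendstoInMeasure_derivDelta_sq (hp2 : p < 2) (hX : ∀ i ω, IsCountingPath (X i ω).1)
    (hX₀ : ∀ ω, IsCountingPath (X₀ ω).1) (hpos : ∀ ω, 0 < (X₀ ω).2) (hind : iIndepFun X P)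
    (hid : ∀ i, IdentDistrib (X i) X₀ P P₀)
    (h2 : MemLp (fun ω => atInfty (X₀ ω).1) 2 P₀)
    (hK : ∀ u, kFun F u = surv γ u) (hF : (F.1 : ℝ≥0 → ℝ) = ν) (hμ : IncRC μ)
    (hν : IncRC ν) (hν0 : ν 0 = 0) (h : ∀ s, ν s = lsInt (surv γ) μ s) (ht : 0 < surv γ t)
    (hlim : ∀ δ : ℝ, 0 < δ → Tendsto (fun n : ℕ =>
      P {ω | ENNReal.ofReal (δ * (n : ℝ) ^ (-(1 / 4 : ℝ))) ≤ ‖empMean p X n ω - F‖ₑ}) atTop (𝓝 0))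
    (s : Icc 0 t) {v : ℝ} (hL : MemLp (fun ω => influence (surv γ) μ (X₀ ω) s) 2 P₀)
    (hmean : ∫ ω, influence (surv γ) μ (X₀ ω) s ∂P₀ = 0)
    (hvar : Var[fun ω => influence (surv γ) μ (X₀ ω) s; P₀] = v) :
    TendstoInMeasure P (fun (n : ℕ) ω => (n : ℝ)⁻¹ * ∑ i ∈ Finset.range n,
      (derivDelta p t (empMean p X n ω) (X i ω) s) ^ 2) atTop (fun _ => v) := by
  have hΦ := measurable_influence (γ := γ) hμ (ht.trans_le (surv_anti γ s.2.2))
  have hO : ∀ i, IdentDistrib (obs (hX i)) (obs hX₀) P P₀ := fun i =>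
    identDistrib_obs (hX i) hX₀ (hid i)
  have hindO := iIndepFun_obs hX hind
  obtain ⟨r, hr, κ, hκ, hb⟩ :=
    exists_derivDelta_bound hp2 (isUnit_kMap (exists_le_abs_kFun hK ht))
  have hmean_sq : ∀ {Ψ : Path × ℝ≥0 → ℝ}, Measurable Ψ → MemLp (fun ω => Ψ (obs hX₀ ω)) 2 P₀ →
      TendstoInMeasure P (fun (n : ℕ) ω => (n : ℝ)⁻¹ * ∑ i ∈ Finset.range n,
        Ψ (obs (hX i) ω) ^ 2) atTop (fun _ => ∫ ω, Ψ (obs hX₀ ω) ^ 2 ∂P₀) := by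
    intro Ψ hΨ hm
    have hi : ∀ i, IdentDistrib (fun ω => Ψ (obs (hX i) ω) ^ 2) (fun ω => Ψ (obs hX₀ ω) ^ 2) P P₀ :=
      fun i => (hO i).comp (hΨ.pow_const 2)
    rw [← (hi 0).integral_eq]
    exact tendstoInMeasure_mean (X := fun i ω => Ψ (obs (hX i) ω) ^ 2)
      ((hi 0).symm.integrable_snd hm.integrable_sq)
      (hindO.comp (fun _ z => Ψ z ^ 2) fun _ => hΨ.pow_const 2) fun i => (hi i).trans (hi 0).symm
  have hqm : Measurable fun z : Path × ℝ≥0 => 2 * atInfty z.1.1 + 4 :=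
    ((measurable_path_atInfty.comp measurable_fst).const_mul 2).add_const 4
  have hv : v = ∫ ω, influence (surv γ) μ (X₀ ω) s ^ 2 ∂P₀ := by
    rw [← hvar, variance_of_integral_eq_zero hL.aestronglyMeasurable.aemeasurable hmean]
  rw [hv]
  have hb_lim := hmean_sq hΦ hL
  have hq_lim := hmean_sq hqm ((h2.const_mul 2).add (memLp_const 4))
  refine tendstoInMeasure_mean_sq (a := fun n i ω => derivDelta p t (empMean p X n ω) (X i ω) s)
    (b := fun i ω => influence (surv γ) μ (X i ω) s)
    (q := fun i ω => 2 * atInfty (X i ω).1 + 4) (D := fun n ω => ‖empMean p X n ω - F‖) hr hκ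
    (fun i ω => ?_) ?_ (fun δ hδ => ?_) hb_lim hq_lim
  · have := (hX i ω).atInfty_nonneg
    positivity
  · filter_upwards [ae_time_pos hpos hid] with ω hω n _ hD i
    rw [← derivDelta_distribution hp2 hK hF hν hν0 h ht (hX i ω) (hω i) s]
    exact hb _ hD _ _ (hX i ω) s
  · refine tendsto_of_tendsto_of_tendsto_of_le_of_le' tendsto_const_nhds (hlim δ hδ)
      (Eventually.of_forall fun _ => zero_le) ?_
    filter_upwards [eventually_gt_atTop 0] with n hn
    refine measure_mono fun ω hω => ?_
    have hω : δ ≤ ‖empMean p X n ω - F‖ := hω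
    have hn' : (1 : ℝ) ≤ n := by exact_mod_cast hn
    change _ ≤ ‖empMean p X n ω - F‖ₑ
    rw [← ofReal_norm]
    exact ENNReal.ofReal_le_ofReal ((mul_le_of_le_one_right hδ.le
      (Real.rpow_le_one_of_one_le_of_nonpos hn' (by norm_num))).trans hω)

end Sample

end CensRec
end

open CensRec in
theorem mainTheorem5
    -- the process `N`, the independent censoring time `C`, and their characteristics
    {Ω₀ : Type*} [MeasurableSpace Ω₀] (P₀ : Measure Ω₀) [IsProbabilityMeasure P₀]
    (N : Ω₀ → ℝ≥0 → ℝ) (hN : Measurable N) (hNpath : ∀ ω, IsCountingPath (N ω))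
    (hN2 : MemLp (fun ω => atInfty (N ω)) 2 P₀)
    (C : Ω₀ → ℝ≥0) (hC : Measurable C) (hCpos : ∀ ω, 0 < C ω)
    (hindep : IndepFun N C P₀)
    (μ ν K G : ℝ≥0 → ℝ) (Λ : Measure ℝ≥0)
    (hμ : μ = meanFun P₀ N)
    (hν : ν = meanFun P₀ (fun ω => censor (N ω) (C ω)))
    (hK : K = survFun P₀ C) (hG : G = distFun P₀ C) (hΛ : Λ = hazard P₀ C)
    -- the independent replications `X i` of `(Ñ, C)`
    {Ω : Type*} [MeasurableSpace Ω] (P : Measure Ω) [IsProbabilityMeasure P]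
    (X : ℕ → Ω → (ℝ≥0 → ℝ) × ℝ≥0)
    (hXpath : ∀ i ω, IsCountingPath (X i ω).1)
    (hXindep : iIndepFun X P)
    (hXident : ∀ i, IdentDistrib (X i) (fun ω => (censor (N ω) (C ω), C ω)) P P₀)
    -- the time horizon and the exponent
    (t : ℝ≥0) (ht : 0 < t) (hKt : 0 < K t)
    (p : ℝ) [Fact (1 ≤ p)] (hp2 : p < 2) :
    -- `Ñ` is a counting process, and `ν` and `μ` determine each other
    ((∀ ω, IsCountingPath (censor (N ω) (C ω))) ∧
      (∀ s, ν s = lsInt K μ s) ∧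
      (∀ s, 0 < K s → μ s = lsInt (fun u => 1 / K u) ν s)) ∧
    -- the estimating functional is well defined and differentiable of any order
    -- wherever `K(f)` is bounded away from zero on `[0, t]`
    (∀ f : Wr ℝ≥0 p × Wr ℝ≥0 p, (∃ c > 0, ∀ s ≤ t, c ≤ |kFun f s|) →
      (∀ s : Icc 0 t, HasYoungIntegral (fun u => 1 / kFun f u) f.1 s (muPath t f s)) ∧
      MemWr p (muPath t f) ∧
      (∀ k : ℕ, ContDiffAt ℝ k (muFun p t) f) ∧
      ∀ (g : Wr ℝ≥0 p × Wr ℝ≥0 p) (s : Icc 0 t), ∃ I J : ℝ,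
        HasYoungIntegral (fun u => 1 / kFun f u) g.1 s I ∧
        HasYoungIntegral (fun u => kFun g u / kFun f u ^ 2) f.1 s J ∧
        (fderiv ℝ (muFun p t) f g : Wr (Icc 0 t) p) s = I - J) ∧
    -- this applies at `F = (ν, G)`, where the functional has value `μ`, and the influence
    -- function is the derivative at `F` in direction `δ_x - F`
    (MemWr p ν ∧ MemWr p G ∧
      (∃ c > 0, ∀ s ≤ t, c ≤ |kFun (toWr p ν, toWr p G) s|) ∧
      (∀ s : Icc 0 t, muFun p t (toWr p ν, toWr p G) s = μ s) ∧
      (∀ (x : ℝ≥0 → ℝ) (c : ℝ≥0), IsCountingPath x → 0 < c →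
        MemWr p x ∧ MemWr p (simplePath c) ∧
        ∀ s : Icc 0 t,
          derivDelta p t (toWr p ν, toWr p G) (x, c) s = influence K μ (x, c) s)) ∧
    -- the estimator is the functional at the empirical mean `F_n = n⁻¹ ∑ δ_{X_i}`
    (∀ n : ℕ, 0 < n → ∀ ω, ∀ s : Icc 0 t, muHat X n ω s = muFun p t (empMean p X n ω) s) ∧
    -- the asymptotic expansion in `p`-variation
    (4 / 3 < p → ∀ ε : ℝ≥0∞, 0 < ε →
      Tendsto (fun n : ℕ => P {ω | ε ≤ pVarENorm p (fun s : Icc 0 t =>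
          √(n : ℝ) * (muHat X n ω s - μ s)
            - (√(n : ℝ))⁻¹ * ∑ i ∈ Finset.range n, influence K μ (X i ω) s)})
        atTop (𝓝 0)) ∧
    -- the influence function in terms of `N`, its mean and variance, and asymptotic normality
    (∀ s ≤ t,
      (∀ ω, influence K μ (censor (N ω) (C ω), C ω) s =
        N ω s - μ s - martInt Λ (C ω)
          (fun u => (N ω s - μ s - (N ω u - μ u)) / Function.rightLim K u) s) ∧
      MemLp (fun ω => influence K μ (censor (N ω) (C ω), C ω) s) 2 P₀ ∧
      ∫ ω, influence K μ (censor (N ω) (C ω), C ω) s ∂P₀ = 0 ∧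
      IntegrableOn (fun u => Var[fun ω => N ω s - N ω u; P₀] * (1 / Function.rightLim K u))
        (Ioo 0 s) Λ ∧
      Var[fun ω => influence K μ (censor (N ω) (C ω), C ω) s; P₀] = asympVar P₀ N K Λ s ∧
      TendstoInDistribution (fun (n : ℕ) ω => √(n : ℝ) * (muHat X n ω s - μ s)) atTop
        (id : ℝ → ℝ) (fun _ => P) (gaussianReal 0 (Real.toNNReal (asympVar P₀ N K Λ s)))) ∧
    -- consistency of the plug-in variance estimator
    (4 / 3 < p → ∀ s : Icc 0 t,
      TendstoInMeasure P
        (fun (n : ℕ) ω => (n : ℝ)⁻¹ * ∑ i ∈ Finset.range n,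
          (derivDelta p t (empMean p X n ω) (X i ω) s) ^ 2)
        atTop (fun _ => asympVar P₀ N K Λ s)) := by
  subst hμ hν hK hG hΛ
  have hγ := Measure.isProbabilityMeasure_map (μ := P₀) hC.aemeasurable
  have hKγ : survFun P₀ C = surv (P₀.map C) := survFun_eq hC
  have htγ : 0 < surv (P₀.map C) t := by rwa [← hKγ]
  have hX₀ : ∀ ω, IsCountingPath (censor (N ω) (C ω)) := fun ω =>
    isCountingPath_censor (hNpath ω) _
  have hdN := domProc_counting hNpath
    (fun u => ((measurable_pi_apply u).comp hN).aemeasurable) hN2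
  have hdX := domProc_censor hN hNpath hN2 hC
  have hμ0 : meanFun P₀ N 0 = 0 := meanFun_zero hNpath
  have hν0 : meanFun P₀ (fun ω => censor (N ω) (C ω)) 0 = 0 := meanFun_zero hX₀
  have hνμ := meanFun_censor_eq hN hNpath hN2 hC hindep
  have hXpos : ∀ᵐ ω ∂P, ∀ i, 0 < (X i ω).2 :=
    ae_time_pos (X₀ := fun ω => (censor (N ω) (C ω), C ω)) hCpos hXident
  have hF1 : ∀ (q : ℝ) [hq : Fact (1 ≤ q)],
      (toWr q (meanFun P₀ fun ω => censor (N ω) (C ω)) : ℝ≥0 → ℝ)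
        = meanFun P₀ fun ω => censor (N ω) (C ω) := fun q hq =>
    toWr_of_memWr (hdX.memWr_meanFun hq.out)
  have hF2 : ∀ (q : ℝ) [hq : Fact (1 ≤ q)],
      (toWr q (distFun P₀ C) : ℝ≥0 → ℝ) = distFun P₀ C := fun q hq =>
    toWr_of_memWr (memWr_distFun hC hq.out)
  have hkF : ∀ (q : ℝ) [hq : Fact (1 ≤ q)] (u : ℝ≥0),
      kFun (toWr q (meanFun P₀ fun ω => censor (N ω) (C ω)), toWr q (distFun P₀ C)) u
        = surv (P₀.map C) u := fun q _ u => kFun_distFun hC hCpos (hF2 q) u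
  -- Stated for every exponent `q` in `(4/3, 2)`: pointwise asymptotic normality is claimed for all
  -- `p` and uses an exponent of its own.
  have hlim : ∀ (q : ℝ) [hq : Fact (1 ≤ q)], 4 / 3 < q → q < 2 → ∀ δ : ℝ, 0 < δ →
      Tendsto (fun n : ℕ => P {ω | ENNReal.ofReal (δ * (n : ℝ) ^ (-(1 / 4 : ℝ)))
        ≤ ‖empMean q X n ω - (toWr q (meanFun P₀ fun ω => censor (N ω) (C ω)),
          toWr q (distFun P₀ C))‖ₑ}) atTop (𝓝 0) := by
    intro q _ hq43 hq2 δ hδ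
    refine tendsto_measure_of_majorant (r := 1 / q - 1) ?_
      (exists_empMean_majorant (X₀ := fun ω => (censor (N ω) (C ω), C ω)) (by linarith) hq2 hXpath
        hX₀ hCpos hXindep hXident (memLp_atInfty_censor hN hNpath hN2 hC) (fun s => ?_)
        fun s => ?_) hδ
    -- This is where `4/3` enters: `1/q - 1 < -1/4`.
    · have h1 : 1 / q < 1 / (4 / 3) := one_div_lt_one_div_of_lt (by norm_num) hq43
      norm_num at h1 ⊢
      linarith
    · exact congrFun (hF1 q) s
    · exact (congrFun (hF2 q) s).trans (distFun_eq_integral hC s)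
  have hexp : ∀ (q : ℝ) [hq : Fact (1 ≤ q)], 4 / 3 < q → q < 2 → ∀ ε : ℝ≥0∞, 0 < ε →
      Tendsto (fun n : ℕ => P {ω | ε ≤ pVarENorm q (fun s : Icc 0 t =>
          √(n : ℝ) * (muHat X n ω s - meanFun P₀ N s) - (√(n : ℝ))⁻¹ *
            ∑ i ∈ Finset.range n, influence (surv (P₀.map C)) (meanFun P₀ N) (X i ω) s)})
        atTop (𝓝 0) := fun q _ hq43 hq2 ε hε =>
    tendsto_measure_expansion hq2 hXpath (hkF q) (hF1 q) hdN.incRC_meanFun hμ0 hdX.incRC_meanFun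
      hν0 hνμ htγ hXpos (hlim q hq43 hq2) hε
  refine ⟨⟨hX₀, fun s => ?_, fun s hs => ?_⟩, fun f hf => muFun_differentiability hp2 hf,
    ⟨hdX.memWr_meanFun Fact.out, memWr_distFun hC Fact.out, exists_le_abs_kFun (hkF p) htγ,
      muFun_apply_distribution hp2 (hkF p) (hF1 p) hdN.incRC_meanFun hμ0 hdX.incRC_meanFun hν0
        hνμ htγ,
      fun x c hx hc => ⟨hx.memWr Fact.out, memWr_simplePath Fact.out c, fun s => ?_⟩⟩,
    fun n _ ω s => congrFun (muHat_eq_muFun hp2 hXpath n ω t) s, fun hp43 => ?_, fun s hs => ?_,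
    fun hp43 s => ?_⟩
  · rw [hKγ]
    exact hνμ s
  · rw [hKγ] at hs ⊢
    exact (lsInt_inv_density hdN.incRC_meanFun hμ0 hdX.incRC_meanFun hν0 hνμ hs).symm
  · rw [hKγ]
    exact derivDelta_distribution hp2 (hkF p) (hF1 p) hdX.incRC_meanFun hν0 hνμ htγ hx hc s
  · rw [hKγ]
    exact hexp p hp43 hp2
  · have hsγ : 0 < surv (P₀.map C) s := htγ.trans_le (surv_anti _ hs)
    have hs' : 0 < survFun P₀ C s := by rwa [hKγ]
    have hL := memLp_influence hN hNpath hN2 hC hsγ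
    have hmean := integral_influence hN hNpath hN2 hC hindep hsγ
    have hvar := variance_influence_eq_asympVar hN hNpath hN2 hC hCpos hindep hsγ
    refine ⟨fun ω => influence_eq_martInt hC hCpos (hNpath ω) hdN.incRC_meanFun hμ0 (hCpos ω) hs',
      hKγ ▸ hL, hKγ ▸ hmean,
      (integrableOn_odds_iff hC _ s).1 (integrableOn_variance hN hNpath hN2 hC hCpos hsγ), ?_,
      tendstoInDistribution_muHat (X₀ := fun ω => (censor (N ω) (C ω), C ω)) hXpath hX₀ hXindep
        hXident hdN.incRC_meanFun hsγ hL hmean hvar fun ε hε => ?_⟩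
    · rw [← hvar, hKγ]
    -- Neither the estimator nor the claim at a fixed `s` depends on `p`, so the expansion is used
    -- with exponent `3/2`; the norm bounds the value at `s`.
    · have : Fact ((1 : ℝ) ≤ 3 / 2) := ⟨by norm_num⟩
      refine tendsto_of_tendsto_of_tendsto_of_le_of_le tendsto_const_nhds
        (hexp (3 / 2) (by norm_num) (by norm_num) ε hε) (fun _ => zero_le) fun n => ?_
      refine measure_mono fun ω hω => ?_
      have hω : ε ≤ ‖_‖ₑ := hω
      change ε ≤ pVarENorm (3 / 2) _
      exact hω.trans <| (enorm_le_supENorm (fun s : Icc 0 t => √(n : ℝ) * (muHat X n ω s - meanFun P₀ N s)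
        - (√(n : ℝ))⁻¹ * ∑ i ∈ Finset.range n,
          influence (surv (P₀.map C)) (meanFun P₀ N) (X i ω) s) ⟨s, zero_le, hs⟩).trans le_add_self
  · have hsγ : 0 < surv (P₀.map C) (s : ℝ≥0) := htγ.trans_le (surv_anti _ s.2.2)
    exact tendstoInMeasure_derivDelta_sq (X₀ := fun ω => (censor (N ω) (C ω), C ω)) hp2 hXpath hX₀
      hCpos hXindep hXident (memLp_atInfty_censor hN hNpath hN2 hC) (hkF p) (hF1 p)
      hdN.incRC_meanFun hdX.incRC_meanFun hν0 hνμ htγ (hlim p hp43 hp2) s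
      (memLp_influence hN hNpath hN2 hC hsγ) (integral_influence hN hNpath hN2 hC hindep hsγ)
      (variance_influence_eq_asympVar hN hNpath hN2 hC hCpos hindep hsγ)
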